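/- Let $\mathfrak h$ be a finite-dimensional complex vector space, $G\subseteq GL(\mathfrak h)$ a finite group generated by (complex) reflections and acting irreducibly on $\mathfrak h$, $\mathcal S\subseteq G$ the set of reflections, $c:\mathcal S\to\mathbb C$ a conjugation invariant function and $t\in\mathbb C$. For $s\in\mathcal S$ let $\lambda_s$ be its nontrivial eigenvalue on $\mathfrak h^*$, $d_s=(1-\lambda_s)/2$, and let $\alpha_s\in\mathfrak h^*$, $\alpha_s^\vee\in\mathfrak h$ be eigenvectors of $s$ with eigenvalues $\lambda_s$, $\lambda_s^{-1}$ and $\alpha_s(\alpha_s^\vee)=2$. Let $\mathsf H_{t,c}$ be the rational Cherednik algebra: it is generated over $\mathbb C$ by the tensor algebra of $\mathfrak h\oplus\mathfrak h^*$ and by $\mathbb C G$, with relations $gy=g(y)g$, $gx=g(x)g$, $[y,y']=0=[x,x']$ and $[y,x]=t\,x(y)-\sum_{s\in\mathcal S}c(s)\alpha_s(y)x(\alpha_s^\vee)s$, for $g\in G$, $y,y'\in\mathfrak h$, $x,x'\in\mathfrak h^*$. It is $\mathbb Z$-graded with $\deg x=1$, $\deg y=-1$, $\deg g=0$. For graded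 $\mathsf H_{t,c}$-modules $X,Y$, let $\mathrm{Ext}^p(X,Y)=\bigoplus_{n\in\mathbb Z}\mathrm{Ext}^p(X,Y)_n$, where $\mathrm{Ext}^p(X,Y)_n$ is the $p$-th cohomology of the complex of homomorphisms of degree $n$ from a graded projective resolution of $X$ to $Y$, and let $\mathrm{EPgr}(X,Y)=\sum_{p\ge 0}(-1)^p\,\mathrm{dimgr}\,\mathrm{Ext}^p(X,Y)$, where $\mathrm{dimgr}$ of a graded vector space is the function $n\mapsto\dim(\cdot)_n$. For (virtual) graded $G$-representations $\sigma,\sigma'$, finite dimensional in each degree, let $\langle\sigma,\sigma'\rangle^{\mathrm{gr}}_G$ be the function $n\mapsto\sum_{d\in\mathbb Z}\dim\mathrm{Hom}_G(\sigma_d,\sigma'_{d+n})$, where $\dim\mathrm{Hom}_G$ is extended biadditively; it is defined if each of these sums has only finitely many nonzero terms. Put $V=\mathfrak h\oplus\mathfrak h^*$, with $\mathfrak h$ in degree $-1$ and $\mathfrak h^*$ in degree $1$, write $\bigwedge^{\pm}$ for the even and odd parts of an exterior algebra, and let $\langle\sigma,\sigma'\rangle^{V\text{-ell}}_G=\langle\sigma\otimes(\bigwedge^{+}V-\bigwedge^{-}V),\sigma'\rangle^{\mathrm{gr}}_G$.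 Let $S^*=\bigwedge\mathfrak h^*$ (graded, with $\mathfrak h^*$ in degree $1$), on which $x\in\mathfrak h^*$ acts by $\mathfrak s^*(x)=2x\wedge(\cdot)$ and $y\in\mathfrak h$ by $\mathfrak s^*(y)=-\partial_y$. The local Dirac operator of $X$ is $D_X=\sum_j x_j\otimes\mathfrak s^*(y_j)+\sum_j y_j\otimes\mathfrak s^*(x_j)$ on $X\otimes S^*$, for dual bases $x_j$ of $\mathfrak h^*$ and $y_j$ of $\mathfrak h$; it restricts to $D_X^{\pm}:X\otimes S^{*,\pm}\to X\otimes S^{*,\mp}$. Let $H_D^\pm(X)=\ker D_X^\pm/(\ker D_X^\pm\cap\mathrm{im}\,D_X^\mp)$, and let $I_D(X)=H_D^+(X)-H_D^-(X)$ be the local Dirac index, a virtual graded $G$-representation. A graded $\mathsf H_{t,c}$-module $X$ has an infinitesimal character if it is finitely generated over $\mathbb C[\mathfrak h]$, locally nilpotent for $\mathfrak h$, and moreover: when $t\ne 0$, there is a constant $k_X$ such that $\mathbf{eu}=\sum_i x_iy_i+\frac12\dim\mathfrak h-\sum_{s}\frac{c(s)}{d_s}s$ acts on each $X_d$ by the scalar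 $td+k_X$; when $t=0$, the centre of $\mathsf H_{0,c}$ acts on $X$ by scalars. Theorem. Let $X,Y$ be graded $\mathsf H_{t,c}$-modules of finite type, i.e. finite dimensional in each degree. Then $X$ has a graded projective resolution, and with any such resolution: (1) Suppose that $X$ is finitely generated over $\mathsf H_{t,c}$, or that for every $n$ the space of $G$-homomorphisms $\bigwedge V\otimes X|_G\to Y|_G$ of degree $n$ is finite dimensional. Then the graded spaces $\mathrm{Ext}^p(X,Y)$ are finite dimensional in each degree and zero for all but finitely many $p$, the pairing $\langle X|_G,Y|_G\rangle^{V\text{-ell}}_G$ is defined, and $$\mathrm{EPgr}(X,Y)=\langle X|_G,Y|_G\rangle^{V\text{-ell}}_G.$$ (2) If $X$ and $Y$ have infinitesimal characters, then all three pairings below are defined (with $\mathrm{Ext}^p(X,Y)$ as in (1)) and $$\mathrm{EPgr}(X,Y)=\langle X|_G,Y|_G\rangle^{V\text{-ell}}_G=\langle I_D(X),I_D(Y)\rangle^{\mathrm{gr}}_G.$$ -/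

import Mathlib

open scoped TensorProduct

universe u v w

noncomputable section

namespace Cherednik

/-! ## Complex reflection groups with parameters -/

/-- A (complex) reflection: a linear automorphism whose fixed space has codimension one. -/
def IsReflection {h : Type u} [AddCommGroup h] [Module ℂ h] (s : h ≃ₗ[ℂ] h) : Prop :=
  Module.finrank ℂ (LinearMap.range ((s : h →ₗ[ℂ] h) - LinearMap.id)) = 1

/-- The set of reflections contained in a group `G` of linear automorphisms. -/
def reflections {h : Type u} [AddCommGroup h] [Module ℂ h] (G : Subgroup (h ≃ₗ[ℂ] h)) :
    Set (h ≃ₗ[ℂ] h) :=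
  {s | s ∈ G ∧ IsReflection s}

/-- A finite group `G ⊆ GL(h)` generated by reflections and acting irreducibly on `h`, a choice of
eigenvectors `α_s ∈ h*`, `α_s^∨ ∈ h` for the nontrivial eigenvalues `λ_s`, `λ_s⁻¹` of each
reflection `s`, normalised by `α_s(α_s^∨) = 2`, and a conjugation invariant function `c` on the set
of reflections. The group acts on `h*` by `(g x)(y) = x(g⁻¹ y)`. -/
structure Datum (h : Type u) [AddCommGroup h] [Module ℂ h] where
  G : Subgroup (h ≃ₗ[ℂ] h)
  finite : Finite G
  generated : Subgroup.closure (reflections G) = G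
  nontrivial : Nontrivial h
  irreducible : ∀ W : Submodule ℂ h,
    (∀ g ∈ G, ∀ y ∈ W, g y ∈ W) → W = ⊥ ∨ W = ⊤
  lam : reflections G → ℂ
  lam_ne_one : ∀ s, lam s ≠ 1
  root : reflections G → Module.Dual ℂ h
  coroot : reflections G → h
  root_eigen : ∀ (s : reflections G) (y : h),
    root s ((s : h ≃ₗ[ℂ] h)⁻¹ y) = lam s * root s y
  coroot_eigen : ∀ s : reflections G, (s : h ≃ₗ[ℂ] h) (coroot s) = (lam s)⁻¹ • coroot s
  root_coroot : ∀ s, root s (coroot s) = 2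
  c : reflections G → ℂ
  c_conj : ∀ g ∈ G, ∀ s s' : reflections G,
    (s' : h ≃ₗ[ℂ] h) = g * (s : h ≃ₗ[ℂ] h) * g⁻¹ → c s' = c s

variable {h : Type u} [AddCommGroup h] [Module ℂ h]

instance (D : Datum h) : Finite D.G := D.finite

instance (D : Datum h) : Finite (reflections D.G) :=
  Finite.of_injective (fun s => (⟨s.1, s.2.1⟩ : D.G))
    fun _ _ hab => Subtype.ext (congrArg (fun g : D.G => (g : h ≃ₗ[ℂ] h)) hab)

instance (D : Datum h) : Fintype (reflections D.G) := Fintype.ofFinite _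

/-- A reflection of `G`, as an element of `G`. -/
def Datum.refl (D : Datum h) (s : reflections D.G) : D.G := ⟨s.1, s.2.1⟩

/-- The tautological representation of `G` on `h`. -/
def Datum.rep (D : Datum h) : Representation ℂ D.G h where
  toFun g := ((g : h ≃ₗ[ℂ] h) : h →ₗ[ℂ] h)
  map_one' := rfl
  map_mul' _ _ := rfl

/-- The contragredient representation of `G` on `h*`. -/
abbrev Datum.dualRep (D : Datum h) : Representation ℂ D.G (Module.Dual ℂ h) := D.rep.dual

/-! ## The rational Cherednik algebra -/

/-- Generators: the elements of `G`, of `h` and of `h*`. -/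
inductive Gen (D : Datum h) : Type u
  | g : D.G → Gen D
  | y : h → Gen D
  | x : Module.Dual ℂ h → Gen D

/-- The degree of a generator: `0` on `G`, `-1` on `h`, `1` on `h*`. -/
def Gen.deg {D : Datum h} : Gen D → ℤ
  | .g _ => 0
  | .y _ => -1
  | .x _ => 1

section Algebra

variable (D : Datum h) (t : ℂ)

/-- A group element as an element of the free algebra. -/
abbrev gg (a : D.G) : FreeAlgebra ℂ (Gen D) := FreeAlgebra.ι ℂ (Gen.g a)

/-- An element of `h` as an element of the free algebra. -/
abbrev yy (a : h) : FreeAlgebra ℂ (Gen D) := FreeAlgebra.ι ℂ (Gen.y a)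

/-- An element of `h*` as an element of the free algebra. -/
abbrev xx (a : Module.Dual ℂ h) : FreeAlgebra ℂ (Gen D) := FreeAlgebra.ι ℂ (Gen.x a)

/-- The relations of the rational Cherednik algebra. The first six present the free product of the
tensor algebra of `h ⊕ h*` and the group algebra of `G`; the others are the relations of `H_{t,c}`
proper. -/
inductive Rel : FreeAlgebra ℂ (Gen D) → FreeAlgebra ℂ (Gen D) → Prop
  | y_add (a b : h) : Rel (yy D (a + b)) (yy D a + yy D b)
  | y_smul (r : ℂ) (a : h) : Rel (yy D (r • a)) (r • yy D a)
  | x_add (a b : Module.Dual ℂ h) : Rel (xx D (a + b)) (xx D a + xx D b)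
  | x_smul (r : ℂ) (a : Module.Dual ℂ h) : Rel (xx D (r • a)) (r • xx D a)
  | g_one : Rel (gg D 1) 1
  | g_mul (a b : D.G) : Rel (gg D (a * b)) (gg D a * gg D b)
  | g_y (a : D.G) (b : h) : Rel (gg D a * yy D b) (yy D (D.rep a b) * gg D a)
  | g_x (a : D.G) (b : Module.Dual ℂ h) : Rel (gg D a * xx D b) (xx D (D.dualRep a b) * gg D a)
  | y_comm (a b : h) : Rel (yy D a * yy D b) (yy D b * yy D a)
  | x_comm (a b : Module.Dual ℂ h) : Rel (xx D a * xx D b) (xx D b * xx D a)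
  | y_x (a : h) (b : Module.Dual ℂ h) :
      Rel (yy D a * xx D b - xx D b * yy D a)
        (algebraMap ℂ _ (t * b a)
          - ∑ s, (D.c s * D.root s a * b (D.coroot s)) • gg D (D.refl s))

/-- The rational Cherednik algebra `H_{t,c}(G, h)`. -/
def H : Type u := RingQuot (Rel D t)

instance : Ring (H D t) := inferInstanceAs (Ring (RingQuot (Rel D t)))

instance : Algebra ℂ (H D t) := inferInstanceAs (Algebra ℂ (RingQuot (Rel D t)))

/-- The class of a generator in `H_{t,c}`. -/
def gen (a : Gen D) : H D t := RingQuot.mkAlgHom ℂ (Rel D t) (FreeAlgebra.ι ℂ a)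

lemma gen_y_add (a b : h) : gen D t (.y (a + b)) = gen D t (.y a) + gen D t (.y b) := by
  have := RingQuot.mkAlgHom_rel ℂ (Rel.y_add (D := D) (t := t) a b)
  rw [map_add] at this
  exact this

lemma gen_y_smul (r : ℂ) (a : h) : gen D t (.y (r • a)) = r • gen D t (.y a) := by
  have := RingQuot.mkAlgHom_rel ℂ (Rel.y_smul (D := D) (t := t) r a)
  rw [map_smul] at this
  exact this

lemma gen_x_add (a b : Module.Dual ℂ h) :
    gen D t (.x (a + b)) = gen D t (.x a) + gen D t (.x b) := by
  have := RingQuot.mkAlgHom_rel ℂ (Rel.x_add (D := D) (t := t) a b)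
  rw [map_add] at this
  exact this

lemma gen_x_smul (r : ℂ) (a : Module.Dual ℂ h) :
    gen D t (.x (r • a)) = r • gen D t (.x a) := by
  have := RingQuot.mkAlgHom_rel ℂ (Rel.x_smul (D := D) (t := t) r a)
  rw [map_smul] at this
  exact this

lemma gen_g_one : gen D t (.g 1) = 1 := by
  have := RingQuot.mkAlgHom_rel ℂ (Rel.g_one (D := D) (t := t))
  rw [map_one] at this
  exact this

lemma gen_g_mul (a b : D.G) : gen D t (.g (a * b)) = gen D t (.g a) * gen D t (.g b) := by
  have := RingQuot.mkAlgHom_rel ℂ (Rel.g_mul (D := D) (t := t) a b)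
  rw [map_mul] at this
  exact this

lemma gen_g_y (a : D.G) (b : h) :
    gen D t (.g a) * gen D t (.y b) = gen D t (.y (D.rep a b)) * gen D t (.g a) := by
  have := RingQuot.mkAlgHom_rel ℂ (Rel.g_y (D := D) (t := t) a b)
  rw [map_mul, map_mul] at this
  exact this

lemma gen_g_x (a : D.G) (b : Module.Dual ℂ h) :
    gen D t (.g a) * gen D t (.x b) = gen D t (.x (D.dualRep a b)) * gen D t (.g a) := by
  have := RingQuot.mkAlgHom_rel ℂ (Rel.g_x (D := D) (t := t) a b)
  rw [map_mul, map_mul] at this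
  exact this

/-- The inclusion `h → H_{t,c}`. -/
def yMap : h →ₗ[ℂ] H D t where
  toFun a := gen D t (.y a)
  map_add' := gen_y_add D t
  map_smul' := gen_y_smul D t

/-- The inclusion `h* → H_{t,c}`. -/
def xMap : Module.Dual ℂ h →ₗ[ℂ] H D t where
  toFun a := gen D t (.x a)
  map_add' := gen_x_add D t
  map_smul' := gen_x_smul D t

/-- The inclusion `G → H_{t,c}`. -/
def gMap : D.G →* H D t where
  toFun a := gen D t (.g a)
  map_one' := gen_g_one D t
  map_mul' := gen_g_mul D t

/-- The degree `n` subspace of `H_{t,c}`: the span of the words in the generators of degree `n`. -/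
def degPart (n : ℤ) : Submodule ℂ (H D t) :=
  Submodule.span ℂ {a | ∃ l : List (Gen D), (l.map Gen.deg).sum = n ∧ a = (l.map (gen D t)).prod}

lemma gen_mem_degPart (a : Gen D) : gen D t a ∈ degPart D t a.deg :=
  Submodule.subset_span ⟨[a], by simp, by simp⟩

/-- `d_s = (1 - λ_s) / 2`. -/
def dCoef (s : reflections D.G) : ℂ := (1 - D.lam s) / 2

/-- The Euler element
`eu = ∑ x_i y_i + (1/2) dim h - ∑_s (c(s) / d_s) s`, for dual bases `x_i`, `y_i`. -/
def euler [FiniteDimensional ℂ h] : H D t :=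
  ∑ i, xMap D t ((Module.finBasis ℂ h).coord i) * yMap D t (Module.finBasis ℂ h i)
    + algebraMap ℂ _ ((Module.finrank ℂ h : ℂ) / 2)
    - ∑ s, (D.c s / dCoef D s) • gMap D t (D.refl s)

/-- The image of `ℂ[h] = Sym h*` in `H_{t,c}`. -/
def polyX : Subalgebra ℂ (H D t) := Algebra.adjoin ℂ (Set.range (xMap D t))

end Algebra

/-! ## Graded modules -/

/-- A `ℤ`-graded left `H_{t,c}`-module. -/
structure GrMod (D : Datum h) (t : ℂ) where
  carrier : Type v
  [addCommGroup : AddCommGroup carrier]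
  [moduleC : Module ℂ carrier]
  [moduleH : Module (H D t) carrier]
  [tower : IsScalarTower ℂ (H D t) carrier]
  piece : ℤ → Submodule ℂ carrier
  isInternal : DirectSum.IsInternal piece
  smul_mem : ∀ (i j : ℤ), ∀ a ∈ degPart D t i, ∀ v ∈ piece j, a • v ∈ piece (i + j)

attribute [instance] GrMod.addCommGroup GrMod.moduleC GrMod.moduleH GrMod.tower

variable {D : Datum h} {t : ℂ}

namespace GrMod

/-- Finite type: every degree is finite dimensional. -/
def FiniteType (X : GrMod.{u, v} D t) : Prop := ∀ n, Module.Finite ℂ (X.piece n)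

/-- Membership in category `𝒪`: finitely generated over `ℂ[h]`, and `ℂ[h*]`-locally nilpotent, i.e.
every vector is killed by all sufficiently long products of elements of `h`. -/
def InCategoryO (X : GrMod.{u, v} D t) : Prop :=
  Module.Finite (polyX D t) X.carrier ∧
  ∀ v : X.carrier, ∃ N : ℕ, ∀ l : List h, l.length = N → (l.map (yMap D t)).prod • v = 0

/-- A graded module in category `𝒪` with an infinitesimal character. -/
def HasInfChar [FiniteDimensional ℂ h] (X : GrMod.{u, v} D t) : Prop :=
  X.InCategoryO ∧
  (t ≠ 0 → ∃ k : ℂ, ∀ d : ℤ, ∀ v ∈ X.piece d, euler D t • v = (t * d + k) • v) ∧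
  (t = 0 → ∃ χ : Subalgebra.center ℂ (H D t) → ℂ, ∀ (z : Subalgebra.center ℂ (H D t))
    (v : X.carrier), (z : H D t) • v = χ z • v)

/-- The homomorphisms of degree `n`: the `H_{t,c}`-linear maps sending degree `i` to degree
`i + n`. -/
def hom (X : GrMod.{u, v} D t) (Y : GrMod.{u, w} D t) (n : ℤ) :
    Submodule ℂ (X.carrier →ₗ[H D t] Y.carrier) where
  carrier := {f | ∀ i, ∀ v ∈ X.piece i, f v ∈ Y.piece (i + n)}
  add_mem' hf hg i v hv := (Y.piece (i + n)).add_mem (hf i v hv) (hg i v hv)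
  zero_mem' i _ _ := (Y.piece (i + n)).zero_mem
  smul_mem' r _ hf i v hv := (Y.piece (i + n)).smul_mem r (hf i v hv)

end GrMod

/-! ## Graded `Ext` and the graded Euler–Poincaré pairing -/

/-- A projective resolution `⋯ → P 1 → P 0 → X → 0` in the category of graded `H_{t,c}`-modules and
degree zero maps. (A graded module is projective there if and only if it is projective as an
ungraded module.) -/
structure GrProjRes (X : GrMod.{u, v} D t) where
  P : ℕ → GrMod.{u, max u v} D t
  projective : ∀ p, Module.Projective (H D t) (P p).carrier
  d : ∀ p, (P (p + 1)).carrier →ₗ[H D t] (P p).carrier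
  d_mem : ∀ p, d p ∈ (P (p + 1)).hom (P p) 0
  aug : (P 0).carrier →ₗ[H D t] X.carrier
  aug_mem : aug ∈ (P 0).hom X 0
  aug_surjective : Function.Surjective aug
  exact_zero : Function.Exact (d 0) aug
  exact_succ : ∀ p, Function.Exact (d (p + 1)) (d p)

namespace GrProjRes

variable {X : GrMod.{u, v} D t} (R : GrProjRes X) (Y : GrMod.{u, w} D t)

/-- The coboundary `f ↦ f ∘ d` on homomorphisms into `Y`. -/
def coboundary (p : ℕ) :
    ((R.P p).carrier →ₗ[H D t] Y.carrier) →ₗ[ℂ] ((R.P (p + 1)).carrier →ₗ[H D t] Y.carrier) where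
  toFun f := f ∘ₗ R.d p
  map_add' _ _ := rfl
  map_smul' _ _ := rfl

/-- The cocycles of internal degree `n` in `Hom(P p, Y)`. -/
def cocycles (p : ℕ) (n : ℤ) : Submodule ℂ ((R.P p).carrier →ₗ[H D t] Y.carrier) :=
  (R.P p).hom Y n ⊓ LinearMap.ker (R.coboundary Y p)

/-- The coboundaries of internal degree `n` in `Hom(P p, Y)`. -/
def coboundaries : (p : ℕ) → (n : ℤ) → Submodule ℂ ((R.P p).carrier →ₗ[H D t] Y.carrier)
  | 0, _ => ⊥
  | p + 1, n => ((R.P p).hom Y n).map (R.coboundary Y p)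

/-- The degree `n` part of `Ext^p(X, Y)`, computed by the given graded projective resolution. -/
abbrev Ext (p : ℕ) (n : ℤ) : Type (max u v w) :=
  R.cocycles Y p n ⧸ (R.coboundaries Y p n).submoduleOf (R.cocycles Y p n)

/-- The graded Euler–Poincaré pairing `∑_p (-1)^p dimgr Ext^p(X, Y)`, as the function sending `n` to
the coefficient of degree `n`. -/
def EPgr (n : ℤ) : ℤ := ∑ᶠ p : ℕ, (-1) ^ p * (Module.finrank ℂ (R.Ext Y p n) : ℤ)

/-- The graded Euler–Poincaré pairing is well defined: each `Ext^p(X, Y)` is degreewise finite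
dimensional and only finitely many of them are nonzero. -/
def EPgrDefined : Prop :=
  (∀ p n, Module.Finite ℂ (R.Ext Y p n)) ∧ ∃ N : ℕ, ∀ p > N, ∀ n, Subsingleton (R.Ext Y p n)

end GrProjRes

/-! ## Graded representations of `G` and their pairing -/

/-- A graded representation of `G`, given by a family of stable subspaces (the graded pieces) of an
ambient representation. Only the pieces matter. -/
structure GrRep (D : Datum h) where
  amb : Type v
  [addCommGroup : AddCommGroup amb]
  [module : Module ℂ amb]
  rho : Representation ℂ D.G amb
  piece : ℤ → Submodule ℂ amb
  stable : ∀ n g, piece n ≤ (piece n).comap (rho g)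

attribute [instance] GrRep.addCommGroup GrRep.module

namespace GrRep

/-- The representation of `G` in degree `n`. -/
def pieceRep (A : GrRep.{u, v} D) (n : ℤ) : Representation ℂ D.G (A.piece n) :=
  A.rho.subrepresentation (A.piece n) (A.stable n)

/-- `dim Hom_G(A_i, B_j)`. -/
def homDim (A : GrRep.{u, v} D) (B : GrRep.{u, w} D) (i j : ℤ) : ℕ :=
  Module.finrank ℂ (Representation.IntertwiningMap (A.pieceRep i) (B.pieceRep j))

/-- The zero graded representation. -/
def zero (D : Datum h) : GrRep.{u, 0} D where
  amb := ℂ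
  rho := 1
  piece _ := ⊥
  stable _ _ := bot_le

/-- The tensor product of graded representations, graded by total degree. -/
def tensor (A : GrRep.{u, v} D) (B : GrRep.{u, w} D) : GrRep.{u, max v w} D where
  amb := A.amb ⊗[ℂ] B.amb
  rho := A.rho.tprod B.rho
  piece n := ⨆ i : ℤ, Submodule.map₂ (TensorProduct.mk ℂ A.amb B.amb) (A.piece i) (B.piece (n - i))
  stable n g := by
    refine iSup_le fun i => Submodule.map₂_le.2 fun a ha b hb => ?_
    rw [Submodule.mem_comap]
    refine Submodule.mem_iSup_of_mem i ?_
    exact Submodule.apply_mem_map₂ _ (A.stable i g ha) (B.stable (n - i) g hb)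

end GrRep

/-- A formal difference `pos - neg` of graded representations of `G`. -/
structure VirtGrRep (D : Datum h) where
  pos : GrRep.{u, v} D
  neg : GrRep.{u, w} D

/-- A graded representation, as a virtual graded representation. -/
def GrRep.toVirt (A : GrRep.{u, v} D) : VirtGrRep.{u, v, 0} D := ⟨A, GrRep.zero D⟩

namespace VirtGrRep

universe v' w'

/-- `dim Hom_G(A_i, B_j)`, extended biadditively to virtual representations. -/
def homDim (A : VirtGrRep.{u, v, w} D) (B : VirtGrRep.{u, v', w'} D) (i j : ℤ) : ℤ :=
  (A.pos.homDim B.pos i j : ℤ) - A.pos.homDim B.neg i j - A.neg.homDim B.pos i j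
    + A.neg.homDim B.neg i j

/-- The graded pairing `⟨A, B⟩_G^gr = dimgr Hom_G(A, B)` of virtual graded representations, as the
function sending `n` to the coefficient `∑_d dim Hom_G(A_d, B_{d+n})` of degree `n`. -/
def pairing (A : VirtGrRep.{u, v, w} D) (B : VirtGrRep.{u, v', w'} D) (n : ℤ) : ℤ :=
  ∑ᶠ d : ℤ, A.homDim B d (d + n)

/-- The graded pairing is well defined: all sums `∑_d dim Hom_G(A_d, B_{d+n})` have only finitely
many nonzero terms. -/
def PairingDefined (A : VirtGrRep.{u, v, w} D) (B : VirtGrRep.{u, v', w'} D) : Prop :=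
  ∀ n : ℤ, {d : ℤ | A.homDim B d (d + n) ≠ 0}.Finite

end VirtGrRep

/-! ## Exterior algebras and the elliptic pairing -/

section Exterior

variable {V : Type v} [AddCommGroup V] [Module ℂ V]

/-- The representation of a group on the exterior algebra of a representation. -/
def extRep {G : Type w} [Group G] (ρ : Representation ℂ G V) :
    Representation ℂ G (ExteriorAlgebra ℂ V) where
  toFun g := (ExteriorAlgebra.map (ρ g)).toLinearMap
  map_one' := by
    rw [map_one, Module.End.one_eq_id, ExteriorAlgebra.map_id]
    rfl
  map_mul' a b := by
    rw [map_mul, Module.End.mul_eq_comp, ← ExteriorAlgebra.map_comp_map]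
    rfl

lemma map_extRep_pow {G : Type w} [Group G] (ρ : Representation ℂ G V) (W : Submodule ℂ V)
    (hW : ∀ g, W ≤ W.comap (ρ g)) (g : G) (a : ℕ) :
    (W.map (ExteriorAlgebra.ι ℂ)) ^ a ≤
      ((W.map (ExteriorAlgebra.ι ℂ)) ^ a).comap (ExteriorAlgebra.map (ρ g)).toLinearMap := by
  rw [← Submodule.map_le_iff_le_comap, Submodule.map_pow]
  refine pow_le_pow_left' ?_ a
  rw [Submodule.map_le_iff_le_comap]
  rintro _ ⟨y, hy, rfl⟩
  exact ⟨ρ g y, hW g hy, (ExteriorAlgebra.map_apply_ι _ _).symm⟩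

end Exterior

/-- `V = h ⊕ h*` as a representation of `G`. -/
abbrev vRep (D : Datum h) : Representation ℂ D.G (h × Module.Dual ℂ h) := D.rep.prod D.dualRep

/-- The subspace `h` of `⋀ V`. -/
def extY (h : Type u) [AddCommGroup h] [Module ℂ h] :
    Submodule ℂ (ExteriorAlgebra ℂ (h × Module.Dual ℂ h)) :=
  (LinearMap.range (LinearMap.inl ℂ h (Module.Dual ℂ h))).map (ExteriorAlgebra.ι ℂ)

/-- The subspace `h*` of `⋀ V`. -/
def extX (h : Type u) [AddCommGroup h] [Module ℂ h] :
    Submodule ℂ (ExteriorAlgebra ℂ (h × Module.Dual ℂ h)) :=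
  (LinearMap.range (LinearMap.inr ℂ h (Module.Dual ℂ h))).map (ExteriorAlgebra.ι ℂ)

/-- The even (`ε = 0`) or odd (`ε = 1`) part of `⋀ V` as a graded representation, where `h` has
degree `-1` and `h*` has degree `1`: the degree `n` part is the sum of all `⋀^a h* ⋀^b h` with
`a - b = n` and `a + b` of parity `ε`. -/
def extV (D : Datum h) (ε : ZMod 2) : GrRep.{u, u} D where
  amb := ExteriorAlgebra ℂ (h × Module.Dual ℂ h)
  rho := extRep (vRep D)
  piece n := ⨆ (a : ℕ) (b : ℕ) (_ : (a : ℤ) - b = n ∧ ((a + b : ℕ) : ZMod 2) = ε),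
    extX h ^ a * extY h ^ b
  stable n g := by
    refine iSup_le fun a => iSup_le fun b => iSup_le fun hab => ?_
    refine le_trans ?_ (Submodule.comap_mono
      (le_iSup_of_le a (le_iSup_of_le b (le_iSup_of_le hab le_rfl))))
    rw [← Submodule.map_le_iff_le_comap]
    refine (Submodule.map_mul _ _ (ExteriorAlgebra.map (vRep D g))).trans_le ?_
    refine mul_le_mul' ?_ ?_
    · refine Submodule.map_le_iff_le_comap.2 (map_extRep_pow (vRep D) _ (fun g => ?_) g a)
      rintro _ ⟨x, rfl⟩
      exact ⟨D.dualRep g x, by simp⟩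
    · refine Submodule.map_le_iff_le_comap.2 (map_extRep_pow (vRep D) _ (fun g => ?_) g b)
      rintro _ ⟨y, rfl⟩
      exact ⟨D.rep g y, by simp⟩

/-- The even (`ε = 0`) or odd (`ε = 1`) part of the spin module `S* = ⋀ h*` as a graded
representation, where `⋀^a h*` has degree `a`. -/
def spin (D : Datum h) (ε : ZMod 2) : GrRep.{u, u} D where
  amb := ExteriorAlgebra ℂ (Module.Dual ℂ h)
  rho := extRep D.dualRep
  piece n := ⨆ (a : ℕ) (_ : (a : ℤ) = n ∧ (a : ZMod 2) = ε),
    ((⊤ : Submodule ℂ (Module.Dual ℂ h)).map (ExteriorAlgebra.ι ℂ)) ^ a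
  stable n g := by
    refine iSup_le fun a => iSup_le fun ha => ?_
    exact (map_extRep_pow D.dualRep ⊤ (fun _ _ _ => trivial) g a).trans
      (Submodule.comap_mono (le_iSup_of_le a (le_iSup_of_le ha le_rfl)))

/-- The `V`-elliptic combination `A ⊗ (⋀⁺ V - ⋀⁻ V)`. -/
def GrRep.elliptic (A : GrRep.{u, v} D) : VirtGrRep.{u, max u v, max u v} D :=
  ⟨A.tensor (extV D 0), A.tensor (extV D 1)⟩

/-- The `V`-elliptic pairing `⟨A, B⟩_G^{V-ell} = ⟨A ⊗ (⋀⁺ V - ⋀⁻ V), B⟩_G^gr`. -/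
def vEll (A : GrRep.{u, v} D) (B : GrRep.{u, w} D) : ℤ → ℤ := A.elliptic.pairing B.toVirt

/-- The graded `V`-elliptic pairing is well defined. -/
def VEllDefined (A : GrRep.{u, v} D) (B : GrRep.{u, w} D) : Prop :=
  A.elliptic.PairingDefined B.toVirt

/-- In every degree `n`, the space of `G`-homomorphisms `⋀ V ⊗ A → B` of degree `n` is finite
dimensional (for `A`, `B` of finite type). -/
def HomFinite (A : GrRep.{u, v} D) (B : GrRep.{u, w} D) : Prop :=
  ∀ (ε : ZMod 2) (n : ℤ), {d : ℤ | (A.tensor (extV D ε)).homDim B d (d + n) ≠ 0}.Finite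

/-! ## The local Dirac operator and the local Dirac index -/

section Restriction

/-- The restriction `X|_G`. -/
def GrMod.rep (X : GrMod.{u, v} D t) : Representation ℂ D.G X.carrier :=
  ((Algebra.lsmul ℂ ℂ X.carrier : H D t →ₐ[ℂ] Module.End ℂ X.carrier) :
    H D t →* Module.End ℂ X.carrier).comp (gMap D t)

lemma GrMod.rep_apply (X : GrMod.{u, v} D t) (g : D.G) (v : X.carrier) :
    X.rep g v = gen D t (.g g) • v := rfl

/-- The restriction `X|_G` as a graded representation. -/
def GrMod.res (X : GrMod.{u, v} D t) : GrRep.{u, v} D where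
  amb := X.carrier
  rho := X.rep
  piece := X.piece
  stable n g v hv := by
    have := X.smul_mem 0 n _ (gen_mem_degPart D t (.g g)) v hv
    rwa [zero_add] at this

end Restriction

section Dirac

variable (X : GrMod.{u, v} D t)

/-- The underlying space of `X ⊗ S*`. -/
abbrev spinSpace : Type (max u v) := X.carrier ⊗[ℂ] ExteriorAlgebra ℂ (Module.Dual ℂ h)

/-- The Clifford action of `y ∈ h` on `S* = ⋀ h*`: `y` acts by `-∂_y`, where `∂_y` is the odd
derivation with `∂_y x = x(y)`. -/
def cliffY : h →ₗ[ℂ] Module.End ℂ (ExteriorAlgebra ℂ (Module.Dual ℂ h)) :=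
  -(CliffordAlgebra.contractLeft (Q := (0 : QuadraticForm ℂ (Module.Dual ℂ h))) ∘ₗ
    Module.Dual.eval ℂ h)

/-- The Clifford action of `x ∈ h*` on `S* = ⋀ h*`: `x` acts by `2 μ_x`, where `μ_x` is exterior
multiplication by `x`. -/
def cliffX : Module.Dual ℂ h →ₗ[ℂ] Module.End ℂ (ExteriorAlgebra ℂ (Module.Dual ℂ h)) :=
  (2 : ℂ) • (LinearMap.mul ℂ (ExteriorAlgebra ℂ (Module.Dual ℂ h)) ∘ₗ ExteriorAlgebra.ι ℂ)

/-- The action of `h` on `X`. -/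
def actY : h →ₗ[ℂ] Module.End ℂ X.carrier :=
  (Algebra.lsmul ℂ ℂ X.carrier : H D t →ₐ[ℂ] Module.End ℂ X.carrier).toLinearMap ∘ₗ yMap D t

/-- The action of `h*` on `X`. -/
def actX : Module.Dual ℂ h →ₗ[ℂ] Module.End ℂ X.carrier :=
  (Algebra.lsmul ℂ ℂ X.carrier : H D t →ₐ[ℂ] Module.End ℂ X.carrier).toLinearMap ∘ₗ xMap D t

/-- The local Dirac operator on `X ⊗ S*`: the action of
`∑_j x_j ⊗ y_j + ∑_j y_j ⊗ x_j ∈ H_{t,c} ⊗ C(V)`, for dual bases `x_j` of `h*` and `y_j` of `h`. -/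
def dirac [FiniteDimensional ℂ h] : Module.End ℂ (spinSpace X) :=
  ∑ j, TensorProduct.map (actX X ((Module.finBasis ℂ h).coord j))
      (cliffY (Module.finBasis ℂ h j))
    + ∑ j, TensorProduct.map (actY X (Module.finBasis ℂ h j))
      (cliffX ((Module.finBasis ℂ h).coord j))

/-- `X ⊗ S^{*,±}` as a graded representation. -/
abbrev spinRep (ε : ZMod 2) : GrRep.{u, max u v} D := X.res.tensor (spin D ε)

lemma sum_dual_basis {W : Type w} [AddCommGroup W] [Module ℂ W] [FiniteDimensional ℂ h]
    (B : Module.Dual ℂ h →ₗ[ℂ] h →ₗ[ℂ] W) (g : D.G) :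
    ∑ j, B (D.dualRep g ((Module.finBasis ℂ h).coord j)) (D.rep g (Module.finBasis ℂ h j))
      = ∑ j, B ((Module.finBasis ℂ h).coord j) (Module.finBasis ℂ h j) := by
  set b := Module.finBasis ℂ h
  have h1 : ∀ j, D.rep g (b j) = ∑ k, b.coord k (D.rep g (b j)) • b k := fun j =>
    (b.sum_repr _).symm
  have h2 : ∀ k, ∑ j, b.coord k (D.rep g (b j)) • D.dualRep g (b.coord j) = b.coord k := by
    intro k
    refine LinearMap.ext fun v => ?_
    obtain ⟨z, rfl⟩ : ∃ z, D.rep g z = v := ⟨D.rep g⁻¹ v, Representation.self_inv_apply _ _ _⟩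
    have h3 : ∀ j, D.dualRep g (b.coord j) (D.rep g z) = b.repr z j := by
      intro j
      simp [Representation.dual_apply, Module.Dual.transpose_apply]
    have h4 : D.rep g z = ∑ j, b.repr z j • D.rep g (b j) := by
      calc D.rep g z = D.rep g (∑ j, b.repr z j • b j) := by rw [b.sum_repr]
        _ = _ := by rw [map_sum]; exact Finset.sum_congr rfl fun j _ => map_smul _ _ _
    rw [LinearMap.sum_apply]
    simp only [LinearMap.smul_apply, h3, smul_eq_mul]
    conv_rhs => rw [h4]
    simp [mul_comm]
  calc _ = ∑ j, ∑ k, B (b.coord k (D.rep g (b j)) • D.dualRep g (b.coord j)) (b k) := by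
        refine Finset.sum_congr rfl fun j _ => ?_
        conv_lhs => rw [h1 j, map_sum]
        simp
    _ = _ := by
        rw [Finset.sum_comm]
        refine Finset.sum_congr rfl fun k _ => ?_
        conv_rhs => rw [← h2 k]
        rw [map_sum, LinearMap.sum_apply]

lemma extRep_cliffX (g : D.G) (x : Module.Dual ℂ h)
    (m : ExteriorAlgebra ℂ (Module.Dual ℂ h)) :
    extRep D.dualRep g (cliffX x m) = cliffX (D.dualRep g x) (extRep D.dualRep g m) := by
  change ExteriorAlgebra.map (D.dualRep g) ((2 : ℂ) • (ExteriorAlgebra.ι ℂ x * m)) =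
    (2 : ℂ) • (ExteriorAlgebra.ι ℂ (D.dualRep g x) * ExteriorAlgebra.map (D.dualRep g) m)
  rw [map_smul, map_mul, ExteriorAlgebra.map_apply_ι]

lemma extRep_contract (g : D.G) (y : h) (m : ExteriorAlgebra ℂ (Module.Dual ℂ h)) :
    ExteriorAlgebra.map (D.dualRep g)
      (CliffordAlgebra.contractLeft (Q := (0 : QuadraticForm ℂ (Module.Dual ℂ h)))
        (Module.Dual.eval ℂ h y) m) =
      CliffordAlgebra.contractLeft (Q := (0 : QuadraticForm ℂ (Module.Dual ℂ h)))
        (Module.Dual.eval ℂ h (D.rep g y)) (ExteriorAlgebra.map (D.dualRep g) m) := by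
  have key : ∀ x : Module.Dual ℂ h, (D.dualRep g x) (D.rep g y) = x y := by
    intro x
    simp [Representation.dual_apply, Module.Dual.transpose_apply]
  induction m using CliffordAlgebra.left_induction with
  | algebraMap r =>
    rw [CliffordAlgebra.contractLeft_algebraMap, map_zero]
    erw [AlgHom.commutes, CliffordAlgebra.contractLeft_algebraMap]
  | add a b ha hb => simp only [map_add, ha, hb]
  | ι_mul a x ha =>
    have e : ExteriorAlgebra.map (D.dualRep g)
        (CliffordAlgebra.ι (0 : QuadraticForm ℂ (Module.Dual ℂ h)) x)
          = CliffordAlgebra.ι (0 : QuadraticForm ℂ (Module.Dual ℂ h)) (D.dualRep g x) :=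
      ExteriorAlgebra.map_apply_ι _ _
    rw [CliffordAlgebra.contractLeft_ι_mul, map_sub, map_smul, map_mul, map_mul, e,
      CliffordAlgebra.contractLeft_ι_mul, ha]
    simp only [Module.Dual.eval_apply, key]

lemma extRep_cliffY (g : D.G) (y : h) (m : ExteriorAlgebra ℂ (Module.Dual ℂ h)) :
    extRep D.dualRep g (cliffY y m) = cliffY (D.rep g y) (extRep D.dualRep g m) := by
  change ExteriorAlgebra.map (D.dualRep g) (-_) = -_
  rw [map_neg]
  exact congrArg Neg.neg (extRep_contract g y m)

lemma rep_actX (g : D.G) (x : Module.Dual ℂ h) (v : X.carrier) :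
    X.rep g (actX X x v) = actX X (D.dualRep g x) (X.rep g v) := by
  change gen D t (.g g) • gen D t (.x x) • v =
    gen D t (.x (D.dualRep g x)) • gen D t (.g g) • v
  rw [smul_smul, smul_smul, gen_g_x]

lemma rep_actY (g : D.G) (y : h) (v : X.carrier) :
    X.rep g (actY X y v) = actY X (D.rep g y) (X.rep g v) := by
  change gen D t (.g g) • gen D t (.y y) • v =
    gen D t (.y (D.rep g y)) • gen D t (.g g) • v
  rw [smul_smul, smul_smul, gen_g_y]

/-- The Dirac operator is `G`-equivariant. -/
lemma dirac_equivariant [FiniteDimensional ℂ h] (g : D.G) (m : spinSpace X) :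
    X.rep.tprod (extRep D.dualRep) g (dirac X m) =
      dirac X (X.rep.tprod (extRep D.dualRep) g m) := by
  have e : (X.rep.tprod (extRep D.dualRep) g) ∘ₗ dirac X =
      dirac X ∘ₗ (X.rep.tprod (extRep D.dualRep) g) := by
    refine TensorProduct.ext' fun v m => ?_
    have hx : ∑ j, (actX X (D.dualRep g ((Module.finBasis ℂ h).coord j)) (X.rep g v)) ⊗ₜ[ℂ]
          (cliffY (D.rep g (Module.finBasis ℂ h j)) (extRep D.dualRep g m)) =
        ∑ j, (actX X ((Module.finBasis ℂ h).coord j) (X.rep g v)) ⊗ₜ[ℂ]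
          (cliffY (Module.finBasis ℂ h j) (extRep D.dualRep g m)) := sum_dual_basis (D := D) (LinearMap.mk₂ ℂ
      (fun (x : Module.Dual ℂ h) (y : h) =>
        (actX X x (X.rep g v)) ⊗ₜ[ℂ] (cliffY y (extRep D.dualRep g m)))
      (by intros; simp [TensorProduct.add_tmul]) (by intros; simp [TensorProduct.smul_tmul'])
      (by intros; simp [TensorProduct.tmul_add]) (by intros; simp)) g
    have hy : ∑ j, (actY X (D.rep g (Module.finBasis ℂ h j)) (X.rep g v)) ⊗ₜ[ℂ]
          (cliffX (D.dualRep g ((Module.finBasis ℂ h).coord j)) (extRep D.dualRep g m)) =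
        ∑ j, (actY X (Module.finBasis ℂ h j) (X.rep g v)) ⊗ₜ[ℂ]
          (cliffX ((Module.finBasis ℂ h).coord j) (extRep D.dualRep g m)) := sum_dual_basis (D := D) (LinearMap.mk₂ ℂ
      (fun (x : Module.Dual ℂ h) (y : h) =>
        (actY X y (X.rep g v)) ⊗ₜ[ℂ] (cliffX x (extRep D.dualRep g m)))
      (by intros; simp [TensorProduct.tmul_add]) (by intros; simp)
      (by intros; simp [TensorProduct.add_tmul])
      (by intros; simp [TensorProduct.smul_tmul'])) g
    simp only [dirac, LinearMap.comp_apply, LinearMap.add_apply, LinearMap.sum_apply, map_add,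
      map_sum, Representation.tprod_apply, TensorProduct.map_tmul, extRep_cliffX, extRep_cliffY,
      rep_actX, rep_actY, hx, hy]
  exact LinearMap.congr_fun e m

/-- The subspace `X ⊗ S^{*,±}` of `X ⊗ S*`. -/
def spinPart (ε : ZMod 2) : Submodule ℂ (spinSpace X) := ⨆ n, (spinRep X ε).piece n

lemma spinPart_stable (ε : ZMod 2) (g : D.G) :
    spinPart X ε ≤ (spinPart X ε).comap ((spinRep X ε).rho g) :=
  iSup_le fun n => ((spinRep X ε).stable n g).trans
    (Submodule.comap_mono (le_iSup (spinRep X ε).piece n))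

variable [FiniteDimensional ℂ h]

/-- The kernel of `D_X^±`, the restriction of the Dirac operator to `X ⊗ S^{*,±}`. -/
def diracKer (ε : ZMod 2) : Submodule ℂ (spinSpace X) :=
  LinearMap.ker (dirac X) ⊓ spinPart X ε

/-- The image of `D_X^∓`, the restriction of the Dirac operator to `X ⊗ S^{*,∓}`. -/
def diracIm (ε : ZMod 2) : Submodule ℂ (spinSpace X) :=
  (spinPart X (ε + 1)).map (dirac X)

lemma dirac_stable (ε : ZMod 2) (g : D.G) :
    diracKer X ε ⊓ diracIm X ε ≤ (diracKer X ε ⊓ diracIm X ε).comap ((spinRep X ε).rho g) := by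
  rintro m ⟨⟨h1, h2⟩, w, hw, rfl⟩
  refine ⟨⟨?_, spinPart_stable X ε g h2⟩, (spinRep X (ε + 1)).rho g w,
    spinPart_stable X (ε + 1) g hw, (dirac_equivariant X g w).symm⟩
  change dirac X (X.rep.tprod (extRep D.dualRep) g _) = 0
  rw [← dirac_equivariant]
  have h3 : dirac X (dirac X w) = 0 := h1
  rw [h3, map_zero]

/-- The Dirac cohomology `H_D^±(X) = ker D_X^± / (ker D_X^± ∩ im D_X^∓)` as a graded representation
of `G`: the degree `n` part is the image of the degree `n` part of `ker D_X^±`. The sign is `+` for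
`ε = 0` and `-` for `ε = 1`. -/
def diracCoh (ε : ZMod 2) : GrRep.{u, max u v} D where
  amb := spinSpace X ⧸ (diracKer X ε ⊓ diracIm X ε)
  rho := (spinRep X ε).rho.quotient (diracKer X ε ⊓ diracIm X ε) (dirac_stable X ε)
  piece n := (LinearMap.ker (dirac X) ⊓ (spinRep X ε).piece n).map (Submodule.mkQ _)
  stable n g := by
    rintro _ ⟨m, ⟨h1, h2⟩, rfl⟩
    refine ⟨(spinRep X ε).rho g m, ⟨?_, (spinRep X ε).stable n g h2⟩, rfl⟩
    change dirac X (X.rep.tprod (extRep D.dualRep) g m) = 0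
    rw [← dirac_equivariant]
    have h3 : dirac X m = 0 := h1
    rw [h3, map_zero]

/-- The local Dirac index `I_D(X) = H_D^+(X) - H_D^-(X)`. -/
def diracIndex : VirtGrRep.{u, max u v, max u v} D := ⟨diracCoh X 0, diracCoh X 1⟩

end Dirac

end Cherednik

namespace Cherednik
variable {h : Type u} [AddCommGroup h] [Module ℂ h]

/-! ## Reflections -/

section Reflections

variable (D : Datum h)

lemma Datum.rep_inv_apply (g : D.G) (y : h) : D.rep g⁻¹ y = (g : h ≃ₗ[ℂ] h)⁻¹ y := rfl

lemma Datum.dualRep_apply (g : D.G) (x : Module.Dual ℂ h) (y : h) :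
    D.dualRep g x y = x (D.rep g⁻¹ y) := by
  simp [Representation.dual_apply, Module.Dual.transpose_apply]

lemma Datum.rep_inv_rep (g : D.G) (y : h) : D.rep g⁻¹ (D.rep g y) = y :=
  Representation.inv_self_apply _ _ _

lemma Datum.rep_rep_inv (g : D.G) (y : h) : D.rep g (D.rep g⁻¹ y) = y :=
  Representation.self_inv_apply _ _ _

lemma dCoef_ne_zero (s : reflections D.G) : dCoef D s ≠ 0 := by
  have := D.lam_ne_one s
  unfold dCoef
  intro h0
  apply this
  have : (1 : ℂ) - D.lam s = 0 := by
    rcases div_eq_zero_iff.1 h0 with h1 | h1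
    · exact h1
    · norm_num at h1
  exact (sub_eq_zero.1 this).symm

lemma Datum.lam_ne_zero (s : reflections D.G) : D.lam s ≠ 0 := by
  intro h0
  have h1 := D.root_eigen s ((s : h ≃ₗ[ℂ] h) (D.coroot s))
  rw [h0, zero_mul] at h1
  have h2 : (s : h ≃ₗ[ℂ] h)⁻¹ ((s : h ≃ₗ[ℂ] h) (D.coroot s)) = D.coroot s :=
    (s : h ≃ₗ[ℂ] h).symm_apply_apply _
  rw [h2, D.root_coroot] at h1
  norm_num at h1

lemma Datum.coroot_ne_zero (s : reflections D.G) : D.coroot s ≠ 0 := by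
  intro h0
  have := D.root_coroot s
  rw [h0, map_zero] at this
  norm_num at this

/-- The action of the inverse of a reflection on `h`. -/
lemma Datum.refl_inv_apply (s : reflections D.G) (y : h) :
    D.rep (D.refl s)⁻¹ y = y - (dCoef D s * D.root s y) • D.coroot s := by
  rw [Datum.rep_inv_apply]
  change (s : h ≃ₗ[ℂ] h)⁻¹ y = _
  have hs : Module.finrank ℂ (LinearMap.range (((s : h ≃ₗ[ℂ] h) : h →ₗ[ℂ] h) - LinearMap.id)) = 1 :=
    s.2.2
  have hmem : (((D.lam s)⁻¹ - 1) • D.coroot s) ∈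
      LinearMap.range (((s : h ≃ₗ[ℂ] h) : h →ₗ[ℂ] h) - LinearMap.id) := by
    refine ⟨D.coroot s, ?_⟩
    have := D.coroot_eigen s
    simp [this, sub_smul]
  have hl : (D.lam s)⁻¹ - 1 ≠ 0 := by
    intro h0
    exact D.lam_ne_one s (inv_eq_one.1 (sub_eq_zero.1 h0))
  have hmem' : D.coroot s ∈
      LinearMap.range (((s : h ≃ₗ[ℂ] h) : h →ₗ[ℂ] h) - LinearMap.id) := by
    have := Submodule.smul_mem _ ((D.lam s)⁻¹ - 1)⁻¹ hmem
    rwa [smul_smul, inv_mul_cancel₀ hl, one_smul] at this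
  set y' := (s : h ≃ₗ[ℂ] h)⁻¹ y with hy'
  have hy : (s : h ≃ₗ[ℂ] h) y' = y := (s : h ≃ₗ[ℂ] h).apply_symm_apply y
  obtain ⟨r, hr⟩ := (finrank_eq_one_iff_of_nonzero' (⟨D.coroot s, hmem'⟩ :
    LinearMap.range (((s : h ≃ₗ[ℂ] h) : h →ₗ[ℂ] h) - LinearMap.id))
    (by simpa [Subtype.ext_iff] using D.coroot_ne_zero s)).1 hs ⟨y - y', y', by simp [hy]⟩
  have hr' : r • D.coroot s = y - y' := congrArg Subtype.val hr
  have h1 := D.root_eigen s y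
  have h2 : D.root s (r • D.coroot s) = D.root s (y - y') := by rw [hr']
  rw [map_smul, map_sub, D.root_coroot] at h2
  have h3 : r = dCoef D s * D.root s y := by
    unfold dCoef
    rw [smul_eq_mul] at h2
    have h1' : D.root s y' = D.lam s * D.root s y := h1
    rw [h1'] at h2
    linear_combination h2 / 2
  rw [← h3, hr']
  abel

/-- The action of a reflection on `h*`. -/
lemma Datum.refl_dual_apply (s : reflections D.G) (x : Module.Dual ℂ h) :
    D.dualRep (D.refl s) x = x - (dCoef D s * x (D.coroot s)) • D.root s := by
  refine LinearMap.ext fun y => ?_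
  rw [Datum.dualRep_apply, Datum.refl_inv_apply]
  simp
  ring

/-- The conjugate of a reflection. -/
def Datum.conj (g : D.G) (s : reflections D.G) : reflections D.G :=
  ⟨(g * D.refl s * g⁻¹ : D.G), (g * D.refl s * g⁻¹ : D.G).2, by
    have hs := s.2.2
    unfold IsReflection at hs ⊢
    have : ((((g * D.refl s * g⁻¹ : D.G) : h ≃ₗ[ℂ] h) : h →ₗ[ℂ] h) - LinearMap.id) =
        ((g : h ≃ₗ[ℂ] h) : h →ₗ[ℂ] h) ∘ₗ (((s : h ≃ₗ[ℂ] h) : h →ₗ[ℂ] h) - LinearMap.id) ∘ₗ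
          ((g : h ≃ₗ[ℂ] h).symm : h →ₗ[ℂ] h) := by
      refine LinearMap.ext fun y => ?_
      have e : (g : h ≃ₗ[ℂ] h) ((g : h ≃ₗ[ℂ] h).symm y) = y := LinearEquiv.apply_symm_apply _ _
      simp only [LinearMap.sub_apply, LinearMap.comp_apply, map_sub, LinearMap.id_apply,
        LinearEquiv.coe_coe, e]
      rfl
    rw [this, LinearMap.range_comp, LinearMap.range_comp, LinearEquiv.range, Submodule.map_top]
    rw [LinearEquiv.finrank_map_eq, hs]⟩

lemma Datum.refl_conj (g : D.G) (s : reflections D.G) :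
    D.refl (D.conj g s) = g * D.refl s * g⁻¹ := Subtype.ext rfl

/-- Conjugation by `g` as a permutation of the reflections. -/
def Datum.conjEquiv (g : D.G) : reflections D.G ≃ reflections D.G where
  toFun := D.conj g
  invFun := D.conj g⁻¹
  left_inv s := Subtype.ext (by simp [Datum.conj, Datum.refl, mul_assoc])
  right_inv s := Subtype.ext (by simp [Datum.conj, Datum.refl, mul_assoc])

lemma Datum.c_conj' (g : D.G) (s : reflections D.G) : D.c (D.conj g s) = D.c s :=
  D.c_conj g g.2 s _ rfl

lemma Datum.conj_root_smul (g : D.G) (s : reflections D.G) (y : h) :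
    (dCoef D (D.conj g s) * D.root (D.conj g s) (D.rep g y)) • D.coroot (D.conj g s) =
      (dCoef D s * D.root s y) • D.rep g (D.coroot s) := by
  have h1 := D.refl_inv_apply (D.conj g s) (D.rep g y)
  have h2 := congrArg (D.rep g) (D.refl_inv_apply s y)
  rw [Datum.refl_conj] at h1
  have h3 : D.rep (g * D.refl s * g⁻¹)⁻¹ (D.rep g y) = D.rep g (D.rep (D.refl s)⁻¹ y) := by
    simp only [mul_inv_rev, inv_inv, map_mul, Module.End.mul_apply, Datum.rep_inv_rep]
  rw [h3, h2, map_sub, map_smul] at h1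
  exact (sub_right_injective h1).symm

lemma dCoef_conj (g : D.G) (s : reflections D.G) : dCoef D (D.conj g s) = dCoef D s := by
  set s' := D.conj g s
  have h1 := D.conj_root_smul g s (D.coroot s)
  rw [D.root_coroot] at h1
  have hd := dCoef_ne_zero D s
  have hne : D.rep g (D.coroot s) ≠ 0 := by
    intro h0
    have := D.rep_inv_rep g (D.coroot s)
    rw [h0, map_zero] at this
    exact D.coroot_ne_zero s this.symm
  have h2 := congrArg (D.root s') h1
  rw [map_smul, map_smul, D.root_coroot, smul_eq_mul, smul_eq_mul] at h2
  have h3 : D.root s' (D.rep g (D.coroot s)) ≠ 0 := by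
    intro h0
    rw [show D.root (D.conj g s) = D.root s' from rfl, h0, mul_zero, zero_smul] at h1
    exact (smul_ne_zero (mul_ne_zero hd two_ne_zero) hne) h1.symm
  refine mul_right_cancel₀ (mul_ne_zero h3 two_ne_zero) ?_
  linear_combination h2

lemma Datum.conj_root_coroot (g : D.G) (s : reflections D.G) (y : h) :
    D.root (D.conj g s) (D.rep g y) • D.coroot (D.conj g s) =
      D.root s y • D.rep g (D.coroot s) := by
  have h1 := D.conj_root_smul g s y
  rw [dCoef_conj, mul_smul, mul_smul] at h1
  exact smul_right_injective _ (dCoef_ne_zero D s) h1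

lemma Datum.exists_conj_scalar (g : D.G) (s : reflections D.G) : ∃ r : ℂ, r ≠ 0 ∧
    D.rep g (D.coroot s) = r • D.coroot (D.conj g s) ∧
    ∀ y, D.root (D.conj g s) (D.rep g y) = r * D.root s y := by
  have h1 := D.conj_root_coroot g s (D.coroot s)
  rw [D.root_coroot] at h1
  refine ⟨D.root (D.conj g s) (D.rep g (D.coroot s)) / 2, ?_, ?_, fun y => ?_⟩
  · intro h0
    have h2 : D.root (D.conj g s) (D.rep g (D.coroot s)) = 0 := by linear_combination 2 * h0
    rw [h2, zero_smul] at h1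
    have h3 := (smul_eq_zero.1 h1.symm).resolve_left two_ne_zero
    have := D.rep_inv_rep g (D.coroot s)
    rw [h3, map_zero] at this
    exact D.coroot_ne_zero s this.symm
  · rw [div_eq_inv_mul, mul_smul, h1, smul_smul]
    norm_num
  · have h2 := congrArg (D.root (D.conj g s)) (D.conj_root_coroot g s y)
    rw [map_smul, map_smul, D.root_coroot, smul_eq_mul, smul_eq_mul] at h2
    linear_combination h2 / 2

end Reflections

/-! ## Twisted derivations of symmetric algebras -/

section TwistedDerivation

variable {M : Type*} [AddCommGroup M] [Module ℂ M]

open SymmetricAlgebra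

/-- The algebra homomorphism `Sym M → Sym M[ω]`, `ω² = u ω`, sending `x ∈ M` to `x + a(x) ω`. -/
def twistHom (a : Module.Dual ℂ M) (m : M) :
    SymmetricAlgebra ℂ M →ₐ[ℂ] QuadraticAlgebra (SymmetricAlgebra ℂ M) 0 (ι ℂ M m) :=
  lift
    { toFun := fun x => ⟨ι ℂ M x, algebraMap ℂ _ (a x)⟩
      map_add' := fun x y => by ext <;> simp
      map_smul' := fun r x => QuadraticAlgebra.ext ((ι ℂ M).map_smul r x) (by
        change algebraMap ℂ (SymmetricAlgebra ℂ M) (a (r • x)) = r • algebraMap ℂ _ (a x)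
        rw [map_smul, smul_eq_mul, map_mul, Algebra.smul_def]) }

lemma twistHom_ι (a : Module.Dual ℂ M) (m x : M) :
    twistHom a m (ι ℂ M x) = ⟨ι ℂ M x, algebraMap ℂ _ (a x)⟩ :=
  lift_ι_apply _ _

lemma re_twistHom (a : Module.Dual ℂ M) (m : M) (f : SymmetricAlgebra ℂ M) :
    (twistHom a m f).re = f := by
  induction f using SymmetricAlgebra.induction with
  | algebraMap r => rw [AlgHom.commutes]; rfl
  | ι x => rw [twistHom_ι]
  | mul f g hf hg => rw [map_mul, QuadraticAlgebra.re_mul, hf, hg]; simp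
  | add f g hf hg => rw [map_add, QuadraticAlgebra.re_add, hf, hg]

/-- The algebra endomorphism of `Sym M` sending `x ∈ M` to `x + a(x) m`. -/
def twistAct (a : Module.Dual ℂ M) (m : M) : SymmetricAlgebra ℂ M →ₐ[ℂ] SymmetricAlgebra ℂ M :=
  lift (ι ℂ M ∘ₗ (LinearMap.id + a.smulRight m))

lemma twistAct_ι (a : Module.Dual ℂ M) (m x : M) :
    twistAct a m (ι ℂ M x) = ι ℂ M (x + a x • m) := lift_ι_apply _ _

/-- The twisted derivation `q` of `Sym M` with `q(x) = a(x)` for `x ∈ M` and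
`q(fg) = f q(g) + q(f) σ(g)`, where `σ(x) = x + a(x) m`. -/
def twistDer (a : Module.Dual ℂ M) (m : M) : SymmetricAlgebra ℂ M →ₗ[ℂ] SymmetricAlgebra ℂ M where
  toFun f := (twistHom a m f).im
  map_add' f g := by simp
  map_smul' r f := by simp

lemma twistDer_ι (a : Module.Dual ℂ M) (m x : M) :
    twistDer a m (ι ℂ M x) = algebraMap ℂ _ (a x) :=
  congrArg QuadraticAlgebra.im (twistHom_ι a m x)

lemma twistDer_algebraMap (a : Module.Dual ℂ M) (m : M) (r : ℂ) :
    twistDer a m (algebraMap ℂ _ r) = 0 := by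
  change (twistHom a m (algebraMap ℂ _ r)).im = 0
  rw [AlgHom.commutes]
  rfl

lemma twistDer_one (a : Module.Dual ℂ M) (m : M) : twistDer a m 1 = 0 := by
  rw [← map_one (algebraMap ℂ (SymmetricAlgebra ℂ M)), twistDer_algebraMap]

lemma twistAct_eq (a : Module.Dual ℂ M) (m : M) (f : SymmetricAlgebra ℂ M) :
    twistAct a m f = f + ι ℂ M m * twistDer a m f := by
  induction f using SymmetricAlgebra.induction with
  | algebraMap r => rw [AlgHom.commutes, twistDer_algebraMap, mul_zero, add_zero]
  | ι x => rw [twistAct_ι, twistDer_ι, map_add, map_smul, Algebra.smul_def, mul_comm]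
  | mul f g hf hg =>
    have : twistDer a m (f * g) = f * twistDer a m g + twistDer a m f * g
        + ι ℂ M m * (twistDer a m f * twistDer a m g) := by
      change (twistHom a m (f * g)).im = _
      rw [map_mul, QuadraticAlgebra.im_mul, re_twistHom, re_twistHom]
      change f * twistDer a m g + twistDer a m f * g + _ = _
      rw [mul_assoc]
      rfl
    rw [map_mul, hf, hg, this]
    ring
  | add f g hf hg => rw [map_add, map_add, hf, hg]; ring

lemma twistDer_mul (a : Module.Dual ℂ M) (m : M) (f g : SymmetricAlgebra ℂ M) :
    twistDer a m (f * g) = f * twistDer a m g + twistDer a m f * twistAct a m g := by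
  rw [twistAct_eq]
  change (twistHom a m (f * g)).im = _
  rw [map_mul, QuadraticAlgebra.im_mul, re_twistHom, re_twistHom]
  change f * twistDer a m g + twistDer a m f * g + _ = _
  rw [mul_assoc, mul_add, ← add_assoc]
  congr 1
  change ι ℂ M m * (twistDer a m f * twistDer a m g) = _
  ring

lemma twistAct_zero (a : Module.Dual ℂ M) : twistAct a 0 = AlgHom.id ℂ _ := by
  refine SymmetricAlgebra.algHom_ext (LinearMap.ext fun x => ?_)
  change twistAct a 0 (ι ℂ M x) = ι ℂ M x
  rw [twistAct_ι, smul_zero, add_zero]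

/-- The derivation of `Sym M` extending `a : M → ℂ`. -/
def symDer (a : Module.Dual ℂ M) : SymmetricAlgebra ℂ M →ₗ[ℂ] SymmetricAlgebra ℂ M :=
  twistDer a 0

lemma symDer_ι (a : Module.Dual ℂ M) (x : M) : symDer a (ι ℂ M x) = algebraMap ℂ _ (a x) :=
  twistDer_ι a 0 x

lemma symDer_one (a : Module.Dual ℂ M) : symDer a 1 = 0 := twistDer_one a 0

lemma symDer_algebraMap (a : Module.Dual ℂ M) (r : ℂ) : symDer a (algebraMap ℂ _ r) = 0 :=
  twistDer_algebraMap a 0 r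

lemma symDer_mul (a : Module.Dual ℂ M) (f g : SymmetricAlgebra ℂ M) :
    symDer a (f * g) = f * symDer a g + symDer a f * g := by
  have := twistDer_mul a 0 f g
  rwa [twistAct_zero] at this

/-- The functoriality of the symmetric algebra. -/
def symMap (φ : M →ₗ[ℂ] M) : SymmetricAlgebra ℂ M →ₐ[ℂ] SymmetricAlgebra ℂ M :=
  lift (ι ℂ M ∘ₗ φ)

lemma symMap_ι (φ : M →ₗ[ℂ] M) (x : M) : symMap φ (ι ℂ M x) = ι ℂ M (φ x) := lift_ι_apply _ _

/-- The representation of a group on the symmetric algebra of a representation. -/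
def symRep {G : Type*} [Group G] (ρ : Representation ℂ G M) :
    Representation ℂ G (SymmetricAlgebra ℂ M) where
  toFun g := (symMap (ρ g)).toLinearMap
  map_one' := by
    rw [map_one]
    have : symMap (1 : M →ₗ[ℂ] M) = AlgHom.id ℂ _ :=
      SymmetricAlgebra.algHom_ext (LinearMap.ext fun x => symMap_ι _ _)
    rw [this]
    rfl
  map_mul' g g' := by
    have : symMap (ρ (g * g')) = (symMap (ρ g)).comp (symMap (ρ g')) := by
      refine SymmetricAlgebra.algHom_ext (LinearMap.ext fun x => ?_)
      change symMap _ (ι ℂ M x) = symMap _ (symMap _ (ι ℂ M x))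
      rw [symMap_ι, symMap_ι, symMap_ι, map_mul]
      rfl
    rw [this]
    rfl

lemma symRep_ι {G : Type*} [Group G] (ρ : Representation ℂ G M) (g : G) (x : M) :
    symRep ρ g (ι ℂ M x) = ι ℂ M (ρ g x) := symMap_ι _ _

lemma symRep_mul {G : Type*} [Group G] (ρ : Representation ℂ G M) (g : G)
    (f f' : SymmetricAlgebra ℂ M) : symRep ρ g (f * f') = symRep ρ g f * symRep ρ g f' :=
  map_mul (symMap (ρ g)) f f'

lemma symRep_one {G : Type*} [Group G] (ρ : Representation ℂ G M) (g : G) :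
    symRep ρ g 1 = 1 := map_one (symMap (ρ g))

lemma symRep_algebraMap {G : Type*} [Group G] (ρ : Representation ℂ G M) (g : G) (r : ℂ) :
    symRep ρ g (algebraMap ℂ _ r) = algebraMap ℂ _ r := (symMap (ρ g)).commutes r

/-- Naturality of twisted derivations. -/
lemma symRep_twistDer {G : Type*} [Group G] (ρ : Representation ℂ G M) (g : G)
    (a a' : Module.Dual ℂ M) (m m' : M) (r : ℂ)
    (ha : ∀ x, a' (ρ g x) = r * a x) (hm : ρ g m = r • m') (f : SymmetricAlgebra ℂ M) :
    twistDer a' m' (symRep ρ g f) = r • symRep ρ g (twistDer a m f) := by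
  have hσ : ∀ f, twistAct a' m' (symRep ρ g f) = symRep ρ g (twistAct a m f) := by
    intro f
    have : (twistAct a' m').comp (symMap (ρ g)) = (symMap (ρ g)).comp (twistAct a m) := by
      refine SymmetricAlgebra.algHom_ext (LinearMap.ext fun x => ?_)
      change twistAct a' m' (symMap (ρ g) (ι ℂ M x)) = symMap (ρ g) (twistAct a m (ι ℂ M x))
      rw [symMap_ι, twistAct_ι, twistAct_ι, symMap_ι, map_add (ρ g), map_smul (ρ g), hm, ha,
        smul_smul, mul_comm]
    exact DFunLike.congr_fun this f
  induction f using SymmetricAlgebra.induction with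
  | algebraMap c => simp [symRep_algebraMap, twistDer_algebraMap]
  | ι x =>
    rw [symRep_ι, twistDer_ι, twistDer_ι, symRep_algebraMap, ha, map_mul, Algebra.smul_def]
  | mul f f' hf hf' =>
    rw [symRep_mul, twistDer_mul, twistDer_mul, hf, hf', hσ, map_add, symRep_mul, symRep_mul,
      smul_add, mul_smul_comm, smul_mul_assoc]
  | add f f' hf hf' => simp only [map_add, hf, hf', smul_add]

end TwistedDerivation

end Cherednik

namespace Cherednik
variable {h : Type u} [AddCommGroup h] [Module ℂ h]

/-! ## The polynomial representation -/

section PBWModel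

variable (D : Datum h) (t : ℂ)

/-- The vector space `ℂ[G] ⊗ Sym h ⊗ Sym h*`. -/
abbrev PBW : Type u :=
  MonoidAlgebra ℂ D.G ⊗[ℂ] (SymmetricAlgebra ℂ h ⊗[ℂ] SymmetricAlgebra ℂ (Module.Dual ℂ h))

variable {D} in
lemma PBW.ext_iff' {W : Type*} [AddCommGroup W] [Module ℂ W] {φ ψ : PBW D →ₗ[ℂ] W}
    (H : ∀ k p f, φ (k ⊗ₜ (p ⊗ₜ f)) = ψ (k ⊗ₜ (p ⊗ₜ f))) : φ = ψ := by
  refine TensorProduct.ext' fun k z => ?_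
  induction z using TensorProduct.induction_on with
  | zero => simp
  | tmul p f => exact H k p f
  | add a b ha hb => rw [TensorProduct.tmul_add, map_add, map_add, ha, hb]

/-- Right multiplication by `g` on `ℂ[G]`. -/
def rightG (g : D.G) : Module.End ℂ (MonoidAlgebra ℂ D.G) :=
  LinearMap.mulRight ℂ (MonoidAlgebra.of ℂ D.G g)

lemma rightG_one (k : MonoidAlgebra ℂ D.G) : rightG D 1 k = k := by
  change k * MonoidAlgebra.of ℂ D.G 1 = k
  rw [map_one, mul_one]

lemma rightG_mul (a b : D.G) (k : MonoidAlgebra ℂ D.G) :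
    rightG D (a * b) k = rightG D b (rightG D a k) := by
  change k * MonoidAlgebra.of ℂ D.G (a * b) = k * MonoidAlgebra.of ℂ D.G a * _
  rw [map_mul, mul_assoc]

/-- The twisted derivation of `Sym h*` attached to a reflection. -/
def reflDer (s : reflections D.G) : Module.End ℂ (SymmetricAlgebra ℂ (Module.Dual ℂ h)) :=
  twistDer (Module.Dual.eval ℂ h (D.coroot s)) (-(dCoef D s • D.root s))

lemma twistAct_refl (s : reflections D.G) (f : SymmetricAlgebra ℂ (Module.Dual ℂ h)) :
    twistAct (Module.Dual.eval ℂ h (D.coroot s)) (-(dCoef D s • D.root s)) f =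
      symRep D.dualRep (D.refl s) f := by
  change _ = symMap (D.dualRep (D.refl s)) f
  congr 1
  refine SymmetricAlgebra.algHom_ext (LinearMap.ext fun x => ?_)
  change twistAct _ _ (SymmetricAlgebra.ι ℂ _ x) = symMap _ (SymmetricAlgebra.ι ℂ _ x)
  rw [twistAct_ι, symMap_ι, Datum.refl_dual_apply]
  congr 1
  rw [smul_neg, smul_smul, ← sub_eq_add_neg, Module.Dual.eval_apply, mul_comm]

lemma reflDer_mul (s : reflections D.G) (f f' : SymmetricAlgebra ℂ (Module.Dual ℂ h)) :
    reflDer D s (f * f') =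
      f * reflDer D s f' + reflDer D s f * symRep D.dualRep (D.refl s) f' := by
  rw [← twistAct_refl]
  exact twistDer_mul _ _ f f'

lemma reflDer_ι (s : reflections D.G) (x : Module.Dual ℂ h) :
    reflDer D s (SymmetricAlgebra.ι ℂ _ x) = algebraMap ℂ _ (x (D.coroot s)) :=
  twistDer_ι _ _ x

lemma reflDer_one (s : reflections D.G) : reflDer D s 1 = 0 := twistDer_one _ _

lemma reflDer_algebraMap (s : reflections D.G) (r : ℂ) :
    reflDer D s (algebraMap ℂ _ r) = 0 := twistDer_algebraMap _ _ r

/-- Right multiplication by `x ∈ h*`. -/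
def opX (x : Module.Dual ℂ h) : Module.End ℂ (PBW D) :=
  TensorProduct.map LinearMap.id
    (TensorProduct.map LinearMap.id (LinearMap.mulLeft ℂ (SymmetricAlgebra.ι ℂ _ x)))

/-- Right multiplication by `g ∈ G`. -/
def opG (g : D.G) : Module.End ℂ (PBW D) :=
  TensorProduct.map (rightG D g)
    (TensorProduct.map (symRep D.rep g⁻¹) (symRep D.dualRep g⁻¹))

/-- The contribution of a reflection to right multiplication by `y ∈ h`. -/
def opS (s : reflections D.G) : Module.End ℂ (PBW D) :=
  TensorProduct.map (rightG D (D.refl s))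
    (TensorProduct.map (symRep D.rep (D.refl s)⁻¹)
      (symRep D.dualRep (D.refl s)⁻¹ ∘ₗ reflDer D s))

/-- Right multiplication by `y ∈ h`. -/
def opY (y : h) : Module.End ℂ (PBW D) :=
  TensorProduct.map LinearMap.id
      (TensorProduct.map (LinearMap.mulLeft ℂ (SymmetricAlgebra.ι ℂ _ y)) LinearMap.id)
    - t • TensorProduct.map LinearMap.id
      (TensorProduct.map LinearMap.id (symDer (Module.Dual.eval ℂ h y)))
    + ∑ s, (D.c s * D.root s y) • opS D s

variable (k : MonoidAlgebra ℂ D.G) (p : SymmetricAlgebra ℂ h)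
  (f : SymmetricAlgebra ℂ (Module.Dual ℂ h))

lemma opX_apply (x : Module.Dual ℂ h) :
    opX D x (k ⊗ₜ (p ⊗ₜ f)) = k ⊗ₜ (p ⊗ₜ (SymmetricAlgebra.ι ℂ _ x * f)) := rfl

lemma opG_apply (g : D.G) : opG D g (k ⊗ₜ (p ⊗ₜ f)) =
    rightG D g k ⊗ₜ (symRep D.rep g⁻¹ p ⊗ₜ symRep D.dualRep g⁻¹ f) := rfl

lemma opS_apply (s : reflections D.G) : opS D s (k ⊗ₜ (p ⊗ₜ f)) =
    rightG D (D.refl s) k ⊗ₜ (symRep D.rep (D.refl s)⁻¹ p ⊗ₜ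
      symRep D.dualRep (D.refl s)⁻¹ (reflDer D s f)) := rfl

lemma opY_apply (y : h) : opY D t y (k ⊗ₜ (p ⊗ₜ f)) =
    k ⊗ₜ ((SymmetricAlgebra.ι ℂ _ y * p) ⊗ₜ f)
      - t • (k ⊗ₜ (p ⊗ₜ symDer (Module.Dual.eval ℂ h y) f))
      + ∑ s, (D.c s * D.root s y) • opS D s (k ⊗ₜ (p ⊗ₜ f)) := by
  rw [opY, LinearMap.add_apply, LinearMap.sum_apply]
  rfl

lemma opX_add (x x' : Module.Dual ℂ h) : opX D (x + x') = opX D x + opX D x' :=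
  PBW.ext_iff' fun k p f => by
    rw [LinearMap.add_apply, opX_apply, opX_apply, opX_apply, map_add, add_mul,
      TensorProduct.tmul_add, TensorProduct.tmul_add]

lemma opX_smul (r : ℂ) (x : Module.Dual ℂ h) : opX D (r • x) = r • opX D x :=
  PBW.ext_iff' fun k p f => by
    rw [LinearMap.smul_apply, opX_apply, opX_apply, map_smul, smul_mul_assoc,
      TensorProduct.tmul_smul, TensorProduct.tmul_smul]

lemma opX_comm (x x' : Module.Dual ℂ h) : opX D x * opX D x' = opX D x' * opX D x :=
  PBW.ext_iff' fun k p f => by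
    rw [Module.End.mul_apply, Module.End.mul_apply, opX_apply, opX_apply, opX_apply, opX_apply,
      mul_left_comm]

lemma opG_one : opG D 1 = 1 :=
  PBW.ext_iff' fun k p f => by
    rw [opG_apply, rightG_one, inv_one, map_one, map_one]
    rfl

lemma opG_mul (a b : D.G) : opG D (a * b) = opG D b * opG D a :=
  PBW.ext_iff' fun k p f => by
    rw [Module.End.mul_apply, opG_apply, opG_apply, opG_apply, rightG_mul, mul_inv_rev, map_mul,
      map_mul]
    rfl

lemma opX_opG (g : D.G) (x : Module.Dual ℂ h) :
    opX D x * opG D g = opG D g * opX D (D.dualRep g x) :=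
  PBW.ext_iff' fun k p f => by
    rw [Module.End.mul_apply, Module.End.mul_apply, opX_apply, opG_apply, opG_apply, opX_apply,
      symRep_mul, symRep_ι, Representation.inv_self_apply]

lemma symDer_eval_symRep (g : D.G) (y : h) :
    symDer (Module.Dual.eval ℂ h y) (symRep D.dualRep g⁻¹ f) =
      symRep D.dualRep g⁻¹ (symDer (Module.Dual.eval ℂ h (D.rep g y)) f) := by
  have := symRep_twistDer D.dualRep g⁻¹ (Module.Dual.eval ℂ h (D.rep g y))
    (Module.Dual.eval ℂ h y) 0 0 1 (fun x => ?_) (by simp) f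
  · rw [one_smul] at this
    exact this
  · rw [Module.Dual.eval_apply, Module.Dual.eval_apply, Datum.dualRep_apply, inv_inv, one_mul]

lemma opS_opG (g : D.G) (s : reflections D.G) (y : h) :
    D.root s y • (opS D s * opG D g) =
      D.root (D.conj g s) (D.rep g y) • (opG D g * opS D (D.conj g s)) := by
  obtain ⟨r, hr0, hr1, hr2⟩ := D.exists_conj_scalar g s
  refine PBW.ext_iff' fun k p f => ?_
  rw [hr2, LinearMap.smul_apply, LinearMap.smul_apply, Module.End.mul_apply, Module.End.mul_apply,
    opG_apply, opS_apply, opS_apply, opG_apply, ← rightG_mul, ← rightG_mul, D.refl_conj]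
  have e1 : g * D.refl s * g⁻¹ * g = g * D.refl s := by group
  have e2 : ∀ {W : Type u} [AddCommGroup W] [Module ℂ W] (ρ : Representation ℂ D.G W) (w : W),
      ρ g⁻¹ (ρ (g * D.refl s * g⁻¹)⁻¹ w) = ρ (D.refl s)⁻¹ (ρ g⁻¹ w) := by
    intro W _ _ ρ w
    rw [← Module.End.mul_apply, ← map_mul, ← Module.End.mul_apply, ← map_mul]
    congr 2
    group
  have e3 : reflDer D s (symRep D.dualRep g⁻¹ f) =
      r • symRep D.dualRep g⁻¹ (reflDer D (D.conj g s) f) := by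
    refine symRep_twistDer D.dualRep g⁻¹ _ _ _ _ r (fun x => ?_) ?_ f
    · rw [Module.Dual.eval_apply, Module.Dual.eval_apply, Datum.dualRep_apply, inv_inv, hr1,
        map_smul, smul_eq_mul]
    · refine LinearMap.ext fun z => ?_
      rw [Datum.dualRep_apply, inv_inv, dCoef_conj]
      simp only [LinearMap.neg_apply, LinearMap.smul_apply, smul_eq_mul, hr2]
      ring
  rw [e1, e2, e2, e3]
  simp only [map_smul, TensorProduct.tmul_smul, smul_smul]
  rw [mul_comm]

lemma opY_opG (g : D.G) (y : h) : opY D t y * opG D g = opG D g * opY D t (D.rep g y) := by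
  have hS : ∑ s, (D.c s * D.root s y) • (opS D s * opG D g) =
      ∑ s, (D.c s * D.root s (D.rep g y)) • (opG D g * opS D s) := by
    rw [← (D.conjEquiv g).sum_comp (fun s => (D.c s * D.root s (D.rep g y)) • (opG D g * opS D s))]
    refine Finset.sum_congr rfl fun s _ => ?_
    change _ = (D.c (D.conj g s) * D.root (D.conj g s) (D.rep g y)) •
      (opG D g * opS D (D.conj g s))
    rw [mul_smul, opS_opG, D.c_conj', mul_smul]
  refine PBW.ext_iff' fun k p f => ?_
  have hS' := LinearMap.congr_fun hS (k ⊗ₜ (p ⊗ₜ f))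
  simp only [LinearMap.sum_apply, LinearMap.smul_apply, Module.End.mul_apply] at hS'
  rw [Module.End.mul_apply, Module.End.mul_apply, opY_apply, map_add, map_sub, map_smul, map_sum]
  simp only [map_smul]
  rw [← hS', opG_apply, opY_apply, opG_apply, opG_apply, symDer_eval_symRep, symRep_mul, symRep_ι,
    D.rep_inv_rep]

lemma opY_add (y y' : h) : opY D t (y + y') = opY D t y + opY D t y' := by
  refine PBW.ext_iff' fun k p f => ?_
  rw [LinearMap.add_apply, opY_apply, opY_apply, opY_apply]
  have : symDer (Module.Dual.eval ℂ h (y + y')) f =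
      symDer (Module.Dual.eval ℂ h y) f + symDer (Module.Dual.eval ℂ h y') f := by
    induction f using SymmetricAlgebra.induction with
    | algebraMap r => simp [symDer_algebraMap]
    | ι x => simp [symDer_ι]
    | mul f f' hf hf' => rw [symDer_mul, symDer_mul, symDer_mul, hf, hf']; ring
    | add f f' hf hf' =>
      rw [(symDer _).map_add, (symDer _).map_add, (symDer _).map_add, hf, hf']
      abel
  rw [this]
  simp only [map_add, mul_add, add_smul, Finset.sum_add_distrib, add_mul, TensorProduct.tmul_add,
    TensorProduct.add_tmul, smul_add]
  abel

lemma opY_smul (r : ℂ) (y : h) : opY D t (r • y) = r • opY D t y := by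
  refine PBW.ext_iff' fun k p f => ?_
  rw [LinearMap.smul_apply, opY_apply, opY_apply]
  have : symDer (Module.Dual.eval ℂ h (r • y)) f = r • symDer (Module.Dual.eval ℂ h y) f := by
    induction f using SymmetricAlgebra.induction with
    | algebraMap r => simp [symDer_algebraMap]
    | ι x => simp [symDer_ι, Algebra.smul_def]
    | mul f f' hf hf' =>
      rw [symDer_mul, symDer_mul, hf, hf', smul_add, mul_smul_comm, smul_mul_assoc]
    | add f f' hf hf' => rw [map_add, map_add, hf, hf', smul_add]
  rw [this]
  simp only [map_smul, smul_mul_assoc, TensorProduct.tmul_smul, ← TensorProduct.smul_tmul',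
    smul_add, smul_sub, Finset.smul_sum, smul_smul, smul_eq_mul]
  rw [mul_comm t r]
  congr 1
  refine Finset.sum_congr rfl fun s _ => ?_
  rw [mul_left_comm]

lemma opX_opY (x : Module.Dual ℂ h) (y : h) :
    opX D x * opY D t y - opY D t y * opX D x =
      (t * x y) • 1 - ∑ s, (D.c s * D.root s y * x (D.coroot s)) • opG D (D.refl s) := by
  refine PBW.ext_iff' fun k p f => ?_
  have hS : ∀ s, opX D x (opS D s (k ⊗ₜ (p ⊗ₜ f))) - opS D s (opX D x (k ⊗ₜ (p ⊗ₜ f))) =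
      -(x (D.coroot s) • opG D (D.refl s) (k ⊗ₜ (p ⊗ₜ f))) := by
    intro s
    rw [opX_apply, opS_apply, opS_apply, opX_apply, opG_apply, mul_comm (SymmetricAlgebra.ι ℂ _ x),
      mul_comm (SymmetricAlgebra.ι ℂ _ x), reflDer_mul, reflDer_ι, map_add, symRep_mul, symRep_mul,
      symRep_ι, symRep_algebraMap, symRep_ι, Representation.inv_self_apply, mul_comm _
      (algebraMap ℂ _ _), ← Algebra.smul_def]
    simp only [TensorProduct.tmul_add, TensorProduct.tmul_smul]
    abel
  rw [LinearMap.sub_apply, LinearMap.sub_apply, LinearMap.smul_apply, LinearMap.sum_apply,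
    Module.End.one_apply, Module.End.mul_apply, Module.End.mul_apply]
  conv_lhs => rw [opY_apply, opX_apply, opY_apply, map_add, map_sub, map_smul, map_sum]
  rw [opX_apply, opX_apply]
  have e1 : symDer (Module.Dual.eval ℂ h y) (SymmetricAlgebra.ι ℂ _ x * f) =
      SymmetricAlgebra.ι ℂ _ x * symDer (Module.Dual.eval ℂ h y) f + x y • f := by
    rw [symDer_mul, symDer_ι, Module.Dual.eval_apply, Algebra.smul_def]
  have e2 : ∀ s, (D.c s * D.root s y * x (D.coroot s)) •
        opG D (D.refl s) (k ⊗ₜ (p ⊗ₜ f)) = (D.c s * D.root s y) •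
        (opS D s (k ⊗ₜ (p ⊗ₜ (SymmetricAlgebra.ι ℂ _ x * f))) -
          opX D x (opS D s (k ⊗ₜ (p ⊗ₜ f)))) := by
    intro s
    have := hS s
    rw [opX_apply] at this
    rw [← neg_sub, this, neg_neg, smul_smul]
  rw [e1]
  simp only [LinearMap.smul_apply, e2, smul_sub, Finset.sum_sub_distrib, map_smul,
    TensorProduct.tmul_add, TensorProduct.tmul_smul, smul_add, smul_smul]
  abel

lemma Datum.refl_apply (s : reflections D.G) (y : h) :
    D.rep (D.refl s) y = y + (dCoef D s * (D.lam s)⁻¹ * D.root s y) • D.coroot s := by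
  have h1 := D.refl_inv_apply s (D.rep (D.refl s) y)
  have h2 := D.root_eigen s (D.rep (D.refl s) y)
  rw [D.rep_inv_rep] at h1
  have h3 : (s : h ≃ₗ[ℂ] h)⁻¹ (D.rep (D.refl s) y) = y := D.rep_inv_rep (D.refl s) y
  rw [h3] at h2
  have h4 : D.root s (D.rep (D.refl s) y) = (D.lam s)⁻¹ * D.root s y := by
    rw [h2, inv_mul_cancel_left₀ (D.lam_ne_zero s)]
  rw [h4, ← mul_assoc] at h1
  exact (sub_eq_iff_eq_add.1 h1.symm)

lemma commutator_mul_of_jacobi {R : Type*} [Ring R] {X Y Y' K K' : R} (h1 : Y * X = X * Y - K)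
    (h1' : Y' * X = X * Y' - K') (h3 : Y' * K - K * Y' = Y * K' - K' * Y) :
    (Y * Y' - Y' * Y) * X = X * (Y * Y' - Y' * Y) := by
  have e1 : Y * Y' * X = X * (Y * Y') - K * Y' - Y * K' := by
    rw [mul_assoc, h1', mul_sub, ← mul_assoc, h1, sub_mul, mul_assoc]
  have e2 : Y' * Y * X = X * (Y' * Y) - K' * Y - Y' * K := by
    rw [mul_assoc, h1, mul_sub, ← mul_assoc, h1', sub_mul, mul_assoc]
  rw [sub_mul, mul_sub, e1, e2]
  have h4 : Y' * K = K * Y' + (Y * K' - K' * Y) := by rw [← h3]; abel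
  rw [h4]
  abel

lemma commutator_sub_sum {R ι : Type*} [Ring R] [Algebra ℂ R] [Fintype ι] {Y : R} {a : ℂ}
    {b r : ι → ℂ} {g z : ι → R} (e : ∀ s, Y * g s = g s * Y + r s • z s) :
    Y * (a • 1 - ∑ s, b s • g s) - (a • 1 - ∑ s, b s • g s) * Y = -∑ s, (b s * r s) • z s := by
  simp only [mul_sub, sub_mul, Finset.mul_sum, Finset.sum_mul, mul_smul_comm, smul_mul_assoc,
    e, mul_one, one_mul, smul_add, Finset.sum_add_distrib, smul_smul]
  abel

lemma opY_comm_opX (x : Module.Dual ℂ h) (y y' : h) :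
    (opY D t y * opY D t y' - opY D t y' * opY D t y) * opX D x =
      opX D x * (opY D t y * opY D t y' - opY D t y' * opY D t y) := by
  have h1 : ∀ y, opY D t y * opX D x = opX D x * opY D t y -
      ((t * x y) • 1 - ∑ s, (D.c s * D.root s y * x (D.coroot s)) • opG D (D.refl s)) :=
    fun y => by
      rw [← opX_opY]
      exact (sub_sub_cancel (G := Module.End ℂ (PBW D)) _ _).symm
  refine commutator_mul_of_jacobi (R := Module.End ℂ (PBW D)) (h1 y) (h1 y') ?_
  have e : ∀ y' s, opY D t y' * opG D (D.refl s) = opG D (D.refl s) * opY D t y' +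
      (dCoef D s * (D.lam s)⁻¹ * D.root s y') • (opG D (D.refl s) * opY D t (D.coroot s)) := by
    intro y' s
    rw [opY_opG, D.refl_apply, opY_add, opY_smul]
    exact (mul_add _ _ _).trans (congrArg _ (mul_smul_comm _ _ _))
  refine (commutator_sub_sum (R := Module.End ℂ (PBW D)) (e y')).trans
    (Eq.trans ?_ (commutator_sub_sum (R := Module.End ℂ (PBW D)) (e y)).symm)
  congr 1
  refine Finset.sum_congr rfl fun s _ => ?_
  congr 1
  ring

lemma opY_one (y : h) : opY D t y (k ⊗ₜ (p ⊗ₜ 1)) =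
    k ⊗ₜ ((SymmetricAlgebra.ι ℂ _ y * p) ⊗ₜ 1) := by
  rw [opY_apply, symDer_one]
  simp only [opS_apply, reflDer_one, map_zero, TensorProduct.tmul_zero, smul_zero, sub_zero,
    Finset.sum_const_zero, add_zero]

lemma opY_comm (y y' : h) : opY D t y * opY D t y' = opY D t y' * opY D t y := by
  rw [← sub_eq_zero]
  refine PBW.ext_iff' fun k p f => ?_
  rw [LinearMap.zero_apply]
  have key : ∀ (f g : SymmetricAlgebra ℂ (Module.Dual ℂ h)),
      (∀ p, (opY D t y * opY D t y' - opY D t y' * opY D t y) (k ⊗ₜ (p ⊗ₜ g)) = 0) →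
      ∀ p, (opY D t y * opY D t y' - opY D t y' * opY D t y) (k ⊗ₜ (p ⊗ₜ (f * g))) = 0 := by
    intro f
    induction f using SymmetricAlgebra.induction with
    | algebraMap r =>
      intro g hg p
      rw [← Algebra.smul_def, TensorProduct.tmul_smul, TensorProduct.tmul_smul, map_smul, hg,
        smul_zero]
    | ι x =>
      intro g hg p
      have := LinearMap.congr_fun (opY_comm_opX D t x y y') (k ⊗ₜ (p ⊗ₜ g))
      rw [Module.End.mul_apply, Module.End.mul_apply, opX_apply, hg, map_zero] at this
      exact this
    | mul f f' hf hf' =>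
      intro g hg p
      rw [mul_assoc]
      exact hf _ (hf' g hg) p
    | add f f' hf hf' =>
      intro g hg p
      rw [add_mul, TensorProduct.tmul_add, TensorProduct.tmul_add, map_add, hf g hg, hf' g hg,
        add_zero]
  have := key f 1 (fun p => ?_) p
  · rwa [mul_one] at this
  · rw [LinearMap.sub_apply, Module.End.mul_apply, Module.End.mul_apply, opY_one, opY_one, opY_one,
      opY_one, mul_left_comm, sub_self]

/-- The operator attached to a generator. -/
def opGen : Gen D → (Module.End ℂ (PBW D))ᵐᵒᵖ
  | .g a => .op (opG D a)
  | .y a => .op (opY D t a)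
  | .x a => .op (opX D a)

/-- The right action of `H_{t,c}` on `ℂ[G] ⊗ Sym h ⊗ Sym h*`. -/
def pbwAct : H D t →ₐ[ℂ] (Module.End ℂ (PBW D))ᵐᵒᵖ :=
  RingQuot.liftAlgHom ℂ ⟨FreeAlgebra.lift ℂ (opGen D t), by
    intro a b hab
    induction hab with
    | y_add a b =>
      simp only [map_add, FreeAlgebra.lift_ι_apply, opGen, opY_add, MulOpposite.op_add]
    | y_smul r a =>
      simp only [map_smul, FreeAlgebra.lift_ι_apply, opGen, opY_smul, MulOpposite.op_smul]
    | x_add a b =>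
      simp only [map_add, FreeAlgebra.lift_ι_apply, opGen, opX_add, MulOpposite.op_add]
    | x_smul r a =>
      simp only [map_smul, FreeAlgebra.lift_ι_apply, opGen, opX_smul, MulOpposite.op_smul]
    | g_one =>
      simp only [map_one, FreeAlgebra.lift_ι_apply, opGen, opG_one, MulOpposite.op_one]
    | g_mul a b =>
      simp only [map_mul, FreeAlgebra.lift_ι_apply, opGen, opG_mul, MulOpposite.op_mul]
    | g_y a b =>
      simp only [map_mul, FreeAlgebra.lift_ι_apply, opGen, ← MulOpposite.op_mul, opY_opG]
    | g_x a b =>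
      simp only [map_mul, FreeAlgebra.lift_ι_apply, opGen, ← MulOpposite.op_mul, opX_opG]
    | y_comm a b =>
      simp only [map_mul, FreeAlgebra.lift_ι_apply, opGen, ← MulOpposite.op_mul]
      rw [opY_comm]
    | x_comm a b =>
      simp only [map_mul, FreeAlgebra.lift_ι_apply, opGen, ← MulOpposite.op_mul]
      rw [opX_comm]
    | y_x a b =>
      rw [map_sub, map_sub, map_mul, map_mul, map_sum, AlgHom.commutes]
      simp only [map_smul, FreeAlgebra.lift_ι_apply, opGen, ← MulOpposite.op_mul,
        ← MulOpposite.op_sub, opX_opY, Algebra.algebraMap_eq_smul_one, ← MulOpposite.op_smul]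
      rw [MulOpposite.op_sub]
      congr 1
      exact map_sum MulOpposite.opAddEquiv _ _⟩

lemma pbwAct_gen (a : Gen D) : pbwAct D t (gen D t a) = opGen D t a := by
  change RingQuot.liftAlgHom ℂ _ (RingQuot.mkAlgHom ℂ (Rel D t) (FreeAlgebra.ι ℂ a)) = _
  rw [RingQuot.liftAlgHom_mkAlgHom_apply, FreeAlgebra.lift_ι_apply]

end PBWModel

end Cherednik

namespace Cherednik
variable {h : Type u} [AddCommGroup h] [Module ℂ h]

/-! ## The Poincaré–Birkhoff–Witt theorem -/

section NoncommutativeLift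

variable {M B : Type*} [AddCommGroup M] [Module ℂ M] [Ring B] [Algebra ℂ B]

/-- The extension to `Sym M` of a linear map with commuting values. -/
def symLift (φ : M →ₗ[ℂ] B) (hφ : ∀ a b, φ a * φ b = φ b * φ a) : SymmetricAlgebra ℂ M →ₐ[ℂ] B :=
  letI := Algebra.adjoinCommRingOfComm ℂ (s := Set.range φ)
    (by rintro _ ⟨a, rfl⟩ _ ⟨b, rfl⟩; exact hφ a b)
  (Algebra.adjoin ℂ (Set.range φ)).val.comp (SymmetricAlgebra.lift
    (A := Algebra.adjoin ℂ (Set.range φ))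
    (φ.codRestrict (Subalgebra.toSubmodule (Algebra.adjoin ℂ (Set.range φ)))
      fun a => Algebra.subset_adjoin ⟨a, rfl⟩))

lemma symLift_ι (φ : M →ₗ[ℂ] B) (hφ : ∀ a b, φ a * φ b = φ b * φ a) (a : M) :
    symLift φ hφ (SymmetricAlgebra.ι ℂ M a) = φ a := by
  letI := Algebra.adjoinCommRingOfComm ℂ (s := Set.range φ)
    (by rintro _ ⟨a, rfl⟩ _ ⟨b, rfl⟩; exact hφ a b)
  exact congrArg (Algebra.adjoin ℂ (Set.range φ)).val (SymmetricAlgebra.lift_ι_apply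
    (A := Algebra.adjoin ℂ (Set.range φ)) _ a)

end NoncommutativeLift

section PBWTheorem

variable (D : Datum h) (t : ℂ)

lemma gen_y_comm (a b : h) :
    gen D t (.y a) * gen D t (.y b) = gen D t (.y b) * gen D t (.y a) := by
  have := RingQuot.mkAlgHom_rel ℂ (Rel.y_comm (D := D) (t := t) a b)
  rw [map_mul, map_mul] at this
  exact this

lemma gen_x_comm (a b : Module.Dual ℂ h) :
    gen D t (.x a) * gen D t (.x b) = gen D t (.x b) * gen D t (.x a) := by
  have := RingQuot.mkAlgHom_rel ℂ (Rel.x_comm (D := D) (t := t) a b)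
  rw [map_mul, map_mul] at this
  exact this

lemma gen_y_x (a : h) (b : Module.Dual ℂ h) :
    gen D t (.y a) * gen D t (.x b) - gen D t (.x b) * gen D t (.y a) =
      algebraMap ℂ _ (t * b a) -
        ∑ s, (D.c s * D.root s a * b (D.coroot s)) • gen D t (.g (D.refl s)) := by
  have := RingQuot.mkAlgHom_rel ℂ (Rel.y_x (D := D) (t := t) a b)
  rw [map_sub, map_sub, map_mul, map_mul, map_sum, AlgHom.commutes] at this
  simp only [map_smul] at this
  exact this

variable {D t} in
/-- Induction on the elements of `H_{t,c}`. -/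
lemma H.induction {P : H D t → Prop} (hs : ∀ r : ℂ, P (algebraMap ℂ _ r))
    (hg : ∀ a, P (gen D t a)) (hm : ∀ a b, P a → P b → P (a * b))
    (ha : ∀ a b, P a → P b → P (a + b)) (a : H D t) : P a := by
  obtain ⟨a, rfl⟩ := RingQuot.mkAlgHom_surjective ℂ (Rel D t) a
  induction a using FreeAlgebra.induction with
  | grade0 r => rw [AlgHom.commutes]; exact hs r
  | grade1 x => exact hg x
  | mul a b h1 h2 => rw [map_mul]; exact hm _ _ h1 h2
  | add a b h1 h2 => rw [map_add]; exact ha _ _ h1 h2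

/-- The homomorphism `Sym h → H_{t,c}`. -/
def symY : SymmetricAlgebra ℂ h →ₐ[ℂ] H D t := symLift (yMap D t) (gen_y_comm D t)

/-- The homomorphism `Sym h* → H_{t,c}`. -/
def symX : SymmetricAlgebra ℂ (Module.Dual ℂ h) →ₐ[ℂ] H D t := symLift (xMap D t) (gen_x_comm D t)

/-- The homomorphism `ℂ[G] → H_{t,c}`. -/
def groupAlg : MonoidAlgebra ℂ D.G →ₐ[ℂ] H D t := MonoidAlgebra.lift ℂ (H D t) D.G (gMap D t)

lemma symY_ι (y : h) : symY D t (SymmetricAlgebra.ι ℂ _ y) = gen D t (.y y) := symLift_ι _ _ y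

lemma symX_ι (x : Module.Dual ℂ h) : symX D t (SymmetricAlgebra.ι ℂ _ x) = gen D t (.x x) :=
  symLift_ι _ _ x

lemma groupAlg_of (g : D.G) : groupAlg D t (MonoidAlgebra.of ℂ D.G g) = gen D t (.g g) :=
  MonoidAlgebra.lift_of _ _

/-- The normal ordering map `ℂ[G] ⊗ Sym h ⊗ Sym h* → H_{t,c}`. -/
def normalOrder : PBW D →ₗ[ℂ] H D t :=
  LinearMap.mul' ℂ (H D t) ∘ₗ TensorProduct.map (groupAlg D t).toLinearMap
    (LinearMap.mul' ℂ (H D t) ∘ₗ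
      TensorProduct.map (symY D t).toLinearMap (symX D t).toLinearMap)

variable (k : MonoidAlgebra ℂ D.G) (p : SymmetricAlgebra ℂ h)
  (f : SymmetricAlgebra ℂ (Module.Dual ℂ h))

lemma normalOrder_tmul : normalOrder D t (k ⊗ₜ (p ⊗ₜ f)) =
    groupAlg D t k * (symY D t p * symX D t f) := rfl

lemma gen_g_symY (g : D.G) : gen D t (.g g) * symY D t p =
    symY D t (symRep D.rep g p) * gen D t (.g g) := by
  induction p using SymmetricAlgebra.induction with
  | algebraMap r =>
    rw [symRep_algebraMap, AlgHom.commutes, Algebra.commutes]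
  | ι x => rw [symRep_ι, symY_ι, symY_ι, gen_g_y]
  | mul a b ha hb =>
    rw [symRep_mul, map_mul, map_mul, ← mul_assoc, ha, mul_assoc, hb, mul_assoc]
  | add a b ha hb => rw [map_add, map_add, map_add, mul_add, add_mul, ha, hb]

lemma gen_g_symX (g : D.G) : gen D t (.g g) * symX D t f =
    symX D t (symRep D.dualRep g f) * gen D t (.g g) := by
  induction f using SymmetricAlgebra.induction with
  | algebraMap r =>
    rw [symRep_algebraMap, AlgHom.commutes, Algebra.commutes]
  | ι x => rw [symRep_ι, symX_ι, symX_ι, gen_g_x]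
  | mul a b ha hb =>
    rw [symRep_mul, map_mul, map_mul, ← mul_assoc, ha, mul_assoc, hb, mul_assoc]
  | add a b ha hb => rw [map_add, map_add, map_add, mul_add, add_mul, ha, hb]

lemma symX_gen_y (y : h) : symX D t f * gen D t (.y y) =
    gen D t (.y y) * symX D t f - t • symX D t (symDer (Module.Dual.eval ℂ h y) f)
      + ∑ s, (D.c s * D.root s y) •
        (symX D t (reflDer D s f) * gen D t (.g (D.refl s))) := by
  induction f using SymmetricAlgebra.induction with
  | algebraMap r =>
    simp only [AlgHom.commutes, symDer_algebraMap, reflDer_algebraMap, map_zero, zero_mul, smul_zero,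
      Finset.sum_const_zero, sub_zero, add_zero]
    rw [Algebra.commutes]
  | ι x =>
    have := gen_y_x D t y x
    have e : gen D t (.x x) * gen D t (.y y) = gen D t (.y y) * gen D t (.x x) -
      (algebraMap ℂ _ (t * x y) -
        ∑ s, (D.c s * D.root s y * x (D.coroot s)) • gen D t (.g (D.refl s))) := by
      rw [← this]; abel
    simp only [symX_ι, symDer_ι, reflDer_ι, AlgHom.commutes, ← Algebra.smul_def, smul_smul]
    rw [e, map_mul, ← Algebra.smul_def, Module.Dual.eval_apply]
    abel
  | mul a b ha hb =>
    rw [map_mul, mul_assoc, hb, mul_add, mul_sub, ← mul_assoc, ha, symDer_mul, map_add, map_mul,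
      map_mul]
    simp only [reflDer_mul, map_add, map_mul, add_mul, sub_mul, smul_add, Finset.sum_add_distrib,
      Finset.sum_mul, Finset.mul_sum, mul_smul_comm, smul_mul_assoc, mul_assoc, gen_g_symX]
    abel
  | add a b ha hb =>
    simp only [map_add, mul_add, add_mul, ha, hb, smul_add, Finset.sum_add_distrib]
    abel

lemma groupAlg_rightG (g : D.G) :
    groupAlg D t (rightG D g k) = groupAlg D t k * gen D t (.g g) := by
  rw [← groupAlg_of, ← map_mul]
  rfl

lemma normalOrder_opX (x : Module.Dual ℂ h) (z : PBW D) :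
    normalOrder D t (opX D x z) = normalOrder D t z * gen D t (.x x) := by
  have : normalOrder D t ∘ₗ opX D x =
      LinearMap.mulRight ℂ (gen D t (.x x)) ∘ₗ normalOrder D t := by
    refine PBW.ext_iff' fun k p f => ?_
    change normalOrder D t (k ⊗ₜ (p ⊗ₜ (SymmetricAlgebra.ι ℂ _ x * f))) =
      normalOrder D t (k ⊗ₜ (p ⊗ₜ f)) * gen D t (.x x)
    rw [normalOrder_tmul, normalOrder_tmul, mul_comm _ f, map_mul, symX_ι, mul_assoc, mul_assoc]
  exact LinearMap.congr_fun this z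

lemma normalOrder_opG (g : D.G) (z : PBW D) :
    normalOrder D t (opG D g z) = normalOrder D t z * gen D t (.g g) := by
  have : normalOrder D t ∘ₗ opG D g =
      LinearMap.mulRight ℂ (gen D t (.g g)) ∘ₗ normalOrder D t := by
    refine PBW.ext_iff' fun k p f => ?_
    change normalOrder D t (rightG D g k ⊗ₜ (symRep D.rep g⁻¹ p ⊗ₜ symRep D.dualRep g⁻¹ f)) =
      normalOrder D t (k ⊗ₜ (p ⊗ₜ f)) * gen D t (.g g)
    rw [normalOrder_tmul, normalOrder_tmul, groupAlg_rightG, mul_assoc, ← mul_assoc (gen D t (.g g)),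
      gen_g_symY, mul_assoc (symY D t _) (gen D t (.g g)), gen_g_symX,
      Representation.self_inv_apply, Representation.self_inv_apply]
    simp only [mul_assoc]
  exact LinearMap.congr_fun this z

lemma normalOrder_opY (y : h) (z : PBW D) :
    normalOrder D t (opY D t y z) = normalOrder D t z * gen D t (.y y) := by
  have : normalOrder D t ∘ₗ opY D t y =
      LinearMap.mulRight ℂ (gen D t (.y y)) ∘ₗ normalOrder D t := by
    refine PBW.ext_iff' fun k p f => ?_
    rw [LinearMap.comp_apply, LinearMap.comp_apply, opY_apply, map_add, map_sub, map_smul, map_sum]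
    change _ = normalOrder D t (k ⊗ₜ (p ⊗ₜ f)) * gen D t (.y y)
    have hS : ∀ s, normalOrder D t (opS D s (k ⊗ₜ (p ⊗ₜ f))) =
        normalOrder D t (k ⊗ₜ (p ⊗ₜ reflDer D s f)) * gen D t (.g (D.refl s)) := by
      intro s
      rw [← normalOrder_opG]
      rfl
    simp only [map_smul, hS]
    rw [normalOrder_tmul, normalOrder_tmul, normalOrder_tmul, mul_assoc, mul_assoc, symX_gen_y,
      mul_add, mul_sub, mul_add, mul_sub, ← mul_assoc (symY D t p) (gen D t (.y y)),
      mul_comm (SymmetricAlgebra.ι ℂ _ y), map_mul, symY_ι]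
    simp only [Finset.mul_sum, mul_smul_comm, mul_assoc, normalOrder_tmul]
  exact LinearMap.congr_fun this z

lemma normalOrder_pbwAct (a : H D t) (z : PBW D) :
    normalOrder D t ((pbwAct D t a).unop z) = normalOrder D t z * a := by
  induction a using H.induction generalizing z with
  | hs r =>
    rw [AlgHom.commutes, ← Algebra.commutes, ← Algebra.smul_def, ← map_smul]
    rfl
  | hg a =>
    rw [pbwAct_gen]
    cases a with
    | g a => exact normalOrder_opG D t a z
    | y a => exact normalOrder_opY D t a z
    | x a => exact normalOrder_opX D t a z
  | hm a b ha hb =>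
    rw [map_mul, MulOpposite.unop_mul, Module.End.mul_apply, hb, ha, mul_assoc]
  | ha a b ha hb =>
    rw [map_add, MulOpposite.unop_add, LinearMap.add_apply, map_add, ha, hb, mul_add]

lemma pbwAct_symX (f' : SymmetricAlgebra ℂ (Module.Dual ℂ h)) :
    (pbwAct D t (symX D t f)).unop (k ⊗ₜ (p ⊗ₜ f')) = k ⊗ₜ (p ⊗ₜ (f * f')) := by
  induction f using SymmetricAlgebra.induction generalizing f' with
  | algebraMap r =>
    rw [AlgHom.commutes, AlgHom.commutes, ← Algebra.smul_def, TensorProduct.tmul_smul,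
      TensorProduct.tmul_smul]
    rfl
  | ι x => rw [symX_ι, pbwAct_gen]; rfl
  | mul a b ha hb =>
    rw [mul_comm, map_mul, map_mul, MulOpposite.unop_mul, Module.End.mul_apply, hb, ha, ← mul_assoc,
      mul_comm a b]
  | add a b ha hb =>
    rw [map_add, map_add, MulOpposite.unop_add, LinearMap.add_apply, ha, hb, add_mul,
      TensorProduct.tmul_add, TensorProduct.tmul_add]

lemma pbwAct_symY (p' : SymmetricAlgebra ℂ h) :
    (pbwAct D t (symY D t p)).unop (k ⊗ₜ (p' ⊗ₜ 1)) = k ⊗ₜ ((p * p') ⊗ₜ 1) := by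
  induction p using SymmetricAlgebra.induction generalizing p' with
  | algebraMap r =>
    rw [AlgHom.commutes, AlgHom.commutes, ← Algebra.smul_def, ← TensorProduct.smul_tmul',
      TensorProduct.tmul_smul]
    rfl
  | ι x => rw [symY_ι, pbwAct_gen]; exact opY_one D t k p' x
  | mul a b ha hb =>
    rw [mul_comm, map_mul, map_mul, MulOpposite.unop_mul, Module.End.mul_apply, hb, ha, ← mul_assoc,
      mul_comm a b]
  | add a b ha hb =>
    rw [map_add, map_add, MulOpposite.unop_add, LinearMap.add_apply, ha, hb, add_mul,
      TensorProduct.add_tmul, TensorProduct.tmul_add]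

lemma pbwAct_groupAlg : (pbwAct D t (groupAlg D t k)).unop (1 ⊗ₜ (1 ⊗ₜ 1)) =
    k ⊗ₜ ((1 : SymmetricAlgebra ℂ h) ⊗ₜ (1 : SymmetricAlgebra ℂ (Module.Dual ℂ h))) := by
  induction k using MonoidAlgebra.induction_on with
  | of g =>
    rw [groupAlg_of, pbwAct_gen]
    change opG D g _ = _
    rw [opG_apply, symRep_one, symRep_one]
    congr 1
    exact one_mul _
  | add a b ha hb =>
    rw [map_add, map_add, MulOpposite.unop_add, LinearMap.add_apply, ha, hb, TensorProduct.add_tmul]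
  | smul r a ha =>
    rw [map_smul, map_smul, MulOpposite.unop_smul, LinearMap.smul_apply, ha,
      TensorProduct.smul_tmul']

/-- The Poincaré–Birkhoff–Witt isomorphism. -/
def pbwEquiv : H D t ≃ₗ[ℂ] PBW D :=
  LinearEquiv.ofLinearMap
    { toFun := fun a => (pbwAct D t a).unop (1 ⊗ₜ (1 ⊗ₜ 1))
      map_add' := fun a b => by rw [map_add, MulOpposite.unop_add, LinearMap.add_apply]
      map_smul' := fun r a => by
        rw [map_smul, MulOpposite.unop_smul, LinearMap.smul_apply, RingHom.id_apply] }
    (normalOrder D t)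
    (PBW.ext_iff' fun k p f => by
      rw [LinearMap.comp_apply, normalOrder_tmul]
      change (pbwAct D t (groupAlg D t k * (symY D t p * symX D t f))).unop (1 ⊗ₜ (1 ⊗ₜ 1)) =
        k ⊗ₜ (p ⊗ₜ f)
      rw [map_mul, map_mul, MulOpposite.unop_mul, MulOpposite.unop_mul, Module.End.mul_apply,
        Module.End.mul_apply, pbwAct_groupAlg, pbwAct_symY, pbwAct_symX, mul_one, mul_one])
    (LinearMap.ext fun a => by
      change normalOrder D t ((pbwAct D t a).unop (1 ⊗ₜ (1 ⊗ₜ 1))) = a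
      rw [normalOrder_pbwAct, normalOrder_tmul, map_one, map_one, map_one, one_mul, one_mul,
        one_mul])

lemma pbwEquiv_mul (a b : H D t) :
    pbwEquiv D t (a * b) = (pbwAct D t b).unop (pbwEquiv D t a) := by
  change (pbwAct D t (a * b)).unop (1 ⊗ₜ (1 ⊗ₜ 1)) = _
  rw [map_mul]
  rfl

end PBWTheorem

end Cherednik

namespace Cherednik
variable {h : Type u} [AddCommGroup h] [Module ℂ h]

/-! ## The filtration by degree and its partial derivatives -/

section SymDegree

variable {M : Type*} [AddCommGroup M] [Module ℂ M]

/-- The homogeneous polynomials of degree `n`. -/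
def symDeg (M : Type*) [AddCommGroup M] [Module ℂ M] (n : ℕ) :
    Submodule ℂ (SymmetricAlgebra ℂ M) := (LinearMap.range (SymmetricAlgebra.ι ℂ M)) ^ n

lemma ι_mul_mem_symDeg {n : ℕ} (x : M) {f : SymmetricAlgebra ℂ M} (hf : f ∈ symDeg M n) :
    SymmetricAlgebra.ι ℂ M x * f ∈ symDeg M (n + 1) := by
  rw [symDeg, pow_succ']
  exact Submodule.mul_mem_mul ⟨x, rfl⟩ hf

lemma symDeg_succ_induction {n : ℕ} {P : SymmetricAlgebra ℂ M → Prop}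
    (h1 : ∀ x, ∀ f ∈ symDeg M n, P (SymmetricAlgebra.ι ℂ M x * f))
    (h2 : ∀ a b, P a → P b → P (a + b)) {f : SymmetricAlgebra ℂ M} (hf : f ∈ symDeg M (n + 1)) :
    P f := by
  rw [symDeg, pow_succ'] at hf
  refine Submodule.mul_induction_on hf ?_ h2
  rintro _ ⟨x, rfl⟩ f hf
  exact h1 x f hf

lemma mem_symDeg_zero {f : SymmetricAlgebra ℂ M} :
    f ∈ symDeg M 0 ↔ ∃ r : ℂ, f = algebraMap ℂ _ r := by
  rw [symDeg, pow_zero, Submodule.mem_one]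
  exact ⟨fun ⟨r, hr⟩ => ⟨r, hr.symm⟩, fun ⟨r, hr⟩ => ⟨r, hr.symm⟩⟩

lemma iSup_symDeg : ⨆ n, symDeg M n = ⊤ := by
  rw [eq_top_iff]
  intro f _
  induction f using SymmetricAlgebra.induction with
  | algebraMap r => exact Submodule.mem_iSup_of_mem 0 (mem_symDeg_zero.2 ⟨r, rfl⟩)
  | ι x =>
    refine Submodule.mem_iSup_of_mem 1 ?_
    rw [symDeg, pow_one]
    exact ⟨x, rfl⟩
  | add a b ha hb => exact add_mem (ha trivial) (hb trivial)
  | mul a b ha hb =>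
    have : a * b ∈ (⨆ n, symDeg M n) * (⨆ n, symDeg M n) :=
      Submodule.mul_mem_mul (ha trivial) (hb trivial)
    rw [Submodule.iSup_mul] at this
    refine (iSup_le fun n => ?_ : _ ≤ ⨆ n, symDeg M n) this
    rw [Submodule.mul_iSup]
    refine iSup_le fun m => ?_
    rw [symDeg, symDeg, ← pow_add]
    exact le_iSup (symDeg M) (n + m)

lemma twistAct_mem_symDeg (a : Module.Dual ℂ M) (m : M) {n : ℕ} {f : SymmetricAlgebra ℂ M}
    (hf : f ∈ symDeg M n) : twistAct a m f ∈ symDeg M n := by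
  induction n generalizing f with
  | zero =>
    obtain ⟨r, rfl⟩ := mem_symDeg_zero.1 hf
    rwa [AlgHom.commutes]
  | succ n ih =>
    refine symDeg_succ_induction (P := fun f => twistAct a m f ∈ symDeg M (n + 1))
      (fun x f hf => ?_) (fun a b ha hb => ?_) hf
    · rw [map_mul, twistAct_ι]
      exact ι_mul_mem_symDeg _ (ih hf)
    · rw [map_add]
      exact add_mem ha hb

lemma twistDer_mem_symDeg (a : Module.Dual ℂ M) (m : M) {n : ℕ} {f : SymmetricAlgebra ℂ M}
    (hf : f ∈ symDeg M (n + 1)) : twistDer a m f ∈ symDeg M n := by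
  induction n generalizing f with
  | zero =>
    refine symDeg_succ_induction (P := fun f => twistDer a m f ∈ symDeg M 0)
      (fun x f hf => ?_) (fun a b ha hb => ?_) hf
    · obtain ⟨r, rfl⟩ := mem_symDeg_zero.1 hf
      rw [twistDer_mul, twistDer_algebraMap, twistDer_ι, AlgHom.commutes, mul_zero, zero_add,
        ← map_mul]
      exact mem_symDeg_zero.2 ⟨_, rfl⟩
    · rw [map_add]
      exact add_mem ha hb
  | succ n ih =>
    refine symDeg_succ_induction (P := fun f => twistDer a m f ∈ symDeg M (n + 1))
      (fun x f hf => ?_) (fun a b ha hb => ?_) hf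
    · rw [twistDer_mul, twistDer_ι, ← Algebra.smul_def]
      exact add_mem (ι_mul_mem_symDeg _ (ih hf)) (Submodule.smul_mem _ _ (twistAct_mem_symDeg a m hf))
    · rw [map_add]
      exact add_mem ha hb

lemma twistDer_symDeg_zero (a : Module.Dual ℂ M) (m : M) {f : SymmetricAlgebra ℂ M}
    (hf : f ∈ symDeg M 0) : twistDer a m f = 0 := by
  obtain ⟨r, rfl⟩ := mem_symDeg_zero.1 hf
  rw [twistDer_algebraMap]

lemma symRep_mem_symDeg {G : Type*} [Group G] (ρ : Representation ℂ G M) (g : G) {n : ℕ}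
    {f : SymmetricAlgebra ℂ M} (hf : f ∈ symDeg M n) : symRep ρ g f ∈ symDeg M n := by
  induction n generalizing f with
  | zero =>
    obtain ⟨r, rfl⟩ := mem_symDeg_zero.1 hf
    rwa [symRep_algebraMap]
  | succ n ih =>
    refine symDeg_succ_induction (P := fun f => symRep ρ g f ∈ symDeg M (n + 1))
      (fun x f hf => ?_) (fun a b ha hb => ?_) hf
    · rw [symRep_mul, symRep_ι]
      exact ι_mul_mem_symDeg _ (ih hf)
    · rw [map_add]
      exact add_mem ha hb

end SymDegree

section PBWFiltration

variable (D : Datum h) (t : ℂ)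

/-- The elements of degree less than `n` in `ℂ[G] ⊗ Sym h ⊗ Sym h*`. -/
def pbwFil (n : ℕ) : Submodule ℂ (PBW D) :=
  Submodule.span ℂ {z | ∃ (a b : ℕ) (k : MonoidAlgebra ℂ D.G) (p : SymmetricAlgebra ℂ h)
    (f : SymmetricAlgebra ℂ (Module.Dual ℂ h)),
    a + b < n ∧ p ∈ symDeg h a ∧ f ∈ symDeg _ b ∧ z = k ⊗ₜ (p ⊗ₜ f)}

variable {D}

lemma tmul_mem_pbwFil {n a b : ℕ} (hab : a + b < n) (k : MonoidAlgebra ℂ D.G)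
    {p : SymmetricAlgebra ℂ h} {f : SymmetricAlgebra ℂ (Module.Dual ℂ h)}
    (hp : p ∈ symDeg h a) (hf : f ∈ symDeg _ b) : k ⊗ₜ (p ⊗ₜ f) ∈ pbwFil D n :=
  Submodule.subset_span ⟨a, b, k, p, f, hab, hp, hf, rfl⟩

lemma pbwFil_mono {m n : ℕ} (hmn : m ≤ n) : pbwFil D m ≤ pbwFil D n := by
  refine Submodule.span_mono ?_
  rintro z ⟨a, b, k, p, f, hab, hp, hf, rfl⟩
  exact ⟨a, b, k, p, f, hab.trans_le hmn, hp, hf, rfl⟩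

lemma pbwFil_zero : pbwFil D 0 = ⊥ := by
  rw [pbwFil, Submodule.span_eq_bot]
  rintro z ⟨a, b, k, p, f, hab, -⟩
  exact absurd hab (Nat.not_lt_zero _)

lemma exists_mem_pbwFil (z : PBW D) : ∃ n, z ∈ pbwFil D n := by
  have key : (⊤ : Submodule ℂ (PBW D)) ≤ ⨆ n, pbwFil D n := by
    rw [← TensorProduct.span_tmul_eq_top, Submodule.span_le]
    rintro _ ⟨k, z, rfl⟩
    induction z using TensorProduct.induction_on with
    | zero => rw [TensorProduct.tmul_zero]; exact zero_mem _
    | add a b ha hb => rw [TensorProduct.tmul_add]; exact add_mem ha hb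
    | tmul p f =>
      have hp : p ∈ ⨆ n, symDeg h n := by rw [iSup_symDeg]; trivial
      have hf : f ∈ ⨆ n, symDeg (Module.Dual ℂ h) n := by rw [iSup_symDeg]; trivial
      induction hp using Submodule.iSup_induction' with
      | mem a p hp =>
        induction hf using Submodule.iSup_induction' with
        | mem b f hf =>
          exact Submodule.mem_iSup_of_mem (a + b + 1) (tmul_mem_pbwFil (Nat.lt_succ_self _) k hp hf)
        | zero => rw [TensorProduct.tmul_zero, TensorProduct.tmul_zero]; exact zero_mem _
        | add f f' _ _ h1 h2 =>
          rw [TensorProduct.tmul_add, TensorProduct.tmul_add]; exact add_mem h1 h2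
      | zero => rw [TensorProduct.zero_tmul, TensorProduct.tmul_zero]; exact zero_mem _
      | add p p' _ _ h1 h2 =>
        rw [TensorProduct.add_tmul, TensorProduct.tmul_add]; exact add_mem h1 h2
  have := key (Submodule.mem_top (x := z))
  rwa [Submodule.mem_iSup_of_directed _ (Monotone.directed_le fun _ _ => pbwFil_mono)] at this

/-- A linear map lowering the degree by one, up to terms of lower degree. -/
lemma pbwFil_map_le {φ : PBW D →ₗ[ℂ] PBW D} {m n : ℕ}
    (H : ∀ a b k p f, a + b < m → p ∈ symDeg h a → f ∈ symDeg (Module.Dual ℂ h) b →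
      φ (k ⊗ₜ (p ⊗ₜ f)) ∈ pbwFil D n) {z : PBW D} (hz : z ∈ pbwFil D m) : φ z ∈ pbwFil D n := by
  have : pbwFil D m ≤ (pbwFil D n).comap φ := by
    refine Submodule.span_le.2 ?_
    rintro z ⟨a, b, k, p, f, hab, hp, hf, rfl⟩
    exact H a b k p f hab hp hf
  exact this hz

lemma opX_mem_pbwFil (x : Module.Dual ℂ h) {n : ℕ} {z : PBW D} (hz : z ∈ pbwFil D n) :
    opX D x z ∈ pbwFil D (n + 1) :=
  pbwFil_map_le (fun a b k p f hab hp hf => by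
    rw [opX_apply]
    exact tmul_mem_pbwFil (by omega) k hp (ι_mul_mem_symDeg x hf)) hz

lemma opG_mem_pbwFil (g : D.G) {n : ℕ} {z : PBW D} (hz : z ∈ pbwFil D n) :
    opG D g z ∈ pbwFil D n :=
  pbwFil_map_le (fun a b k p f hab hp hf => by
    rw [opG_apply]
    exact tmul_mem_pbwFil hab _ (symRep_mem_symDeg _ _ hp) (symRep_mem_symDeg _ _ hf)) hz

lemma opS_mem_pbwFil (s : reflections D.G) {n : ℕ} {z : PBW D} (hz : z ∈ pbwFil D (n + 1)) :
    opS D s z ∈ pbwFil D n :=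
  pbwFil_map_le (fun a b k p f hab hp hf => by
    rw [opS_apply]
    obtain _ | b := b
    · rw [reflDer, twistDer_symDeg_zero _ _ hf, map_zero, TensorProduct.tmul_zero,
        TensorProduct.tmul_zero]
      exact zero_mem _
    · exact tmul_mem_pbwFil (a := a) (b := b) (by omega) _ (symRep_mem_symDeg _ _ hp)
        (symRep_mem_symDeg _ _ (twistDer_mem_symDeg _ _ hf))) hz

/-- Differentiation in the last factor. -/
def derX (a : Module.Dual ℂ (Module.Dual ℂ h)) : Module.End ℂ (PBW D) :=
  TensorProduct.map LinearMap.id (TensorProduct.map LinearMap.id (symDer a))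

/-- Differentiation in the middle factor. -/
def derY (a : Module.Dual ℂ h) : Module.End ℂ (PBW D) :=
  TensorProduct.map LinearMap.id (TensorProduct.map (symDer a) LinearMap.id)

lemma derX_apply (a : Module.Dual ℂ (Module.Dual ℂ h)) (k : MonoidAlgebra ℂ D.G)
    (p : SymmetricAlgebra ℂ h) (f : SymmetricAlgebra ℂ (Module.Dual ℂ h)) :
    derX a (k ⊗ₜ (p ⊗ₜ f)) = (k ⊗ₜ (p ⊗ₜ symDer a f) : PBW D) := rfl

lemma derY_apply (a : Module.Dual ℂ h) (k : MonoidAlgebra ℂ D.G)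
    (p : SymmetricAlgebra ℂ h) (f : SymmetricAlgebra ℂ (Module.Dual ℂ h)) :
    derY a (k ⊗ₜ (p ⊗ₜ f)) = (k ⊗ₜ (symDer a p ⊗ₜ f) : PBW D) := rfl

lemma derX_mem_pbwFil (a : Module.Dual ℂ (Module.Dual ℂ h)) {n : ℕ} {z : PBW D}
    (hz : z ∈ pbwFil D (n + 1)) : derX a z ∈ pbwFil D n :=
  pbwFil_map_le (fun i b k p f hab hp hf => by
    rw [derX_apply]
    obtain _ | b := b
    · rw [symDer, twistDer_symDeg_zero _ _ hf, TensorProduct.tmul_zero, TensorProduct.tmul_zero]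
      exact zero_mem _
    · exact tmul_mem_pbwFil (a := i) (b := b) (by omega) _ hp (twistDer_mem_symDeg _ _ hf)) hz

lemma derY_mem_pbwFil (a : Module.Dual ℂ h) {n : ℕ} {z : PBW D}
    (hz : z ∈ pbwFil D (n + 1)) : derY a z ∈ pbwFil D n :=
  pbwFil_map_le (fun i b k p f hab hp hf => by
    rw [derY_apply]
    obtain _ | i := i
    · rw [symDer, twistDer_symDeg_zero _ _ hp, TensorProduct.zero_tmul, TensorProduct.tmul_zero]
      exact zero_mem _
    · exact tmul_mem_pbwFil (a := i) (b := b) (by omega) _ (twistDer_mem_symDeg _ _ hp) hf) hz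

lemma opY_sub_mem_pbwFil (y : h) {n : ℕ} {z : PBW D} (hz : z ∈ pbwFil D (n + 1)) :
    opY D t y z - TensorProduct.map LinearMap.id (TensorProduct.map
      (LinearMap.mulLeft ℂ (SymmetricAlgebra.ι ℂ _ y)) LinearMap.id) z ∈ pbwFil D n := by
  have e : opY D t y z = TensorProduct.map LinearMap.id (TensorProduct.map
      (LinearMap.mulLeft ℂ (SymmetricAlgebra.ι ℂ _ y)) LinearMap.id) z
        - t • derX (Module.Dual.eval ℂ h y) z + ∑ s, (D.c s * D.root s y) • opS D s z := by
    rw [opY, LinearMap.add_apply, LinearMap.sum_apply]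
    rfl
  rw [e]
  have h2 : -(t • derX (Module.Dual.eval ℂ h y) z) + ∑ s, (D.c s * D.root s y) • opS D s z ∈
      pbwFil D n :=
    add_mem (neg_mem (Submodule.smul_mem _ _ (derX_mem_pbwFil _ hz)))
      (Submodule.sum_mem _ fun s _ => Submodule.smul_mem _ _ (opS_mem_pbwFil s hz))
  convert h2 using 1
  abel

lemma opY_mem_pbwFil (y : h) {n : ℕ} {z : PBW D} (hz : z ∈ pbwFil D n) :
    opY D t y z ∈ pbwFil D (n + 1) := by
  have h1 := opY_sub_mem_pbwFil t y (pbwFil_mono n.le_succ hz)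
  have h2 : TensorProduct.map LinearMap.id (TensorProduct.map
      (LinearMap.mulLeft ℂ (SymmetricAlgebra.ι ℂ _ y)) LinearMap.id) z ∈ pbwFil D (n + 1) :=
    pbwFil_map_le (fun a b k p f hab hp hf =>
      tmul_mem_pbwFil (by omega) k (ι_mul_mem_symDeg y hp) hf) hz
  have := add_mem (pbwFil_mono n.le_succ h1) h2
  rwa [sub_add_cancel] at this

/-- The partial derivative in the direction of a linear form on `h ⊕ h*`. -/
def pbwDer (ξ : Module.Dual ℂ (h × Module.Dual ℂ h)) : Module.End ℂ (PBW D) :=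
  derY (ξ ∘ₗ LinearMap.inl ℂ _ _) + derX (ξ ∘ₗ LinearMap.inr ℂ _ _)

lemma pbwDer_mem_pbwFil (ξ : Module.Dual ℂ (h × Module.Dual ℂ h)) {n : ℕ} {z : PBW D}
    (hz : z ∈ pbwFil D (n + 1)) : pbwDer ξ z ∈ pbwFil D n :=
  add_mem (derY_mem_pbwFil _ hz) (derX_mem_pbwFil _ hz)

lemma pbwDer_opX (ξ : Module.Dual ℂ (h × Module.Dual ℂ h)) (x : Module.Dual ℂ h) (z : PBW D) :
    pbwDer ξ (opX D x z) = opX D x (pbwDer ξ z) + ξ (0, x) • z := by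
  have : (pbwDer ξ ∘ₗ opX D x : PBW D →ₗ[ℂ] PBW D) =
      opX D x ∘ₗ pbwDer ξ + ξ (0, x) • LinearMap.id := by
    refine PBW.ext_iff' fun k p f => ?_
    rw [LinearMap.comp_apply, LinearMap.add_apply, LinearMap.comp_apply, pbwDer,
      LinearMap.add_apply, LinearMap.add_apply, map_add, opX_apply, derX_apply, derY_apply,
      derX_apply, derY_apply, opX_apply, opX_apply, symDer_mul, symDer_ι, LinearMap.smul_apply,
      LinearMap.id_apply, ← Algebra.smul_def, TensorProduct.tmul_add, TensorProduct.tmul_add,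
      TensorProduct.tmul_smul, TensorProduct.tmul_smul, add_assoc]
    rfl
  exact LinearMap.congr_fun this z

lemma pbwDer_mulY (ξ : Module.Dual ℂ (h × Module.Dual ℂ h)) (y : h) (z : PBW D) :
    pbwDer ξ (TensorProduct.map LinearMap.id (TensorProduct.map
      (LinearMap.mulLeft ℂ (SymmetricAlgebra.ι ℂ _ y)) LinearMap.id) z) =
    TensorProduct.map LinearMap.id (TensorProduct.map
      (LinearMap.mulLeft ℂ (SymmetricAlgebra.ι ℂ _ y)) LinearMap.id) (pbwDer ξ z) +
        ξ (y, 0) • z := by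
  set φ : PBW D →ₗ[ℂ] PBW D := TensorProduct.map LinearMap.id (TensorProduct.map
      (LinearMap.mulLeft ℂ (SymmetricAlgebra.ι ℂ _ y)) LinearMap.id) with hφ
  have hφ' : ∀ k p f, φ (k ⊗ₜ (p ⊗ₜ f)) = k ⊗ₜ ((SymmetricAlgebra.ι ℂ _ y * p) ⊗ₜ f) :=
    fun _ _ _ => rfl
  have : (pbwDer ξ ∘ₗ φ : PBW D →ₗ[ℂ] PBW D) = φ ∘ₗ pbwDer ξ + ξ (y, 0) • LinearMap.id := by
    refine PBW.ext_iff' fun k p f => ?_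
    rw [LinearMap.comp_apply, LinearMap.add_apply, LinearMap.comp_apply, pbwDer,
      LinearMap.add_apply, LinearMap.add_apply, map_add, hφ', derX_apply, derY_apply,
      derX_apply, derY_apply, hφ', hφ', symDer_mul, symDer_ι, LinearMap.smul_apply,
      LinearMap.id_apply, ← Algebra.smul_def, TensorProduct.add_tmul, TensorProduct.tmul_add,
      ← TensorProduct.smul_tmul', TensorProduct.tmul_smul, add_right_comm]
    rfl
  exact LinearMap.congr_fun this z

lemma pbwDer_opY_sub_mem (ξ : Module.Dual ℂ (h × Module.Dual ℂ h)) (y : h) {n : ℕ} {z : PBW D}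
    (hz : z ∈ pbwFil D (n + 1)) :
    pbwDer ξ (opY D t y z) - opY D t y (pbwDer ξ z) - ξ (y, 0) • z ∈ pbwFil D n := by
  set φ : PBW D →ₗ[ℂ] PBW D := TensorProduct.map LinearMap.id (TensorProduct.map
      (LinearMap.mulLeft ℂ (SymmetricAlgebra.ι ℂ _ y)) LinearMap.id) with hφ
  have h1 := pbwDer_mem_pbwFil ξ (pbwFil_mono n.le_succ (opY_sub_mem_pbwFil t y hz))
  have h2 := opY_sub_mem_pbwFil t y (pbwFil_mono n.le_succ (pbwDer_mem_pbwFil ξ hz))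
  have h3 := sub_mem h1 h2
  rw [map_sub, pbwDer_mulY] at h3
  convert h3 using 1
  abel

lemma pbwFil_succ_induction {n : ℕ} {P : PBW D → Prop}
    (h0 : ∀ z ∈ pbwFil D (n + 1), P z) (hX : ∀ x, ∀ z ∈ pbwFil D (n + 1), P (opX D x z))
    (hY : ∀ y, ∀ z ∈ pbwFil D (n + 1), P (opY D t y z)) (ha : ∀ a b, P a → P b → P (a + b))
    (hs : ∀ (r : ℂ) a, P a → P (r • a)) {z : PBW D} (hz : z ∈ pbwFil D (n + 2)) : P z := by
  induction hz using Submodule.span_induction with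
  | zero => exact h0 0 (zero_mem _)
  | add a b _ _ h1 h2 => exact ha a b h1 h2
  | smul r z hz hP => exact hs r z hP
  | mem z hz =>
    obtain ⟨a, b, k, p, f, hab, hp, hf, rfl⟩ := hz
    obtain _ | b := b
    · obtain _ | a := a
      · exact h0 _ (tmul_mem_pbwFil (by omega) k hp hf)
      · obtain ⟨r, rfl⟩ := mem_symDeg_zero.1 hf
        refine symDeg_succ_induction (P := fun p => P (k ⊗ₜ (p ⊗ₜ algebraMap ℂ _ r)))
          (fun y p hp => ?_) (fun p p' h1 h2 => ?_) hp
        · rw [Algebra.algebraMap_eq_smul_one, TensorProduct.tmul_smul, TensorProduct.tmul_smul,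
            ← opY_one D t]
          exact hs _ _ (hY _ _ (tmul_mem_pbwFil (a := a) (b := 0) (by omega) k hp
            (mem_symDeg_zero.2 ⟨1, (map_one _).symm⟩)))
        · rw [TensorProduct.add_tmul, TensorProduct.tmul_add]
          exact ha _ _ h1 h2
    · refine symDeg_succ_induction (P := fun f => P (k ⊗ₜ (p ⊗ₜ f)))
        (fun x f hf => ?_) (fun f f' h1 h2 => ?_) hf
      · exact hX x _ (tmul_mem_pbwFil (a := a) (b := b) (by omega) k hp hf)
      · rw [TensorProduct.tmul_add, TensorProduct.tmul_add]
        exact ha _ _ h1 h2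

lemma mem_pbwFil_one {z : PBW D} (hz : z ∈ pbwFil D 1) : ∃ k : MonoidAlgebra ℂ D.G,
    z = k ⊗ₜ ((1 : SymmetricAlgebra ℂ h) ⊗ₜ (1 : SymmetricAlgebra ℂ (Module.Dual ℂ h))) := by
  induction hz using Submodule.span_induction with
  | zero => exact ⟨0, (TensorProduct.zero_tmul _ _).symm⟩
  | add a b _ _ h1 h2 =>
    obtain ⟨k, rfl⟩ := h1
    obtain ⟨l, rfl⟩ := h2
    exact ⟨k + l, (TensorProduct.add_tmul _ _ _).symm⟩
  | smul r z hz hP =>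
    obtain ⟨k, rfl⟩ := hP
    exact ⟨r • k, TensorProduct.smul_tmul' _ _ _⟩
  | mem z hz =>
    obtain ⟨a, b, k, p, f, hab, hp, hf, rfl⟩ := hz
    obtain rfl : a = 0 := by omega
    obtain rfl : b = 0 := by omega
    obtain ⟨r, rfl⟩ := mem_symDeg_zero.1 hf
    obtain ⟨r', rfl⟩ := mem_symDeg_zero.1 hp
    refine ⟨(r * r') • k, ?_⟩
    rw [Algebra.algebraMap_eq_smul_one, Algebra.algebraMap_eq_smul_one, TensorProduct.tmul_smul,
      TensorProduct.tmul_smul, ← TensorProduct.smul_tmul', TensorProduct.tmul_smul, smul_smul,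
      TensorProduct.smul_tmul']

end PBWFiltration

section Filtration

variable (D : Datum h) (t : ℂ)

/-- The inclusion of `V = h ⊕ h*` into `H_{t,c}`. -/
def vMap : h × Module.Dual ℂ h →ₗ[ℂ] H D t := (yMap D t).coprod (xMap D t)

lemma vMap_apply (v : h × Module.Dual ℂ h) :
    vMap D t v = gen D t (.y v.1) + gen D t (.x v.2) := rfl

/-- The elements of `H_{t,c}` of filtration degree less than `n`. -/
def fil (n : ℕ) : Submodule ℂ (H D t) := (pbwFil D n).comap (pbwEquiv D t).toLinearMap

/-- Partial derivatives on `H_{t,c}`, defined through the Poincaré–Birkhoff–Witt isomorphism. -/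
def der (ξ : Module.Dual ℂ (h × Module.Dual ℂ h)) : Module.End ℂ (H D t) :=
  (pbwEquiv D t).symm.toLinearMap ∘ₗ pbwDer ξ ∘ₗ (pbwEquiv D t).toLinearMap

variable {D t}

lemma mem_fil {n : ℕ} {a : H D t} : a ∈ fil D t n ↔ pbwEquiv D t a ∈ pbwFil D n := Iff.rfl

lemma pbwEquiv_der (ξ : Module.Dual ℂ (h × Module.Dual ℂ h)) (a : H D t) :
    pbwEquiv D t (der D t ξ a) = pbwDer ξ (pbwEquiv D t a) :=
  (pbwEquiv D t).apply_symm_apply _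

lemma fil_mono {m n : ℕ} (hmn : m ≤ n) : fil D t m ≤ fil D t n :=
  Submodule.comap_mono (pbwFil_mono hmn)

lemma fil_zero : fil D t 0 = ⊥ := by
  rw [fil, pbwFil_zero]
  exact LinearEquiv.ker _

lemma exists_mem_fil (a : H D t) : ∃ n, a ∈ fil D t n := exists_mem_pbwFil (pbwEquiv D t a)

lemma pbwEquiv_mul_vMap (a : H D t) (v : h × Module.Dual ℂ h) :
    pbwEquiv D t (a * vMap D t v) =
      opY D t v.1 (pbwEquiv D t a) + opX D v.2 (pbwEquiv D t a) := by
  rw [vMap_apply, mul_add, map_add, pbwEquiv_mul, pbwEquiv_mul, pbwAct_gen, pbwAct_gen]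
  rfl

lemma mul_vMap_mem_fil {n : ℕ} {a : H D t} (ha : a ∈ fil D t n) (v : h × Module.Dual ℂ h) :
    a * vMap D t v ∈ fil D t (n + 1) := by
  rw [mem_fil, pbwEquiv_mul_vMap]
  exact add_mem (opY_mem_pbwFil t _ ha) (opX_mem_pbwFil _ ha)

lemma mul_gen_g_mem_fil {n : ℕ} {a : H D t} (ha : a ∈ fil D t n) (g : D.G) :
    a * gen D t (.g g) ∈ fil D t n := by
  rw [mem_fil, pbwEquiv_mul, pbwAct_gen]
  exact opG_mem_pbwFil _ ha

lemma der_mem_fil (ξ : Module.Dual ℂ (h × Module.Dual ℂ h)) {n : ℕ} {a : H D t}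
    (ha : a ∈ fil D t (n + 1)) : der D t ξ a ∈ fil D t n := by
  rw [mem_fil, pbwEquiv_der]
  exact pbwDer_mem_pbwFil ξ ha

lemma der_mul_vMap_sub_mem_fil (ξ : Module.Dual ℂ (h × Module.Dual ℂ h))
    (v : h × Module.Dual ℂ h) {n : ℕ} {a : H D t} (ha : a ∈ fil D t (n + 1)) :
    der D t ξ (a * vMap D t v) - der D t ξ a * vMap D t v - ξ v • a ∈ fil D t n := by
  rw [mem_fil, map_sub, map_sub, pbwEquiv_der, pbwEquiv_mul_vMap, pbwEquiv_mul_vMap, map_add,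
    pbwEquiv_der, map_smul, pbwDer_opX]
  have := pbwDer_opY_sub_mem t ξ v.1 ha
  have hv : ξ v = ξ (v.1, 0) + ξ (0, v.2) := by rw [← map_add]; simp
  rw [hv, add_smul]
  convert this using 1
  abel

lemma fil_succ_induction {n : ℕ} {P : H D t → Prop} (h0 : ∀ a ∈ fil D t (n + 1), P a)
    (hv : ∀ v, ∀ a ∈ fil D t (n + 1), P (a * vMap D t v)) (ha : ∀ a b, P a → P b → P (a + b))
    (hs : ∀ (r : ℂ) a, P a → P (r • a)) {a : H D t} (haf : a ∈ fil D t (n + 2)) : P a := by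
  have := pbwFil_succ_induction t (P := fun z => P ((pbwEquiv D t).symm z))
    (fun z hz => h0 _ (by rwa [mem_fil, LinearEquiv.apply_symm_apply]))
    (fun x z hz => ?_) (fun y z hz => ?_) (fun a b h1 h2 => by rw [map_add]; exact ha _ _ h1 h2)
    (fun r a h1 => by rw [map_smul]; exact hs _ _ h1) haf
  · have e := (pbwEquiv D t).symm_apply_apply a
    change P ((pbwEquiv D t).symm (pbwEquiv D t a)) at this
    exact e ▸ this
  · have h1 := hv (0, x) ((pbwEquiv D t).symm z) (by rwa [mem_fil, LinearEquiv.apply_symm_apply])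
    convert h1 using 1
    rw [LinearEquiv.symm_apply_eq, pbwEquiv_mul_vMap, LinearEquiv.apply_symm_apply]
    have : opY D t 0 z = 0 := by
      have := opY_smul D t 0 0
      rw [zero_smul, zero_smul] at this
      rw [this, LinearMap.zero_apply]
    rw [this, zero_add]
  · have h1 := hv (y, 0) ((pbwEquiv D t).symm z) (by rwa [mem_fil, LinearEquiv.apply_symm_apply])
    convert h1 using 1
    rw [LinearEquiv.symm_apply_eq, pbwEquiv_mul_vMap, LinearEquiv.apply_symm_apply]
    have : opX D 0 z = 0 := by
      have := opX_smul D 0 0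
      rw [zero_smul, zero_smul] at this
      rw [this, LinearMap.zero_apply]
    rw [this, add_zero]

lemma mem_fil_one {a : H D t} (ha : a ∈ fil D t 1) : ∃ k, a = groupAlg D t k := by
  obtain ⟨k, hk⟩ := mem_pbwFil_one ha
  refine ⟨k, (pbwEquiv D t).injective ?_⟩
  exact hk.trans (pbwAct_groupAlg D t k).symm

/-- The coefficient of the scalar part of the commutator of two elements of `V`. -/
def sympForm (u v : h × Module.Dual ℂ h) : ℂ := v.2 u.1 - u.2 v.1

/-- The skew form on `V` attached to a reflection. -/
def reflForm (s : reflections D.G) (u v : h × Module.Dual ℂ h) : ℂ :=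
  D.root s u.1 * v.2 (D.coroot s) - D.root s v.1 * u.2 (D.coroot s)

lemma vMap_commutator (u v : h × Module.Dual ℂ h) :
    vMap D t u * vMap D t v - vMap D t v * vMap D t u =
      (t * sympForm u v) • 1 - ∑ s, (D.c s * reflForm s u v) • gen D t (.g (D.refl s)) := by
  have h1 := gen_y_x D t u.1 v.2
  have h2 := gen_y_x D t v.1 u.2
  have h3 := gen_y_comm D t u.1 v.1
  have h4 := gen_x_comm D t u.2 v.2
  have e : vMap D t u * vMap D t v - vMap D t v * vMap D t u =
      (gen D t (.y u.1) * gen D t (.x v.2) - gen D t (.x v.2) * gen D t (.y u.1)) -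
      (gen D t (.y v.1) * gen D t (.x u.2) - gen D t (.x u.2) * gen D t (.y v.1)) := by
    rw [vMap_apply, vMap_apply, add_mul, add_mul, mul_add, mul_add, mul_add, mul_add, h3, h4]
    abel
  rw [e, h1, h2, sympForm]
  have e2 : ∀ s, (D.c s * reflForm s u v) • gen D t (.g (D.refl s)) =
      (D.c s * D.root s u.1 * v.2 (D.coroot s)) • gen D t (.g (D.refl s)) -
      (D.c s * D.root s v.1 * u.2 (D.coroot s)) • gen D t (.g (D.refl s)) := by
    intro s
    rw [← sub_smul, reflForm]
    congr 1
    ring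
  simp only [e2, Finset.sum_sub_distrib, Algebra.algebraMap_eq_smul_one, mul_sub, sub_smul]
  abel

lemma mul_commutator_mem_fil {n : ℕ} {a : H D t} (ha : a ∈ fil D t n)
    (u v : h × Module.Dual ℂ h) :
    a * (vMap D t u * vMap D t v - vMap D t v * vMap D t u) ∈ fil D t n := by
  rw [vMap_commutator, mul_sub, mul_smul_comm, mul_one, Finset.mul_sum]
  refine sub_mem (Submodule.smul_mem _ _ ha) (Submodule.sum_mem _ fun s _ => ?_)
  rw [mul_smul_comm]
  exact Submodule.smul_mem _ _ (mul_gen_g_mem_fil ha _)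

/-- Euler's identity, up to terms of lower degree. -/
lemma sum_der_mul_sub_mem_fil {ι : Type*} [Fintype ι] (b : Module.Basis ι ℂ (h × Module.Dual ℂ h))
    {n : ℕ} {a : H D t} (ha : a ∈ fil D t (n + 1)) :
    ∑ j, der D t (b.coord j) a * vMap D t (b j) - (n : ℂ) • a ∈ fil D t n := by
  induction n generalizing a with
  | zero =>
    have : ∀ j, der D t (b.coord j) a = 0 := fun j => by
      have := der_mem_fil (b.coord j) ha
      rwa [fil_zero, Submodule.mem_bot] at this
    simp only [this, zero_mul, Finset.sum_const_zero, Nat.cast_zero, zero_smul, sub_self]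
    exact zero_mem _
  | succ n ih =>
    refine fil_succ_induction (P := fun a => ∑ j, der D t (b.coord j) a * vMap D t (b j) -
      ((n + 1 : ℕ) : ℂ) • a ∈ fil D t (n + 1)) (fun a ha => ?_) (fun v a ha => ?_)
      (fun a a' h1 h2 => ?_) (fun r a h1 => ?_) ha
    · exact sub_mem (Submodule.sum_mem _ fun j _ => mul_vMap_mem_fil (der_mem_fil _ ha) _)
        (Submodule.smul_mem _ _ ha)
    · have h1 : ∀ j, der D t (b.coord j) (a * vMap D t v) * vMap D t (b j) -
          der D t (b.coord j) a * vMap D t (b j) * vMap D t v - b.coord j v • (a * vMap D t (b j)) ∈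
          fil D t (n + 1) := by
        intro j
        have e1 := mul_vMap_mem_fil (der_mul_vMap_sub_mem_fil (b.coord j) v ha) (b j)
        have e2 := fil_mono n.le_succ
          (mul_commutator_mem_fil (der_mem_fil (b.coord j) ha) v (b j))
        have e3 := add_mem e1 e2
        convert e3 using 1
        rw [sub_mul, sub_mul, mul_sub, smul_mul_assoc, ← mul_assoc, ← mul_assoc]
        abel
      have h2 := Submodule.sum_mem (fil D t (n + 1)) (t := Finset.univ) fun j _ => h1 j
      have h3 : ∑ j, b.coord j v • (a * vMap D t (b j)) = a * vMap D t v := by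
        conv_rhs => rw [← b.sum_repr v, map_sum, Finset.mul_sum]
        simp only [map_smul, mul_smul_comm]
        rfl
      rw [Finset.sum_sub_distrib, Finset.sum_sub_distrib, h3, ← Finset.sum_mul] at h2
      have h4 := mul_vMap_mem_fil (ih ha) v
      have h5 := add_mem h2 h4
      convert h5 using 1
      rw [sub_mul, smul_mul_assoc, Nat.cast_add, Nat.cast_one, add_smul, one_smul]
      abel
    · convert add_mem h1 h2 using 1
      simp only [map_add, add_mul, Finset.sum_add_distrib, smul_add]
      abel
    · convert Submodule.smul_mem _ r h1 using 1
      simp only [map_smul, smul_mul_assoc, Finset.smul_sum, smul_sub, smul_comm r]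

end Filtration

end Cherednik

namespace Cherednik

section DualBases

variable {K : Type*} {W U : Type*} [Field K] [AddCommGroup W] [Module K W]
  [AddCommGroup U] [Module K U]

/-- The canonical element of `W* ⊗ W` does not depend on the choice of a basis. -/
lemma sum_coord_basis_eq {ι κ : Type*} [Fintype ι] [Fintype κ] (b : Module.Basis ι K W)
    (b' : Module.Basis κ K W) (B : Module.Dual K W →ₗ[K] W →ₗ[K] U) :
    ∑ j, B (b.coord j) (b j) = ∑ k, B (b'.coord k) (b' k) := by
  have h1 : ∀ j, b j = ∑ k, b'.coord k (b j) • b' k := fun j => (b'.sum_repr _).symm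
  have h2 : ∀ k, ∑ j, b'.coord k (b j) • b.coord j = b'.coord k := by
    intro k
    refine b.ext fun i => ?_
    classical
    simp [Finsupp.single_apply]
  calc _ = ∑ j, ∑ k, B (b'.coord k (b j) • b.coord j) (b' k) := by
        refine Finset.sum_congr rfl fun j _ => ?_
        conv_lhs => rw [h1 j, map_sum]
        simp
    _ = _ := by
        rw [Finset.sum_comm]
        refine Finset.sum_congr rfl fun k _ => ?_
        conv_rhs => rw [← h2 k]
        rw [map_sum, LinearMap.sum_apply]

lemma sum_coord_comp_basis {ι : Type*} [Fintype ι] (b : Module.Basis ι K W) (φ : W ≃ₗ[K] W)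
    (B : Module.Dual K W →ₗ[K] W →ₗ[K] U) :
    ∑ j, B (b.coord j ∘ₗ (φ.symm : W →ₗ[K] W)) (φ (b j)) = ∑ j, B (b.coord j) (b j) := by
  rw [sum_coord_basis_eq b (b.map φ) B]
  refine Finset.sum_congr rfl fun j _ => ?_
  rw [Module.Basis.map_apply]
  rfl

end DualBases

section Contraction

variable {W : Type v} [AddCommGroup W] [Module ℂ W] {W' : Type w} [AddCommGroup W'] [Module ℂ W']

/-- Contraction with a linear form, as an operator on the exterior algebra. -/
def ctr : Module.Dual ℂ W →ₗ[ℂ] Module.End ℂ (ExteriorAlgebra ℂ W) :=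
  CliffordAlgebra.contractLeft (Q := (0 : QuadraticForm ℂ W))

/-- Exterior multiplication by a vector. -/
def wedge : W →ₗ[ℂ] Module.End ℂ (ExteriorAlgebra ℂ W) :=
  LinearMap.mul ℂ (ExteriorAlgebra ℂ W) ∘ₗ ExteriorAlgebra.ι ℂ

lemma wedge_apply (w : W) (ω : ExteriorAlgebra ℂ W) :
    wedge w ω = ExteriorAlgebra.ι ℂ w * ω := rfl

lemma ctr_wedge (ξ : Module.Dual ℂ W) (w : W) (ω : ExteriorAlgebra ℂ W) :
    ctr ξ (wedge w ω) = ξ w • ω - wedge w (ctr ξ ω) :=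
  CliffordAlgebra.contractLeft_ι_mul (Q := (0 : QuadraticForm ℂ W)) _ _ _

lemma ctr_self (ξ : Module.Dual ℂ W) (ω : ExteriorAlgebra ℂ W) : ctr ξ (ctr ξ ω) = 0 :=
  CliffordAlgebra.contractLeft_contractLeft (Q := (0 : QuadraticForm ℂ W)) _ _

lemma ctr_comm (ξ η : Module.Dual ℂ W) (ω : ExteriorAlgebra ℂ W) :
    ctr ξ (ctr η ω) = -ctr η (ctr ξ ω) :=
  CliffordAlgebra.contractLeft_comm (Q := (0 : QuadraticForm ℂ W)) _ _ _

lemma ctr_algebraMap (ξ : Module.Dual ℂ W) (r : ℂ) :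
    ctr ξ (algebraMap ℂ (ExteriorAlgebra ℂ W) r) = 0 :=
  CliffordAlgebra.contractLeft_algebraMap (Q := (0 : QuadraticForm ℂ W)) _ _

lemma wedge_comm (v w : W) (ω : ExteriorAlgebra ℂ W) :
    wedge v (wedge w ω) = -wedge w (wedge v ω) := by
  rw [wedge_apply, wedge_apply, wedge_apply, wedge_apply, ← mul_assoc, ← mul_assoc,
    eq_neg_iff_add_eq_zero, ← add_mul, ExteriorAlgebra.ι_add_mul_swap, zero_mul]

lemma wedge_self (v : W) (ω : ExteriorAlgebra ℂ W) : wedge v (wedge v ω) = 0 := by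
  rw [wedge_apply, wedge_apply, ← mul_assoc, ExteriorAlgebra.ι_sq_zero, zero_mul]

lemma ext_induction {P : ExteriorAlgebra ℂ W → Prop}
    (hr : ∀ r, P (algebraMap ℂ (ExteriorAlgebra ℂ W) r)) (ha : ∀ a b, P a → P b → P (a + b))
    (hw : ∀ w a, P a → P (wedge w a)) (ω : ExteriorAlgebra ℂ W) : P ω :=
  CliffordAlgebra.left_induction (Q := (0 : QuadraticForm ℂ W)) (P := P) hr ha
    (fun a w h => hw w a h) ω

lemma exteriorPower_succ (p : ℕ) :
    ⋀[ℂ]^(p + 1) W = LinearMap.range (ExteriorAlgebra.ι ℂ (M := W)) * ⋀[ℂ]^p W :=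
  pow_succ' _ _

lemma exteriorPower_zero : ⋀[ℂ]^0 W = 1 := pow_zero _

lemma wedge_mem_exteriorPower (w : W) {p : ℕ} {ω : ExteriorAlgebra ℂ W} (hω : ω ∈ ⋀[ℂ]^p W) :
    wedge w ω ∈ ⋀[ℂ]^(p + 1) W := by
  rw [exteriorPower_succ]
  exact Submodule.mul_mem_mul ⟨w, rfl⟩ hω

lemma mem_exteriorPower_zero {ω : ExteriorAlgebra ℂ W} :
    ω ∈ ⋀[ℂ]^0 W ↔ ∃ r : ℂ, algebraMap ℂ _ r = ω := by
  rw [exteriorPower_zero, Submodule.mem_one]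

lemma exteriorPower_induction {P : ℕ → ExteriorAlgebra ℂ W → Prop}
    (hr : ∀ r, P 0 (algebraMap ℂ (ExteriorAlgebra ℂ W) r))
    (ha : ∀ p a b, P p a → P p b → P p (a + b))
    (hw : ∀ p w a, a ∈ ⋀[ℂ]^p W → P p a → P (p + 1) (wedge w a)) {p : ℕ}
    {ω : ExteriorAlgebra ℂ W} (hω : ω ∈ ⋀[ℂ]^p W) : P p ω := by
  induction p generalizing ω with
  | zero =>
    obtain ⟨r, rfl⟩ := mem_exteriorPower_zero.1 hω
    exact hr r
  | succ p ih =>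
    rw [exteriorPower_succ] at hω
    refine Submodule.mul_induction_on hω ?_ (fun a b => ha _ a b)
    rintro _ ⟨w, rfl⟩ a h
    exact hw p w a h (ih h)

lemma ctr_exteriorPower_zero (ξ : Module.Dual ℂ W) {ω : ExteriorAlgebra ℂ W}
    (hω : ω ∈ ⋀[ℂ]^0 W) : ctr ξ ω = 0 := by
  obtain ⟨r, rfl⟩ := mem_exteriorPower_zero.1 hω
  exact ctr_algebraMap ξ r

lemma ctr_mem_exteriorPower_pred (ξ : Module.Dual ℂ W) {p : ℕ} {ω : ExteriorAlgebra ℂ W}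
    (hω : ω ∈ ⋀[ℂ]^p W) : ctr ξ ω ∈ ⋀[ℂ]^(p - 1) W := by
  refine exteriorPower_induction (P := fun p ω => ctr ξ ω ∈ ⋀[ℂ]^(p - 1) W) (fun r => ?_)
    (fun p a b h1 h2 => ?_) (fun p w a hm h1 => ?_) hω
  · rw [ctr_algebraMap]
    exact zero_mem _
  · rw [map_add]
    exact add_mem h1 h2
  · rw [ctr_wedge]
    refine sub_mem (Submodule.smul_mem _ _ hm) ?_
    cases p with
    | zero => rw [ctr_exteriorPower_zero ξ hm, map_zero]; exact zero_mem _
    | succ p => exact wedge_mem_exteriorPower w h1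

lemma ctr_mem_exteriorPower (ξ : Module.Dual ℂ W) {p : ℕ} {ω : ExteriorAlgebra ℂ W}
    (hω : ω ∈ ⋀[ℂ]^(p + 1) W) : ctr ξ ω ∈ ⋀[ℂ]^p W := ctr_mem_exteriorPower_pred ξ hω

/-- Euler's identity on the exterior algebra. -/
lemma sum_wedge_ctr {ι : Type*} [Fintype ι] (b : Module.Basis ι ℂ W) {p : ℕ}
    {ω : ExteriorAlgebra ℂ W} (hω : ω ∈ ⋀[ℂ]^p W) :
    ∑ j, wedge (b j) (ctr (b.coord j) ω) = (p : ℂ) • ω := by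
  refine exteriorPower_induction (P := fun p ω => ∑ j, wedge (b j) (ctr (b.coord j) ω) =
    (p : ℂ) • ω) (fun r => ?_) (fun p a b h1 h2 => ?_) (fun p w a hm h1 => ?_) hω
  · simp [ctr_algebraMap]
  · simp only [map_add, Finset.sum_add_distrib, h1, h2, smul_add]
  · have e : ∀ j, wedge (b j) (ctr (b.coord j) (wedge w a)) =
        wedge (b.coord j w • b j) a + wedge w (wedge (b j) (ctr (b.coord j) a)) := by
      intro j
      rw [ctr_wedge, map_sub, wedge_comm, map_smul, map_smul, LinearMap.smul_apply, sub_neg_eq_add]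
    have : ∑ j, b.coord j w • b j = w := b.sum_repr w
    rw [Finset.sum_congr rfl fun j _ => e j, Finset.sum_add_distrib, ← map_sum, h1, map_smul,
      ← LinearMap.sum_apply, ← map_sum, this, Nat.cast_add, Nat.cast_one, add_smul, one_smul, add_comm]

lemma map_wedge (φ : W →ₗ[ℂ] W') (w : W) (ω : ExteriorAlgebra ℂ W) :
    ExteriorAlgebra.map φ (wedge w ω) = wedge (φ w) (ExteriorAlgebra.map φ ω) := by
  rw [wedge_apply, map_mul, ExteriorAlgebra.map_apply_ι, wedge_apply]

lemma ctr_map (φ : W →ₗ[ℂ] W') (ξ : Module.Dual ℂ W') (ω : ExteriorAlgebra ℂ W) :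
    ctr ξ (ExteriorAlgebra.map φ ω) = ExteriorAlgebra.map φ (ctr (ξ ∘ₗ φ) ω) := by
  induction ω using ext_induction with
  | hr r => rw [AlgHom.commutes, ctr_algebraMap, ctr_algebraMap, map_zero]
  | ha a b h1 h2 => rw [map_add, map_add, h1, h2, map_add, map_add]
  | hw w a h1 => rw [map_wedge, ctr_wedge, h1, ctr_wedge, map_sub, map_smul, map_wedge]; rfl

/-- The exterior algebra endomorphism induced by `w ↦ w - f(w) u`. -/
lemma map_sub_smul (f : Module.Dual ℂ W) (u : W) (φ : W →ₗ[ℂ] W) (hφ : ∀ w, φ w = w - f w • u)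
    (ω : ExteriorAlgebra ℂ W) :
    ExteriorAlgebra.map φ ω = ω - wedge u (ctr f ω) := by
  induction ω using ext_induction with
  | hr r => rw [AlgHom.commutes, ctr_algebraMap, map_zero, sub_zero]
  | ha a b h1 h2 => rw [map_add, h1, h2, map_add, map_add]; abel
  | hw w a h1 =>
    rw [map_wedge, h1, hφ, map_sub, map_sub, LinearMap.sub_apply, LinearMap.sub_apply, map_smul,
      LinearMap.smul_apply, LinearMap.smul_apply, wedge_self, ctr_wedge, map_sub, map_smul,
      wedge_comm u w]
    simp only [smul_zero, sub_zero]
    abel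

lemma map_mem_exteriorPower (φ : W →ₗ[ℂ] W') {p : ℕ} {ω : ExteriorAlgebra ℂ W}
    (hω : ω ∈ ⋀[ℂ]^p W) : ExteriorAlgebra.map φ ω ∈ ⋀[ℂ]^p W' := by
  refine exteriorPower_induction (P := fun p ω => ExteriorAlgebra.map φ ω ∈ ⋀[ℂ]^p W')
    (fun r => ?_) (fun p a b h1 h2 => ?_) (fun p w a hm h1 => ?_) hω
  · rw [AlgHom.commutes]
    exact mem_exteriorPower_zero.2 ⟨r, rfl⟩
  · rw [map_add]
    exact add_mem h1 h2
  · rw [map_wedge]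
    exact wedge_mem_exteriorPower _ h1

lemma exteriorPower_internal : DirectSum.IsInternal fun p : ℕ => ⋀[ℂ]^p W :=
  DirectSum.Decomposition.isInternal _

lemma iSup_exteriorPower : ⨆ p : ℕ, ⋀[ℂ]^p W = ⊤ := exteriorPower_internal.submodule_iSup_eq_top

lemma exteriorPower_eq_bot [FiniteDimensional ℂ W] {p : ℕ} (hp : Module.finrank ℂ W < p) :
    ⋀[ℂ]^p W = ⊥ := by
  rw [← Submodule.finrank_eq_zero (R := ℂ), exteriorPower.finrank_eq, Nat.choose_eq_zero_of_lt hp]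

instance finite_exteriorAlgebra [FiniteDimensional ℂ W] :
    FiniteDimensional ℂ (ExteriorAlgebra ℂ W) := by
  have h1 : ⨆ p : Fin (Module.finrank ℂ W + 1), ⋀[ℂ]^(p : ℕ) W = ⊤ := by
    refine top_le_iff.1 (iSup_exteriorPower.symm.le.trans (iSup_le fun p => ?_))
    by_cases hp : p < Module.finrank ℂ W + 1
    · exact le_iSup (fun p : Fin (Module.finrank ℂ W + 1) => ⋀[ℂ]^(p : ℕ) W) ⟨p, hp⟩
    · rw [exteriorPower_eq_bot (by omega)]
      exact bot_le
  have h2 : FiniteDimensional ℂ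
      (⨆ p : Fin (Module.finrank ℂ W + 1), ⋀[ℂ]^(p : ℕ) W : Submodule ℂ _) :=
    Submodule.finite_iSup _
  rw [h1] at h2
  exact Module.Finite.equiv Submodule.topEquiv

end Contraction

section GradingOperator

variable {M : Type v} [AddCommGroup M] [Module ℂ M] {M' : Type w} [AddCommGroup M'] [Module ℂ M']

/-- The subspace of degree `n` for the grading defined by an operator, acting on it by `2 ^ n`. -/
def deg (τ : Module.End ℂ M) (n : ℤ) : Submodule ℂ M := Module.End.eigenspace τ ((2 : ℂ) ^ n)

lemma mem_deg {τ : Module.End ℂ M} {n : ℤ} {m : M} : m ∈ deg τ n ↔ τ m = (2 : ℂ) ^ n • m :=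
  Module.End.mem_eigenspace_iff

lemma two_zpow_injective : Function.Injective fun n : ℤ => (2 : ℂ) ^ n := by
  intro m n hmn
  have := congrArg (fun z : ℂ => ‖z‖) hmn
  simp only [norm_zpow, RCLike.norm_ofNat] at this
  exact zpow_right_injective₀ (by norm_num) (by norm_num) this

lemma iSupIndep_deg (τ : Module.End ℂ M) : iSupIndep (deg τ) :=
  (Module.End.eigenspaces_iSupIndep τ).comp two_zpow_injective

/-- The operator `τ` is a grading operator: it defines a grading. -/
def IsGrading (τ : Module.End ℂ M) : Prop := ⨆ n, deg τ n = ⊤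

lemma IsGrading.isInternal {τ : Module.End ℂ M} (hτ : IsGrading τ) :
    DirectSum.IsInternal (deg τ) :=
  (DirectSum.isInternal_submodule_iff_iSupIndep_and_iSup_eq_top _).2 ⟨iSupIndep_deg τ, hτ⟩

lemma deg_disjoint {τ : Module.End ℂ M} {s : Finset ℤ} {f : ℤ → M} (hf : ∀ n, f n ∈ deg τ n)
    (hs : ∑ n ∈ s, f n = 0) : ∀ n ∈ s, f n = 0 := by
  intro n hn
  rw [← Finset.add_sum_erase _ _ hn] at hs
  refine Submodule.disjoint_def.1 (iSupIndep_deg τ n) _ (hf n) ?_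
  rw [eq_neg_of_add_eq_zero_left hs]
  refine neg_mem (Submodule.sum_mem _ fun j hj => ?_)
  exact Submodule.mem_iSup_of_mem j (Submodule.mem_iSup_of_mem (Finset.ne_of_mem_erase hj) (hf j))

/-- If a submodule stable under `τ` contains a sum of homogeneous elements, then it contains the
summands. -/
lemma mem_of_sum_mem {τ : Module.End ℂ M} {p : Submodule ℂ M} (hp : p ≤ p.comap τ) {s : Finset ℤ}
    {f : ℤ → M} (hf : ∀ n, f n ∈ deg τ n) (hs : ∑ n ∈ s, f n ∈ p) : ∀ n ∈ s, f n ∈ p := by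
  have h1 : ∀ n, p.mkQ (f n) ∈ deg (p.mapQ p τ hp) n := fun n => by
    rw [mem_deg, Submodule.mkQ_apply, Submodule.mapQ_apply, mem_deg.1 (hf n)]
    rfl
  have h3 : ∑ n ∈ s, p.mkQ (f n) = 0 := by
    rw [← map_sum]
    exact (Submodule.Quotient.mk_eq_zero p).2 hs
  intro n hn
  exact (Submodule.Quotient.mk_eq_zero p).1 (deg_disjoint h1 h3 n hn)

lemma exists_sum_of_mem_iSup {S : ℤ → Submodule ℂ M} {m : M} (hm : m ∈ ⨆ n, S n) :
    ∃ (s : Finset ℤ) (f : ℤ → M), (∀ n, f n ∈ S n) ∧ ∑ n ∈ s, f n = m := by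
  obtain ⟨f, hf, rfl⟩ := (Submodule.mem_iSup_iff_exists_finsupp _ _).1 hm
  exact ⟨f.support, f, hf, rfl⟩

lemma IsGrading.exists_sum {τ : Module.End ℂ M} (hτ : IsGrading τ) (m : M) :
    ∃ (s : Finset ℤ) (f : ℤ → M), (∀ n, f n ∈ deg τ n) ∧ ∑ n ∈ s, f n = m :=
  exists_sum_of_mem_iSup (hτ.symm ▸ Submodule.mem_top)

lemma mem_of_mem_iSup_of_mem_deg {τ : Module.End ℂ M} {S : ℤ → Submodule ℂ M}
    (hS : ∀ n, S n ≤ deg τ n) {m : M} (hm : m ∈ ⨆ n, S n) {d : ℤ} (hd : m ∈ deg τ d) : m ∈ S d := by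
  obtain ⟨s, f, hf, rfl⟩ := exists_sum_of_mem_iSup hm
  have h1 : ∑ n ∈ insert d s, ((if n ∈ s then f n else 0) -
      if n = d then ∑ n ∈ s, f n else 0) = 0 := by
    rw [Finset.sum_sub_distrib, Finset.sum_ite_eq' (insert d s) d,
      if_pos (Finset.mem_insert_self _ _), sub_eq_zero, Finset.sum_ite_mem,
      Finset.inter_eq_right.2 (Finset.subset_insert _ _)]
  have h2 := deg_disjoint (τ := τ) (fun n => ?_) h1 d (Finset.mem_insert_self _ _)
  · rw [if_pos rfl, sub_eq_zero] at h2
    rw [← h2]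
    split_ifs
    · exact hf d
    · exact zero_mem _
  · refine sub_mem ?_ ?_
    · split_ifs
      · exact hS n (hf n)
      · exact zero_mem _
    · split_ifs with h
      · exact h ▸ hd
      · exact zero_mem _

lemma deg_eq_of_iSup_eq_top {τ : Module.End ℂ M} {S : ℤ → Submodule ℂ M}
    (hS : ∀ n, S n ≤ deg τ n) (h : ⨆ n, S n = ⊤) (d : ℤ) : deg τ d = S d :=
  le_antisymm (fun _ hm => mem_of_mem_iSup_of_mem_deg hS (h ▸ Submodule.mem_top) hm) (hS d)

lemma isGrading_of_iSup_eq_top {τ : Module.End ℂ M} {S : ℤ → Submodule ℂ M}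
    (hS : ∀ n, S n ≤ deg τ n) (h : ⨆ n, S n = ⊤) : IsGrading τ :=
  top_le_iff.1 (h.symm.le.trans (iSup_mono hS))

lemma mem_deg_restrict {τ : Module.End ℂ M} {p : Submodule ℂ M} (hp : ∀ m ∈ p, τ m ∈ p) {n : ℤ}
    {m : p} : m ∈ deg (τ.restrict hp) n ↔ (m : M) ∈ deg τ n := by
  rw [mem_deg, mem_deg, ← Subtype.coe_inj]
  rfl

lemma IsGrading.exists_sum_mem {τ : Module.End ℂ M} (hτ : IsGrading τ) {p : Submodule ℂ M}
    (hp : ∀ m ∈ p, τ m ∈ p) {m : M} (hm : m ∈ p) :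
    ∃ (s : Finset ℤ) (f : ℤ → M), (∀ n, f n ∈ deg τ n) ∧ (∀ n, f n ∈ p) ∧ ∑ n ∈ s, f n = m := by
  obtain ⟨s, f, hf, rfl⟩ := hτ.exists_sum m
  have := mem_of_sum_mem hp hf hm
  refine ⟨s, fun n => if n ∈ s then f n else 0, fun n => ?_, fun n => ?_, ?_⟩
  · dsimp only
    split_ifs
    · exact hf n
    · exact zero_mem _
  · dsimp only
    split_ifs with h
    · exact this n h
    · exact zero_mem _
  · rw [Finset.sum_ite_mem, Finset.inter_self]

lemma tmul_mem_deg {τ : Module.End ℂ M} {σ : Module.End ℂ M'} {i j : ℤ} {m : M} {m' : M'}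
    (hm : m ∈ deg τ i) (hm' : m' ∈ deg σ j) :
    m ⊗ₜ[ℂ] m' ∈ deg (TensorProduct.map τ σ) (i + j) := by
  rw [mem_deg, TensorProduct.map_tmul, mem_deg.1 hm, mem_deg.1 hm', TensorProduct.smul_tmul_smul,
    zpow_add₀ two_ne_zero]

lemma IsGrading.tensor {τ : Module.End ℂ M} {σ : Module.End ℂ M'} (hτ : IsGrading τ)
    (hσ : IsGrading σ) : IsGrading (TensorProduct.map τ σ) := by
  refine top_le_iff.1 fun z _ => ?_
  induction z with
  | zero => exact zero_mem _
  | add a b h1 h2 => exact add_mem (h1 trivial) (h2 trivial)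
  | tmul m m' =>
    obtain ⟨s, f, hf, rfl⟩ := hτ.exists_sum m
    obtain ⟨s', f', hf', rfl⟩ := hσ.exists_sum m'
    rw [TensorProduct.sum_tmul]
    refine Submodule.sum_mem _ fun i _ => ?_
    rw [TensorProduct.tmul_sum]
    exact Submodule.sum_mem _ fun j _ => Submodule.mem_iSup_of_mem (i + j)
      (tmul_mem_deg (hf i) (hf' j))

/-- The operator acting by `2 ^ n` in degree `n`. -/
def gradingOp {A : ℤ → Submodule ℂ M} (hA : DirectSum.IsInternal A) : Module.End ℂ M :=
  (DirectSum.toModule ℂ ℤ M fun n => ((2 : ℂ) ^ n) • (A n).subtype) ∘ₗ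
    (LinearEquiv.ofBijective (DirectSum.coeLinearMap A) hA).symm.toLinearMap

lemma gradingOp_apply {A : ℤ → Submodule ℂ M} (hA : DirectSum.IsInternal A) {n : ℤ} {m : M}
    (hm : m ∈ A n) : gradingOp hA m = (2 : ℂ) ^ n • m := by
  have : (LinearEquiv.ofBijective (DirectSum.coeLinearMap A) hA).symm m =
      DirectSum.lof ℂ ℤ (fun n => A n) n ⟨m, hm⟩ := by
    refine (LinearEquiv.symm_apply_eq _).2 ?_
    exact (DirectSum.coeLinearMap_lof A n ⟨m, hm⟩).symm
  change DirectSum.toModule ℂ ℤ M _ ((LinearEquiv.ofBijective (DirectSum.coeLinearMap A) hA).symm m)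
    = _
  rw [this, DirectSum.toModule_lof]
  rfl

lemma deg_gradingOp {A : ℤ → Submodule ℂ M} (hA : DirectSum.IsInternal A) (n : ℤ) :
    deg (gradingOp hA) n = A n :=
  deg_eq_of_iSup_eq_top (fun _ _ hm => mem_deg.2 (gradingOp_apply hA hm))
    hA.submodule_iSup_eq_top n

lemma isGrading_gradingOp {A : ℤ → Submodule ℂ M} (hA : DirectSum.IsInternal A) :
    IsGrading (gradingOp hA) :=
  isGrading_of_iSup_eq_top (fun n => (deg_gradingOp hA n).ge) hA.submodule_iSup_eq_top

/-- Two linear maps agree if they agree on homogeneous elements. -/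
lemma IsGrading.hom_ext {τ : Module.End ℂ M} (hτ : IsGrading τ) {f f' : M →ₗ[ℂ] M'}
    (h : ∀ n, ∀ m ∈ deg τ n, f m = f' m) : f = f' := by
  refine LinearMap.ext fun m => ?_
  obtain ⟨s, g, hg, rfl⟩ := hτ.exists_sum m
  rw [map_sum, map_sum]
  exact Finset.sum_congr rfl fun n _ => h n _ (hg n)

end GradingOperator

end Cherednik

namespace Cherednik
variable {h : Type u} [AddCommGroup h] [Module ℂ h]

section Tens

variable {M : Type*} {N : Type*} [AddCommGroup M] [Module ℂ M] [AddCommGroup N] [Module ℂ N]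

/-- The subspace of a tensor product spanned by the pure tensors from two subspaces. -/
def tens (A : Submodule ℂ M) (B : Submodule ℂ N) : Submodule ℂ (M ⊗[ℂ] N) :=
  Submodule.map₂ (TensorProduct.mk ℂ M N) A B

lemma tmul_mem_tens {A : Submodule ℂ M} {B : Submodule ℂ N} {a : M} {b : N} (ha : a ∈ A)
    (hb : b ∈ B) : a ⊗ₜ b ∈ tens A B :=
  Submodule.apply_mem_map₂ _ ha hb

lemma tens_le {A : Submodule ℂ M} {B : Submodule ℂ N} {S : Submodule ℂ (M ⊗[ℂ] N)} :
    tens A B ≤ S ↔ ∀ a ∈ A, ∀ b ∈ B, a ⊗ₜ b ∈ S := Submodule.map₂_le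

lemma tens_mono {A A' : Submodule ℂ M} {B B' : Submodule ℂ N} (hA : A ≤ A') (hB : B ≤ B') :
    tens A B ≤ tens A' B' := Submodule.map₂_le_map₂ hA hB

lemma tens_bot_left {B : Submodule ℂ N} : tens (⊥ : Submodule ℂ M) B = ⊥ :=
  Submodule.map₂_bot_left _ _

lemma tens_bot_right {A : Submodule ℂ M} : tens A (⊥ : Submodule ℂ N) = ⊥ :=
  Submodule.map₂_bot_right _ _

lemma tens_iSup_right {ι : Sort*} (A : Submodule ℂ M) (B : ι → Submodule ℂ N) :
    tens A (⨆ i, B i) = ⨆ i, tens A (B i) := Submodule.map₂_iSup_right _ _ _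

lemma tens_iSup_left {ι : Sort*} (A : ι → Submodule ℂ M) (B : Submodule ℂ N) :
    tens (⨆ i, A i) B = ⨆ i, tens (A i) B := Submodule.map₂_iSup_left _ _ _

/-- A linear map is determined on a tensor product of subspaces by pure tensors. -/
lemma mem_of_mem_tens {A : Submodule ℂ M} {B : Submodule ℂ N} {P : Type*} [AddCommGroup P]
    [Module ℂ P] (f : M ⊗[ℂ] N →ₗ[ℂ] P) (S : Submodule ℂ P)
    (hf : ∀ a ∈ A, ∀ b ∈ B, f (a ⊗ₜ b) ∈ S) {z : M ⊗[ℂ] N} (hz : z ∈ tens A B) : f z ∈ S :=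
  tens_le (S := S.comap f) |>.2 hf hz

lemma mem_of_mem_tens₃ {M' : Type*} [AddCommGroup M'] [Module ℂ M'] {A : Submodule ℂ M'}
    {B : Submodule ℂ M} {C : Submodule ℂ N} {P : Type*} [AddCommGroup P] [Module ℂ P]
    (f : M' ⊗[ℂ] (M ⊗[ℂ] N) →ₗ[ℂ] P) (S : Submodule ℂ P)
    (hf : ∀ a ∈ A, ∀ b ∈ B, ∀ c ∈ C, f (a ⊗ₜ (b ⊗ₜ c)) ∈ S) {z : M' ⊗[ℂ] (M ⊗[ℂ] N)}
    (hz : z ∈ tens A (tens B C)) : f z ∈ S :=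
  mem_of_mem_tens f S (fun a ha _ hb =>
    mem_of_mem_tens (f ∘ₗ TensorProduct.mk ℂ M' (M ⊗[ℂ] N) a) S (hf a ha) hb) hz

end Tens

section Representation

variable (D : Datum h) (t : ℂ)

instance : Fintype D.G := Fintype.ofFinite _

instance : Invertible (Fintype.card D.G : ℂ) :=
  invertibleOfNonzero (Nat.cast_ne_zero.2 Fintype.card_ne_zero)

lemma gen_g_vMap (g : D.G) (v : h × Module.Dual ℂ h) :
    gen D t (.g g) * vMap D t v = vMap D t (vRep D g v) * gen D t (.g g) := by
  rw [vMap_apply, vMap_apply, mul_add, add_mul, gen_g_y, gen_g_x]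
  rfl

/-- The action of a group element on `V`, as an equivalence. -/
def vEquiv (g : D.G) : (h × Module.Dual ℂ h) ≃ₗ[ℂ] (h × Module.Dual ℂ h) :=
  LinearEquiv.ofLinearMap (vRep D g) (vRep D g⁻¹)
    (by rw [← Module.End.mul_eq_comp, ← map_mul, mul_inv_cancel, map_one]; rfl)
    (by rw [← Module.End.mul_eq_comp, ← map_mul, inv_mul_cancel, map_one]; rfl)

/-- The linear forms on `V` attached to a reflection. -/
def rootForm (s : reflections D.G) : Module.Dual ℂ (h × Module.Dual ℂ h) :=
  D.root s ∘ₗ LinearMap.fst ℂ _ _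

/-- The linear forms on `V` attached to the coroot of a reflection. -/
def corootForm (s : reflections D.G) : Module.Dual ℂ (h × Module.Dual ℂ h) :=
  Module.Dual.eval ℂ h (D.coroot s) ∘ₗ LinearMap.snd ℂ _ _

variable {D}

lemma rootForm_comp (s : reflections D.G) :
    rootForm D s ∘ₗ vRep D (D.refl s) = (D.lam s)⁻¹ • rootForm D s := by
  refine LinearMap.ext fun v => ?_
  have := D.root_eigen s (D.rep (D.refl s) v.1)
  have e : (s : h ≃ₗ[ℂ] h)⁻¹ (D.rep (D.refl s) v.1) = v.1 := LinearEquiv.symm_apply_apply _ _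
  rw [e] at this
  change D.root s (D.rep (D.refl s) v.1) = (D.lam s)⁻¹ * D.root s v.1
  rw [this, inv_mul_cancel_left₀ (D.lam_ne_zero s)]

lemma corootForm_comp (s : reflections D.G) :
    corootForm D s ∘ₗ vRep D (D.refl s) = D.lam s • corootForm D s := by
  refine LinearMap.ext fun v => ?_
  change D.dualRep (D.refl s) v.2 (D.coroot s) = D.lam s * v.2 (D.coroot s)
  rw [Datum.refl_dual_apply]
  simp only [LinearMap.sub_apply, LinearMap.smul_apply, smul_eq_mul, D.root_coroot, dCoef]
  ring

/-- A reflection acts trivially on the elements of `⋀ V` killed by its two linear forms. -/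
lemma map_refl_of_ctr_eq_zero (s : reflections D.G)
    {ω : ExteriorAlgebra ℂ (h × Module.Dual ℂ h)} (h1 : ctr (rootForm D s) ω = 0)
    (h2 : ctr (corootForm D s) ω = 0) : ExteriorAlgebra.map (vRep D (D.refl s)) ω = ω := by
  have e : vRep D (D.refl s) = LinearMap.prodMap (D.rep (D.refl s)) LinearMap.id ∘ₗ
      LinearMap.prodMap LinearMap.id (D.dualRep (D.refl s)) := rfl
  have e1 := map_sub_smul (rootForm D s) ((-(dCoef D s * (D.lam s)⁻¹) • D.coroot s, 0))
    (LinearMap.prodMap (D.rep (D.refl s)) LinearMap.id) (fun v => ?_) ω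
  · have e2 := map_sub_smul (corootForm D s) ((0, dCoef D s • D.root s))
      (LinearMap.prodMap LinearMap.id (D.dualRep (D.refl s))) (fun v => ?_) ω
    · rw [e, ← ExteriorAlgebra.map_comp_map, AlgHom.comp_apply, e2, h2, map_zero, sub_zero, e1, h1,
        map_zero, sub_zero]
    · ext1
      · simp
      · simp only [LinearMap.prodMap_apply, Datum.refl_dual_apply, Prod.snd_sub, Prod.smul_snd, smul_smul,
          corootForm, LinearMap.comp_apply, LinearMap.snd_apply, Module.Dual.eval_apply]
        congr 2
        ring
  · ext1
    · simp only [LinearMap.prodMap_apply, Datum.refl_apply, Prod.fst_sub, Prod.smul_fst, smul_smul,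
          rootForm, LinearMap.comp_apply, LinearMap.fst_apply]
      rw [mul_neg, neg_smul, sub_neg_eq_add]
      congr 2
      ring
    · simp

lemma ctr_ctr_map_refl (s : reflections D.G) (ω : ExteriorAlgebra ℂ (h × Module.Dual ℂ h)) :
    ctr (rootForm D s) (ctr (corootForm D s) (ExteriorAlgebra.map (vRep D (D.refl s)) ω)) =
      ctr (rootForm D s) (ctr (corootForm D s) ω) := by
  rw [ctr_map, ctr_map, rootForm_comp, corootForm_comp, map_smul, map_smul, LinearMap.smul_apply,
    LinearMap.smul_apply, map_smul, map_smul, map_smul, smul_smul, inv_mul_cancel₀ (D.lam_ne_zero s), one_smul]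
  refine map_refl_of_ctr_eq_zero s (ctr_self _ _) ?_
  rw [ctr_comm, ctr_self, map_zero, neg_zero]

end Representation

section Koszul

variable {D : Datum h} {t : ℂ} (X : GrMod.{u, v} D t)

/-- The space `X ⊗ ⋀ V`. -/
abbrev extSpace : Type (max u v) := X.carrier ⊗[ℂ] ExteriorAlgebra ℂ (h × Module.Dual ℂ h)

/-- The ambient space `H ⊗ X ⊗ ⋀ V` of the Koszul complex. -/
abbrev koszulSpace : Type (max u v) := H D t ⊗[ℂ] extSpace X

/-- The representation of `G` on `X ⊗ ⋀ V`. -/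
abbrev extSpaceRep : Representation ℂ D.G (extSpace X) := X.rep.tprod (extRep (vRep D))

/-- The representation of `G` on `H ⊗ X ⊗ ⋀ V` commuting with left multiplication by `H`. -/
def koszulRep : Representation ℂ D.G (koszulSpace X) where
  toFun g := TensorProduct.map (LinearMap.mulRight ℂ (gen D t (.g g⁻¹))) (extSpaceRep X g)
  map_one' := by
    rw [inv_one, gen_g_one, map_one, LinearMap.mulRight_one]
    exact TensorProduct.map_id
  map_mul' g g' := by
    rw [map_mul, mul_inv_rev, gen_g_mul, LinearMap.mulRight_mul, Module.End.mul_eq_comp,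
      TensorProduct.map_comp]
    rfl

lemma koszulRep_tmul (g : D.G) (a : H D t) (m : extSpace X) :
    koszulRep X g (a ⊗ₜ m) = (a * gen D t (.g g⁻¹)) ⊗ₜ extSpaceRep X g m := rfl

lemma extSpaceRep_tmul (g : D.G) (x : X.carrier) (ω : ExteriorAlgebra ℂ (h × Module.Dual ℂ h)) :
    extSpaceRep X g (x ⊗ₜ ω) = (gen D t (.g g) • x) ⊗ₜ ExteriorAlgebra.map (vRep D g) ω := rfl

/-- The averaging operator. -/
abbrev koszulAv : Module.End ℂ (koszulSpace X) := (koszulRep X).averageMap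

/-- The action of `v ∈ V` on `X`. -/
def actV : h × Module.Dual ℂ h →ₗ[ℂ] Module.End ℂ X.carrier :=
  (Algebra.lsmul ℂ ℂ X.carrier : H D t →ₐ[ℂ] Module.End ℂ X.carrier).toLinearMap ∘ₗ vMap D t

lemma actV_apply (v : h × Module.Dual ℂ h) (x : X.carrier) : actV X v x = vMap D t v • x := rfl

lemma koszulSpace_ext {N : Type*} [AddCommGroup N] [Module ℂ N] {f f' : koszulSpace X →ₗ[ℂ] N}
    (H : ∀ a x ω, f (a ⊗ₜ (x ⊗ₜ ω)) = f' (a ⊗ₜ (x ⊗ₜ ω))) : f = f' :=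
  TensorProduct.ext' fun a m =>
    LinearMap.congr_fun (TensorProduct.ext' (g := f ∘ₗ TensorProduct.mk ℂ (Cherednik.H D t)
      (extSpace X) a) (h := f' ∘ₗ TensorProduct.mk ℂ (Cherednik.H D t) (extSpace X) a) (H a)) m

lemma koszulRep_smul (g : D.G) (a : H D t) (z : koszulSpace X) :
    koszulRep X g (a • z) = a • koszulRep X g z := by
  have : koszulRep X g ∘ₗ (Algebra.lsmul ℂ ℂ (koszulSpace X) a) =
      (Algebra.lsmul ℂ ℂ (koszulSpace X) a) ∘ₗ koszulRep X g := koszulSpace_ext X fun b x ω => by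
    change koszulRep X g ((a * b) ⊗ₜ (x ⊗ₜ ω)) = a • koszulRep X g (b ⊗ₜ (x ⊗ₜ ω))
    rw [koszulRep_tmul, koszulRep_tmul, TensorProduct.smul_tmul', smul_eq_mul, mul_assoc]
  exact LinearMap.congr_fun this z

variable [FiniteDimensional ℂ h]

/-- A basis of `V`. -/
abbrev vBasis (h : Type u) [AddCommGroup h] [Module ℂ h] [FiniteDimensional ℂ h] :=
  Module.finBasis ℂ (h × Module.Dual ℂ h)

/-- The part of the Koszul differential acting on `X ⊗ ⋀ V`. -/
def leftD : Module.End ℂ (extSpace X) :=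
  ∑ j, TensorProduct.map (actV X (vBasis h j)) (ctr ((vBasis h).coord j))

lemma leftD_tmul (x : X.carrier) (ω : ExteriorAlgebra ℂ (h × Module.Dual ℂ h)) :
    leftD X (x ⊗ₜ ω) = ∑ j, (vMap D t (vBasis h j) • x) ⊗ₜ ctr ((vBasis h).coord j) ω := by
  rw [leftD, LinearMap.sum_apply]
  rfl

/-- The part of the Koszul differential involving right multiplication. -/
def rightD : Module.End ℂ (koszulSpace X) :=
  ∑ j, TensorProduct.map (LinearMap.mulRight ℂ (vMap D t (vBasis h j)))
    (TensorProduct.map LinearMap.id (ctr ((vBasis h).coord j)))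

lemma rightD_tmul (a : H D t) (x : X.carrier) (ω : ExteriorAlgebra ℂ (h × Module.Dual ℂ h)) :
    rightD X (a ⊗ₜ (x ⊗ₜ ω)) =
      ∑ j, (a * vMap D t (vBasis h j)) ⊗ₜ (x ⊗ₜ ctr ((vBasis h).coord j) ω) := by
  rw [rightD, LinearMap.sum_apply]
  rfl

/-- The Koszul differential on `H ⊗ X ⊗ ⋀ V`. -/
def koszulD : Module.End ℂ (koszulSpace X) := rightD X - TensorProduct.map LinearMap.id (leftD X)

lemma koszulD_tmul (a : H D t) (x : X.carrier) (ω : ExteriorAlgebra ℂ (h × Module.Dual ℂ h)) :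
    koszulD X (a ⊗ₜ (x ⊗ₜ ω)) = ∑ j, ((a * vMap D t (vBasis h j)) ⊗ₜ
        (x ⊗ₜ ctr ((vBasis h).coord j) ω) -
      a ⊗ₜ ((vMap D t (vBasis h j) • x) ⊗ₜ ctr ((vBasis h).coord j) ω)) := by
  rw [koszulD, LinearMap.sub_apply, rightD_tmul, TensorProduct.map_tmul, leftD_tmul,
    TensorProduct.tmul_sum, Finset.sum_sub_distrib]
  rfl

lemma koszulD_smul (a : H D t) (z : koszulSpace X) : koszulD X (a • z) = a • koszulD X z := by
  have : koszulD X ∘ₗ (Algebra.lsmul ℂ ℂ (koszulSpace X) a) =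
      (Algebra.lsmul ℂ ℂ (koszulSpace X) a) ∘ₗ koszulD X := koszulSpace_ext X fun b x ω => by
    change koszulD X ((a * b) ⊗ₜ _) = a • koszulD X _
    rw [koszulD_tmul, koszulD_tmul, Finset.smul_sum]
    refine Finset.sum_congr rfl fun j _ => ?_
    rw [smul_sub, TensorProduct.smul_tmul', TensorProduct.smul_tmul', smul_eq_mul, smul_eq_mul,
      mul_assoc]
  exact LinearMap.congr_fun this z

/-- The Koszul differential of a pure tensor is obtained by applying this bilinear map to the
canonical element of `V* ⊗ V`. -/
def koszulB (a : H D t) (x : X.carrier) (ω : ExteriorAlgebra ℂ (h × Module.Dual ℂ h)) :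
    Module.Dual ℂ (h × Module.Dual ℂ h) →ₗ[ℂ] h × Module.Dual ℂ h →ₗ[ℂ] koszulSpace X :=
  LinearMap.mk₂ ℂ
    (fun (ξ : Module.Dual ℂ (h × Module.Dual ℂ h)) (v : h × Module.Dual ℂ h) =>
      (a * vMap D t v) ⊗ₜ[ℂ] (x ⊗ₜ[ℂ] ctr ξ ω) - a ⊗ₜ[ℂ] ((vMap D t v • x) ⊗ₜ[ℂ] ctr ξ ω))
    (fun ξ ξ' v => by
      simp only [map_add, LinearMap.add_apply, TensorProduct.tmul_add]; abel)
    (fun r ξ v => by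
      simp only [map_smul, LinearMap.smul_apply, TensorProduct.tmul_smul, smul_sub])
    (fun ξ v v' => by
      simp only [map_add, mul_add, add_smul, TensorProduct.tmul_add, TensorProduct.add_tmul]
      abel)
    (fun r ξ v => by
      simp only [map_smul, mul_smul_comm, smul_assoc, TensorProduct.tmul_smul,
        ← TensorProduct.smul_tmul', smul_sub])

omit [FiniteDimensional ℂ h] in
lemma koszulB_apply (a : H D t) (x : X.carrier) (ω : ExteriorAlgebra ℂ (h × Module.Dual ℂ h))
    (ξ : Module.Dual ℂ (h × Module.Dual ℂ h)) (v : h × Module.Dual ℂ h) :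
    koszulB X a x ω ξ v =
      (a * vMap D t v) ⊗ₜ[ℂ] (x ⊗ₜ[ℂ] ctr ξ ω) - a ⊗ₜ[ℂ] ((vMap D t v • x) ⊗ₜ[ℂ] ctr ξ ω) :=
  rfl

lemma koszulRep_koszulB (g : D.G) (a : H D t) (x : X.carrier)
    (ω : ExteriorAlgebra ℂ (h × Module.Dual ℂ h)) (ξ : Module.Dual ℂ (h × Module.Dual ℂ h))
    (v : h × Module.Dual ℂ h) :
    koszulRep X g (koszulB X a x ω (ξ ∘ₗ vRep D g) v) =
      koszulB X (a * gen D t (.g g⁻¹)) (gen D t (.g g) • x) (ExteriorAlgebra.map (vRep D g) ω) ξ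
        (vRep D g v) := by
  have e3 : vMap D t v * gen D t (.g g⁻¹) = gen D t (.g g⁻¹) * vMap D t (vRep D g v) := by
    rw [gen_g_vMap, ← Module.End.mul_apply, ← map_mul, inv_mul_cancel, map_one]
    rfl
  rw [koszulB_apply, koszulB_apply, map_sub, koszulRep_tmul, koszulRep_tmul, extSpaceRep_tmul,
    extSpaceRep_tmul, ctr_map, mul_assoc, e3, mul_assoc, smul_smul, smul_smul,
    gen_g_vMap D t g v]

lemma koszulD_koszulRep (g : D.G) (z : koszulSpace X) :
    koszulD X (koszulRep X g z) = koszulRep X g (koszulD X z) := by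
  have : koszulD X ∘ₗ koszulRep X g = koszulRep X g ∘ₗ koszulD X :=
    koszulSpace_ext X fun a x ω => by
      have h1 : koszulD X (a ⊗ₜ (x ⊗ₜ ω)) = _ := (koszulD_tmul X a x ω).trans
        (sum_coord_comp_basis (vBasis h) (vEquiv D g⁻¹) (koszulB X a x ω)).symm
      rw [LinearMap.comp_apply, LinearMap.comp_apply, h1, map_sum, koszulRep_tmul,
        extSpaceRep_tmul, koszulD_tmul]
      refine Finset.sum_congr rfl fun j _ => ?_
      have e1 : ((vBasis h).coord j) ∘ₗ ((vEquiv D g⁻¹).symm : _ →ₗ[ℂ] _) =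
          (vBasis h).coord j ∘ₗ vRep D g := by
        refine LinearMap.ext fun v => ?_
        change (vBasis h).coord j (vRep D g⁻¹⁻¹ v) = (vBasis h).coord j (vRep D g v)
        rw [inv_inv]
      have e2 : vRep D g (vEquiv D g⁻¹ (vBasis h j)) = vBasis h j := by
        change (vRep D g * vRep D g⁻¹) (vBasis h j) = _
        rw [← map_mul, mul_inv_cancel, map_one]
        rfl
      rw [e1, koszulRep_koszulB, e2, koszulB_apply]
  exact LinearMap.congr_fun this z

end Koszul

end Cherednik

namespace Cherednik
variable {h : Type u} [AddCommGroup h] [Module ℂ h]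

section KoszulSquare

variable {D : Datum h} {t : ℂ} (X : GrMod.{u, v} D t)

lemma reflForm_eq (s : reflections D.G) (u v : h × Module.Dual ℂ h) :
    reflForm s u v = rootForm D s u * corootForm D s v - rootForm D s v * corootForm D s u := rfl

/-- The obstruction to `d² = 0` attached to a reflection. -/
def koszulTheta (s : reflections D.G) : Module.End ℂ (extSpace X) :=
  TensorProduct.map LinearMap.id (ctr (rootForm D s) ∘ₗ ctr (corootForm D s))

lemma koszulTheta_tmul (s : reflections D.G) (x : X.carrier)
    (ω : ExteriorAlgebra ℂ (h × Module.Dual ℂ h)) :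
    koszulTheta X s (x ⊗ₜ ω) = x ⊗ₜ ctr (rootForm D s) (ctr (corootForm D s) ω) := rfl

lemma koszulTheta_extSpaceRep (s : reflections D.G) (x : X.carrier)
    (ω : ExteriorAlgebra ℂ (h × Module.Dual ℂ h)) :
    koszulTheta X s (extSpaceRep X (D.refl s) (x ⊗ₜ ω)) =
      (gen D t (.g (D.refl s)) • x) ⊗ₜ ctr (rootForm D s) (ctr (corootForm D s) ω) := by
  rw [extSpaceRep_tmul, koszulTheta_tmul, ctr_ctr_map_refl]

variable [FiniteDimensional ℂ h]

lemma sum_apply_smul_ctr (ξ : Module.Dual ℂ (h × Module.Dual ℂ h))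
    (ω : ExteriorAlgebra ℂ (h × Module.Dual ℂ h)) :
    ∑ j, ξ (vBasis h j) • ctr ((vBasis h).coord j) ω = ctr ξ ω := by
  have h1 : ∑ j, ξ (vBasis h j) • (vBasis h).coord j = ξ := by
    refine (vBasis h).ext fun i => ?_
    classical
    simp [Finsupp.single_apply]
  conv_rhs => rw [← h1, map_sum, LinearMap.sum_apply]
  simp only [map_smul, LinearMap.smul_apply]

lemma sum_reflForm_smul_ctr_ctr (s : reflections D.G)
    (ω : ExteriorAlgebra ℂ (h × Module.Dual ℂ h)) :
    ∑ j, ∑ k, reflForm s (vBasis h j) (vBasis h k) •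
        ctr ((vBasis h).coord k) (ctr ((vBasis h).coord j) ω) =
      -((2 : ℂ) • ctr (rootForm D s) (ctr (corootForm D s) ω)) := by
  have key : ∀ ξ η : Module.Dual ℂ (h × Module.Dual ℂ h),
      ∑ j, ∑ k, (ξ (vBasis h j) * η (vBasis h k)) •
        ctr ((vBasis h).coord k) (ctr ((vBasis h).coord j) ω) = ctr η (ctr ξ ω) := by
    intro ξ η
    conv_rhs => rw [← sum_apply_smul_ctr ξ ω, map_sum]
    refine Finset.sum_congr rfl fun j _ => ?_
    rw [map_smul, ← sum_apply_smul_ctr η, Finset.smul_sum]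
    simp only [smul_smul]
  have h1 := key (rootForm D s) (corootForm D s)
  have h2 := key (corootForm D s) (rootForm D s)
  simp only [reflForm_eq, sub_smul, Finset.sum_sub_distrib]
  rw [h1]
  simp only [mul_comm (rootForm D s _)] at h2 ⊢
  rw [h2, ctr_comm, two_smul]
  abel

lemma koszulD_koszulD_tmul (a : H D t) (x : X.carrier)
    (ω : ExteriorAlgebra ℂ (h × Module.Dual ℂ h)) :
    koszulD X (koszulD X (a ⊗ₜ (x ⊗ₜ ω))) =
      ∑ s, D.c s • ((a * gen D t (.g (D.refl s))) ⊗ₜ koszulTheta X s (x ⊗ₜ ω) -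
        a ⊗ₜ ((gen D t (.g (D.refl s)) • x) ⊗ₜ
          ctr (rootForm D s) (ctr (corootForm D s) ω))) := by
  set b := vBasis h with hb
  set V := vMap D t with hV
  set F : _ → _ → koszulSpace X := fun j k =>
    (a * V (b j) * V (b k)) ⊗ₜ (x ⊗ₜ ctr (b.coord k) (ctr (b.coord j) ω))
    - (a * V (b j)) ⊗ₜ ((V (b k) • x) ⊗ₜ ctr (b.coord k) (ctr (b.coord j) ω))
    - (a * V (b k)) ⊗ₜ ((V (b j) • x) ⊗ₜ ctr (b.coord k) (ctr (b.coord j) ω))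
    + a ⊗ₜ ((V (b k) • V (b j) • x) ⊗ₜ ctr (b.coord k) (ctr (b.coord j) ω)) with hF
  have h1 : koszulD X (koszulD X (a ⊗ₜ (x ⊗ₜ ω))) = ∑ j, ∑ k, F j k := by
    rw [koszulD_tmul, map_sum]
    refine Finset.sum_congr rfl fun j _ => ?_
    rw [map_sub, koszulD_tmul, koszulD_tmul, ← Finset.sum_sub_distrib]
    refine Finset.sum_congr rfl fun k _ => ?_
    simp only [hF, hV, hb]
    abel
  have h2 : ∀ j k, F j k + F k j = -∑ s, (D.c s * reflForm s (b j) (b k)) •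
      ((a * gen D t (.g (D.refl s))) ⊗ₜ (x ⊗ₜ ctr (b.coord k) (ctr (b.coord j) ω)) -
        a ⊗ₜ ((gen D t (.g (D.refl s)) • x) ⊗ₜ ctr (b.coord k) (ctr (b.coord j) ω))) := by
    intro j k
    set η := ctr (b.coord k) (ctr (b.coord j) ω) with hη
    have e0 : ctr (b.coord j) (ctr (b.coord k) ω) = -η := ctr_comm _ _ _
    have e1 : F j k + F k j =
        (a * (V (b j) * V (b k) - V (b k) * V (b j))) ⊗ₜ (x ⊗ₜ η) -
        a ⊗ₜ (((V (b j) * V (b k) - V (b k) * V (b j)) • x) ⊗ₜ η) := by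
      simp only [hF, e0]
      rw [← hη]
      simp only [TensorProduct.tmul_neg, mul_sub, sub_smul, TensorProduct.tmul_sub,
        TensorProduct.sub_tmul, mul_assoc, mul_smul]
      abel
    rw [e1, hV, vMap_commutator, mul_sub, mul_smul_comm, mul_one, sub_smul, smul_assoc, one_smul,
      TensorProduct.sub_tmul, TensorProduct.sub_tmul, TensorProduct.tmul_sub,
      ← TensorProduct.smul_tmul', ← TensorProduct.smul_tmul', TensorProduct.tmul_smul,
      sub_sub_sub_cancel_left, Finset.mul_sum, Finset.sum_smul, TensorProduct.sum_tmul,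
      TensorProduct.sum_tmul, TensorProduct.tmul_sum, ← Finset.sum_sub_distrib,
      ← Finset.sum_neg_distrib]
    refine Finset.sum_congr rfl fun s _ => ?_
    rw [mul_smul_comm, smul_assoc, ← TensorProduct.smul_tmul', ← TensorProduct.smul_tmul',
      TensorProduct.tmul_smul, smul_sub, neg_sub]
    rfl
  have h3 : (2 : ℂ) • koszulD X (koszulD X (a ⊗ₜ (x ⊗ₜ ω))) = ∑ j, ∑ k, (F j k + F k j) := by
    rw [h1, two_smul]
    conv_lhs => rw [add_comm, Finset.sum_comm]
    simp only [Finset.sum_add_distrib]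
    rw [add_comm]
    congr 1
    exact Finset.sum_comm
  have h4 : ∀ s, ∑ j : Fin (Module.finrank ℂ (h × Module.Dual ℂ h)),
      ∑ k : Fin (Module.finrank ℂ (h × Module.Dual ℂ h)), (D.c s * reflForm s (b j) (b k)) •
      ((a * gen D t (.g (D.refl s))) ⊗ₜ[ℂ] (x ⊗ₜ[ℂ] ctr (b.coord k) (ctr (b.coord j) ω)) -
        a ⊗ₜ[ℂ] ((gen D t (.g (D.refl s)) • x) ⊗ₜ[ℂ] ctr (b.coord k) (ctr (b.coord j) ω))) =
      -((2 : ℂ) • D.c s • ((a * gen D t (.g (D.refl s))) ⊗ₜ[ℂ] koszulTheta X s (x ⊗ₜ[ℂ] ω) -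
        a ⊗ₜ[ℂ] ((gen D t (.g (D.refl s)) • x) ⊗ₜ
          ctr (rootForm D s) (ctr (corootForm D s) ω)))) := by
    intro s
    set L : ExteriorAlgebra ℂ (h × Module.Dual ℂ h) →ₗ[ℂ] koszulSpace X :=
      TensorProduct.mk ℂ (H D t) (extSpace X) (a * gen D t (.g (D.refl s))) ∘ₗ
        TensorProduct.mk ℂ X.carrier _ x -
      TensorProduct.mk ℂ (H D t) (extSpace X) a ∘ₗ
        TensorProduct.mk ℂ X.carrier _ (gen D t (.g (D.refl s)) • x) with hL
    have := congrArg L (sum_reflForm_smul_ctr_ctr s ω)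
    rw [map_sum, map_neg, map_smul] at this
    simp only [map_sum, map_smul] at this
    rw [smul_comm]
    refine Eq.trans ?_ ((congrArg (D.c s • ·) this).trans (smul_neg _ _))
    simp only [Finset.smul_sum, smul_smul]
    rfl
  have h5 : (2 : ℂ) • koszulD X (koszulD X (a ⊗ₜ (x ⊗ₜ ω))) = (2 : ℂ) •
      ∑ s, D.c s • ((a * gen D t (.g (D.refl s))) ⊗ₜ koszulTheta X s (x ⊗ₜ ω) -
        a ⊗ₜ ((gen D t (.g (D.refl s)) • x) ⊗ₜ
          ctr (rootForm D s) (ctr (corootForm D s) ω))) := by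
    rw [h3]
    simp only [h2, Finset.sum_neg_distrib]
    rw [Finset.sum_congr rfl fun j _ => Finset.sum_comm, Finset.sum_comm,
      Finset.sum_congr rfl fun s _ => h4 s, Finset.sum_neg_distrib, neg_neg, Finset.smul_sum]
  exact smul_right_injective _ (two_ne_zero (α := ℂ)) h5

lemma koszulD_koszulD_eq (z : koszulSpace X) :
    koszulD X (koszulD X z) = ∑ s, D.c s •
      TensorProduct.map (LinearMap.mulRight ℂ (gen D t (.g (D.refl s)))) (koszulTheta X s)
        (z - koszulRep X (D.refl s) z) := by
  have : koszulD X ∘ₗ koszulD X = ∑ s, D.c s •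
      (TensorProduct.map (LinearMap.mulRight ℂ (gen D t (.g (D.refl s)))) (koszulTheta X s) ∘ₗ
        (LinearMap.id - koszulRep X (D.refl s))) := koszulSpace_ext X fun a x ω => by
    rw [LinearMap.comp_apply, koszulD_koszulD_tmul, LinearMap.sum_apply]
    refine Finset.sum_congr rfl fun s _ => ?_
    rw [LinearMap.smul_apply, LinearMap.comp_apply, LinearMap.sub_apply, LinearMap.id_apply,
      map_sub, koszulRep_tmul, TensorProduct.map_tmul, TensorProduct.map_tmul,
      koszulTheta_extSpaceRep]
    congr 3
    rw [LinearMap.mulRight_apply, mul_assoc, ← gen_g_mul, inv_mul_cancel, gen_g_one, mul_one]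
  have h2 := LinearMap.congr_fun this z
  rw [LinearMap.sum_apply] at h2
  exact h2

lemma koszulD_koszulD {z : koszulSpace X} (hz : z ∈ (koszulRep X).invariants) :
    koszulD X (koszulD X z) = 0 := by
  rw [koszulD_koszulD_eq]
  refine Finset.sum_eq_zero fun s _ => ?_
  rw [hz (D.refl s), sub_self, map_zero, smul_zero]

end KoszulSquare

section Augmentation

variable {D : Datum h} {t : ℂ} (X : GrMod.{u, v} D t)

/-- The projection `X ⊗ ⋀ V → X ⊗ ⋀⁰ V = X`. -/
def extAug : extSpace X →ₗ[ℂ] X.carrier :=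
  (TensorProduct.rid ℂ X.carrier).toLinearMap ∘ₗ
    TensorProduct.map LinearMap.id ExteriorAlgebra.algebraMapInv.toLinearMap

lemma extAug_tmul (x : X.carrier) (ω : ExteriorAlgebra ℂ (h × Module.Dual ℂ h)) :
    extAug X (x ⊗ₜ ω) = ExteriorAlgebra.algebraMapInv ω • x := by
  rw [extAug, LinearMap.comp_apply, TensorProduct.map_tmul]
  exact TensorProduct.rid_tmul _ _

/-- The augmentation of the Koszul complex. -/
def koszulAug : koszulSpace X →ₗ[ℂ] X.carrier :=
  TensorProduct.lift (Algebra.lsmul ℂ ℂ X.carrier : H D t →ₐ[ℂ] _).toLinearMap ∘ₗ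
    TensorProduct.map LinearMap.id (extAug X)

lemma koszulAug_tmul (a : H D t) (m : extSpace X) :
    koszulAug X (a ⊗ₜ m) = a • extAug X m := by
  rw [koszulAug, LinearMap.comp_apply, TensorProduct.map_tmul]
  exact TensorProduct.lift.tmul _ _

lemma koszulAug_smul (a : H D t) (z : koszulSpace X) :
    koszulAug X (a • z) = a • koszulAug X z := by
  induction z using TensorProduct.induction_on with
  | zero => rw [smul_zero, map_zero, smul_zero]
  | add z z' h1 h2 => rw [smul_add, map_add, h1, h2, map_add, smul_add]
  | tmul b m => rw [TensorProduct.smul_tmul', koszulAug_tmul, koszulAug_tmul, smul_eq_mul, mul_smul]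

lemma extAug_extSpaceRep (g : D.G) (m : extSpace X) :
    extAug X (extSpaceRep X g m) = gen D t (.g g) • extAug X m := by
  induction m using TensorProduct.induction_on with
  | zero => rw [map_zero, map_zero, smul_zero]
  | add z z' h1 h2 => rw [map_add, map_add, h1, h2, map_add, smul_add]
  | tmul x ω =>
    rw [extSpaceRep_tmul, extAug_tmul, extAug_tmul, smul_comm]
    congr 1
    refine congrArg (· • x) ?_
    have : (ExteriorAlgebra.algebraMapInv : ExteriorAlgebra ℂ (h × Module.Dual ℂ h) →ₐ[ℂ] ℂ).comp
        (ExteriorAlgebra.map (vRep D g)) = ExteriorAlgebra.algebraMapInv := by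
      ext v <;> simp [ExteriorAlgebra.algebraMapInv]
    exact AlgHom.congr_fun this ω

lemma koszulAug_koszulRep (g : D.G) (z : koszulSpace X) :
    koszulAug X (koszulRep X g z) = koszulAug X z := by
  induction z using TensorProduct.induction_on with
  | zero => rw [map_zero, map_zero]
  | add z z' h1 h2 => rw [map_add, map_add, h1, h2, map_add]
  | tmul a m =>
    rw [koszulRep_tmul, koszulAug_tmul, koszulAug_tmul, extAug_extSpaceRep, smul_smul, mul_assoc,
      ← gen_g_mul, inv_mul_cancel, gen_g_one, mul_one]

lemma averageMap_apply {G : Type*} [Group G] [Fintype G] [Invertible (Fintype.card G : ℂ)]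
    {M : Type*} [AddCommGroup M] [Module ℂ M] (ρ : Representation ℂ G M) (m : M) :
    ρ.averageMap m = (⅟(Fintype.card G : ℂ)) • ∑ g, ρ g m := by
  simp [Representation.averageMap, GroupAlgebra.average, map_sum, Representation.asAlgebraHom_of]

/-- An equivariant map commutes with averaging. -/
lemma map_averageMap {G : Type*} [Group G] [Fintype G] [Invertible (Fintype.card G : ℂ)]
    {M N : Type*} [AddCommGroup M] [Module ℂ M] [AddCommGroup N] [Module ℂ N]
    (ρ : Representation ℂ G M) (σ : Representation ℂ G N) (f : M →ₗ[ℂ] N)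
    (hf : ∀ g m, f (ρ g m) = σ g (f m)) (m : M) : f (ρ.averageMap m) = σ.averageMap (f m) := by
  rw [averageMap_apply, averageMap_apply, map_smul, map_sum]
  simp only [hf]

lemma averageMap_mem {G : Type*} [Group G] [Fintype G] [Invertible (Fintype.card G : ℂ)]
    {M : Type*} [AddCommGroup M] [Module ℂ M] (ρ : Representation ℂ G M) {S : Submodule ℂ M}
    (hS : ∀ g, ∀ m ∈ S, ρ g m ∈ S) {m : M} (hm : m ∈ S) : ρ.averageMap m ∈ S := by
  rw [averageMap_apply]
  exact S.smul_mem _ (S.sum_mem fun g _ => hS g m hm)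

lemma averageMap_map {G : Type*} [Group G] [Fintype G] [Invertible (Fintype.card G : ℂ)]
    {M : Type*} [AddCommGroup M] [Module ℂ M] (ρ : Representation ℂ G M) (g : G) (m : M) :
    ρ.averageMap (ρ g m) = ρ.averageMap m := by
  rw [averageMap_apply, averageMap_apply]
  congr 1
  exact Fintype.sum_equiv (Equiv.mulRight g) _ _ fun g' => by
    rw [Equiv.coe_mulRight, map_mul, Module.End.mul_apply]

lemma koszulAug_koszulAv (z : koszulSpace X) : koszulAug X (koszulAv X z) = koszulAug X z := by
  rw [averageMap_apply, map_smul, map_sum]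
  simp only [koszulAug_koszulRep, Finset.sum_const, Finset.card_univ]
  rw [← Nat.cast_smul_eq_nsmul ℂ, smul_smul, invOf_mul_self, one_smul]

lemma koszulAv_smul (a : H D t) (z : koszulSpace X) : koszulAv X (a • z) = a • koszulAv X z := by
  rw [averageMap_apply, averageMap_apply, smul_comm a, Finset.smul_sum (r := a)]
  exact congrArg _ (Finset.sum_congr rfl fun g _ => koszulRep_smul X g a z)

variable [FiniteDimensional ℂ h]

lemma koszulAug_koszulD (z : koszulSpace X) : koszulAug X (koszulD X z) = 0 := by
  have : koszulAug X ∘ₗ koszulD X = 0 := koszulSpace_ext X fun a x ω => by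
    rw [LinearMap.comp_apply, koszulD_tmul, map_sum, LinearMap.zero_apply]
    refine Finset.sum_eq_zero fun j _ => ?_
    rw [map_sub, koszulAug_tmul, koszulAug_tmul, extAug_tmul, extAug_tmul, mul_smul,
      smul_comm (vMap D t _), sub_self]
  exact LinearMap.congr_fun this z

lemma koszulD_koszulAv (z : koszulSpace X) : koszulD X (koszulAv X z) = koszulAv X (koszulD X z) :=
  map_averageMap _ _ _ (koszulD_koszulRep X) z

end Augmentation

end Cherednik

namespace Cherednik
variable {h : Type u} [AddCommGroup h] [Module ℂ h]

section KoszulSubspaces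

variable {D : Datum h} {t : ℂ} (X : GrMod.{u, v} D t)

/-- The subspace `X ⊗ ⋀ᵖ V`. -/
def extPart (p : ℕ) : Submodule ℂ (extSpace X) :=
  tens ⊤ (⋀[ℂ]^p (h × Module.Dual ℂ h))

/-- The `G`-invariants in `H ⊗ N`, for a subspace `N` of `X ⊗ ⋀ V`. -/
def koszulInv (N : Submodule ℂ (extSpace X)) : Submodule ℂ (koszulSpace X) :=
  tens ⊤ N ⊓ (koszulRep X).invariants

variable {X}

lemma koszulInv_mono {N N' : Submodule ℂ (extSpace X)} (h : N ≤ N') :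
    koszulInv X N ≤ koszulInv X N' := inf_le_inf_right _ (tens_mono le_rfl h)

lemma koszulRep_mem_tens {A : Submodule ℂ (H D t)} {N : Submodule ℂ (extSpace X)}
    (hA : ∀ g, ∀ a ∈ A, a * gen D t (.g g) ∈ A) (hN : ∀ g, ∀ m ∈ N, extSpaceRep X g m ∈ N)
    (g : D.G) {z : koszulSpace X} (hz : z ∈ tens A N) : koszulRep X g z ∈ tens A N :=
  mem_of_mem_tens (koszulRep X g) _ (fun a ha m hm =>
    tmul_mem_tens (hA g⁻¹ a ha) (hN g m hm)) hz

lemma extSpaceRep_mem_extPart (g : D.G) {p : ℕ} {m : extSpace X} (hm : m ∈ extPart X p) :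
    extSpaceRep X g m ∈ extPart X p :=
  mem_of_mem_tens (extSpaceRep X g) _ (fun _ _ _ hω =>
    tmul_mem_tens (A := (⊤ : Submodule ℂ X.carrier)) trivial (map_mem_exteriorPower _ hω)) hm

lemma koszulAv_mem_koszulInv {N : Submodule ℂ (extSpace X)}
    (hN : ∀ g, ∀ m ∈ N, extSpaceRep X g m ∈ N) {z : koszulSpace X} (hz : z ∈ tens ⊤ N) :
    koszulAv X z ∈ koszulInv X N :=
  ⟨averageMap_mem _ (fun g _ => koszulRep_mem_tens (A := (⊤ : Submodule ℂ (H D t)))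
    (fun _ _ _ => trivial) hN g) hz,
    Representation.averageMap_invariant _ z⟩

lemma koszulAv_eq_self {z : koszulSpace X} (hz : z ∈ (koszulRep X).invariants) :
    koszulAv X z = z := Representation.averageMap_id _ z hz

/-- An element of `H ⊗ X` of filtration degree zero is determined up to averaging by its image
in `X`. -/
lemma koszulAv_eq_of_mem_fil_one {z : koszulSpace X} (hz : z ∈ tens (fil D t 1) (extPart X 0)) :
    koszulAv X z = koszulAv X (1 ⊗ₜ (koszulAug X z ⊗ₜ 1)) := by
  set f : koszulSpace X →ₗ[ℂ] koszulSpace X := koszulAv X -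
    koszulAv X ∘ₗ TensorProduct.mk ℂ (H D t) (extSpace X) 1 ∘ₗ
      (TensorProduct.mk ℂ X.carrier _).flip 1 ∘ₗ koszulAug X with hf
  have : f z ∈ (⊥ : Submodule ℂ (koszulSpace X)) := by
    refine mem_of_mem_tens₃ f ⊥ (fun a ha x _ ω hω => ?_) hz
    obtain ⟨r, rfl⟩ := mem_exteriorPower_zero.1 hω
    obtain ⟨k, rfl⟩ := mem_fil_one ha
    rw [Submodule.mem_bot]
    set L : MonoidAlgebra ℂ D.G →ₗ[ℂ] koszulSpace X := f ∘ₗ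
      (TensorProduct.mk ℂ (H D t) (extSpace X)).flip (x ⊗ₜ algebraMap ℂ _ r) ∘ₗ
      (groupAlg D t).toLinearMap with hL
    have hL0 : L = 0 := MonoidAlgebra.lhom_ext' fun g => LinearMap.ext_ring (by
      change f (groupAlg D t (MonoidAlgebra.of ℂ D.G g) ⊗ₜ (x ⊗ₜ algebraMap ℂ _ r)) = 0
      rw [groupAlg_of]
      change koszulAv X _ - koszulAv X (1 ⊗ₜ (koszulAug X _ ⊗ₜ 1)) = 0
      rw [← averageMap_map (koszulRep X) g, koszulRep_tmul, ← gen_g_mul, mul_inv_cancel, gen_g_one,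
        koszulAug_tmul, extAug_tmul, extSpaceRep_tmul, AlgHom.commutes, sub_eq_zero,
        Algebra.algebraMap_eq_smul_one, map_smul, map_one, smul_eq_mul, mul_one, smul_comm,
        TensorProduct.tmul_smul]
      rfl)
    exact LinearMap.congr_fun hL0 k
  exact sub_eq_zero.1 ((Submodule.mem_bot ℂ).1 this)

variable [FiniteDimensional ℂ h]

lemma koszulD_mem_tens {p : ℕ} {z : koszulSpace X} (hz : z ∈ tens ⊤ (extPart X (p + 1))) :
    koszulD X z ∈ tens ⊤ (extPart X p) := by
  refine mem_of_mem_tens₃ (koszulD X) _ (fun a _ x _ ω hω => ?_) hz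
  rw [koszulD_tmul]
  exact Submodule.sum_mem _ fun j _ => sub_mem
    (tmul_mem_tens trivial (tmul_mem_tens trivial (ctr_mem_exteriorPower _ hω)))
    (tmul_mem_tens trivial (tmul_mem_tens trivial (ctr_mem_exteriorPower _ hω)))

lemma koszulD_eq_zero {z : koszulSpace X} (hz : z ∈ tens ⊤ (extPart X 0)) : koszulD X z = 0 := by
  refine (Submodule.mem_bot ℂ).1 (mem_of_mem_tens₃ (koszulD X) ⊥ (fun a _ x _ ω hω => ?_) hz)
  rw [koszulD_tmul, Submodule.mem_bot]
  exact Finset.sum_eq_zero fun j _ => by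
    rw [ctr_exteriorPower_zero _ hω, TensorProduct.tmul_zero, TensorProduct.tmul_zero,
      TensorProduct.tmul_zero, TensorProduct.tmul_zero, sub_zero]

lemma koszulD_mem_invariants {z : koszulSpace X} (hz : z ∈ (koszulRep X).invariants) :
    koszulD X z ∈ (koszulRep X).invariants := fun g => by
  rw [← koszulD_koszulRep, hz g]

variable (X)

/-- The homotopy showing the exactness of the Koszul complex. -/
def koszulHomotopy : Module.End ℂ (koszulSpace X) :=
  ∑ j, TensorProduct.map (der D t ((vBasis h).coord j))
    (TensorProduct.map LinearMap.id (wedge (vBasis h j)))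

lemma koszulHomotopy_tmul (a : H D t) (x : X.carrier)
    (ω : ExteriorAlgebra ℂ (h × Module.Dual ℂ h)) :
    koszulHomotopy X (a ⊗ₜ (x ⊗ₜ ω)) =
      ∑ j, der D t ((vBasis h).coord j) a ⊗ₜ (x ⊗ₜ wedge (vBasis h j) ω) := by
  rw [koszulHomotopy, LinearMap.sum_apply]
  rfl

variable {X}

lemma koszulHomotopy_mem {p : ℕ} {z : koszulSpace X} (hz : z ∈ tens ⊤ (extPart X p)) :
    koszulHomotopy X z ∈ tens ⊤ (extPart X (p + 1)) := by
  refine mem_of_mem_tens₃ (koszulHomotopy X) _ (fun a _ x _ ω hω => ?_) hz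
  rw [koszulHomotopy_tmul]
  exact Submodule.sum_mem _ fun j _ =>
    tmul_mem_tens trivial (tmul_mem_tens trivial (wedge_mem_exteriorPower _ hω))

omit [FiniteDimensional ℂ h] in
lemma wedge_ctr_mem (v : h × Module.Dual ℂ h) (ξ : Module.Dual ℂ (h × Module.Dual ℂ h)) {p : ℕ}
    {ω : ExteriorAlgebra ℂ (h × Module.Dual ℂ h)} (hω : ω ∈ ⋀[ℂ]^p (h × Module.Dual ℂ h)) :
    wedge v (ctr ξ ω) ∈ ⋀[ℂ]^p (h × Module.Dual ℂ h) := by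
  cases p with
  | zero => rw [ctr_exteriorPower_zero ξ hω, map_zero]; exact zero_mem _
  | succ p => exact wedge_mem_exteriorPower v (ctr_mem_exteriorPower ξ hω)

lemma koszul_homotopy_formula {m p : ℕ} {z : koszulSpace X}
    (hz : z ∈ tens (fil D t (m + 1)) (extPart X p)) :
    koszulD X (koszulHomotopy X z) + koszulHomotopy X (koszulD X z) - ((m : ℂ) + p) • z ∈
      tens (fil D t m) (extPart X p) := by
  refine mem_of_mem_tens₃ (koszulD X ∘ₗ koszulHomotopy X + koszulHomotopy X ∘ₗ koszulD X -
    ((m : ℂ) + p) • LinearMap.id) _ (fun a ha x _ ω hω => ?_) hz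
  set b := vBasis h with hb
  set δ := fun j => der D t (b.coord j) with hd
  set R := fun j k => δ j (a * vMap D t (b k)) - δ j a * vMap D t (b k) - b.coord j (b k) • a
    with hR
  have hRm : ∀ j k, R j k ∈ fil D t m := fun j k => der_mul_vMap_sub_mem_fil (b.coord j) (b k) ha
  have e1 : koszulD X (koszulHomotopy X (a ⊗ₜ (x ⊗ₜ ω))) +
      koszulHomotopy X (koszulD X (a ⊗ₜ (x ⊗ₜ ω))) =
      ∑ j, ∑ k, (b.coord k (b j) • (δ j a * vMap D t (b k)) ⊗ₜ (x ⊗ₜ ω) +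
        R j k ⊗ₜ (x ⊗ₜ wedge (b j) (ctr (b.coord k) ω)) +
        b.coord j (b k) • a ⊗ₜ (x ⊗ₜ wedge (b j) (ctr (b.coord k) ω)) -
        b.coord k (b j) • δ j a ⊗ₜ ((vMap D t (b k) • x) ⊗ₜ ω)) := by
    rw [koszulHomotopy_tmul, koszulD_tmul, map_sum, map_sum]
    simp only [koszulD_tmul, map_sub, koszulHomotopy_tmul]
    simp only [← Finset.sum_sub_distrib]
    conv_lhs =>
      congr
      · skip
      · rw [Finset.sum_comm]
    rw [← Finset.sum_add_distrib]
    refine Finset.sum_congr rfl fun j _ => ?_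
    rw [← Finset.sum_add_distrib]
    refine Finset.sum_congr rfl fun k _ => ?_
    simp only [hR, hd, hb, ctr_wedge, TensorProduct.tmul_sub, TensorProduct.sub_tmul,
      TensorProduct.tmul_smul, ← TensorProduct.smul_tmul']
    abel
  have e2 : ∀ (j k) (m' : koszulSpace X), b.coord k (b j) • m' = if j = k then m' else 0 := by
    intro j k m'
    rw [Module.Basis.coord_apply, Module.Basis.repr_self, Finsupp.single_apply]
    split_ifs
    · exact one_smul _ _
    · exact zero_smul _ _
  have e3 := sum_wedge_ctr b hω
  have e4 : (koszulD X ∘ₗ koszulHomotopy X + koszulHomotopy X ∘ₗ koszulD X -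
      ((m : ℂ) + p) • LinearMap.id : Module.End ℂ (koszulSpace X)) (a ⊗ₜ (x ⊗ₜ ω)) =
      (∑ j, δ j a * vMap D t (b j) - (m : ℂ) • a) ⊗ₜ (x ⊗ₜ ω) +
      ∑ j, ∑ k, R j k ⊗ₜ (x ⊗ₜ wedge (b j) (ctr (b.coord k) ω)) -
      ∑ j, δ j a ⊗ₜ ((vMap D t (b j) • x) ⊗ₜ ω) := by
    have e5 : a ⊗ₜ[ℂ] (x ⊗ₜ[ℂ] ((p : ℂ) • ω)) =
        ∑ j, a ⊗ₜ[ℂ] (x ⊗ₜ[ℂ] wedge (b j) (ctr (b.coord j) ω)) := by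
      rw [← e3, TensorProduct.tmul_sum, TensorProduct.tmul_sum]
    have e6 : (koszulD X ∘ₗ koszulHomotopy X + koszulHomotopy X ∘ₗ koszulD X -
      ((m : ℂ) + p) • LinearMap.id : Module.End ℂ (koszulSpace X)) (a ⊗ₜ (x ⊗ₜ ω)) =
      (koszulD X (koszulHomotopy X (a ⊗ₜ (x ⊗ₜ ω))) +
      koszulHomotopy X (koszulD X (a ⊗ₜ (x ⊗ₜ ω)))) - ((m : ℂ) + p) • a ⊗ₜ (x ⊗ₜ ω) := rfl
    rw [e6, e1]
    simp only [Finset.sum_add_distrib, Finset.sum_sub_distrib, e2, Finset.sum_ite_eq,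
      Finset.mem_univ, if_true, Finset.sum_ite_eq']
    rw [TensorProduct.sub_tmul, TensorProduct.sum_tmul, add_smul, ← e5, TensorProduct.tmul_smul,
      TensorProduct.tmul_smul]
    simp only [TensorProduct.smul_tmul']
    abel
  rw [e4]
  refine sub_mem (add_mem (tmul_mem_tens (sum_der_mul_sub_mem_fil b ha)
    (tmul_mem_tens trivial hω)) (Submodule.sum_mem _ fun j _ => Submodule.sum_mem _ fun k _ => ?_))
    (Submodule.sum_mem _ fun j _ => ?_)
  · exact tmul_mem_tens (hRm j k) (tmul_mem_tens trivial (wedge_ctr_mem _ _ hω))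
  · exact tmul_mem_tens (der_mem_fil _ ha) (tmul_mem_tens trivial hω)

/-- One step of the descent proving exactness. -/
lemma exists_koszulD_sub_mem {m p : ℕ} (hmp : m + p ≠ 0) {z : koszulSpace X}
    (hz : z ∈ tens (fil D t (m + 1)) (extPart X p)) (hinv : z ∈ (koszulRep X).invariants)
    (hd : koszulD X z = 0) :
    ∃ w ∈ koszulInv X (extPart X (p + 1)), z - koszulD X w ∈ tens (fil D t m) (extPart X p) := by
  have hmp' : (m : ℂ) + p ≠ 0 := by exact_mod_cast hmp
  have h1 := koszul_homotopy_formula hz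
  rw [hd, map_zero, add_zero] at h1
  have h2 := averageMap_mem (koszulRep X) (fun g _ => koszulRep_mem_tens
    (fun g' a ha => mul_gen_g_mem_fil ha g') (fun g' _ => extSpaceRep_mem_extPart g') g) h1
  rw [map_sub, map_smul, koszulAv_eq_self hinv, ← koszulD_koszulAv] at h2
  refine ⟨((m : ℂ) + p)⁻¹ • koszulAv X (koszulHomotopy X z), Submodule.smul_mem _ _
    (koszulAv_mem_koszulInv (fun g _ => extSpaceRep_mem_extPart g)
      (koszulHomotopy_mem (tens_mono le_top le_rfl hz))), ?_⟩
  have h3 := Submodule.smul_mem _ (-((m : ℂ) + p)⁻¹) h2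
  convert h3 using 1
  rw [map_smul, smul_sub, neg_smul, neg_smul, smul_smul, inv_mul_cancel₀ hmp', one_smul]
  abel

omit [FiniteDimensional ℂ h] in
lemma exists_mem_tens_fil {N : Submodule ℂ (extSpace X)} {z : koszulSpace X}
    (hz : z ∈ tens ⊤ N) : ∃ n, z ∈ tens (fil D t n) N := by
  have h1 : (⨆ n, fil D t n) = ⊤ := top_le_iff.1 fun a _ => by
    obtain ⟨n, hn⟩ := exists_mem_fil a
    exact Submodule.mem_iSup_of_mem n hn
  rw [← h1, tens_iSup_left] at hz
  refine (Submodule.mem_iSup_of_directed _ ?_).1 hz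
  exact (show Monotone fun n => tens (fil D t n) N from
    fun m n hmn => tens_mono (fil_mono hmn) le_rfl).directed_le

/-- The Koszul complex is exact in positive degrees. -/
lemma exists_koszulD_eq {p : ℕ} (hp : p ≠ 0) {z : koszulSpace X}
    (hz : z ∈ koszulInv X (extPart X p)) (hd : koszulD X z = 0) :
    ∃ w ∈ koszulInv X (extPart X (p + 1)), koszulD X w = z := by
  obtain ⟨n, hn⟩ := exists_mem_tens_fil hz.1
  have hinv := hz.2
  clear hz
  induction n generalizing z with
  | zero =>
    rw [fil_zero, tens_bot_left, Submodule.mem_bot] at hn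
    exact ⟨0, zero_mem _, by rw [map_zero, hn]⟩
  | succ m ih =>
    obtain ⟨w, hw, hw'⟩ := exists_koszulD_sub_mem (by omega) hn hinv hd
    obtain ⟨w', hw1, hw2⟩ := ih (by rw [map_sub, hd, koszulD_koszulD X hw.2, sub_zero]) hw'
      (sub_mem hinv (koszulD_mem_invariants hw.2))
    exact ⟨w' + w, add_mem hw1 hw, by rw [map_add, hw2, sub_add_cancel]⟩

/-- The Koszul complex is exact in degree zero. -/
lemma exists_koszulD_eq_of_koszulAug_eq_zero {z : koszulSpace X}
    (hz : z ∈ koszulInv X (extPart X 0)) (hd : koszulAug X z = 0) :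
    ∃ w ∈ koszulInv X (extPart X 1), koszulD X w = z := by
  obtain ⟨n, hn⟩ := exists_mem_tens_fil hz.1
  have hinv := hz.2
  clear hz
  induction n generalizing z with
  | zero =>
    rw [fil_zero, tens_bot_left, Submodule.mem_bot] at hn
    exact ⟨0, zero_mem _, by rw [map_zero, hn]⟩
  | succ m ih =>
    cases m with
    | zero =>
      have := koszulAv_eq_of_mem_fil_one hn
      rw [hd, TensorProduct.zero_tmul, TensorProduct.tmul_zero, map_zero,
        koszulAv_eq_self hinv] at this
      exact ⟨0, zero_mem _, by rw [map_zero, this]⟩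
    | succ m =>
      obtain ⟨w, hw, hw'⟩ := exists_koszulD_sub_mem (by omega) hn hinv
        (koszulD_eq_zero (tens_mono le_top le_rfl hn))
      obtain ⟨w', hw1, hw2⟩ := ih (by rw [map_sub, hd, koszulAug_koszulD, sub_zero]) hw'
        (sub_mem hinv (koszulD_mem_invariants hw.2))
      exact ⟨w' + w, add_mem hw1 hw, by rw [map_add, hw2, sub_add_cancel]⟩

end KoszulSubspaces

end Cherednik

namespace Cherednik
variable {h : Type u} [AddCommGroup h] [Module ℂ h]

section GradingOfH

variable (D : Datum h) (t : ℂ)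

lemma lift_zpow_deg_rel {a b : FreeAlgebra ℂ (Gen D)} (hab : Rel D t a b) :
    FreeAlgebra.lift ℂ (fun a => (2 : ℂ) ^ a.deg • gen D t a) a =
      FreeAlgebra.lift ℂ (fun a => (2 : ℂ) ^ a.deg • gen D t a) b := by
  have h2 : ((2 : ℂ) ^ (-1 : ℤ)) * (2 : ℂ) ^ (1 : ℤ) = 1 := by norm_num
  induction hab with
  | y_add a b => simp [gen_y_add, Gen.deg]
  | y_smul r a => simp [gen_y_smul, Gen.deg, smul_comm r]
  | x_add a b => simp [gen_x_add, Gen.deg]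
  | x_smul r a => simp [gen_x_smul, Gen.deg, smul_comm r]
  | g_one => simp [gen_g_one, Gen.deg]
  | g_mul a b => simp [gen_g_mul, Gen.deg]
  | g_y a b => simp [gen_g_y, Gen.deg]
  | g_x a b => simp [gen_g_x, Gen.deg]
  | y_comm a b => simp [gen_y_comm D t a b, Gen.deg]
  | x_comm a b => simp [gen_x_comm D t a b, Gen.deg]
  | y_x a b =>
    have h3 := gen_y_x D t a b
    simp only [map_sub, map_mul, map_sum, map_smul, FreeAlgebra.lift_ι_apply, Gen.deg,
      AlgHom.commutes, zpow_zero, one_smul, smul_mul_smul_comm, h2]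
    rw [mul_comm, h2, one_smul, h3, map_mul]

/-- The automorphism of `H_{t,c}` acting by `2 ^ n` in degree `n`. -/
def tauH : H D t →ₐ[ℂ] H D t :=
  RingQuot.liftAlgHom ℂ ⟨FreeAlgebra.lift ℂ fun a => (2 : ℂ) ^ a.deg • gen D t a,
    fun _ _ hab => lift_zpow_deg_rel D t hab⟩

lemma tauH_gen (a : Gen D) : tauH D t (gen D t a) = (2 : ℂ) ^ a.deg • gen D t a := by
  have := RingQuot.liftAlgHom_mkAlgHom_apply ℂ (s := Rel D t)
    (FreeAlgebra.lift ℂ fun a => (2 : ℂ) ^ a.deg • gen D t a)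
    (fun _ _ hab => lift_zpow_deg_rel D t hab) (FreeAlgebra.ι ℂ a)
  rw [FreeAlgebra.lift_ι_apply] at this
  exact this

lemma tauH_gen_g (g : D.G) : tauH D t (gen D t (.g g)) = gen D t (.g g) := by
  rw [tauH_gen, Gen.deg, zpow_zero, one_smul]

lemma degPart_le_deg (n : ℤ) : degPart D t n ≤ deg (tauH D t).toLinearMap n := by
  refine Submodule.span_le.2 ?_
  rintro _ ⟨l, rfl, rfl⟩
  rw [SetLike.mem_coe, mem_deg, AlgHom.toLinearMap_apply]
  induction l with
  | nil => simp
  | cons a l ih =>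
    rw [List.map_cons, List.prod_cons, map_mul, ih, tauH_gen, List.map_cons, List.sum_cons,
      smul_mul_smul_comm, zpow_add₀ two_ne_zero]

lemma isGrading_tauH : IsGrading (tauH D t).toLinearMap := by
  have hmul : ∀ {i j : ℤ} {a b : H D t}, a ∈ deg (tauH D t).toLinearMap i →
      b ∈ deg (tauH D t).toLinearMap j → a * b ∈ deg (tauH D t).toLinearMap (i + j) := by
    intro i j a b ha hb
    rw [mem_deg, AlgHom.toLinearMap_apply] at *
    rw [map_mul, ha, hb, smul_mul_smul_comm, zpow_add₀ two_ne_zero]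
  refine top_le_iff.1 fun a _ => ?_
  induction a using H.induction with
  | hs r => exact Submodule.mem_iSup_of_mem 0 (mem_deg.2 (by simp))
  | hg a => exact Submodule.mem_iSup_of_mem a.deg (mem_deg.2 (tauH_gen D t a))
  | ha a b h1 h2 => exact add_mem (h1 trivial) (h2 trivial)
  | hm a b h1 h2 =>
    obtain ⟨s, f, hf, rfl⟩ := exists_sum_of_mem_iSup (h1 trivial)
    obtain ⟨s', f', hf', rfl⟩ := exists_sum_of_mem_iSup (h2 trivial)
    rw [Finset.sum_mul]
    refine Submodule.sum_mem _ fun i _ => ?_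
    rw [Finset.mul_sum]
    exact Submodule.sum_mem _ fun j _ => Submodule.mem_iSup_of_mem (i + j) (hmul (hf i) (hf' j))

end GradingOfH

section GradingOfModules

variable {D : Datum h} {t : ℂ}

/-- The grading operator of a graded module. -/
def GrMod.tau (X : GrMod.{u, v} D t) : Module.End ℂ X.carrier := gradingOp X.isInternal

lemma GrMod.deg_tau (X : GrMod.{u, v} D t) (n : ℤ) : deg X.tau n = X.piece n := deg_gradingOp _ n

lemma GrMod.isGrading_tau (X : GrMod.{u, v} D t) : IsGrading X.tau := isGrading_gradingOp _

lemma GrMod.tau_apply (X : GrMod.{u, v} D t) {n : ℤ} {x : X.carrier} (hx : x ∈ X.piece n) :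
    X.tau x = (2 : ℂ) ^ n • x := gradingOp_apply _ hx

lemma GrMod.tau_smul (X : GrMod.{u, v} D t) (a : H D t) (x : X.carrier) :
    X.tau (a • x) = tauH D t a • X.tau x := by
  induction a using H.induction generalizing x with
  | hs r => rw [AlgHom.commutes, algebraMap_smul, algebraMap_smul, map_smul]
  | ha a b h1 h2 => rw [add_smul, map_add, h1, h2, map_add, add_smul]
  | hm a b h1 h2 => rw [mul_smul, h1, h2, map_mul, mul_smul]
  | hg a =>
    have : X.tau ∘ₗ Algebra.lsmul ℂ ℂ X.carrier (gen D t a) =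
        Algebra.lsmul ℂ ℂ X.carrier (tauH D t (gen D t a)) ∘ₗ X.tau :=
      X.isGrading_tau.hom_ext fun n m hm => by
        rw [X.deg_tau] at hm
        change X.tau (gen D t a • m) = tauH D t (gen D t a) • X.tau m
        rw [X.tau_apply (X.smul_mem _ _ _ (gen_mem_degPart D t a) m hm), X.tau_apply hm, tauH_gen,
          smul_assoc, smul_comm (gen D t a) ((2 : ℂ) ^ n) m, smul_smul, zpow_add₀ two_ne_zero]
    exact LinearMap.congr_fun this x

/-- A graded module, from a grading operator compatible with the one on `H_{t,c}`. -/
def GrMod.ofTau (M : Type v) [AddCommGroup M] [Module ℂ M] [Module (H D t) M]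
    [IsScalarTower ℂ (H D t) M] (τ : Module.End ℂ M) (hτ : IsGrading τ)
    (hsmul : ∀ (a : H D t) (m : M), τ (a • m) = tauH D t a • τ m) : GrMod.{u, v} D t where
  carrier := M
  piece := deg τ
  isInternal := hτ.isInternal
  smul_mem i j a ha m hm := by
    have h1 := mem_deg.1 (degPart_le_deg D t i ha)
    rw [AlgHom.toLinearMap_apply] at h1
    rw [mem_deg, hsmul, h1, mem_deg.1 hm, smul_assoc, smul_comm a, smul_smul,
      zpow_add₀ two_ne_zero]

variable (h) in
/-- The operator on `V` acting by `2⁻¹` on `h` and by `2` on `h*`. -/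
def scaleV : (h × Module.Dual ℂ h) ≃ₗ[ℂ] (h × Module.Dual ℂ h) :=
  LinearEquiv.prodCongr (LinearEquiv.smulOfNeZero ℂ h (2⁻¹) (inv_ne_zero two_ne_zero))
    (LinearEquiv.smulOfNeZero ℂ _ 2 two_ne_zero)

lemma scaleV_apply (v : h × Module.Dual ℂ h) :
    scaleV h v = ((2 : ℂ)⁻¹ • v.1, (2 : ℂ) • v.2) := rfl

variable (h) in
/-- The grading operator of `⋀ V`. -/
def tauE : ExteriorAlgebra ℂ (h × Module.Dual ℂ h) →ₐ[ℂ] ExteriorAlgebra ℂ (h × Module.Dual ℂ h) :=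
  ExteriorAlgebra.map (scaleV h).toLinearMap

lemma tauE_wedge (v : h × Module.Dual ℂ h) (ω : ExteriorAlgebra ℂ (h × Module.Dual ℂ h)) :
    tauE h (wedge v ω) = wedge (scaleV h v) (tauE h ω) := map_wedge _ _ _

lemma wedge_inl_mem_deg (y : h) {n : ℤ} {ω : ExteriorAlgebra ℂ (h × Module.Dual ℂ h)}
    (hω : ω ∈ deg (tauE h).toLinearMap n) :
    wedge (y, 0) ω ∈ deg (tauE h).toLinearMap (n - 1) := by
  rw [mem_deg, AlgHom.toLinearMap_apply] at *
  have : scaleV h (y, 0) = (2 : ℂ)⁻¹ • (y, 0) := by simp [scaleV_apply]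
  rw [tauE_wedge, hω, this, map_smul, map_smul, LinearMap.smul_apply, smul_smul,
    zpow_sub_one₀ two_ne_zero]

lemma wedge_inr_mem_deg (x : Module.Dual ℂ h) {n : ℤ}
    {ω : ExteriorAlgebra ℂ (h × Module.Dual ℂ h)} (hω : ω ∈ deg (tauE h).toLinearMap n) :
    wedge (0, x) ω ∈ deg (tauE h).toLinearMap (n + 1) := by
  rw [mem_deg, AlgHom.toLinearMap_apply] at *
  have : scaleV h (0, x) = (2 : ℂ) • (0, x) := by simp [scaleV_apply]
  rw [tauE_wedge, hω, this, map_smul, map_smul, LinearMap.smul_apply, smul_smul,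
    zpow_add_one₀ two_ne_zero]

lemma isGrading_tauE : IsGrading (tauE h).toLinearMap := by
  refine top_le_iff.1 fun ω _ => ?_
  induction ω using ext_induction with
  | hr r => exact Submodule.mem_iSup_of_mem 0 (mem_deg.2 (by simp))
  | ha a b h1 h2 => exact add_mem (h1 trivial) (h2 trivial)
  | hw v ω h1 =>
    obtain ⟨s, f, hf, rfl⟩ := exists_sum_of_mem_iSup (h1 trivial)
    have : v = (v.1, 0) + (0, v.2) := by simp
    rw [this, map_add, LinearMap.add_apply, map_sum, map_sum]
    exact add_mem
      (Submodule.sum_mem _ fun i _ => Submodule.mem_iSup_of_mem _ (wedge_inl_mem_deg v.1 (hf i)))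
      (Submodule.sum_mem _ fun i _ => Submodule.mem_iSup_of_mem _ (wedge_inr_mem_deg v.2 (hf i)))

lemma scaleV_vRep (g : D.G) (v : h × Module.Dual ℂ h) :
    scaleV h (vRep D g v) = vRep D g (scaleV h v) := by
  change ((2 : ℂ)⁻¹ • D.rep g v.1, (2 : ℂ) • D.dualRep g v.2) =
    (D.rep g ((2 : ℂ)⁻¹ • v.1), D.dualRep g ((2 : ℂ) • v.2))
  rw [map_smul, map_smul]

lemma tauE_map_vRep (g : D.G) (ω : ExteriorAlgebra ℂ (h × Module.Dual ℂ h)) :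
    tauE h (ExteriorAlgebra.map (vRep D g) ω) = ExteriorAlgebra.map (vRep D g) (tauE h ω) := by
  induction ω using ext_induction with
  | hr r => simp only [AlgHom.commutes]
  | ha a b h1 h2 => simp only [map_add, h1, h2]
  | hw v ω h1 => rw [map_wedge, tauE_wedge, h1, tauE_wedge, map_wedge, scaleV_vRep]

lemma tauH_vMap (v : h × Module.Dual ℂ h) :
    tauH D t (vMap D t v) = vMap D t (scaleV h v) := by
  rw [vMap_apply, vMap_apply, map_add, tauH_gen, tauH_gen, scaleV_apply, gen_y_smul, gen_x_smul]
  simp [Gen.deg]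

variable (X : GrMod.{u, v} D t)

/-- The grading operator of `X ⊗ ⋀ V`. -/
def extTau : Module.End ℂ (extSpace X) := TensorProduct.map X.tau (tauE h).toLinearMap

lemma extTau_tmul (x : X.carrier) (ω : ExteriorAlgebra ℂ (h × Module.Dual ℂ h)) :
    extTau X (x ⊗ₜ ω) = X.tau x ⊗ₜ tauE h ω := rfl

lemma isGrading_extTau : IsGrading (extTau X) := X.isGrading_tau.tensor isGrading_tauE

/-- The grading operator of `H ⊗ X ⊗ ⋀ V`. -/
def koszulTau : Module.End ℂ (koszulSpace X) :=
  TensorProduct.map (tauH D t).toLinearMap (extTau X)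

lemma koszulTau_tmul (a : H D t) (m : extSpace X) :
    koszulTau X (a ⊗ₜ m) = tauH D t a ⊗ₜ extTau X m := rfl

lemma isGrading_koszulTau : IsGrading (koszulTau X) :=
  (isGrading_tauH D t).tensor (isGrading_extTau X)

lemma koszulTau_smul (a : H D t) (z : koszulSpace X) :
    koszulTau X (a • z) = tauH D t a • koszulTau X z := by
  induction z using TensorProduct.induction_on with
  | zero => rw [smul_zero, map_zero, smul_zero]
  | add z z' h1 h2 => rw [smul_add, map_add, h1, h2, map_add, smul_add]
  | tmul b m =>
    rw [TensorProduct.smul_tmul', koszulTau_tmul, koszulTau_tmul, smul_eq_mul, map_mul,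
      TensorProduct.smul_tmul', smul_eq_mul]

lemma GrMod.tau_rep (g : D.G) (x : X.carrier) :
    X.tau (gen D t (.g g) • x) = gen D t (.g g) • X.tau x := by
  rw [X.tau_smul, tauH_gen_g]

lemma extTau_extSpaceRep (g : D.G) (m : extSpace X) :
    extTau X (extSpaceRep X g m) = extSpaceRep X g (extTau X m) := by
  induction m using TensorProduct.induction_on with
  | zero => simp only [map_zero]
  | add z z' h1 h2 => simp only [map_add, h1, h2]
  | tmul x ω => rw [extSpaceRep_tmul, extTau_tmul, extTau_tmul, extSpaceRep_tmul, X.tau_rep,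
      tauE_map_vRep]

lemma koszulTau_koszulRep (g : D.G) (z : koszulSpace X) :
    koszulTau X (koszulRep X g z) = koszulRep X g (koszulTau X z) := by
  induction z using TensorProduct.induction_on with
  | zero => simp only [map_zero]
  | add z z' h1 h2 => simp only [map_add, h1, h2]
  | tmul a m => rw [koszulRep_tmul, koszulTau_tmul, koszulTau_tmul, koszulRep_tmul, map_mul,
      tauH_gen_g, extTau_extSpaceRep]

lemma koszulTau_koszulAv (z : koszulSpace X) :
    koszulTau X (koszulAv X z) = koszulAv X (koszulTau X z) :=
  map_averageMap _ _ _ (koszulTau_koszulRep X) z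

lemma koszulAug_koszulTau (z : koszulSpace X) :
    koszulAug X (koszulTau X z) = X.tau (koszulAug X z) := by
  have : koszulAug X ∘ₗ koszulTau X = X.tau ∘ₗ koszulAug X := koszulSpace_ext X fun a x ω => by
    rw [LinearMap.comp_apply, LinearMap.comp_apply, koszulTau_tmul, koszulAug_tmul, koszulAug_tmul, X.tau_smul, extTau_tmul, extAug_tmul,
      extAug_tmul, map_smul]
    congr 2
    have : (ExteriorAlgebra.algebraMapInv : ExteriorAlgebra ℂ (h × Module.Dual ℂ h) →ₐ[ℂ] ℂ).comp
        (tauE h) = ExteriorAlgebra.algebraMapInv := by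
      ext v <;> simp [ExteriorAlgebra.algebraMapInv, tauE]
    exact AlgHom.congr_fun this ω
  exact LinearMap.congr_fun this z

variable [FiniteDimensional ℂ h]

lemma koszulTau_koszulB (a : H D t) (x : X.carrier)
    (ω : ExteriorAlgebra ℂ (h × Module.Dual ℂ h)) (ξ : Module.Dual ℂ (h × Module.Dual ℂ h))
    (v : h × Module.Dual ℂ h) :
    koszulTau X (koszulB X a x ω (ξ ∘ₗ (scaleV h).toLinearMap) v) =
      koszulB X (tauH D t a) (X.tau x) (tauE h ω) ξ (scaleV h v) := by
  rw [koszulB_apply, koszulB_apply, map_sub, koszulTau_tmul, koszulTau_tmul, extTau_tmul,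
    extTau_tmul, map_mul, tauH_vMap, X.tau_smul, tauH_vMap, tauE, ctr_map]

lemma koszulD_koszulTau (z : koszulSpace X) :
    koszulD X (koszulTau X z) = koszulTau X (koszulD X z) := by
  have : koszulD X ∘ₗ koszulTau X = koszulTau X ∘ₗ koszulD X :=
    koszulSpace_ext X fun a x ω => by
      have h1 : koszulD X (a ⊗ₜ (x ⊗ₜ ω)) = _ := (koszulD_tmul X a x ω).trans
        (sum_coord_comp_basis (vBasis h) (scaleV h).symm (koszulB X a x ω)).symm
      rw [LinearMap.comp_apply, LinearMap.comp_apply, h1, map_sum, koszulTau_tmul, extTau_tmul,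
        koszulD_tmul]
      refine Finset.sum_congr rfl fun j _ => ?_
      have e1 : ((vBasis h).coord j) ∘ₗ ((scaleV h).symm.symm : _ →ₗ[ℂ] _) =
          (vBasis h).coord j ∘ₗ (scaleV h).toLinearMap := rfl
      rw [e1, koszulTau_koszulB, LinearEquiv.apply_symm_apply, koszulB_apply]
  exact LinearMap.congr_fun this z

end GradingOfModules

section KoszulModule

lemma tmul_mem_tens_top {M N : Type*} [AddCommGroup M] [Module ℂ M] [AddCommGroup N] [Module ℂ N]
    {B : Submodule ℂ N} (a : M) {b : N} (hb : b ∈ B) : a ⊗ₜ b ∈ tens (⊤ : Submodule ℂ M) B :=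
  tmul_mem_tens trivial hb

variable {D : Datum h} {t : ℂ} {X : GrMod.{u, v} D t}

/-- A subspace of `X ⊗ ⋀ V` which is graded and stable under `G`. -/
structure IsHomogeneous (N : Submodule ℂ (extSpace X)) : Prop where
  rep_mem : ∀ g, ∀ m ∈ N, extSpaceRep X g m ∈ N
  tau_mem : ∀ m ∈ N, extTau X m ∈ N

lemma smul_mem_tens_top {N : Submodule ℂ (extSpace X)} (a : H D t) {z : koszulSpace X}
    (hz : z ∈ tens ⊤ N) : a • z ∈ tens (⊤ : Submodule ℂ (H D t)) N :=
  mem_of_mem_tens (Algebra.lsmul ℂ ℂ (koszulSpace X) a) _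
    (fun b _ m hm => tmul_mem_tens_top (a * b) hm) hz

/-- The `H_{t,c}`-module of `G`-invariants in `H ⊗ N`. -/
def koszulModule (N : Submodule ℂ (extSpace X)) : Submodule (H D t) (koszulSpace X) where
  carrier := koszulInv X N
  add_mem' := add_mem
  zero_mem' := zero_mem (koszulInv X N)
  smul_mem' a z hz := ⟨smul_mem_tens_top a hz.1, fun g => by rw [koszulRep_smul, hz.2 g]⟩

lemma koszulTau_mem {N : Submodule ℂ (extSpace X)} (hN : IsHomogeneous N) {z : koszulSpace X}
    (hz : z ∈ koszulModule N) : koszulTau X z ∈ koszulModule N :=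
  ⟨mem_of_mem_tens (koszulTau X) _ (fun a _ m hm => tmul_mem_tens_top (tauH D t a) (hN.tau_mem m hm)) hz.1,
    fun g => by rw [← koszulTau_koszulRep, hz.2 g]⟩

/-- The grading operator of the module of invariants in `H ⊗ N`. -/
def koszulModuleTau {N : Submodule ℂ (extSpace X)} (hN : IsHomogeneous N) :
    Module.End ℂ (koszulModule N) where
  toFun z := ⟨koszulTau X z, koszulTau_mem hN z.2⟩
  map_add' _ _ := Subtype.ext (map_add _ _ _)
  map_smul' _ _ := Subtype.ext (map_smul _ _ _)

lemma IsGrading.of_injective {M Q : Type*} [AddCommGroup M] [Module ℂ M] [AddCommGroup Q]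
    [Module ℂ Q] {τ : Module.End ℂ M} (hτ : IsGrading τ) {σ : Module.End ℂ Q} (f : Q →ₗ[ℂ] M)
    (hf : Function.Injective f) (hfσ : ∀ q, f (σ q) = τ (f q)) : IsGrading σ := by
  refine top_le_iff.1 fun q _ => ?_
  obtain ⟨s, g, hg, hgf, hs⟩ := hτ.exists_sum_mem (p := LinearMap.range f)
    (by rintro _ ⟨q, rfl⟩; exact ⟨σ q, hfσ q⟩) ⟨q, rfl⟩
  choose g' hg' using hgf
  have : q = ∑ n ∈ s, g' n := hf (by rw [map_sum, ← hs]; simp only [hg'])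
  rw [this]
  refine Submodule.sum_mem _ fun n _ => Submodule.mem_iSup_of_mem n (mem_deg.2 (hf ?_))
  rw [hfσ, hg', map_smul, hg', mem_deg.1 (hg n)]

/-- The graded `H_{t,c}`-module of invariants in `H ⊗ N`. -/
def koszulGrMod {N : Submodule ℂ (extSpace X)} (hN : IsHomogeneous N) :
    GrMod.{u, max u v} D t :=
  GrMod.ofTau (koszulModule N) (koszulModuleTau hN)
    ((isGrading_koszulTau X).of_injective
      { toFun := Subtype.val, map_add' := fun _ _ => rfl, map_smul' := fun _ _ => rfl }
      Subtype.val_injective fun _ => rfl)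
    fun a z => Subtype.ext (koszulTau_smul X a z)

lemma mem_deg_koszulModuleTau {N : Submodule ℂ (extSpace X)} (hN : IsHomogeneous N) {n : ℤ}
    {z : koszulModule N} :
    z ∈ deg (koszulModuleTau hN) n ↔ (z : koszulSpace X) ∈ deg (koszulTau X) n := by
  rw [mem_deg, mem_deg, Subtype.ext_iff]
  rfl

lemma mem_koszulGrMod_piece {N : Submodule ℂ (extSpace X)} (hN : IsHomogeneous N) {n : ℤ}
    {z : koszulModule N} :
    z ∈ (koszulGrMod hN).piece n ↔ (z : koszulSpace X) ∈ deg (koszulTau X) n :=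
  mem_deg_koszulModuleTau hN

lemma projective_koszulModule {N : Submodule ℂ (extSpace X)} (hN : IsHomogeneous N) :
    Module.Projective (H D t) (koszulModule N) := by
  obtain ⟨π, hπ⟩ := N.subtype.exists_leftInverse_of_injective N.ker_subtype
  have hmem : ∀ z, koszulAv X (TensorProduct.map LinearMap.id (N.subtype ∘ₗ π) z) ∈
      koszulModule N := fun z => koszulAv_mem_koszulInv hN.rep_mem (by
    induction z using TensorProduct.induction_on with
    | zero => rw [map_zero]; exact zero_mem _
    | add z z' h1 h2 => rw [map_add]; exact add_mem h1 h2
    | tmul a m => exact tmul_mem_tens_top a (π m).2)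
  have hsmul : ∀ (a : H D t) (z : koszulSpace X),
      TensorProduct.map LinearMap.id (N.subtype ∘ₗ π) (a • z) =
        a • TensorProduct.map LinearMap.id (N.subtype ∘ₗ π) z := fun a z => by
    induction z using TensorProduct.induction_on with
    | zero => rw [smul_zero, map_zero, smul_zero]
    | add z z' h1 h2 => rw [smul_add, map_add, h1, h2, map_add, smul_add]
    | tmul b m => rfl
  refine Module.Projective.of_split (M := koszulSpace X) (koszulModule N).subtype
    { toFun := fun z => ⟨_, hmem z⟩
      map_add' := fun z z' => Subtype.ext (by simp only [map_add]; rfl)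
      map_smul' := fun a z => Subtype.ext (by
        simp only [hsmul, koszulAv_smul]; rfl) } (LinearMap.ext fun z => Subtype.ext ?_)
  change koszulAv X (TensorProduct.map LinearMap.id (N.subtype ∘ₗ π) (z : koszulSpace X)) = z
  have h1 : TensorProduct.map LinearMap.id (N.subtype ∘ₗ π) (z : koszulSpace X) = z := by
    have := mem_of_mem_tens (TensorProduct.map LinearMap.id (N.subtype ∘ₗ π) - LinearMap.id) ⊥
      (fun a _ m hm => ?_) z.2.1
    · exact sub_eq_zero.1 ((Submodule.mem_bot ℂ).1 this)
    · have h2 : π m = ⟨m, hm⟩ := LinearMap.congr_fun hπ ⟨m, hm⟩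
      rw [Submodule.mem_bot, LinearMap.sub_apply, TensorProduct.map_tmul, LinearMap.comp_apply, h2]
      exact sub_self _
  rw [h1, koszulAv_eq_self z.2.2]

end KoszulModule

end Cherednik

namespace Cherednik
variable {h : Type u} [AddCommGroup h] [Module ℂ h]

section Hom

variable {D : Datum h} {t : ℂ} {X : GrMod.{u, v} D t} {N : Submodule ℂ (extSpace X)}

/-- A homogeneous subspace of `X ⊗ ⋀ V`, as a graded representation of `G`. -/
def IsHomogeneous.grRep (hN : IsHomogeneous N) : GrRep.{u, max u v} D where
  amb := extSpace X
  rho := extSpaceRep X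
  piece n := N ⊓ deg (extTau X) n
  stable n g m hm := ⟨hN.rep_mem g m hm.1, by
    have h1 := mem_deg.1 hm.2
    rw [SetLike.mem_coe, mem_deg, extTau_extSpaceRep, h1, map_smul]⟩

lemma koszulAv_one_tmul_rep (g : D.G) (m : extSpace X) :
    koszulAv X (1 ⊗ₜ extSpaceRep X g m) = gen D t (.g g) • koszulAv X (1 ⊗ₜ m) := by
  rw [← koszulAv_smul, ← averageMap_map (koszulRep X) g (gen D t (.g g) • 1 ⊗ₜ m),
    TensorProduct.smul_tmul', koszulRep_tmul, smul_eq_mul, mul_one, ← gen_g_mul, mul_inv_cancel,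
    gen_g_one]

lemma koszulAv_one_tmul_mem_deg {n : ℤ} {m : extSpace X} (hm : m ∈ deg (extTau X) n) :
    koszulAv X (1 ⊗ₜ m) ∈ deg (koszulTau X) n := by
  rw [mem_deg, koszulTau_koszulAv, koszulTau_tmul, map_one, mem_deg.1 hm, TensorProduct.tmul_smul,
    map_smul]

/-- The map `N → (H ⊗ N)^G` obtained by averaging. -/
def koszulUnit (hN : IsHomogeneous N) : N →ₗ[ℂ] koszulModule N where
  toFun m := ⟨koszulAv X (1 ⊗ₜ (m : extSpace X)),
    koszulAv_mem_koszulInv hN.rep_mem (tmul_mem_tens_top 1 m.2)⟩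
  map_add' m m' := Subtype.ext ((congrArg (koszulAv X)
    (TensorProduct.tmul_add (1 : H D t) (m : extSpace X) m')).trans (map_add _ _ _))
  map_smul' r m := Subtype.ext ((congrArg (koszulAv X)
    (TensorProduct.tmul_smul r (1 : H D t) (m : extSpace X))).trans (map_smul _ _ _))

lemma koszulUnit_rep (hN : IsHomogeneous N) (g : D.G) (m : N) :
    koszulUnit hN ⟨extSpaceRep X g m, hN.rep_mem g m m.2⟩ = gen D t (.g g) • koszulUnit hN m :=
  Subtype.ext (koszulAv_one_tmul_rep g (m : extSpace X))

lemma koszulModule_hom_ext (hN : IsHomogeneous N) {M : Type*} [AddCommGroup M] [Module (H D t) M]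
    {f f' : koszulModule N →ₗ[H D t] M}
    (hf : ∀ d, ∀ m : N, (m : extSpace X) ∈ deg (extTau X) d →
      f (koszulUnit hN m) = f' (koszulUnit hN m)) : f = f' := by
  set L := ((LinearMap.eqLocus f f').map (koszulModule N).subtype).restrictScalars ℂ with hL
  have key : ∀ z ∈ tens (⊤ : Submodule ℂ (H D t)) N, koszulAv X z ∈ L := fun z hz => by
    refine mem_of_mem_tens (koszulAv X) L (fun a _ m hm => ?_) hz
    obtain ⟨s, g, hg, hgN, rfl⟩ := (isGrading_extTau X).exists_sum_mem hN.tau_mem hm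
    rw [TensorProduct.tmul_sum, map_sum]
    refine Submodule.sum_mem _ fun d _ => ?_
    have e : a ⊗ₜ g d = a • (1 : H D t) ⊗ₜ[ℂ] g d := by
      rw [TensorProduct.smul_tmul', smul_eq_mul, mul_one]
    rw [e, koszulAv_smul]
    exact Submodule.smul_mem ((LinearMap.eqLocus f f').map (koszulModule N).subtype) a
      ⟨koszulUnit hN ⟨g d, hgN d⟩, hf d _ (hg d), rfl⟩
  refine LinearMap.ext fun z => ?_
  obtain ⟨z', hz', e⟩ := key z z.2.1
  rw [koszulAv_eq_self z.2.2] at e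
  obtain rfl : z' = z := Subtype.ext e
  exact hz'

variable {Y : GrMod.{u, w} D t}

/-- The map `H ⊗ X ⊗ ⋀ V → Y` extending a linear map `X ⊗ ⋀ V → Y`. -/
def koszulLift (φ : extSpace X →ₗ[ℂ] Y.carrier) : koszulSpace X →ₗ[ℂ] Y.carrier :=
  TensorProduct.lift (Algebra.lsmul ℂ ℂ Y.carrier : H D t →ₐ[ℂ] _).toLinearMap ∘ₗ
    TensorProduct.map LinearMap.id φ

lemma koszulLift_tmul (φ : extSpace X →ₗ[ℂ] Y.carrier) (a : H D t) (m : extSpace X) :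
    koszulLift φ (a ⊗ₜ m) = a • φ m := by
  rw [koszulLift, LinearMap.comp_apply, TensorProduct.map_tmul]
  exact TensorProduct.lift.tmul _ _

lemma koszulLift_smul (φ : extSpace X →ₗ[ℂ] Y.carrier) (a : H D t) (z : koszulSpace X) :
    koszulLift φ (a • z) = a • koszulLift φ z := by
  induction z using TensorProduct.induction_on with
  | zero => rw [smul_zero, map_zero, smul_zero]
  | add z z' h1 h2 => rw [smul_add, map_add, h1, h2, map_add, smul_add]
  | tmul b m => rw [TensorProduct.smul_tmul', koszulLift_tmul, koszulLift_tmul, smul_eq_mul, mul_smul]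

lemma koszulLift_koszulAv (φ : extSpace X →ₗ[ℂ] Y.carrier) {m : extSpace X}
    (hφ : ∀ g, φ (extSpaceRep X g m) = gen D t (.g g) • φ m) :
    koszulLift φ (koszulAv X (1 ⊗ₜ m)) = φ m := by
  rw [averageMap_apply, map_smul, map_sum]
  simp only [koszulRep_tmul, koszulLift_tmul, hφ, one_mul, smul_smul, ← gen_g_mul, inv_mul_cancel,
    gen_g_one, one_smul, Finset.sum_const, Finset.card_univ]
  rw [← Nat.cast_smul_eq_nsmul ℂ, smul_smul, invOf_mul_self, one_smul]

/-- The `H_{t,c}`-linear map `(H ⊗ N)^G → Y` extending a linear map `X ⊗ ⋀ V → Y`. -/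
def koszulModuleLift (N : Submodule ℂ (extSpace X)) (φ : extSpace X →ₗ[ℂ] Y.carrier) :
    koszulModule N →ₗ[H D t] Y.carrier where
  toFun z := koszulLift φ z
  map_add' _ _ := map_add _ _ _
  map_smul' a z := koszulLift_smul φ a z

lemma koszulModuleLift_mem_hom (hN : IsHomogeneous N) (φ : extSpace X →ₗ[ℂ] Y.carrier) {n : ℤ}
    (hφ : ∀ d, ∀ m ∈ N, m ∈ deg (extTau X) d → φ m ∈ Y.piece (d + n)) :
    koszulModuleLift N φ ∈ (koszulGrMod hN).hom Y n := by
  have key : ∀ z ∈ tens (⊤ : Submodule ℂ (H D t)) N,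
      Y.tau (koszulLift φ z) = (2 : ℂ) ^ n • koszulLift φ (koszulTau X z) := fun z hz => by
    have := mem_of_mem_tens (Y.tau ∘ₗ koszulLift φ - (2 : ℂ) ^ n • (koszulLift φ ∘ₗ koszulTau X)) ⊥
      (fun a _ m hm => ?_) hz
    · exact sub_eq_zero.1 ((Submodule.mem_bot ℂ).1 this)
    · obtain ⟨s, g, hg, hgN, rfl⟩ := (isGrading_extTau X).exists_sum_mem hN.tau_mem hm
      rw [TensorProduct.tmul_sum, map_sum]
      refine Submodule.sum_mem _ fun d _ => ?_
      rw [Submodule.mem_bot, LinearMap.sub_apply, LinearMap.smul_apply, LinearMap.comp_apply,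
        LinearMap.comp_apply, koszulTau_tmul, koszulLift_tmul, koszulLift_tmul, Y.tau_smul,
        Y.tau_apply (hφ d _ (hgN d) (hg d)), mem_deg.1 (hg d), map_smul, sub_eq_zero,
        smul_comm (tauH D t a), smul_comm (tauH D t a), smul_smul, zpow_add₀ two_ne_zero, mul_comm]
  intro i z hz
  rw [← Y.deg_tau, mem_deg]
  refine (key (show koszulModule N from z).1 (show koszulModule N from z).2.1).trans ?_
  rw [mem_deg.1 ((mem_koszulGrMod_piece hN).1 hz), map_smul, smul_smul, zpow_add₀ two_ne_zero,
    mul_comm]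
  rfl

/-- The homomorphisms `(H ⊗ N)^G → Y` of degree `n` restrict to equivariant maps on the graded
pieces of `N`. -/
def koszulHomRestrict (hN : IsHomogeneous N) (Y : GrMod.{u, w} D t) (n : ℤ) :
    (koszulGrMod hN).hom Y n →ₗ[ℂ]
      (d : ℤ) → Representation.IntertwiningMap (hN.grRep.pieceRep d) (Y.res.pieceRep (d + n)) where
  toFun f d := 
    { toFun := fun m => ⟨f.1 (koszulUnit hN ⟨m.1, m.2.1⟩), f.2 d _
        ((mem_koszulGrMod_piece hN).2 (koszulAv_one_tmul_mem_deg m.2.2))⟩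
      map_add' := fun m m' => Subtype.ext (by
        have : (⟨(m + m').1, (m + m').2.1⟩ : N) = ⟨m.1, m.2.1⟩ + ⟨m'.1, m'.2.1⟩ := rfl
        exact (congrArg (fun m => f.1 (koszulUnit hN m)) this).trans
          ((congrArg f.1 (map_add (koszulUnit hN) _ _)).trans (map_add f.1 _ _)))
      map_smul' := fun r m => Subtype.ext (by
        have : (⟨(r • m).1, (r • m).2.1⟩ : N) = r • ⟨m.1, m.2.1⟩ := rfl
        exact (congrArg (fun m => f.1 (koszulUnit hN m)) this).trans
          ((congrArg f.1 (map_smul (koszulUnit hN) _ _)).trans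
            (LinearMap.map_smul_of_tower (show koszulModule N →ₗ[H D t] Y.carrier from f.1) r _)))
      isIntertwining' := fun g => LinearMap.ext fun m => Subtype.ext (by
        have := koszulUnit_rep hN g ⟨m.1, m.2.1⟩
        exact (congrArg f.1 this).trans (map_smul f.1 _ _)) }
  map_add' _ _ := rfl
  map_smul' _ _ := rfl

lemma koszulHomRestrict_injective (hN : IsHomogeneous N) (Y : GrMod.{u, w} D t) (n : ℤ) :
    Function.Injective (koszulHomRestrict hN Y n) := by
  intro f f' hff
  refine Subtype.ext (koszulModule_hom_ext hN fun d m hm => ?_)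
  have h1 := congrFun hff d
  have h2 := congrArg (fun ψ : Representation.IntertwiningMap (hN.grRep.pieceRep d)
    (Y.res.pieceRep (d + n)) => (ψ ⟨m.1, m.2, hm⟩ : Y.piece (d + n)).1) h1
  exact h2

lemma koszulHomRestrict_surjective (hN : IsHomogeneous N) (Y : GrMod.{u, w} D t) (n : ℤ) :
    Function.Surjective (koszulHomRestrict hN Y n) := by
  intro ψ
  have hq : ∀ d, ∃ q : deg (extTau X) d →ₗ[ℂ] hN.grRep.piece d,
      ∀ m : hN.grRep.piece d, q ⟨m.1, m.2.2⟩ = m := fun d => by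
    obtain ⟨q, hq⟩ := (Submodule.inclusion (inf_le_right : N ⊓ deg (extTau X) d ≤ _)).exists_leftInverse_of_injective
      (Submodule.ker_inclusion _ _ _)
    exact ⟨q, fun m => LinearMap.congr_fun hq m⟩
  choose q hq using hq
  set e := LinearEquiv.ofBijective (DirectSum.coeLinearMap (deg (extTau X)))
    (isGrading_extTau X).isInternal with he
  set φ : extSpace X →ₗ[ℂ] Y.carrier := (DirectSum.toModule ℂ ℤ Y.carrier fun d =>
    (Y.piece (d + n)).subtype ∘ₗ (ψ d).toLinearMap ∘ₗ q d) ∘ₗ e.symm.toLinearMap with hφ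
  have hφd : ∀ d (m : extSpace X) (hm : m ∈ N) (hmd : m ∈ deg (extTau X) d),
      φ m = (ψ d ⟨m, hm, hmd⟩ : Y.piece (d + n)).1 := fun d m hm hmd => by
    have h1 : e.symm m = DirectSum.lof ℂ ℤ (fun d => deg (extTau X) d) d ⟨m, hmd⟩ := by
      refine (LinearEquiv.symm_apply_eq _).2 ?_
      exact (DirectSum.coeLinearMap_lof (deg (extTau X)) d ⟨m, hmd⟩).symm
    change DirectSum.toModule ℂ ℤ Y.carrier _ (e.symm m) = _
    rw [h1, DirectSum.toModule_lof]
    have h2 := hq d ⟨m, hm, hmd⟩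
    exact congrArg (fun z => (ψ d z : Y.piece (d + n)).1) h2
  have hmem := koszulModuleLift_mem_hom (Y := Y) (n := n) hN φ fun d m hm hmd => by
    rw [hφd d m hm hmd]
    exact (ψ d _).2
  refine ⟨⟨_, hmem⟩, funext fun d => Representation.IntertwiningMap.ext (LinearMap.ext fun m =>
    Subtype.ext ?_)⟩
  refine (koszulLift_koszulAv φ (m := m.1) fun g => ?_).trans (hφd d m.1 m.2.1 m.2.2)
  rw [hφd d m.1 m.2.1 m.2.2, hφd d _ (hN.rep_mem g _ m.2.1) (hN.grRep.stable d g m.2).2]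
  have := LinearMap.congr_fun ((ψ d).isIntertwining' g) m
  exact congrArg Subtype.val this

/-- Graded homomorphisms out of `(H ⊗ N)^G` are equivariant maps out of `N`. -/
def koszulHomEquiv (hN : IsHomogeneous N) (Y : GrMod.{u, w} D t) (n : ℤ) :
    (koszulGrMod hN).hom Y n ≃ₗ[ℂ]
      ((d : ℤ) → Representation.IntertwiningMap (hN.grRep.pieceRep d) (Y.res.pieceRep (d + n))) :=
  LinearEquiv.ofBijective (koszulHomRestrict hN Y n)
    ⟨koszulHomRestrict_injective hN Y n, koszulHomRestrict_surjective hN Y n⟩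

lemma finite_intertwiningMap {G : Type*} [Group G] {A : Type*} {B : Type*}
    [AddCommGroup A] [Module ℂ A] [AddCommGroup B] [Module ℂ B] [FiniteDimensional ℂ A]
    [FiniteDimensional ℂ B] (ρ : Representation ℂ G A) (σ : Representation ℂ G B) :
    FiniteDimensional ℂ (Representation.IntertwiningMap ρ σ) :=
  FiniteDimensional.of_injective
    ({ toFun := fun f => f.toLinearMap
       map_add' := fun _ _ => rfl
       map_smul' := fun _ _ => rfl } : Representation.IntertwiningMap ρ σ →ₗ[ℂ] A →ₗ[ℂ] B)
    (Representation.IntertwiningMap.toLinearMap_injective ρ σ)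

/-- A product of finite dimensional spaces, almost all of them zero. -/
lemma finite_pi_of_finrank {ι : Type*} (A : ι → Type*) [∀ i, AddCommGroup (A i)]
    [∀ i, Module ℂ (A i)] [∀ i, FiniteDimensional ℂ (A i)]
    (hA : {i | Module.finrank ℂ (A i) ≠ 0}.Finite) :
    FiniteDimensional ℂ ((i : ι) → A i) ∧
      Module.finrank ℂ ((i : ι) → A i) = ∑ᶠ i, Module.finrank ℂ (A i) := by
  classical
  set s := hA.toFinset with hs
  have h0 : ∀ i, i ∉ s → Subsingleton (A i) := fun i hi =>
    Module.finrank_zero_iff.1 (by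
      by_contra h
      exact hi (hA.mem_toFinset.2 h))
  let e : ((i : ι) → A i) ≃ₗ[ℂ] ((i : s) → A i) := LinearEquiv.ofBijective
    ({ toFun := fun f i => f i
       map_add' := fun _ _ => rfl
       map_smul' := fun _ _ => rfl } : ((i : ι) → A i) →ₗ[ℂ] ((i : s) → A i))
    ⟨fun f f' hff => funext fun i => by
        by_cases hi : i ∈ s
        · exact congrFun hff (⟨i, hi⟩ : s)
        · have := h0 i hi
          exact Subsingleton.elim _ _,
      fun f => ⟨fun i => if hi : i ∈ s then f ⟨i, hi⟩ else 0, funext fun i => dif_pos i.2⟩⟩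
  refine ⟨Module.Finite.equiv e.symm, ?_⟩
  rw [e.finrank_eq, Module.finrank_pi_fintype, finsum_eq_sum_of_support_subset (s := s),
    Finset.sum_coe_sort s fun i => Module.finrank ℂ (A i)]
  intro i hi
  exact hA.mem_toFinset.2 hi

lemma finrank_koszulHom (hN : IsHomogeneous N) (hY : Y.FiniteType)
    (hfin : ∀ d, Module.Finite ℂ (hN.grRep.piece d)) (n : ℤ)
    (hs : {d : ℤ | hN.grRep.homDim Y.res d (d + n) ≠ 0}.Finite) :
    Module.Finite ℂ ((koszulGrMod hN).hom Y n) ∧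
      Module.finrank ℂ ((koszulGrMod hN).hom Y n) = ∑ᶠ d, hN.grRep.homDim Y.res d (d + n) := by
  have : ∀ d, FiniteDimensional ℂ (Representation.IntertwiningMap (hN.grRep.pieceRep d)
      (Y.res.pieceRep (d + n))) := fun d => by
    have := hfin d
    have : FiniteDimensional ℂ (Y.res.piece (d + n)) := hY (d + n)
    exact finite_intertwiningMap _ _
  obtain ⟨h1, h2⟩ := finite_pi_of_finrank _ hs
  exact ⟨Module.Finite.equiv (koszulHomEquiv hN Y n).symm,
    (koszulHomEquiv hN Y n).finrank_eq.trans h2⟩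

end Hom

section Resolution

variable {D : Datum h} {t : ℂ} [FiniteDimensional ℂ h]

/-- A family of homogeneous subspaces `N p ⊆ X ⊗ ⋀ᵖ V` for which the `G`-invariants in `H ⊗ N p`
form an exact subcomplex of the Koszul complex. -/
structure KoszulFamily (X : GrMod.{u, v} D t) where
  N : ℕ → Submodule ℂ (extSpace X)
  homogeneous : ∀ p, IsHomogeneous (N p)
  d_mem : ∀ p, ∀ z ∈ koszulInv X (N (p + 1)), koszulD X z ∈ koszulInv X (N p)
  surjective : ∀ x, ∃ z ∈ koszulInv X (N 0), koszulAug X z = x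
  exact_zero : ∀ z ∈ koszulInv X (N 0), koszulAug X z = 0 →
    ∃ w ∈ koszulInv X (N 1), koszulD X w = z
  exact_succ : ∀ p, ∀ z ∈ koszulInv X (N (p + 1)), koszulD X z = 0 →
    ∃ w ∈ koszulInv X (N (p + 2)), koszulD X w = z

variable {X : GrMod.{u, v} D t}

/-- The graded projective resolution given by a Koszul family. -/
def KoszulFamily.res (K : KoszulFamily X) : GrProjRes X where
  P p := koszulGrMod (K.homogeneous p)
  projective p := projective_koszulModule (K.homogeneous p)
  d p :=
    { toFun := fun z : koszulModule (K.N (p + 1)) =>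
        (⟨koszulD X z, K.d_mem p z z.2⟩ : koszulModule (K.N p))
      map_add' := fun _ _ => Subtype.ext (map_add _ _ _)
      map_smul' := fun a (z : koszulModule (K.N (p + 1))) =>
        Subtype.ext (koszulD_smul X a (z : koszulSpace X)) }
  d_mem p i z hz := by
    have h1 := mem_deg.1 ((mem_koszulGrMod_piece (K.homogeneous (p + 1))).1 hz)
    refine (mem_koszulGrMod_piece (K.homogeneous p)).2 (mem_deg.2 ?_)
    rw [add_zero]
    exact (koszulD_koszulTau X _).symm.trans ((congrArg (koszulD X) h1).trans (map_smul _ _ _))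
  aug :=
    { toFun := fun z : koszulModule (K.N 0) => koszulAug X z
      map_add' := fun _ _ => map_add _ _ _
      map_smul' := fun a (z : koszulModule (K.N 0)) => koszulAug_smul X a (z : koszulSpace X) }
  aug_mem i z hz := by
    have h1 := mem_deg.1 ((mem_koszulGrMod_piece (K.homogeneous 0)).1 hz)
    rw [add_zero, ← X.deg_tau, mem_deg]
    exact (koszulAug_koszulTau X _).symm.trans ((congrArg (koszulAug X) h1).trans (map_smul _ _ _))
  aug_surjective x := by
    obtain ⟨z, hz, rfl⟩ := K.surjective x
    exact ⟨⟨z, hz⟩, rfl⟩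
  exact_zero z := by
    constructor
    · intro hz
      obtain ⟨w, hw, hwz⟩ := K.exact_zero z.1 z.2 hz
      exact ⟨⟨w, hw⟩, Subtype.ext hwz⟩
    · rintro ⟨w, rfl⟩
      exact koszulAug_koszulD X _
  exact_succ p z := by
    constructor
    · intro hz
      obtain ⟨w, hw, hwz⟩ := K.exact_succ p z.1 z.2 (congrArg Subtype.val hz)
      exact ⟨⟨w, hw⟩, Subtype.ext hwz⟩
    · rintro ⟨w, rfl⟩
      exact Subtype.ext (koszulD_koszulD X (show koszulModule (K.N (p + 2)) from w).2.2)

omit [FiniteDimensional ℂ h] in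
lemma exists_koszulAug_eq {N : Submodule ℂ (extSpace X)} (hN : IsHomogeneous N) {x : X.carrier}
    (hx : x ⊗ₜ 1 ∈ N) : ∃ z ∈ koszulInv X N, koszulAug X z = x :=
  ⟨koszulAv X (1 ⊗ₜ (x ⊗ₜ 1)), koszulAv_mem_koszulInv hN.rep_mem (tmul_mem_tens_top 1 hx), by
    rw [koszulAug_koszulAv, koszulAug_tmul, extAug_tmul, map_one, one_smul, one_smul]⟩

omit [FiniteDimensional ℂ h] in
lemma tauE_mem_exteriorPower {p : ℕ} {ω : ExteriorAlgebra ℂ (h × Module.Dual ℂ h)}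
    (hω : ω ∈ ⋀[ℂ]^p (h × Module.Dual ℂ h)) : tauE h ω ∈ ⋀[ℂ]^p (h × Module.Dual ℂ h) :=
  map_mem_exteriorPower _ hω

lemma isHomogeneous_extPart (X : GrMod.{u, v} D t) (p : ℕ) : IsHomogeneous (extPart X p) where
  rep_mem g _ := extSpaceRep_mem_extPart g
  tau_mem m hm := mem_of_mem_tens (extTau X) _
    (fun x _ _ hω => tmul_mem_tens_top (X.tau x) (tauE_mem_exteriorPower hω)) hm

/-- The full Koszul complex. -/
def koszulFamily (X : GrMod.{u, v} D t) : KoszulFamily X where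
  N := extPart X
  homogeneous := isHomogeneous_extPart X
  d_mem p z hz := ⟨koszulD_mem_tens hz.1, koszulD_mem_invariants hz.2⟩
  surjective x := exists_koszulAug_eq (isHomogeneous_extPart X 0)
    (tmul_mem_tens_top x (mem_exteriorPower_zero.2 ⟨1, map_one _⟩))
  exact_zero _ hz := exists_koszulD_eq_of_koszulAug_eq_zero hz
  exact_succ _ _ hz := exists_koszulD_eq (by omega) hz

lemma nonempty_grProjRes (X : GrMod.{u, v} D t) : Nonempty (GrProjRes X) := ⟨(koszulFamily X).res⟩

end Resolution

end Cherednik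

namespace Cherednik
variable {h : Type u} [AddCommGroup h] [Module ℂ h]

section InternalLift

variable {M : Type*} [AddCommGroup M] [Module ℂ M] {M' : Type*} [AddCommGroup M'] [Module ℂ M']
  {A : ℤ → Submodule ℂ M}

/-- The linear map with given restrictions to the pieces of a direct sum decomposition. -/
def internalLift (hA : DirectSum.IsInternal A) (f : ∀ n, A n →ₗ[ℂ] M') : M →ₗ[ℂ] M' :=
  DirectSum.toModule ℂ ℤ M' f ∘ₗ
    (LinearEquiv.ofBijective (DirectSum.coeLinearMap A) hA).symm.toLinearMap

lemma internalLift_apply (hA : DirectSum.IsInternal A) (f : ∀ n, A n →ₗ[ℂ] M') {n : ℤ} {m : M}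
    (hm : m ∈ A n) : internalLift hA f m = f n ⟨m, hm⟩ := by
  have h1 : (LinearEquiv.ofBijective (DirectSum.coeLinearMap A) hA).symm m =
      DirectSum.lof ℂ ℤ (fun n => A n) n ⟨m, hm⟩ := by
    refine (LinearEquiv.symm_apply_eq _).2 ?_
    exact (DirectSum.coeLinearMap_lof A n ⟨m, hm⟩).symm
  change DirectSum.toModule ℂ ℤ M' f
    ((LinearEquiv.ofBijective (DirectSum.coeLinearMap A) hA).symm m) = _
  rw [h1, DirectSum.toModule_lof]

lemma internal_induction (hA : DirectSum.IsInternal A) {P : M → Prop}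
    (hp : ∀ n, ∀ m ∈ A n, P m) (h0 : P 0) (ha : ∀ a b, P a → P b → P (a + b)) (m : M) : P m := by
  have : m ∈ ⨆ n, A n := hA.submodule_iSup_eq_top ▸ Submodule.mem_top
  induction this using Submodule.iSup_induction' with
  | mem i x hx => exact hp i x hx
  | zero => exact h0
  | add x y _ _ h1 h2 => exact ha x y h1 h2

/-- The projection onto a piece of a direct sum decomposition. -/
def internalProj (hA : DirectSum.IsInternal A) (n : ℤ) : M →ₗ[ℂ] M :=
  internalLift hA fun j => if j = n then (A j).subtype else 0

lemma internalProj_of_mem (hA : DirectSum.IsInternal A) {n : ℤ} {m : M} (hm : m ∈ A n) :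
    internalProj hA n m = m := by
  rw [internalProj, internalLift_apply hA _ hm, if_pos rfl]
  rfl

lemma internalProj_of_mem_ne (hA : DirectSum.IsInternal A) {n j : ℤ} (hj : j ≠ n) {m : M}
    (hm : m ∈ A j) : internalProj hA n m = 0 := by
  rw [internalProj, internalLift_apply hA _ hm, if_neg hj]
  rfl

lemma internalProj_mem (hA : DirectSum.IsInternal A) (n : ℤ) (m : M) :
    internalProj hA n m ∈ A n := by
  refine internal_induction hA (P := fun m => internalProj hA n m ∈ A n) (fun j m hm => ?_) ?_
    (fun a b h1 h2 => ?_) m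
  · by_cases hj : j = n
    · subst hj
      rwa [internalProj_of_mem hA hm]
    · rw [internalProj_of_mem_ne hA hj hm]
      exact zero_mem _
  · rw [map_zero]
    exact zero_mem _
  · rw [map_add]
    exact add_mem h1 h2

end InternalLift

section Lifting

variable {D : Datum h} {t : ℂ}

lemma internalProj_smul (Q : GrMod.{u, w} D t) {j : ℤ} {a : H D t} (ha : a ∈ degPart D t j) (i : ℤ)
    (q : Q.carrier) :
    internalProj Q.isInternal (j + i) (a • q) = a • internalProj Q.isInternal i q := by
  refine internal_induction Q.isInternal (P := fun q => internalProj Q.isInternal (j + i) (a • q) =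
    a • internalProj Q.isInternal i q) (fun k q hq => ?_) ?_ (fun q q' h1 h2 => ?_) q
  · by_cases hk : k = i
    · subst hk
      rw [internalProj_of_mem _ hq, internalProj_of_mem _ (Q.smul_mem j k a ha q hq)]
    · rw [internalProj_of_mem_ne _ hk hq, smul_zero,
        internalProj_of_mem_ne _ (by omega) (Q.smul_mem j k a ha q hq)]
  · rw [smul_zero, map_zero, map_zero, smul_zero]
  · rw [smul_add, map_add, h1, h2, map_add, smul_add]

/-- The degree zero component of a homomorphism between graded modules. -/
lemma exists_component_zero (P : GrMod.{u, v} D t) (Q : GrMod.{u, w} D t)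
    (l : P.carrier →ₗ[H D t] Q.carrier) : ∃ l₀ ∈ P.hom Q 0, ∀ i, ∀ x ∈ P.piece i,
      l₀ x = internalProj Q.isInternal i (l x) := by
  set L : P.carrier →ₗ[ℂ] Q.carrier := internalLift P.isInternal fun i =>
    internalProj Q.isInternal i ∘ₗ (l.restrictScalars ℂ) ∘ₗ (P.piece i).subtype with hL
  have hLi : ∀ i, ∀ x ∈ P.piece i, L x = internalProj Q.isInternal i (l x) := fun i x hx => by
    rw [hL, internalLift_apply _ _ hx]
    rfl
  have hsmul : ∀ (a : H D t) x, L (a • x) = a • L x := fun a x => by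
    induction a using H.induction generalizing x with
    | hs r => rw [algebraMap_smul, algebraMap_smul, map_smul]
    | ha a b h1 h2 => rw [add_smul, map_add, h1, h2, add_smul]
    | hm a b h1 h2 => rw [mul_smul, h1, h2, mul_smul]
    | hg a =>
      refine internal_induction P.isInternal (P := fun x => L (gen D t a • x) = gen D t a • L x)
        (fun i x hx => ?_) ?_ (fun x x' h1 h2 => ?_) x
      · rw [hLi i x hx, hLi _ _ (P.smul_mem _ i _ (gen_mem_degPart D t a) x hx), map_smul,
          internalProj_smul Q (gen_mem_degPart D t a)]
      · rw [smul_zero, map_zero, smul_zero]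
      · rw [smul_add, map_add, h1, h2, map_add, smul_add]
  refine ⟨{ toFun := L, map_add' := map_add L, map_smul' := hsmul }, fun i x hx => ?_, hLi⟩
  rw [add_zero]
  change L x ∈ Q.piece i
  rw [hLi i x hx]
  exact internalProj_mem _ _ _

/-- Homomorphisms of degree zero from a projective graded module lift. -/
lemma exists_graded_lift.{w'} {P : GrMod.{u, v} D t} {Q : GrMod.{u, w} D t} {Z : GrMod.{u, w'} D t}
    [Module.Projective (H D t) P.carrier] {f : Q.carrier →ₗ[H D t] Z.carrier} (hf : f ∈ Q.hom Z 0)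
    {g : P.carrier →ₗ[H D t] Z.carrier} (hg : g ∈ P.hom Z 0)
    (hgf : ∀ x, g x ∈ LinearMap.range f) : ∃ l ∈ P.hom Q 0, ∀ x, f (l x) = g x := by
  obtain ⟨l, hl⟩ := Module.projective_lifting_property f.rangeRestrict (g.codRestrict _ hgf)
    f.surjective_rangeRestrict
  have hl' : ∀ x, f (l x) = g x := fun x => congrArg Subtype.val (LinearMap.congr_fun hl x)
  obtain ⟨l₀, hl₀, hl₀i⟩ := exists_component_zero P Q l
  refine ⟨l₀, hl₀, fun x => ?_⟩
  have hproj : ∀ i q, f (internalProj Q.isInternal i q) = internalProj Z.isInternal i (f q) := by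
    intro i q
    refine internal_induction Q.isInternal (P := fun q => f (internalProj Q.isInternal i q) =
      internalProj Z.isInternal i (f q)) (fun k q hq => ?_) ?_ (fun q q' h1 h2 => ?_) q
    · have hfq := hf k q hq
      rw [add_zero] at hfq
      by_cases hk : k = i
      · subst hk
        rw [internalProj_of_mem _ hq, internalProj_of_mem _ hfq]
      · rw [internalProj_of_mem_ne _ hk hq, internalProj_of_mem_ne _ hk hfq, map_zero]
    · simp only [map_zero]
    · simp only [map_add, h1, h2]
  refine internal_induction P.isInternal (P := fun x => f (l₀ x) = g x) (fun i x hx => ?_) ?_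
    (fun x x' h1 h2 => ?_) x
  · have hgx := hg i x hx
    rw [add_zero] at hgx
    rw [hl₀i i x hx, hproj, hl', internalProj_of_mem _ hgx]
  · simp only [map_zero]
  · simp only [map_add, h1, h2]

lemma GrMod.comp_mem_hom {P : GrMod.{u, v} D t} {Q : GrMod.{u, v} D t} {Z : GrMod.{u, w} D t}
    {g : Q.carrier →ₗ[H D t] Z.carrier} {n : ℤ} (hg : g ∈ Q.hom Z n)
    {f : P.carrier →ₗ[H D t] Q.carrier} (hf : f ∈ P.hom Q 0) : g ∘ₗ f ∈ P.hom Z n :=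
  fun i x hx => by
    have := hf i x hx
    rw [add_zero] at this
    exact hg i _ this

end Lifting

namespace GrProjRes

variable {D : Datum h} {t : ℂ} {X : GrMod.{u, v} D t} (R R' : GrProjRes X)

instance (p : ℕ) : Module.Projective (H D t) (R.P p).carrier := R.projective p

lemma aug_d (x : (R.P 1).carrier) : R.aug (R.d 0 x) = 0 := (R.exact_zero _).2 ⟨x, rfl⟩

lemma d_d (p : ℕ) (x : (R.P (p + 2)).carrier) : R.d p (R.d (p + 1) x) = 0 :=
  (R.exact_succ p _).2 ⟨x, rfl⟩

/-- A morphism of resolutions, in one degree. -/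
def PreMap (p : ℕ) : Type (max u v) :=
  {φ : (R.P p).carrier →ₗ[H D t] (R'.P p).carrier //
    φ ∈ (R.P p).hom (R'.P p) 0 ∧ ∀ x, φ (R.d p x) ∈ LinearMap.range (R'.d p)}

lemma exists_preMap_zero : ∃ φ : PreMap R R' 0, ∀ x, R'.aug (φ.1 x) = R.aug x := by
  obtain ⟨l, hl, hl'⟩ := exists_graded_lift R'.aug_mem R.aug_mem fun x => R'.aug_surjective _
  exact ⟨⟨l, hl, fun x => (R'.exact_zero _).1 (by rw [hl', aug_d])⟩, hl'⟩

lemma exists_preMap_succ (p : ℕ) (φ : PreMap R R' p) :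
    ∃ φ' : PreMap R R' (p + 1), ∀ x, R'.d p (φ'.1 x) = φ.1 (R.d p x) := by
  obtain ⟨l, hl, hl'⟩ := exists_graded_lift (R'.d_mem p)
    (GrMod.comp_mem_hom φ.2.1 (R.d_mem p)) φ.2.2
  refine ⟨⟨l, hl, fun x => (R'.exact_succ p _).1 ?_⟩, hl'⟩
  rw [hl', LinearMap.comp_apply, d_d, map_zero]

/-- The components of a morphism of resolutions. -/
def preMap : (p : ℕ) → PreMap R R' p
  | 0 => (exists_preMap_zero R R').choose
  | p + 1 => (exists_preMap_succ R R' p (preMap p)).choose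

lemma exists_map : ∃ φ : ∀ p, (R.P p).carrier →ₗ[H D t] (R'.P p).carrier,
    (∀ p, φ p ∈ (R.P p).hom (R'.P p) 0) ∧ (∀ x, R'.aug (φ 0 x) = R.aug x) ∧
      ∀ p x, R'.d p (φ (p + 1) x) = φ p (R.d p x) :=
  ⟨fun p => (preMap R R' p).1, fun p => (preMap R R' p).2.1,
    (exists_preMap_zero R R').choose_spec,
    fun p => (exists_preMap_succ R R' p (preMap R R' p)).choose_spec⟩

variable {R R'} in
/-- A homotopy between a morphism and zero, in one degree. -/
def PreHomotopy (χ : ∀ p, (R.P p).carrier →ₗ[H D t] (R'.P p).carrier) (p : ℕ) : Type (max u v) :=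
  {s : (R.P p).carrier →ₗ[H D t] (R'.P (p + 1)).carrier //
    s ∈ (R.P p).hom (R'.P (p + 1)) 0 ∧ ∀ x, R'.d p (s (R.d p x)) = χ p (R.d p x)}

section Homotopy

variable {R R'} {χ : ∀ p, (R.P p).carrier →ₗ[H D t] (R'.P p).carrier}
  (hχ : ∀ p, χ p ∈ (R.P p).hom (R'.P p) 0) (hχ0 : ∀ x, R'.aug (χ 0 x) = 0)
  (hχd : ∀ p x, R'.d p (χ (p + 1) x) = χ p (R.d p x))

include hχ hχ0 in
lemma exists_preHomotopy_zero : ∃ s : PreHomotopy χ 0, ∀ x, R'.d 0 (s.1 x) = χ 0 x := by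
  obtain ⟨l, hl, hl'⟩ := exists_graded_lift (R'.d_mem 0) (hχ 0)
    fun x => (R'.exact_zero _).1 (hχ0 x)
  exact ⟨⟨l, hl, fun x => hl' _⟩, hl'⟩

include hχ hχd in
lemma exists_preHomotopy_succ (p : ℕ) (s : PreHomotopy χ p) : ∃ s' : PreHomotopy χ (p + 1),
    ∀ x, R'.d (p + 1) (s'.1 x) = χ (p + 1) x - s.1 (R.d p x) := by
  obtain ⟨l, hl, hl'⟩ := exists_graded_lift (R'.d_mem (p + 1))
    (g := χ (p + 1) - s.1 ∘ₗ R.d p)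
    (sub_mem (hχ (p + 1)) (GrMod.comp_mem_hom s.2.1 (R.d_mem p))) fun x =>
      (R'.exact_succ p _).1 (by
        rw [LinearMap.sub_apply, map_sub, LinearMap.comp_apply, s.2.2, hχd, sub_self])
  refine ⟨⟨l, hl, fun x => ?_⟩, hl'⟩
  rw [hl', LinearMap.sub_apply, LinearMap.comp_apply, d_d, map_zero, sub_zero]

include hχ hχ0 hχd in
lemma exists_homotopy : ∃ s : ∀ p, (R.P p).carrier →ₗ[H D t] (R'.P (p + 1)).carrier,
    (∀ p, s p ∈ (R.P p).hom (R'.P (p + 1)) 0) ∧ (∀ x, R'.d 0 (s 0 x) = χ 0 x) ∧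
      ∀ p x, R'.d (p + 1) (s (p + 1) x) = χ (p + 1) x - s p (R.d p x) := by
  let S : (p : ℕ) → PreHomotopy χ p := fun p => Nat.rec
    (exists_preHomotopy_zero hχ hχ0).choose
    (fun p s => (exists_preHomotopy_succ hχ hχd p s).choose) p
  exact ⟨fun p => (S p).1, fun p => (S p).2.1, (exists_preHomotopy_zero hχ hχ0).choose_spec,
    fun p => (exists_preHomotopy_succ hχ hχd p (S p)).choose_spec⟩

end Homotopy

section Ext

variable (Y : GrMod.{u, w} D t)

variable {R R'} in
/-- Composition with a morphism of resolutions, on cocycles. -/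
def cocyclesMap {φ : ∀ p, (R.P p).carrier →ₗ[H D t] (R'.P p).carrier}
    (hφ : ∀ p, φ p ∈ (R.P p).hom (R'.P p) 0)
    (hφd : ∀ p x, R'.d p (φ (p + 1) x) = φ p (R.d p x)) (p : ℕ) (n : ℤ) :
    R'.cocycles Y p n →ₗ[ℂ] R.cocycles Y p n where
  toFun f := ⟨f.1 ∘ₗ φ p, GrMod.comp_mem_hom f.2.1 (hφ p), LinearMap.ext fun x => by
    have := LinearMap.congr_fun f.2.2 (φ (p + 1) x)
    change f.1 (R'.d p _) = 0 at this
    change f.1 (φ p (R.d p x)) = 0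
    rw [← hφd, this]⟩
  map_add' _ _ := rfl
  map_smul' _ _ := rfl

variable {R R'} in
lemma cocyclesMap_mem_coboundaries {φ : ∀ p, (R.P p).carrier →ₗ[H D t] (R'.P p).carrier}
    (hφ : ∀ p, φ p ∈ (R.P p).hom (R'.P p) 0)
    (hφd : ∀ p x, R'.d p (φ (p + 1) x) = φ p (R.d p x)) (p : ℕ) (n : ℤ) :
    (R'.coboundaries Y p n).submoduleOf (R'.cocycles Y p n) ≤
      ((R.coboundaries Y p n).submoduleOf (R.cocycles Y p n)).comap
        (cocyclesMap Y hφ hφd p n) := by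
  intro f hf
  cases p with
  | zero =>
    have h1 : f.1 = 0 := hf
    change f.1 ∘ₗ φ 0 = 0
    rw [h1, LinearMap.zero_comp]
  | succ p =>
    obtain ⟨f', hf', h1⟩ := hf
    refine ⟨f' ∘ₗ φ p, GrMod.comp_mem_hom hf' (hφ p), LinearMap.ext fun x => ?_⟩
    change f' (φ p (R.d p x)) = f.1 (φ (p + 1) x)
    have h2 : f' ∘ₗ R'.d p = f.1 := h1
    rw [← hφd, ← h2]
    rfl

lemma comp_sub_mem_coboundaries {χ : ∀ p, (R.P p).carrier →ₗ[H D t] (R.P p).carrier}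
    (hχ : ∀ p, χ p ∈ (R.P p).hom (R.P p) 0) (hχ0 : ∀ x, R.aug (χ 0 x) = R.aug x)
    (hχd : ∀ p x, R.d p (χ (p + 1) x) = χ p (R.d p x)) (p : ℕ) (n : ℤ)
    (f : R.cocycles Y p n) : f.1 ∘ₗ χ p - f.1 ∈ R.coboundaries Y p n := by
  have hid : ∀ p, (LinearMap.id : (R.P p).carrier →ₗ[H D t] _) ∈ (R.P p).hom (R.P p) 0 :=
    fun p i x hx => by rwa [add_zero]
  obtain ⟨s, hs, hs0, hs1⟩ := exists_homotopy (R := R) (R' := R)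
    (χ := fun p => χ p - LinearMap.id) (fun p => sub_mem (hχ p) (hid p))
    (fun x => by rw [LinearMap.sub_apply, map_sub, hχ0, LinearMap.id_apply, sub_self])
    (fun p x => by
      rw [LinearMap.sub_apply, map_sub, hχd, LinearMap.id_apply, LinearMap.sub_apply,
        LinearMap.id_apply])
  have hf : ∀ x, f.1 (R.d p x) = 0 := fun x => LinearMap.congr_fun f.2.2 x
  cases p with
  | zero =>
    change f.1 ∘ₗ χ 0 - f.1 = 0
    refine LinearMap.ext fun x => ?_
    have h1 := congrArg f.1 (hs0 x)
    rw [hf, LinearMap.sub_apply, map_sub] at h1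
    exact h1.symm
  | succ p =>
    refine ⟨f.1 ∘ₗ s p, GrMod.comp_mem_hom f.2.1 (hs p), LinearMap.ext fun x => ?_⟩
    change f.1 (s p (R.d p x)) = f.1 (χ (p + 1) x) - f.1 x
    have h1 := congrArg f.1 (hs1 p x)
    rw [hf, LinearMap.sub_apply, map_sub, map_sub, LinearMap.id_apply] at h1
    exact (sub_eq_zero.1 h1.symm).symm

/-- `Ext` does not depend on the choice of a graded projective resolution. -/
lemma nonempty_ext_equiv (p : ℕ) (n : ℤ) : Nonempty (R.Ext Y p n ≃ₗ[ℂ] R'.Ext Y p n) := by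
  obtain ⟨φ, hφ, hφ0, hφd⟩ := exists_map R R'
  obtain ⟨ψ, hψ, hψ0, hψd⟩ := exists_map R' R
  refine ⟨LinearEquiv.ofLinearMap
    (Submodule.mapQ _ _ _ (cocyclesMap_mem_coboundaries Y hψ hψd p n))
    (Submodule.mapQ _ _ _ (cocyclesMap_mem_coboundaries Y hφ hφd p n)) ?_ ?_⟩
  · refine Submodule.linearMap_qext _ (LinearMap.ext fun f => ?_)
    refine (Submodule.Quotient.eq _).2 ?_
    exact comp_sub_mem_coboundaries R' Y (χ := fun p => φ p ∘ₗ ψ p)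
      (fun p => GrMod.comp_mem_hom (hφ p) (hψ p))
      (fun x => by rw [LinearMap.comp_apply, hφ0, hψ0])
      (fun p x => by rw [LinearMap.comp_apply, hφd, hψd, LinearMap.comp_apply]) p n f
  · refine Submodule.linearMap_qext _ (LinearMap.ext fun f => ?_)
    refine (Submodule.Quotient.eq _).2 ?_
    exact comp_sub_mem_coboundaries R Y (χ := fun p => ψ p ∘ₗ φ p)
      (fun p => GrMod.comp_mem_hom (hψ p) (hφ p))
      (fun x => by rw [LinearMap.comp_apply, hψ0, hφ0])
      (fun p x => by rw [LinearMap.comp_apply, hψd, hφd, LinearMap.comp_apply]) p n f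

lemma EPgr_eq : R.EPgr Y = R'.EPgr Y := funext fun n => finsum_congr fun p => by
  rw [(nonempty_ext_equiv R R' Y p n).some.finrank_eq]

variable {R R' Y} in
lemma EPgrDefined.of_res (hR : R'.EPgrDefined Y) : R.EPgrDefined Y := by
  obtain ⟨h1, N, hN⟩ := hR
  refine ⟨fun p n => ?_, N, fun p hp n => ?_⟩
  · have := h1 p n
    exact Module.Finite.equiv (nonempty_ext_equiv R R' Y p n).some.symm
  · have := hN p hp n
    exact (nonempty_ext_equiv R R' Y p n).some.toEquiv.subsingleton

/-- The Euler characteristic of a bounded complex of finite dimensional spaces is that of its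
cohomology. -/
lemma EPgr_of_bounded {N : ℕ} {n : ℤ} (hfin : ∀ p, Module.Finite ℂ ((R.P p).hom Y n))
    (h0 : ∀ p > N, Subsingleton ((R.P p).hom Y n)) :
    (∀ p, Module.Finite ℂ (R.Ext Y p n)) ∧ (∀ p > N, Subsingleton (R.Ext Y p n)) ∧
      R.EPgr Y n = ∑ p ∈ Finset.range (N + 1),
        (-1) ^ p * (Module.finrank ℂ ((R.P p).hom Y n) : ℤ) := by
  have hcoc : ∀ p, Module.Finite ℂ (R.cocycles Y p n) := fun p => by
    have := hfin p
    exact Module.Finite.of_injective (Submodule.inclusion (inf_le_left : R.cocycles Y p n ≤ _))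
      (Submodule.inclusion_injective _)
  have hle : ∀ p, R.coboundaries Y p n ≤ R.cocycles Y p n := fun p => by
    cases p with
    | zero => exact bot_le
    | succ p =>
      rintro _ ⟨f, hf, rfl⟩
      refine ⟨GrMod.comp_mem_hom hf (R.d_mem p), LinearMap.ext fun x => ?_⟩
      change f (R.d p (R.d (p + 1) x)) = 0
      rw [d_d, map_zero]
  have hsub : ∀ p > N, Subsingleton (R.Ext Y p n) := fun p hp => by
    have := h0 p hp
    have : Subsingleton (R.cocycles Y p n) :=
      (Submodule.inclusion_injective (inf_le_left : R.cocycles Y p n ≤ _)).subsingleton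
    exact (Submodule.mkQ_surjective _).subsingleton
  refine ⟨fun p => ?_, hsub, ?_⟩
  · have := hcoc p
    infer_instance
  have e1 : ∀ p, (Module.finrank ℂ (R.Ext Y p n) : ℤ) =
      Module.finrank ℂ (R.cocycles Y p n) - Module.finrank ℂ (R.coboundaries Y p n) := fun p => by
    have := hcoc p
    have h1 := Submodule.finrank_quotient_add_finrank
      ((R.coboundaries Y p n).submoduleOf (R.cocycles Y p n))
    rw [(Submodule.submoduleOfEquivOfLe (hle p)).finrank_eq] at h1
    rw [← h1, Nat.cast_add, add_sub_cancel_right]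
  have e2 : ∀ p, (Module.finrank ℂ ((R.P p).hom Y n) : ℤ) =
      Module.finrank ℂ (R.cocycles Y p n) + Module.finrank ℂ (R.coboundaries Y (p + 1) n) :=
    fun p => by
      have := hfin p
      have h1 := ((R.coboundary Y p).domRestrict ((R.P p).hom Y n)).finrank_range_add_finrank_ker
      have h2 : LinearMap.range ((R.coboundary Y p).domRestrict ((R.P p).hom Y n)) =
          R.coboundaries Y (p + 1) n := LinearMap.range_domRestrict _ _
      have h3 : Module.finrank ℂ (LinearMap.ker ((R.coboundary Y p).domRestrict
          ((R.P p).hom Y n))) = Module.finrank ℂ (R.cocycles Y p n) := by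
        rw [LinearMap.ker_domRestrict]
        have h4 : (R.cocycles Y p n).submoduleOf ((R.P p).hom Y n) =
            (LinearMap.ker (R.coboundary Y p)).submoduleOf ((R.P p).hom Y n) := by
          ext f
          exact ⟨fun hf => hf.2, fun hf => ⟨f.2, hf⟩⟩
        refine Eq.trans ?_ (Submodule.submoduleOfEquivOfLe
          (inf_le_left : R.cocycles Y p n ≤ (R.P p).hom Y n)).finrank_eq
        exact congrArg (fun S : Submodule ℂ ((R.P p).hom Y n) => Module.finrank ℂ S) h4.symm
      rw [h2, h3] at h1
      rw [← h1, Nat.cast_add, add_comm]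
  have e3 : ∀ M, ∑ p ∈ Finset.range M, (-1) ^ p * (Module.finrank ℂ (R.Ext Y p n) : ℤ) =
      ∑ p ∈ Finset.range M, (-1) ^ p * (Module.finrank ℂ ((R.P p).hom Y n) : ℤ) +
        (-1) ^ M * Module.finrank ℂ (R.coboundaries Y M n) := fun M => by
    induction M with
    | zero =>
      have : Module.finrank ℂ (R.coboundaries Y 0 n) = 0 := finrank_bot ℂ _
      rw [this]
      simp
    | succ M ih =>
      rw [Finset.sum_range_succ, Finset.sum_range_succ, ih, e1, e2, pow_succ]
      ring
  have e4 : Module.finrank ℂ (R.coboundaries Y (N + 1) n) = 0 := by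
    have h1 := h0 (N + 1) (by omega)
    have : Subsingleton (R.coboundaries Y (N + 1) n) :=
      (Submodule.inclusion_injective ((hle (N + 1)).trans
        (inf_le_left : R.cocycles Y (N + 1) n ≤ _))).subsingleton
    exact Module.finrank_zero_of_subsingleton
  have e5 := e3 (N + 1)
  rw [e4, Nat.cast_zero, mul_zero, add_zero] at e5
  rw [← e5, EPgr]
  refine finsum_eq_sum_of_support_subset _ fun p hp => ?_
  rw [Finset.coe_range, Set.mem_Iio]
  by_contra hlt
  have := hsub p (by omega)
  exact hp (by
    change (-1 : ℤ) ^ p * (Module.finrank ℂ (R.Ext Y p n) : ℤ) = 0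
    rw [Module.finrank_zero_of_subsingleton, Nat.cast_zero, mul_zero])

end Ext

end GrProjRes

end Cherednik

namespace Cherednik
variable {h : Type u} [AddCommGroup h] [Module ℂ h]

section Trace

variable {M : Type*} [AddCommGroup M] [Module ℂ M] {M' : Type*} [AddCommGroup M'] [Module ℂ M']

/-- The trace is additive on short exact sequences. -/
lemma trace_of_exact {A : Type*} {B : Type*} {C : Type*} [AddCommGroup A] [Module ℂ A]
    [AddCommGroup B] [Module ℂ B] [AddCommGroup C] [Module ℂ C] [FiniteDimensional ℂ A]
    [FiniteDimensional ℂ B] [FiniteDimensional ℂ C] {i : A →ₗ[ℂ] B} {p : B →ₗ[ℂ] C}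
    (hi : Function.Injective i) (hp : Function.Surjective p) (hip : Function.Exact i p)
    {a : Module.End ℂ A} {b : Module.End ℂ B} {c : Module.End ℂ C}
    (hab : ∀ x, i (a x) = b (i x)) (hbc : ∀ x, p (b x) = c (p x)) :
    LinearMap.trace ℂ B b = LinearMap.trace ℂ A a + LinearMap.trace ℂ C c := by
  obtain ⟨s, hs⟩ := p.exists_rightInverse_of_surjective (LinearMap.range_eq_top.2 hp)
  obtain ⟨l, hl⟩ := i.exists_leftInverse_of_injective (LinearMap.ker_eq_bot.2 hi)
  have hs' : ∀ x, p (s x) = x := LinearMap.congr_fun hs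
  have hl' : ∀ x, l (i x) = x := LinearMap.congr_fun hl
  set r : B →ₗ[ℂ] A := l ∘ₗ (LinearMap.id - s ∘ₗ p) with hr
  have hir : ∀ x, i (r x) = x - s (p x) := fun x => by
    obtain ⟨y, hy⟩ := (hip (x - s (p x))).1 (by rw [map_sub, hs', sub_self])
    change i (l (x - s (p x))) = _
    rw [← hy, hl']
  have h1 : b = (b ∘ₗ i) ∘ₗ r + (b ∘ₗ s) ∘ₗ p := LinearMap.ext fun x => by
    change b x = b (i (r x)) + b (s (p x))
    rw [hir, map_sub, sub_add_cancel]
  have h2 : r ∘ₗ (b ∘ₗ i) = a := LinearMap.ext fun x => by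
    apply hi
    change i (r (b (i x))) = i (a x)
    rw [← hab, hir, hip.apply_apply_eq_zero, map_zero, sub_zero]
  have h3 : p ∘ₗ (b ∘ₗ s) = c := LinearMap.ext fun x => by
    change p (b (s x)) = c x
    rw [hbc, hs']
  conv_lhs => rw [h1]
  rw [map_add, LinearMap.trace_comp_comm' r (b ∘ₗ i), LinearMap.trace_comp_comm' p (b ∘ₗ s), h2, h3]

open Classical in
/-- The trace of an endomorphism on a stable subspace. -/
def trOn (f : Module.End ℂ M) (S : Submodule ℂ M) : ℂ :=
  if hS : ∀ m ∈ S, f m ∈ S then LinearMap.trace ℂ S (f.restrict hS) else 0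

lemma trOn_eq {f : Module.End ℂ M} {S : Submodule ℂ M} (hS : ∀ m ∈ S, f m ∈ S) :
    trOn f S = LinearMap.trace ℂ S (f.restrict hS) := dif_pos hS

lemma trOn_bot (f : Module.End ℂ M) : trOn f ⊥ = 0 := by
  rw [trOn_eq (fun m hm => by rw [(Submodule.mem_bot ℂ).1 hm, map_zero]; exact zero_mem _),
    Subsingleton.elim (f.restrict _) 0, map_zero]

variable {f : Module.End ℂ M} {f' : Module.End ℂ M'}

/-- The trace on a preimage and on an image. -/
lemma trOn_add_trOn {d : M →ₗ[ℂ] M'} (hd : ∀ m, d (f m) = f' (d m)) {S : Submodule ℂ M}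
    {B : Submodule ℂ M'} [FiniteDimensional ℂ S] [FiniteDimensional ℂ B]
    (hS : ∀ m ∈ S, f m ∈ S) (hB : ∀ m ∈ B, f' m ∈ B) :
    trOn f S + trOn f' B = trOn f (S ⊓ B.comap d) + trOn f' (S.map d ⊔ B) := by
  have hK : ∀ m ∈ S ⊓ B.comap d, f m ∈ S ⊓ B.comap d := fun m hm =>
    ⟨hS m hm.1, by
      change d (f m) ∈ B
      rw [hd]
      exact hB _ hm.2⟩
  have hT : ∀ m ∈ S.map d ⊔ B, f' m ∈ S.map d ⊔ B := fun m hm => by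
    obtain ⟨_, ⟨s, hs, rfl⟩, b, hb, rfl⟩ := Submodule.mem_sup.1 hm
    rw [map_add, ← hd]
    exact Submodule.add_mem_sup ⟨f s, hS s hs, rfl⟩ (hB b hb)
  set i : (S ⊓ B.comap d : Submodule ℂ M) →ₗ[ℂ] S × B :=
    LinearMap.prod (Submodule.inclusion inf_le_left)
      ((-d ∘ₗ (S ⊓ B.comap d).subtype).codRestrict B fun m => B.neg_mem m.2.2) with hi
  set p : S × B →ₗ[ℂ] (S.map d ⊔ B : Submodule ℂ M') :=
    ((d ∘ₗ S.subtype).coprod B.subtype).codRestrict _ fun m =>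
      Submodule.add_mem_sup ⟨m.1, m.1.2, rfl⟩ m.2.2 with hp
  rw [trOn_eq hS, trOn_eq hB, trOn_eq hK, trOn_eq hT, ← LinearMap.trace_prodMap']
  refine trace_of_exact (i := i) (p := p) (fun x y hxy => ?_) (fun y => ?_) (fun x => ⟨fun hx => ?_,
    ?_⟩) (fun x => ?_) (fun x => ?_)
  · exact Subtype.ext (congrArg (fun z : S × B => (z.1 : M)) hxy)
  · obtain ⟨y, hy⟩ := y
    obtain ⟨_, ⟨s, hs, rfl⟩, b, hb, rfl⟩ := Submodule.mem_sup.1 hy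
    exact ⟨(⟨s, hs⟩, ⟨b, hb⟩), rfl⟩
  · have h1 : d x.1 + x.2 = 0 := congrArg Subtype.val hx
    have h2 : d x.1 = -x.2 := eq_neg_of_add_eq_zero_left h1
    have h3 : d x.1 ∈ B := by
      rw [h2]
      exact B.neg_mem x.2.2
    refine ⟨⟨x.1, x.1.2, h3⟩, Prod.ext rfl (Subtype.ext ?_)⟩
    change -d x.1 = x.2
    rw [h2, neg_neg]
  · rintro ⟨y, rfl⟩
    refine Subtype.ext ?_
    change d y + -d y = 0
    rw [add_neg_cancel]
  · refine Prod.ext rfl (Subtype.ext ?_)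
    change -d (f x) = f' (-d x)
    rw [hd, map_neg]
  · refine Subtype.ext ?_
    change d (f x.1) + f' x.2 = f' (d x.1 + x.2)
    rw [map_add, hd]

lemma trOn_eq_add {d : M →ₗ[ℂ] M'} (hd : ∀ m, d (f m) = f' (d m)) {S : Submodule ℂ M}
    [FiniteDimensional ℂ S] (hS : ∀ m ∈ S, f m ∈ S) :
    trOn f S = trOn f (S ⊓ LinearMap.ker d) + trOn f' (S.map d) := by
  have := trOn_add_trOn (B := (⊥ : Submodule ℂ M')) hd hS
    (fun m hm => by rw [(Submodule.mem_bot ℂ).1 hm, map_zero]; exact zero_mem _)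
  rwa [trOn_bot, add_zero, sup_bot_eq] at this

lemma trOn_sup {S B : Submodule ℂ M} [FiniteDimensional ℂ S] [FiniteDimensional ℂ B]
    (hS : ∀ m ∈ S, f m ∈ S) (hB : ∀ m ∈ B, f m ∈ B) (hSB : Disjoint S B) :
    trOn f (S ⊔ B) = trOn f S + trOn f B := by
  have := trOn_add_trOn (d := LinearMap.id) (f := f) (f' := f) (fun _ => rfl) hS hB
  rw [Submodule.comap_id, Submodule.map_id, hSB.eq_bot, trOn_bot, zero_add] at this
  exact this.symm

lemma map_mem_biSup {ι : Type*} {s : Finset ι} {S : ι → Submodule ℂ M}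
    (hf : ∀ i ∈ s, ∀ m ∈ S i, f m ∈ S i) : ∀ m ∈ ⨆ i ∈ s, S i, f m ∈ ⨆ i ∈ s, S i := by
  intro m hm
  have : (⨆ i ∈ s, S i) ≤ (⨆ i ∈ s, S i).comap f := iSup₂_le fun i hi m hm =>
    Submodule.mem_iSup_of_mem i (Submodule.mem_iSup_of_mem hi (hf i hi m hm))
  exact this hm

lemma trOn_biSup {ι : Type*} {S : ι → Submodule ℂ M} (hS : iSupIndep S) (s : Finset ι)
    (hfin : ∀ i ∈ s, FiniteDimensional ℂ (S i)) (hf : ∀ i ∈ s, ∀ m ∈ S i, f m ∈ S i) :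
    trOn f (⨆ i ∈ s, S i) = ∑ i ∈ s, trOn f (S i) := by
  classical
  induction s using Finset.induction_on with
  | empty => simpa using trOn_bot f
  | insert a s ha ih =>
    have h1 := hfin a (Finset.mem_insert_self _ _)
    have h2 : ∀ i ∈ s, FiniteDimensional ℂ (S i) := fun i hi =>
      hfin i (Finset.mem_insert_of_mem hi)
    have h3 : FiniteDimensional ℂ (⨆ i ∈ s, S i : Submodule ℂ M) := by
      have := fun i : s => h2 i i.2
      rw [iSup_subtype']
      exact Submodule.finite_iSup _
    have h4 : ∀ i ∈ s, ∀ m ∈ S i, f m ∈ S i := fun i hi => hf i (Finset.mem_insert_of_mem hi)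
    rw [Finset.iSup_insert, Finset.sum_insert ha, ← ih h2 h4]
    exact trOn_sup (hf a (Finset.mem_insert_self _ _)) (map_mem_biSup h4)
      (hS.disjoint_biSup (by simpa using ha))

lemma trOn_map {d : M →ₗ[ℂ] M'} (hd : ∀ m, d (f m) = f' (d m)) (hinj : Function.Injective d)
    {S : Submodule ℂ M} [FiniteDimensional ℂ S] (hS : ∀ m ∈ S, f m ∈ S) :
    trOn f' (S.map d) = trOn f S := by
  rw [trOn_eq_add hd hS, LinearMap.ker_eq_bot.2 hinj, inf_bot_eq, trOn_bot, zero_add]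

lemma trOn_top [FiniteDimensional ℂ M] : trOn f ⊤ = LinearMap.trace ℂ M f := by
  have := trOn_map (M := (⊤ : Submodule ℂ M)) (d := (⊤ : Submodule ℂ M).subtype)
    (f := f.restrict fun _ _ => Submodule.mem_top) (f' := f) (fun _ => rfl)
    (Submodule.injective_subtype _) (S := ⊤) (fun _ _ => trivial)
  rw [trOn_eq (fun _ _ => Submodule.mem_top)]
  have e := LinearMap.trace_conj' (f.restrict fun m (_ : m ∈ (⊤ : Submodule ℂ M)) =>
    (Submodule.mem_top : f m ∈ ⊤)) (Submodule.topEquiv (R := ℂ) (M := M))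
  rw [← e]
  rfl

lemma mapIncl_range (S : Submodule ℂ M) (T : Submodule ℂ M') :
    (⊤ : Submodule ℂ (S ⊗[ℂ] T)).map (TensorProduct.mapIncl S T) = tens S T := by
  rw [Submodule.map_top]
  refine le_antisymm ?_ (tens_le.2 fun a ha b hb => ⟨⟨a, ha⟩ ⊗ₜ ⟨b, hb⟩, rfl⟩)
  rintro _ ⟨z, rfl⟩
  induction z with
  | zero => rw [map_zero]; exact zero_mem _
  | add a b h1 h2 => rw [map_add]; exact add_mem h1 h2
  | tmul a b => exact tmul_mem_tens a.2 b.2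

instance finite_tens (S : Submodule ℂ M) (T : Submodule ℂ M') [FiniteDimensional ℂ S]
    [FiniteDimensional ℂ T] : FiniteDimensional ℂ (tens S T) := by
  rw [← mapIncl_range]
  infer_instance

lemma trOn_tens {S : Submodule ℂ M} {T : Submodule ℂ M'} [FiniteDimensional ℂ S]
    [FiniteDimensional ℂ T] (hS : ∀ m ∈ S, f m ∈ S) (hT : ∀ m ∈ T, f' m ∈ T) :
    trOn (TensorProduct.map f f') (tens S T) = trOn f S * trOn f' T := by
  have h1 := trOn_map (d := TensorProduct.mapIncl S T) (S := ⊤)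
    (f := TensorProduct.map (f.restrict hS) (f'.restrict hT)) (f' := TensorProduct.map f f')
    (fun m => ?_) (Module.Flat.tensorProduct_mapIncl_injective_of_right S T) (fun _ _ => trivial)
  · rw [mapIncl_range, trOn_top, LinearMap.trace_tensorProduct'] at h1
    rw [h1, trOn_eq hS, trOn_eq hT]
  · induction m with
    | zero => simp only [map_zero]
    | add a b h1 h2 => simp only [map_add, h1, h2]
    | tmul a b => rfl

/-- The alternating sum of traces along the steps of a filtered complex whose graded pieces are
exact. -/
lemma sum_trOn_eq {δ : Module.End ℂ M} (hδ : ∀ m, δ (f m) = f (δ m)) (A B : ℕ → Submodule ℂ M)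
    [∀ p, FiniteDimensional ℂ (A p)] [∀ p, FiniteDimensional ℂ (B p)]
    (hA : ∀ p, ∀ m ∈ A p, f m ∈ A p) (hB : ∀ p, ∀ m ∈ B p, f m ∈ B p)
    (h0 : ∀ m ∈ A 0, δ m = 0)
    (hex : ∀ p, A (p + 1) ⊓ (B p).comap δ = (A (p + 2)).map δ ⊔ B (p + 1))
    (hex0 : A 0 = (A 1).map δ ⊔ B 0) {P : ℕ} (hP : A (P + 1) = ⊥) (hBP : B (P + 1) = ⊥) :
    ∑ p ∈ Finset.range (P + 1), (-1) ^ p * trOn f (A p) =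
      ∑ p ∈ Finset.range (P + 1), (-1) ^ p * trOn f (B p) := by
  have h1 : ∀ p, trOn f (A (p + 1)) + trOn f (B p) =
      trOn f (A (p + 1) ⊓ (B p).comap δ) + trOn f ((A (p + 1)).map δ ⊔ B p) := fun p =>
    trOn_add_trOn hδ (hA _) (hB _)
  have h2 : ∀ P, ∑ p ∈ Finset.range (P + 1), (-1) ^ p * trOn f (A p) =
      ∑ p ∈ Finset.range (P + 1), (-1) ^ p * trOn f (B p) +
        (-1) ^ P * (trOn f ((A (P + 1)).map δ ⊔ B P) - trOn f (B P)) := fun P => by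
    induction P with
    | zero => simp [hex0]
    | succ P ih =>
      have := h1 P
      rw [Finset.sum_range_succ, ih, Finset.sum_range_succ _ (P + 1), ← hex P,
        pow_succ (-1 : ℂ) P]
      linear_combination (-(-1) ^ P) * this
  rw [h2, hP, Submodule.map_bot, bot_sup_eq, sub_self, mul_zero, add_zero]

end Trace

end Cherednik

namespace Cherednik
variable {h : Type u} [AddCommGroup h] [Module ℂ h]

section Characters

variable {D : Datum h}

/-- The character of the degree `n` part of a graded representation. -/
def GrRep.chr (A : GrRep.{u, v} D) (n : ℤ) (g : D.G) : ℂ := trOn (A.rho g) (A.piece n)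

lemma GrRep.homDim_eq (A : GrRep.{u, v} D) (B : GrRep.{u, w} D) {i j : ℤ}
    (hA : Module.Finite ℂ (A.piece i)) (hB : Module.Finite ℂ (B.piece j)) :
    (A.homDim B i j : ℂ) = (Nat.card D.G : ℂ)⁻¹ * ∑ g, B.chr j g * A.chr i g⁻¹ := by
  have : Invertible (Nat.card D.G : ℂ) := invertibleOfNonzero (by
    rw [Nat.cast_ne_zero]
    exact Nat.card_pos.ne')
  rw [GrRep.homDim, ← Representation.card_inv_mul_sum_char_mul_char_eq_finrank]
  refine congrArg _ (Finset.sum_congr rfl fun g _ => congrArg₂ _ ?_ ?_)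
  · exact (trOn_eq (f := B.rho g) (S := B.piece j) fun m hm => B.stable j g hm).symm
  · exact (trOn_eq (f := A.rho g⁻¹) (S := A.piece i) fun m hm => A.stable i g⁻¹ hm).symm

universe v' w'

/-- The character of the degree `n` part of a virtual graded representation. -/
def VirtGrRep.chr (A : VirtGrRep.{u, v, w} D) (n : ℤ) (g : D.G) : ℂ :=
  A.pos.chr n g - A.neg.chr n g

/-- Finite dimensionality in each degree. -/
def VirtGrRep.FiniteType (A : VirtGrRep.{u, v, w} D) : Prop :=
  ∀ n, Module.Finite ℂ (A.pos.piece n) ∧ Module.Finite ℂ (A.neg.piece n)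

lemma VirtGrRep.homDim_eq {A : VirtGrRep.{u, v, w} D} {B : VirtGrRep.{u, v', w'} D}
    (hA : A.FiniteType) (hB : B.FiniteType) (i j : ℤ) :
    (A.homDim B i j : ℂ) = (Nat.card D.G : ℂ)⁻¹ * ∑ g, B.chr j g * A.chr i g⁻¹ := by
  rw [VirtGrRep.homDim]
  push_cast
  rw [GrRep.homDim_eq _ _ (hA i).1 (hB j).1, GrRep.homDim_eq _ _ (hA i).1 (hB j).2,
    GrRep.homDim_eq _ _ (hA i).2 (hB j).1, GrRep.homDim_eq _ _ (hA i).2 (hB j).2,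
    ← mul_sub, ← mul_sub, ← mul_add, ← Finset.sum_sub_distrib, ← Finset.sum_sub_distrib,
    ← Finset.sum_add_distrib]
  refine congrArg _ (Finset.sum_congr rfl fun g _ => ?_)
  rw [VirtGrRep.chr, VirtGrRep.chr]
  ring

lemma GrRep.finiteType_toVirt {A : GrRep.{u, v} D} (hA : ∀ n, Module.Finite ℂ (A.piece n)) :
    A.toVirt.FiniteType := fun n => ⟨hA n, by
  change Module.Finite ℂ (⊥ : Submodule ℂ ℂ)
  infer_instance⟩

lemma GrRep.chr_toVirt (A : GrRep.{u, v} D) (n : ℤ) (g : D.G) : A.toVirt.chr n g = A.chr n g := by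
  have : (GrRep.zero D).chr n g = 0 := trOn_bot _
  rw [VirtGrRep.chr]
  exact (congrArg _ this).trans (sub_zero _)

end Characters

section Blocks

variable (h) in
/-- The subspace `⋀^a h* ⊗ ⋀^b h` of `⋀ V`. -/
def extBlock (x : ℕ × ℕ) : Submodule ℂ (ExteriorAlgebra ℂ (h × Module.Dual ℂ h)) :=
  extX h ^ x.1 * extY h ^ x.2

variable {D : Datum h}

lemma extRep_mem_extBlock (g : D.G) (x : ℕ × ℕ) : ∀ m ∈ extBlock h x,
    extRep (vRep D) g m ∈ extBlock h x := by
  have : extBlock h x ≤ (extBlock h x).comap (ExteriorAlgebra.map (vRep D g)).toLinearMap := by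
    rw [← Submodule.map_le_iff_le_comap]
    refine (Submodule.map_mul _ _ (ExteriorAlgebra.map (vRep D g))).trans_le ?_
    refine mul_le_mul' ?_ ?_
    · refine Submodule.map_le_iff_le_comap.2 (map_extRep_pow (vRep D) _ (fun g => ?_) g x.1)
      rintro _ ⟨y, rfl⟩
      exact ⟨D.dualRep g y, by simp⟩
    · refine Submodule.map_le_iff_le_comap.2 (map_extRep_pow (vRep D) _ (fun g => ?_) g x.2)
      rintro _ ⟨y, rfl⟩
      exact ⟨D.rep g y, by simp⟩
  exact this

lemma extX_le_range : extX h ≤ LinearMap.range (ExteriorAlgebra.ι ℂ) := by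
  rintro _ ⟨y, -, rfl⟩
  exact ⟨y, rfl⟩

lemma extY_le_range : extY h ≤ LinearMap.range (ExteriorAlgebra.ι ℂ) := by
  rintro _ ⟨y, -, rfl⟩
  exact ⟨y, rfl⟩

lemma extBlock_le_exteriorPower (x : ℕ × ℕ) :
    extBlock h x ≤ ⋀[ℂ]^(x.1 + x.2) (h × Module.Dual ℂ h) := by
  refine (mul_le_mul' (pow_le_pow_left' extX_le_range _)
    (pow_le_pow_left' extY_le_range _)).trans_eq ?_
  exact (pow_add _ _ _).symm

lemma extBlock_eq_bot [FiniteDimensional ℂ h] {x : ℕ × ℕ}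
    (hx : Module.finrank ℂ (h × Module.Dual ℂ h) < x.1 + x.2) : extBlock h x = ⊥ :=
  le_bot_iff.1 ((extBlock_le_exteriorPower x).trans_eq (exteriorPower_eq_bot hx))

section Eigen

variable {A : Type*} [Ring A] [Algebra ℂ A] (φ : A →ₐ[ℂ] A)

lemma mul_le_eigenspace {S T : Submodule ℂ A} {c d : ℂ}
    (hS : S ≤ Module.End.eigenspace φ.toLinearMap c)
    (hT : T ≤ Module.End.eigenspace φ.toLinearMap d) :
    S * T ≤ Module.End.eigenspace φ.toLinearMap (c * d) :=
  Submodule.mul_le.2 fun m hm n hn => by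
    have h1 := Module.End.mem_eigenspace_iff.1 (hS hm)
    have h2 := Module.End.mem_eigenspace_iff.1 (hT hn)
    rw [AlgHom.toLinearMap_apply] at h1 h2
    rw [Module.End.mem_eigenspace_iff, AlgHom.toLinearMap_apply, map_mul, h1, h2,
      smul_mul_smul_comm]

lemma pow_le_eigenspace {S : Submodule ℂ A} {c : ℂ}
    (hS : S ≤ Module.End.eigenspace φ.toLinearMap c) (n : ℕ) :
    S ^ n ≤ Module.End.eigenspace φ.toLinearMap (c ^ n) := by
  induction n with
  | zero =>
    rw [pow_zero, pow_zero, Submodule.one_eq_range]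
    rintro _ ⟨r, rfl⟩
    rw [Module.End.mem_eigenspace_iff, AlgHom.toLinearMap_apply, one_smul]
    exact φ.commutes r
  | succ n ih => rw [pow_succ, pow_succ]; exact mul_le_eigenspace φ ih hS

end Eigen

lemma extBlock_le_deg (x : ℕ × ℕ) : extBlock h x ≤ deg (tauE h).toLinearMap (x.1 - x.2) := by
  have h1 : extX h ≤ Module.End.eigenspace (tauE h).toLinearMap 2 := by
    rintro _ ⟨_, ⟨y, rfl⟩, rfl⟩
    rw [Module.End.mem_eigenspace_iff, AlgHom.toLinearMap_apply, tauE,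
      ExteriorAlgebra.map_apply_ι, ← map_smul]
    simp [scaleV_apply]
  have h2 : extY h ≤ Module.End.eigenspace (tauE h).toLinearMap 2⁻¹ := by
    rintro _ ⟨_, ⟨y, rfl⟩, rfl⟩
    rw [Module.End.mem_eigenspace_iff, AlgHom.toLinearMap_apply, tauE,
      ExteriorAlgebra.map_apply_ι, ← map_smul]
    simp [scaleV_apply]
  have h3 := mul_le_eigenspace _ (pow_le_eigenspace _ h1 x.1) (pow_le_eigenspace _ h2 x.2)
  have h4 : (2 : ℂ) ^ ((x.1 : ℤ) - x.2) = 2 ^ x.1 * 2⁻¹ ^ x.2 := by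
    rw [zpow_sub₀ two_ne_zero, zpow_natCast, zpow_natCast, inv_pow, div_eq_mul_inv]
  rw [deg, h4]
  exact h3

lemma two_pow_mul_three_pow_injective :
    Function.Injective fun x : ℕ × ℕ => (2 : ℂ) ^ x.1 * 3 ^ x.2 := by
  have key : ∀ a b c d : ℕ, 2 ^ a * 3 ^ b = 2 ^ c * 3 ^ d → a ≤ c ∧ b ≤ d := fun a b c d hx => by
    constructor
    · refine (Nat.pow_dvd_pow_iff_le_right (x := 2) (by norm_num)).1 ?_
      exact (Nat.Coprime.pow a d (by norm_num : Nat.Coprime 2 3)).dvd_of_dvd_mul_right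
        (Dvd.intro _ hx)
    · refine (Nat.pow_dvd_pow_iff_le_right (x := 3) (by norm_num)).1 ?_
      exact (Nat.Coprime.pow b c (by norm_num : Nat.Coprime 3 2)).dvd_of_dvd_mul_left
        (Dvd.intro_left _ hx)
  intro x y hxy
  have hN : 2 ^ x.1 * 3 ^ x.2 = 2 ^ y.1 * 3 ^ y.2  := by
    have hxy' : (2 : ℂ) ^ x.1 * 3 ^ x.2 = 2 ^ y.1 * 3 ^ y.2 := hxy
    exact_mod_cast hxy'
  have h1 := key _ _ _ _ hN
  have h2 := key _ _ _ _ hN.symm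
  exact Prod.ext (le_antisymm h1.1 h2.1) (le_antisymm h1.2 h2.2)

variable (h) in
/-- The automorphism of `⋀ V` scaling `h*` by `2` and `h` by `3`. -/
def thetaE : ExteriorAlgebra ℂ (h × Module.Dual ℂ h) →ₐ[ℂ] ExteriorAlgebra ℂ (h × Module.Dual ℂ h) :=
  ExteriorAlgebra.map (LinearMap.prodMap ((3 : ℂ) • LinearMap.id) ((2 : ℂ) • LinearMap.id))

lemma extBlock_le_eigenspace (x : ℕ × ℕ) :
    extBlock h x ≤ Module.End.eigenspace (thetaE h).toLinearMap (2 ^ x.1 * 3 ^ x.2) := by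
  refine mul_le_eigenspace _ (pow_le_eigenspace _ ?_ x.1) (pow_le_eigenspace _ ?_ x.2) <;>
  · rintro _ ⟨_, ⟨y, rfl⟩, rfl⟩
    rw [Module.End.mem_eigenspace_iff, AlgHom.toLinearMap_apply, thetaE,
      ExteriorAlgebra.map_apply_ι, ← map_smul]
    simp

lemma extY_mul_extX_pow_le (a : ℕ) : extY h * extX h ^ a ≤ extX h ^ a * extY h := by
  have h1 : extY h * extX h ≤ extX h * extY h := Submodule.mul_le.2 fun m hm n hn => by
    obtain ⟨y, -, rfl⟩ := id hm
    obtain ⟨x, -, rfl⟩ := id hn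
    rw [eq_neg_of_add_eq_zero_left (ExteriorAlgebra.ι_add_mul_swap y x)]
    exact neg_mem (Submodule.mul_mem_mul hn hm)
  induction a with
  | zero => rw [pow_zero, mul_one, one_mul]
  | succ a ih =>
    calc extY h * extX h ^ (a + 1) = (extY h * extX h ^ a) * extX h := by rw [pow_succ, mul_assoc]
      _ ≤ (extX h ^ a * extY h) * extX h := mul_le_mul' ih le_rfl
      _ = extX h ^ a * (extY h * extX h) := mul_assoc _ _ _
      _ ≤ extX h ^ a * (extX h * extY h) := mul_le_mul' le_rfl h1
      _ = _ := by rw [pow_succ, mul_assoc]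

lemma exteriorPower_le_iSup_extBlock (p : ℕ) :
    ⋀[ℂ]^p (h × Module.Dual ℂ h) ≤ ⨆ x ∈ Finset.HasAntidiagonal.antidiagonal p, extBlock h x := by
  have h0 : LinearMap.range (ExteriorAlgebra.ι ℂ (M := h × Module.Dual ℂ h)) ≤
      extX h ⊔ extY h := by
    rintro _ ⟨v, rfl⟩
    have : v = LinearMap.inr ℂ h _ v.2 + LinearMap.inl ℂ h _ v.1 := by simp
    rw [this, map_add]
    exact Submodule.add_mem_sup ⟨_, ⟨_, rfl⟩, rfl⟩ ⟨_, ⟨_, rfl⟩, rfl⟩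
  induction p with
  | zero =>
    rw [exteriorPower_zero]
    refine le_iSup₂_of_le (0, 0) (by simp) ?_
    rw [extBlock, pow_zero, pow_zero, mul_one]
  | succ p ih =>
    rw [exteriorPower_succ]
    refine (mul_le_mul' h0 ih).trans ?_
    simp only [Submodule.sup_mul, Submodule.mul_iSup]
    refine iSup₂_le fun x hx => sup_le ?_ ?_
    · refine le_iSup₂_of_le (x.1 + 1, x.2) (by simp at hx ⊢; omega) ?_
      rw [extBlock, extBlock, ← mul_assoc, pow_succ']
    · refine le_iSup₂_of_le (x.1, x.2 + 1) (by simp at hx ⊢; omega) ?_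
      rw [extBlock, extBlock, ← mul_assoc, pow_succ' (extY h), ← mul_assoc]
      exact mul_le_mul' (extY_mul_extX_pow_le _) le_rfl

variable {t : ℂ} (X : GrMod.{u, v} D t)

/-- The part of `X ⊗ ⋀^a h* ⊗ ⋀^b h` of total degree `d`. -/
def block (d : ℤ) (x : ℕ × ℕ) : Submodule ℂ (extSpace X) :=
  tens (X.piece (d - x.1 + x.2)) (extBlock h x)

lemma iSupIndep_block (d : ℤ) : iSupIndep (block X d) := by
  have h1 := (Module.End.eigenspaces_iSupIndep (TensorProduct.map (LinearMap.id (M := X.carrier))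
    (thetaE h).toLinearMap)).comp two_pow_mul_three_pow_injective
  refine h1.mono fun x => tens_le.2 fun a _ b hb => ?_
  have h2 := Module.End.mem_eigenspace_iff.1 (extBlock_le_eigenspace x hb)
  change _ ∈ Module.End.eigenspace _ _
  rw [Module.End.mem_eigenspace_iff, TensorProduct.map_tmul, h2, TensorProduct.tmul_smul]
  rfl

variable {X}

lemma extSpaceRep_mem_block (g : D.G) (d : ℤ) (x : ℕ × ℕ) : ∀ m ∈ block X d x,
    extSpaceRep X g m ∈ block X d x := fun m hm => by
  refine mem_of_mem_tens (extSpaceRep X g) (block X d x) (fun a ha b hb => ?_) hm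
  have h1 : X.rep g a ∈ X.piece (d - x.1 + x.2) := X.res.stable _ g ha
  exact tmul_mem_tens h1 (extRep_mem_extBlock g x b hb)

variable [FiniteDimensional ℂ h]

lemma finite_block (hX : X.FiniteType) (d : ℤ) (x : ℕ × ℕ) : Module.Finite ℂ (block X d x) := by
  have : FiniteDimensional ℂ (X.piece (d - x.1 + x.2)) := hX _
  exact finite_tens _ _

/-- The character of `⋀^a h* ⊗ ⋀^b h`. -/
def extChr (g : D.G) (x : ℕ × ℕ) : ℂ := trOn (extRep (vRep D) g) (extBlock h x)

lemma trOn_block (hX : X.FiniteType) (d : ℤ) (x : ℕ × ℕ) (g : D.G) :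
    trOn (extSpaceRep X g) (block X d x) = X.res.chr (d - x.1 + x.2) g * extChr g x := by
  have : FiniteDimensional ℂ (X.piece (d - x.1 + x.2)) := hX _
  exact trOn_tens (X.res.stable _ g) (extRep_mem_extBlock g x)

variable (h) in
/-- A finite set of bidegrees outside of which `⋀^a h* ⊗ ⋀^b h` vanishes. -/
def extIndex : Finset (ℕ × ℕ) :=
  (Finset.range (Module.finrank ℂ (h × Module.Dual ℂ h) + 1)).biUnion Finset.HasAntidiagonal.antidiagonal

lemma mem_extIndex {x : ℕ × ℕ} :
    x ∈ extIndex h ↔ x.1 + x.2 < Module.finrank ℂ (h × Module.Dual ℂ h) + 1 := by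
  simp [extIndex]

lemma block_eq_bot {x : ℕ × ℕ} (hx : x ∉ extIndex h) (d : ℤ) : block X d x = ⊥ := by
  rw [mem_extIndex] at hx
  rw [block, extBlock_eq_bot (by omega)]
  exact tens_bot_right

lemma iSup_block_filter (d : ℤ) (P : ℕ × ℕ → Prop) [DecidablePred P] :
    ⨆ x ∈ (extIndex h).filter P, block X d x = ⨆ (x) (_ : P x), block X d x := by
  refine le_antisymm (iSup₂_le fun x hx => le_iSup₂_of_le x (Finset.mem_filter.1 hx).2 le_rfl)
    (iSup₂_le fun x hx => ?_)
  by_cases hxi : x ∈ extIndex h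
  · exact le_iSup₂_of_le x (Finset.mem_filter.2 ⟨hxi, hx⟩) le_rfl
  · rw [block_eq_bot hxi]
    exact bot_le

lemma finite_iSup_block (hX : X.FiniteType) (d : ℤ) (P : ℕ × ℕ → Prop) [DecidablePred P] :
    Module.Finite ℂ (⨆ x ∈ (extIndex h).filter P, block X d x : Submodule ℂ (extSpace X)) := by
  have := fun x : ((extIndex h).filter P : Finset (ℕ × ℕ)) => finite_block hX d (x : ℕ × ℕ)
  rw [iSup_subtype']
  exact Submodule.finite_iSup _

lemma trOn_iSup_block (hX : X.FiniteType) (d : ℤ) (P : ℕ × ℕ → Prop) [DecidablePred P] (g : D.G) :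
    trOn (extSpaceRep X g) (⨆ x ∈ (extIndex h).filter P, block X d x) =
      ∑ x ∈ (extIndex h).filter P, X.res.chr (d - x.1 + x.2) g * extChr g x := by
  rw [trOn_biSup (iSupIndep_block X d) _ (fun x _ => finite_block hX d x)
    fun x _ => extSpaceRep_mem_block g d x]
  exact Finset.sum_congr rfl fun x _ => trOn_block hX d x g

lemma tensor_extV_piece (ε : ZMod 2) (d : ℤ) : (X.res.tensor (extV D ε)).piece d =
    ⨆ x ∈ (extIndex h).filter (fun x => ((x.1 + x.2 : ℕ) : ZMod 2) = ε), block X d x := by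
  rw [iSup_block_filter]
  change ⨆ i, tens (X.piece i) (⨆ (a : ℕ) (b : ℕ)
    (_ : (a : ℤ) - b = d - i ∧ ((a + b : ℕ) : ZMod 2) = ε), extX h ^ a * extY h ^ b) = _
  simp only [tens_iSup_right]
  refine le_antisymm (iSup_le fun i => iSup_le fun a => iSup_le fun b => iSup_le fun hab => ?_)
    (iSup₂_le fun x hx => ?_)
  · refine le_iSup₂_of_le (a, b) hab.2 ?_
    rw [block, show d - ((a, b) : ℕ × ℕ).1 + ((a, b) : ℕ × ℕ).2 = i by
      have := hab.1
      simp only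
      omega]
    exact le_rfl
  · exact le_iSup_of_le (d - x.1 + x.2) (le_iSup_of_le x.1 (le_iSup_of_le x.2
      (le_iSup_of_le ⟨by omega, hx⟩ le_rfl)))

lemma extPart_inf_deg (p : ℕ) (d : ℤ) : extPart X p ⊓ deg (extTau X) d =
    ⨆ x ∈ (extIndex h).filter (fun x => x.1 + x.2 = p), block X d x := by
  rw [iSup_block_filter]
  have h1 : ∀ d x, block X d x ≤ deg (extTau X) d := fun d x => tens_le.2 fun a ha b hb => by
    have := tmul_mem_deg (GrMod.deg_tau X _ ▸ ha : a ∈ deg X.tau (d - x.1 + x.2))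
      (extBlock_le_deg x hb)
    rw [show d - x.1 + x.2 + ((x.1 : ℤ) - x.2) = d by ring] at this
    exact this
  refine le_antisymm (fun m hm => ?_) (iSup₂_le fun x hx => le_inf ?_ (h1 d x))
  · refine mem_of_mem_iSup_of_mem_deg (τ := extTau X)
      (S := fun d => ⨆ (x : ℕ × ℕ) (_ : x.1 + x.2 = p), block X d x)
      (fun d => iSup₂_le fun x _ => h1 d x) ?_ hm.2
    have h2 := (tens_mono le_rfl (exteriorPower_le_iSup_extBlock p) :
      extPart X p ≤ tens ⊤ _) hm.1
    rw [← X.isInternal.submodule_iSup_eq_top, tens_iSup_left] at h2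
    refine (?_ : (⨆ i, tens (X.piece i) (⨆ x ∈ Finset.HasAntidiagonal.antidiagonal p,
      extBlock h x)) ≤ _) h2
    simp only [tens_iSup_right]
    refine iSup_le fun i => iSup₂_le fun x hx => le_iSup_of_le (i + x.1 - x.2)
      (le_iSup₂_of_le x (Finset.HasAntidiagonal.mem_antidiagonal.1 hx) ?_)
    rw [block, show i + x.1 - x.2 - x.1 + x.2 = i by ring]
  · subst hx
    exact tens_mono le_top (extBlock_le_exteriorPower x)

lemma finite_extPart_inf_deg (hX : X.FiniteType) (p : ℕ) (d : ℤ) :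
    Module.Finite ℂ (extPart X p ⊓ deg (extTau X) d : Submodule ℂ (extSpace X)) := by
  rw [extPart_inf_deg]
  exact finite_iSup_block hX d _

lemma finite_tensor_extV (hX : X.FiniteType) (ε : ZMod 2) (d : ℤ) :
    Module.Finite ℂ ((X.res.tensor (extV D ε)).piece d) := by
  rw [tensor_extV_piece]
  exact finite_iSup_block hX d _

lemma chr_tensor_extV (hX : X.FiniteType) (ε : ZMod 2) (d : ℤ) (g : D.G) :
    (X.res.tensor (extV D ε)).chr d g =
      ∑ p ∈ (Finset.range (Module.finrank ℂ (h × Module.Dual ℂ h) + 1)).filter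
        (fun p : ℕ => (p : ZMod 2) = ε), trOn (extSpaceRep X g) (extPart X p ⊓ deg (extTau X) d) := by
  have h1 : (X.res.tensor (extV D ε)).chr d g = trOn (extSpaceRep X g)
    ((X.res.tensor (extV D ε)).piece d) := rfl
  rw [h1, tensor_extV_piece, trOn_iSup_block hX]
  simp only [extPart_inf_deg, trOn_iSup_block hX]
  rw [← Finset.sum_fiberwise_of_maps_to (g := fun x : ℕ × ℕ => x.1 + x.2)
    (t := (Finset.range (Module.finrank ℂ (h × Module.Dual ℂ h) + 1)).filter
      (fun p : ℕ => (p : ZMod 2) = ε)) (fun x hx => ?_)]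
  · refine Finset.sum_congr rfl fun p hp => Finset.sum_congr ?_ fun _ _ => rfl
    ext x
    simp only [Finset.mem_filter] at hp ⊢
    exact ⟨fun hx => ⟨hx.1.1, hx.2⟩, fun hx => ⟨⟨hx.1, hx.2 ▸ hp.2⟩, hx.2⟩⟩
  · simp only [Finset.mem_filter, mem_extIndex, Finset.mem_range] at hx ⊢
    exact hx

lemma zmod_two_cases (p : ℕ) :
    ((p : ZMod 2) = 0 ∧ (-1 : ℂ) ^ p = 1) ∨ ((p : ZMod 2) = 1 ∧ (-1 : ℂ) ^ p = -1) := by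
  rcases Nat.even_or_odd p with hp | hp
  · exact Or.inl ⟨(ZMod.natCast_eq_zero_iff_even).2 hp, hp.neg_one_pow⟩
  · exact Or.inr ⟨(ZMod.natCast_eq_one_iff_odd).2 hp, hp.neg_one_pow⟩

lemma sum_filter_sub_sum_filter {ι : Type*} (s : Finset ι) (k : ι → ℕ) (F : ι → ℂ) :
    ∑ x ∈ s.filter (fun x => (k x : ZMod 2) = 0), F x -
      ∑ x ∈ s.filter (fun x => (k x : ZMod 2) = 1), F x = ∑ x ∈ s, (-1) ^ k x * F x := by
  rw [Finset.sum_filter, Finset.sum_filter, ← Finset.sum_sub_distrib]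
  refine Finset.sum_congr rfl fun x _ => ?_
  rcases zmod_two_cases (k x) with ⟨h1, h2⟩ | ⟨h1, h2⟩ <;> rw [h1, h2] <;> simp

/-- The character of the elliptic combination, in terms of the Koszul complex. -/
lemma chr_elliptic (hX : X.FiniteType) (d : ℤ) (g : D.G) :
    X.res.elliptic.chr d g =
      ∑ p ∈ Finset.range (Module.finrank ℂ (h × Module.Dual ℂ h) + 1),
        (-1) ^ p * trOn (extSpaceRep X g) (extPart X p ⊓ deg (extTau X) d) := by
  rw [← sum_filter_sub_sum_filter _ (fun p => p)]
  exact congrArg₂ _ (chr_tensor_extV hX 0 d g) (chr_tensor_extV hX 1 d g)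

/-- The character of the elliptic combination, in terms of characters of exterior powers. -/
lemma chr_elliptic_eq_sum_block (hX : X.FiniteType) (d : ℤ) (g : D.G) :
    X.res.elliptic.chr d g = ∑ x ∈ extIndex h, (-1) ^ (x.1 + x.2) *
      (X.res.chr (d - x.1 + x.2) g * extChr g x) := by
  rw [← sum_filter_sub_sum_filter _ (fun x : ℕ × ℕ => x.1 + x.2)]
  have h1 : ∀ ε, (X.res.tensor (extV D ε)).chr d g =
      ∑ x ∈ (extIndex h).filter (fun x => ((x.1 + x.2 : ℕ) : ZMod 2) = ε),
        X.res.chr (d - x.1 + x.2) g * extChr g x := fun ε => by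
    rw [← trOn_iSup_block hX, ← tensor_extV_piece]
    rfl
  rw [← h1, ← h1]
  rfl

end Blocks

end Cherednik

namespace Cherednik
variable {h : Type u} [AddCommGroup h] [Module ℂ h]

section Euler

variable {D : Datum h} {t : ℂ} [FiniteDimensional ℂ h] {X : GrMod.{u, v} D t} {Y : GrMod.{u, w} D t}

omit [FiniteDimensional ℂ h] in
lemma IsHomogeneous.homDim_eq {N : Submodule ℂ (extSpace X)} (hN : IsHomogeneous N)
    (hY : Y.FiniteType) {d : ℤ} (hfin : Module.Finite ℂ (hN.grRep.piece d)) (j : ℤ) :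
    (hN.grRep.homDim Y.res d j : ℂ) = (Nat.card D.G : ℂ)⁻¹ *
      ∑ g, Y.res.chr j g * trOn (extSpaceRep X g⁻¹) (N ⊓ deg (extTau X) d) :=
  GrRep.homDim_eq _ _ hfin (hY j)

lemma elliptic_finiteType (hX : X.FiniteType) : X.res.elliptic.FiniteType :=
  fun d => ⟨finite_tensor_extV hX 0 d, finite_tensor_extV hX 1 d⟩

variable (K : KoszulFamily X)

/-- The Euler–Poincaré pairing computed by a bounded Koszul family. -/
theorem KoszulFamily.pairing_eq (hX : X.FiniteType) (hY : Y.FiniteType) {P : ℕ}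
    (hP : ∀ p > P, K.N p = ⊥)
    (hfin : ∀ p d, Module.Finite ℂ ((K.homogeneous p).grRep.piece d))
    (hs : ∀ p n, {d : ℤ | (K.homogeneous p).grRep.homDim Y.res d (d + n) ≠ 0}.Finite)
    (hchr : ∀ d g, X.res.elliptic.chr d g = ∑ p ∈ Finset.range (P + 1),
      (-1) ^ p * trOn (extSpaceRep X g) (K.N p ⊓ deg (extTau X) d)) (R : GrProjRes X) :
    R.EPgrDefined Y ∧ VEllDefined X.res Y.res ∧ R.EPgr Y = vEll X.res Y.res := by
  have hdim : ∀ d n, X.res.elliptic.homDim Y.res.toVirt d (d + n) =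
      ∑ p ∈ Finset.range (P + 1),
        (-1) ^ p * ((K.homogeneous p).grRep.homDim Y.res d (d + n) : ℤ) := fun d n => by
    have h1 : ((X.res.elliptic.homDim Y.res.toVirt d (d + n) : ℤ) : ℂ) =
        ((∑ p ∈ Finset.range (P + 1),
          (-1) ^ p * ((K.homogeneous p).grRep.homDim Y.res d (d + n) : ℤ) : ℤ) : ℂ) := by
      rw [VirtGrRep.homDim_eq (elliptic_finiteType hX) (GrRep.finiteType_toVirt (A := Y.res) hY)]
      push_cast
      simp only [GrRep.chr_toVirt, hchr, (K.homogeneous _).homDim_eq hY (hfin _ d)]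
      simp only [Finset.mul_sum]
      rw [Finset.sum_comm]
      exact Finset.sum_congr rfl fun p _ => Finset.sum_congr rfl fun g _ => by ring
    exact_mod_cast h1
  have hhom : ∀ p n, Module.Finite ℂ ((K.res.P p).hom Y n) ∧
      Module.finrank ℂ ((K.res.P p).hom Y n) =
        ∑ᶠ d, (K.homogeneous p).grRep.homDim Y.res d (d + n) := fun p n =>
    finrank_koszulHom (K.homogeneous p) hY (hfin p) n (hs p n)
  have hsub : ∀ p > P, ∀ n, Subsingleton ((K.res.P p).hom Y n) := fun p hp n =>
    ⟨fun f f' => Subtype.ext (koszulModule_hom_ext (K.homogeneous p) fun d m _ => by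
      have h1 : m = 0 := Subtype.ext ((Submodule.mem_bot ℂ).1 ((hP p hp).le m.2))
      rw [h1, map_zero]
      exact (map_zero (f.1 : koszulModule (K.N p) →ₗ[H D t] Y.carrier)).trans
        (map_zero (f'.1 : koszulModule (K.N p) →ₗ[H D t] Y.carrier)).symm)⟩
  have hE := fun n => GrProjRes.EPgr_of_bounded (R := K.res) (Y := Y) (N := P) (n := n)
    (fun p => (hhom p n).1) fun p hp => hsub p hp n
  have hdef : K.res.EPgrDefined Y := ⟨fun p n => (hE n).1 p, P, fun p hp n => (hE n).2.1 p hp⟩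
  have hsupp : ∀ n p, (Function.support fun d : ℤ => (-1 : ℤ) ^ p *
      ((K.homogeneous p).grRep.homDim Y.res d (d + n) : ℤ)).Finite := fun n p =>
    (hs p n).subset fun d hd h0 => hd (by
      change (-1 : ℤ) ^ p * (((K.homogeneous p).grRep.homDim Y.res d (d + n) : ℕ) : ℤ) = 0
      rw [h0, Nat.cast_zero, mul_zero])
  refine ⟨hdef.of_res, fun n => ?_, funext fun n => ?_⟩
  · refine (Set.Finite.biUnion (Finset.range (P + 1)).finite_toSet
      fun p _ => hsupp n p).subset fun d hd => ?_
    by_contra hcon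
    refine hd ?_
    rw [hdim]
    refine Finset.sum_eq_zero fun p hp => ?_
    by_contra h0
    exact hcon (Set.mem_biUnion hp h0)
  · rw [GrProjRes.EPgr_eq R K.res, (hE n).2.2, vEll, VirtGrRep.pairing, finsum_congr fun d => hdim d n,
      finsum_sum_comm _ _ fun p _ => hsupp n p]
    refine Finset.sum_congr rfl fun p _ => ?_
    rw [(hhom p n).2, ← mul_finsum]
    refine congrArg _ ((Nat.castAddMonoidHom ℤ).map_finsum ?_)
    exact hs p n

end Euler

section HomFinite

variable {D : Datum h} {t : ℂ} [FiniteDimensional ℂ h] {X : GrMod.{u, v} D t} {Y : GrMod.{u, w} D t}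

lemma homDim_tensor_extV (hX : X.FiniteType) (hY : Y.FiniteType) (ε : ZMod 2) (d j : ℤ) :
    (X.res.tensor (extV D ε)).homDim Y.res d j =
      ∑ p ∈ (Finset.range (Module.finrank ℂ (h × Module.Dual ℂ h) + 1)).filter
        (fun p : ℕ => (p : ZMod 2) = ε), (isHomogeneous_extPart X p).grRep.homDim Y.res d j := by
  have h1 : (((X.res.tensor (extV D ε)).homDim Y.res d j : ℕ) : ℂ) =
      ((∑ p ∈ (Finset.range (Module.finrank ℂ (h × Module.Dual ℂ h) + 1)).filter
        (fun p : ℕ => (p : ZMod 2) = ε),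
          (isHomogeneous_extPart X p).grRep.homDim Y.res d j : ℕ) : ℂ) := by
    push_cast
    rw [GrRep.homDim_eq _ _ (finite_tensor_extV hX ε d) (hY j)]
    simp only [chr_tensor_extV hX,
      (isHomogeneous_extPart X _).homDim_eq hY (finite_extPart_inf_deg hX _ d)]
    simp only [Finset.mul_sum]
    rw [Finset.sum_comm]
  exact_mod_cast h1

lemma extPart_eq_bot {p : ℕ} (hp : p > Module.finrank ℂ (h × Module.Dual ℂ h)) :
    extPart X p = ⊥ := by
  rw [extPart, exteriorPower_eq_bot hp]
  exact tens_bot_right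

/-- The comparison of pairings when the spaces of `G`-homomorphisms are finite dimensional. -/
theorem pairing_eq_of_homFinite (hX : X.FiniteType) (hY : Y.FiniteType)
    (hXY : HomFinite X.res Y.res) (R : GrProjRes X) :
    R.EPgrDefined Y ∧ VEllDefined X.res Y.res ∧ R.EPgr Y = vEll X.res Y.res := by
  refine (koszulFamily X).pairing_eq hX hY (fun p hp => extPart_eq_bot hp)
    (fun p d => finite_extPart_inf_deg hX p d) (fun p n => ?_) (fun d g => chr_elliptic hX d g) R
  refine (hXY p n).subset fun d hd h0 => ?_
  change (isHomogeneous_extPart X p).grRep.homDim Y.res d (d + n) ≠ 0 at hd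
  rw [homDim_tensor_extV hX hY, Finset.sum_eq_zero_iff] at h0
  by_cases hp : p < Module.finrank ℂ (h × Module.Dual ℂ h) + 1
  · exact hd (h0 p (Finset.mem_filter.2 ⟨Finset.mem_range.2 hp, rfl⟩))
  · have h1 : extPart X p = ⊥ := extPart_eq_bot (by omega)
    have h2 := (isHomogeneous_extPart X p).homDim_eq hY (finite_extPart_inf_deg hX p d) (d + n)
    have h3 : ∀ g : D.G, trOn (extSpaceRep X g⁻¹) (extPart X p ⊓ deg (extTau X) d) = 0 := fun g => by
      rw [h1, bot_inf_eq, trOn_bot]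
    simp only [h3, mul_zero, Finset.sum_const_zero] at h2
    exact hd (Nat.cast_eq_zero.1 h2)

end HomFinite

end Cherednik

namespace Cherednik

section HighDegrees

variable {W : Type*} {M : Type*} [AddCommGroup W] [Module ℂ W] [AddCommGroup M] [Module ℂ M]
  {ι : Type*} [Fintype ι]

/-- The Koszul differential on `M ⊗ ⋀ W` of a family of operators on `M` parametrised by `W`. -/
def kosz (L : W →ₗ[ℂ] Module.End ℂ M) (b : Module.Basis ι ℂ W) :
    Module.End ℂ (M ⊗[ℂ] ExteriorAlgebra ℂ W) :=
  ∑ j, TensorProduct.map (L (b j)) (ctr (b.coord j))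

variable {L : W →ₗ[ℂ] Module.End ℂ M} (b : Module.Basis ι ℂ W)

lemma kosz_tmul (m : M) (ω : ExteriorAlgebra ℂ W) :
    kosz L b (m ⊗ₜ ω) = ∑ j, L (b j) m ⊗ₜ ctr (b.coord j) ω := by
  rw [kosz, LinearMap.sum_apply]
  rfl

/-- Operators intertwining two families give morphisms of Koszul complexes. -/
lemma kosz_map {M' : Type*} [AddCommGroup M'] [Module ℂ M'] {L' : W →ₗ[ℂ] Module.End ℂ M'}
    {a a' : M →ₗ[ℂ] M'} (ha : ∀ w m, L' w (a m) = a' (L w m)) (z : M ⊗[ℂ] ExteriorAlgebra ℂ W) :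
    kosz L' b (TensorProduct.map a LinearMap.id z) =
      TensorProduct.map a' LinearMap.id (kosz L b z) := by
  induction z with
  | zero => simp only [map_zero]
  | add z z' h1 h2 => simp only [map_add, h1, h2]
  | tmul m ω =>
    rw [TensorProduct.map_tmul, kosz_tmul, kosz_tmul, map_sum]
    exact Finset.sum_congr rfl fun j _ => by rw [ha, TensorProduct.map_tmul]; rfl

lemma kosz_wedge (w : W) (z : M ⊗[ℂ] ExteriorAlgebra ℂ W) :
    kosz L b (TensorProduct.map LinearMap.id (wedge w) z) =
      TensorProduct.map (L w) LinearMap.id z -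
        TensorProduct.map LinearMap.id (wedge w) (kosz L b z) := by
  induction z with
  | zero => simp only [map_zero, sub_zero]
  | add z z' h1 h2 => simp only [map_add, h1, h2]; abel
  | tmul m ω =>
    rw [TensorProduct.map_tmul, kosz_tmul, kosz_tmul, map_sum, TensorProduct.map_tmul]
    have h1 : L w m ⊗ₜ[ℂ] ω = ∑ j, L (b j) m ⊗ₜ[ℂ] (b.coord j w • ω) := by
      conv_lhs => rw [← b.sum_repr w]
      rw [map_sum, LinearMap.sum_apply, TensorProduct.sum_tmul]
      refine Finset.sum_congr rfl fun j _ => ?_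
      rw [map_smul, LinearMap.smul_apply, ← TensorProduct.smul_tmul', TensorProduct.tmul_smul]
      rfl
    rw [LinearMap.id_apply, LinearMap.id_apply, h1, ← Finset.sum_sub_distrib]
    refine Finset.sum_congr rfl fun j _ => ?_
    rw [ctr_wedge, TensorProduct.tmul_sub, TensorProduct.map_tmul]
    rfl

lemma isNoetherianRing_adjoin {A : Type*} [Ring A] [Algebra ℂ A] {s : Set A} (hs : s.Finite)
    (hcomm : ∀ a ∈ s, ∀ b ∈ s, a * b = b * a) : IsNoetherianRing (Algebra.adjoin ℂ s) := by
  letI := Algebra.adjoinCommRingOfComm ℂ hcomm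
  have h1 : Algebra.FiniteType ℂ (Algebra.adjoin ℂ s) :=
    (Subalgebra.fg_iff_finiteType (Algebra.adjoin ℂ s)).1 ⟨hs.toFinset, by rw [hs.coe_toFinset]⟩
  exact Algebra.FiniteType.isNoetherianRing ℂ _

variable [FiniteDimensional ℂ W]

/-- A finitely generated module over commuting operators of degree one has no Koszul homology in
high degrees. -/
theorem exists_kosz_eq (hcomm : ∀ v w m, L v (L w m) = L w (L v m)) (π : ℕ → Module.End ℂ M)
    (hπ : ∀ k w m, L w (π k m) = π (k + 1) (L w m)) (hπ0 : ∀ m, ∃ K, ∀ k ≥ K, π k m = 0)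
    (F : Finset M) (hF : ∀ S : Submodule ℂ M, (F : Set M) ⊆ S → (∀ w, ∀ m ∈ S, L w m ∈ S) → S = ⊤) :
    ∃ k₀, ∀ k ≥ k₀, ∀ z : M ⊗[ℂ] ExteriorAlgebra ℂ W, kosz L b z = 0 →
      TensorProduct.map (π (k + 1)) LinearMap.id z = z →
        ∃ w, kosz L b (TensorProduct.map (π k) LinearMap.id w) = z := by
  classical
  set A : Subalgebra ℂ (Module.End ℂ M) := Algebra.adjoin ℂ (Set.range fun j => L (b j)) with hA
  have : IsNoetherianRing A := isNoetherianRing_adjoin (Set.finite_range _) (by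
    rintro _ ⟨i, rfl⟩ _ ⟨j, rfl⟩
    exact LinearMap.ext fun m => hcomm _ _ m)
  have hLA : ∀ w, L w ∈ A := fun w => by
    rw [← b.sum_repr w, map_sum]
    exact Subalgebra.sum_mem _ fun j _ => by
      rw [map_smul]
      exact Subalgebra.smul_mem _ (Algebra.subset_adjoin (Set.mem_range_self j)) _
  have hsmul : ∀ (a : A) (z : M ⊗[ℂ] ExteriorAlgebra ℂ W),
      a • z = TensorProduct.map (a : Module.End ℂ M) LinearMap.id z := fun a z => by
    induction z with
    | zero => simp only [map_zero, smul_zero]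
    | add z z' h1 h2 => simp only [map_add, smul_add, h1, h2]
    | tmul m ω => rfl
  have hfin : Module.Finite A M := by
    refine ⟨⟨F, ?_⟩⟩
    rw [← Submodule.restrictScalars_eq_top_iff ℂ]
    refine hF _ Submodule.subset_span fun w m hm => ?_
    have hm' : m ∈ Submodule.span A (F : Set M) := hm
    exact (Submodule.span A (F : Set M)).smul_mem (⟨L w, hLA w⟩ : A) hm'
  have hfin' : Module.Finite A (M ⊗[ℂ] ExteriorAlgebra ℂ W) := by
    obtain ⟨S, hS⟩ := Module.finite_def.1 (inferInstance : Module.Finite ℂ (ExteriorAlgebra ℂ W))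
    refine ⟨⟨Finset.image₂ (fun m ω => m ⊗ₜ ω) F S, ?_⟩⟩
    set T := Submodule.span A ((Finset.image₂ (fun (m : M) (ω : ExteriorAlgebra ℂ W) => m ⊗ₜ[ℂ] ω)
      F S : Finset _) : Set (M ⊗[ℂ] ExteriorAlgebra ℂ W)) with hT
    have h1 : ∀ ω ∈ S, ∀ m : M, m ⊗ₜ[ℂ] ω ∈ T := fun ω hω m => by
      have : (T.restrictScalars ℂ).comap ((TensorProduct.mk ℂ M (ExteriorAlgebra ℂ W)).flip ω) =
          ⊤ := hF _ (fun m hm => Submodule.subset_span (by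
            exact_mod_cast Finset.mem_image₂_of_mem hm hω)) fun w m hm => by
          have h2 : m ⊗ₜ[ℂ] ω ∈ T := hm
          exact T.smul_mem ⟨L w, hLA w⟩ h2
      exact (this.ge (Submodule.mem_top : m ∈ ⊤) :)
    have h2 : ∀ (m : M) (ω : ExteriorAlgebra ℂ W), m ⊗ₜ[ℂ] ω ∈ T := fun m ω => by
      have h3 : Submodule.span ℂ (S : Set (ExteriorAlgebra ℂ W)) ≤
          (T.restrictScalars ℂ).comap (TensorProduct.mk ℂ M (ExteriorAlgebra ℂ W) m) :=
        Submodule.span_le.2 fun ω hω => h1 ω hω m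
      rw [hS] at h3
      exact h3 (Submodule.mem_top : ω ∈ ⊤)
    refine top_le_iff.1 fun z _ => ?_
    induction z with
    | zero => exact zero_mem _
    | add z z' h3 h4 => exact add_mem (h3 trivial) (h4 trivial)
    | tmul m ω => exact h2 m ω
  have hcommA : ∀ a ∈ A, ∀ w m, L w (a m) = a (L w m) := fun a ha w => by
    induction ha using Algebra.adjoin_induction with
    | mem a ha =>
      obtain ⟨j, rfl⟩ := ha
      exact fun m => hcomm _ _ m
    | algebraMap r => exact fun m => map_smul (L w) r m
    | add a a' _ _ h1 h2 =>
      intro m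
      rw [LinearMap.add_apply, map_add, h1, h2]
      rfl
    | mul a a' _ _ h1 h2 =>
      intro m
      rw [Module.End.mul_apply, h1, h2]
      rfl
  let Z : Submodule A (M ⊗[ℂ] ExteriorAlgebra ℂ W) :=
    { carrier := {z | kosz L b z = 0}
      add_mem' := fun {z z'} h1 h2 => by
        change kosz L b (z + z') = 0
        rw [map_add, h1, h2, add_zero]
      zero_mem' := map_zero _
      smul_mem' := fun a z hz => by
        change kosz L b (a • z) = 0
        have hz' : kosz L b z = 0 := hz
        rw [hsmul, kosz_map b (a' := (a : Module.End ℂ M)) (hcommA a a.2), hz', map_zero] }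
  obtain ⟨S, hS⟩ := (IsNoetherian.noetherian Z : Z.FG)
  have hπz : ∀ z : M ⊗[ℂ] ExteriorAlgebra ℂ W, ∃ K, ∀ k ≥ K,
      TensorProduct.map (π k) LinearMap.id z = 0 := fun z => by
    induction z with
    | zero => exact ⟨0, fun k _ => map_zero _⟩
    | add z z' h1 h2 =>
      obtain ⟨K, hK⟩ := h1
      obtain ⟨K', hK'⟩ := h2
      exact ⟨max K K', fun k hk => by
        rw [map_add, hK k (le_trans (le_max_left _ _) hk), hK' k (le_trans (le_max_right _ _) hk),
          add_zero]⟩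
    | tmul m ω =>
      obtain ⟨K, hK⟩ := hπ0 m
      exact ⟨K, fun k hk => by rw [TensorProduct.map_tmul, hK k hk, TensorProduct.zero_tmul]⟩
  choose K hK using hπz
  let T : Submodule A (M ⊗[ℂ] ExteriorAlgebra ℂ W) :=
    { carrier := {z | kosz L b z = 0 ∧ ∀ k ≥ S.sup K, ∃ w,
        kosz L b (TensorProduct.map (π k) LinearMap.id w) =
          TensorProduct.map (π (k + 1)) LinearMap.id z}
      add_mem' := fun {z z'} h1 h2 => ⟨by rw [map_add, h1.1, h2.1, add_zero], fun k hk => by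
        obtain ⟨w, hw⟩ := h1.2 k hk
        obtain ⟨w', hw'⟩ := h2.2 k hk
        exact ⟨w + w', by simp only [map_add, hw, hw']⟩⟩
      zero_mem' := ⟨map_zero _, fun k _ => ⟨0, by simp only [map_zero]⟩⟩
      smul_mem' := by
        rintro ⟨a, ha⟩ z ⟨hz, hz'⟩
        refine ⟨Z.smul_mem ⟨a, ha⟩ hz, ?_⟩
        simp only [hsmul]
        induction ha using Algebra.adjoin_induction generalizing z with
        | mem a ha =>
          obtain ⟨j, rfl⟩ := ha
          intro k hk
          refine ⟨TensorProduct.map LinearMap.id (wedge (b j)) z, ?_⟩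
          have h1 : ∀ (a : Module.End ℂ M) (c : Module.End ℂ (ExteriorAlgebra ℂ W)),
              TensorProduct.map a LinearMap.id (TensorProduct.map LinearMap.id c z) =
                TensorProduct.map LinearMap.id c (TensorProduct.map a LinearMap.id z) :=
            fun a c => by
              rw [← LinearMap.comp_apply, ← LinearMap.comp_apply, ← TensorProduct.map_comp,
                ← TensorProduct.map_comp]
              rfl
          rw [h1, kosz_wedge, kosz_map b (hπ k), hz, map_zero, map_zero, sub_zero,
            ← LinearMap.comp_apply, ← LinearMap.comp_apply, ← TensorProduct.map_comp,
            ← TensorProduct.map_comp]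
          have h2 : L (b j) ∘ₗ π k = π (k + 1) ∘ₗ L (b j) := LinearMap.ext fun m => hπ k _ m
          rw [h2]
        | algebraMap r =>
          intro k hk
          obtain ⟨w, hw⟩ := hz' k hk
          refine ⟨r • w, ?_⟩
          rw [map_smul, map_smul, hw, ← map_smul]
          congr 1
        | add a a' ha ha' h1 h2 =>
          intro k hk
          obtain ⟨w, hw⟩ := h1 hz hz' k hk
          obtain ⟨w', hw'⟩ := h2 hz hz' k hk
          refine ⟨w + w', ?_⟩
          rw [map_add, map_add, hw, hw', ← map_add]
          congr 1
          rw [← LinearMap.add_apply, ← TensorProduct.map_add_left]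
        | mul a a' ha ha' h1 h2 =>
          intro k hk
          have h3 := h1 (z := TensorProduct.map a' LinearMap.id z) (by
            rw [kosz_map b (a' := a') (hcommA a' ha'), hz, map_zero]) (h2 hz hz') k hk
          rw [← LinearMap.comp_apply (TensorProduct.map a LinearMap.id),
            ← TensorProduct.map_comp] at h3
          exact h3 }
  have hZT : Z ≤ T := by
    rw [← hS]
    refine Submodule.span_le.2 fun z hz => ⟨?_, fun k hk => ⟨0, ?_⟩⟩
    · have : z ∈ Z := by
        rw [← hS]
        exact Submodule.subset_span hz
      exact this
    · rw [map_zero, map_zero, hK z (k + 1) (le_trans (Finset.le_sup hz) (by omega))]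
  refine ⟨S.sup K, fun k hk z hz hzk => ?_⟩
  obtain ⟨w, hw⟩ := (hZT (show z ∈ Z from hz)).2 k hk
  exact ⟨w, by rw [hw, hzk]⟩

end HighDegrees

end Cherednik

namespace Cherednik

section Slices

variable {M : Type*} {N : Type*} [AddCommGroup M] [Module ℂ M] [AddCommGroup N] [Module ℂ N]

/-- Contraction of the second tensor factor with a linear form. -/
def sliceR (φ : Module.Dual ℂ N) : M ⊗[ℂ] N →ₗ[ℂ] M :=
  (TensorProduct.rid ℂ M).toLinearMap ∘ₗ TensorProduct.map LinearMap.id φ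

lemma sliceR_tmul (φ : Module.Dual ℂ N) (m : M) (n : N) : sliceR φ (m ⊗ₜ n) = φ n • m := by
  simp [sliceR]

/-- Membership in `S ⊗ N` can be tested on slices. -/
lemma mem_tens_top_of_slice {S : Submodule ℂ M} {z : M ⊗[ℂ] N} (hz : ∀ φ, sliceR φ z ∈ S) :
    z ∈ tens S ⊤ := by
  obtain ⟨f, rfl⟩ := TensorProduct.eq_repr_basis_right (Module.Basis.ofVectorSpace ℂ N) z
  refine Submodule.sum_mem _ fun i hi => tmul_mem_tens ?_ trivial
  have := hz ((Module.Basis.ofVectorSpace ℂ N).coord i)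
  rw [Finsupp.sum, map_sum] at this
  simp only [sliceR_tmul, Module.Basis.coord_apply, Module.Basis.repr_self] at this
  rw [Finset.sum_eq_single i (fun j _ hj => by rw [Finsupp.single_eq_of_ne hj.symm, zero_smul])
    (fun hi' => absurd hi hi'), Finsupp.single_eq_same, one_smul] at this
  exact this

lemma slice_mem {S : Submodule ℂ M} {T : Submodule ℂ N} {z : M ⊗[ℂ] N} (hz : z ∈ tens S T)
    (φ : Module.Dual ℂ N) : sliceR φ z ∈ S :=
  mem_of_mem_tens (sliceR φ) S (fun a ha b _ => by
    rw [sliceR_tmul]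
    exact S.smul_mem _ ha) hz

/-- Kernels are compatible with tensor products. -/
lemma mem_tens_inf_ker {M' : Type*} [AddCommGroup M'] [Module ℂ M'] {f : M →ₗ[ℂ] M'}
    {S : Submodule ℂ M} {z : M ⊗[ℂ] N} (hz : z ∈ tens S ⊤)
    (hfz : TensorProduct.map f LinearMap.id z = 0) : z ∈ tens (S ⊓ LinearMap.ker f) ⊤ := by
  have h1 : ∀ (φ : Module.Dual ℂ N) (z : M ⊗[ℂ] N),
      f (sliceR φ z) = sliceR φ (TensorProduct.map f LinearMap.id z) := fun φ z => by
    induction z with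
    | zero => simp only [map_zero]
    | add a b h1 h2 => simp only [map_add, h1, h2]
    | tmul a b => rw [TensorProduct.map_tmul, sliceR_tmul, sliceR_tmul, map_smul]; rfl
  refine mem_tens_top_of_slice fun φ => ⟨slice_mem hz φ, ?_⟩
  rw [SetLike.mem_coe, LinearMap.mem_ker, h1, hfz, map_zero]

/-- A relation between subspaces of `N` persists in `M ⊗ N`. -/
lemma exists_tens_of_forall {f f' : Module.End ℂ N} {S T S' T' : Submodule ℂ N}
    (H : ∀ n ∈ S, f n ∈ T → ∃ n' ∈ S', n - f' n' ∈ T') {z : M ⊗[ℂ] N} (hz : z ∈ tens ⊤ S)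
    (hfz : TensorProduct.map LinearMap.id f z ∈ tens ⊤ T) :
    ∃ w ∈ tens (⊤ : Submodule ℂ M) S', z - TensorProduct.map LinearMap.id f' w ∈ tens ⊤ T' := by
  obtain ⟨c, rfl⟩ := TensorProduct.eq_repr_basis_left (Module.Basis.ofVectorSpace ℂ M) z
  set b := Module.Basis.ofVectorSpace ℂ M with hb
  have hsl : ∀ {S : Submodule ℂ N} {g : Module.End ℂ N},
      TensorProduct.map LinearMap.id g (c.sum fun i n => b i ⊗ₜ[ℂ] n) ∈ tens ⊤ S →
        ∀ i, g (c i) ∈ S := fun {S g} hS i => by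
    have h1 := mem_of_mem_tens ((TensorProduct.lid ℂ N).toLinearMap ∘ₗ
      TensorProduct.map (b.coord i) LinearMap.id) S (fun a _ n hn => by
        simpa using S.smul_mem _ hn) hS
    rw [Finsupp.sum, map_sum, map_sum] at h1
    simp only [TensorProduct.map_tmul, LinearMap.comp_apply, LinearMap.id_apply,
      LinearEquiv.coe_coe, TensorProduct.lid_tmul, Module.Basis.coord_apply,
      Module.Basis.repr_self] at h1
    rw [Finset.sum_eq_single i (fun j _ hj => by rw [Finsupp.single_eq_of_ne hj.symm, zero_smul])
      (fun hi' => by rw [Finsupp.notMem_support_iff.1 hi', map_zero, smul_zero]),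
      Finsupp.single_eq_same, one_smul] at h1
    exact h1
  have hc : ∀ i, ∃ n' ∈ S', c i - f' n' ∈ T' := fun i => H _ (hsl (g := LinearMap.id) (by
    rw [TensorProduct.map_id]; exact hz) i) (hsl hfz i)
  choose n' hn' hn'' using hc
  refine ⟨c.sum fun i _ => b i ⊗ₜ[ℂ] n' i,
    Submodule.sum_mem _ fun i _ => tmul_mem_tens trivial (hn' i), ?_⟩
  rw [Finsupp.sum, Finsupp.sum, map_sum, ← Finset.sum_sub_distrib]
  refine Submodule.sum_mem _ fun i _ => ?_
  rw [TensorProduct.map_tmul, LinearMap.id_apply, ← TensorProduct.tmul_sub]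
  exact tmul_mem_tens trivial (hn'' i)

end Slices

section AssociatedGraded

variable {W : Type*} {M : Type*} [AddCommGroup W] [Module ℂ W] [AddCommGroup M] [Module ℂ M]
  (G : ℕ → Submodule ℂ M)

/-- The associated graded space of a filtration. -/
def Gr : Type _ := DirectSum ℕ fun j => G (j + 1) ⧸ (G j).submoduleOf (G (j + 1))

instance : AddCommGroup (Gr G) :=
  inferInstanceAs (AddCommGroup (DirectSum ℕ fun j => G (j + 1) ⧸ (G j).submoduleOf (G (j + 1))))

instance : Module ℂ (Gr G) :=
  inferInstanceAs (Module ℂ (DirectSum ℕ fun j => G (j + 1) ⧸ (G j).submoduleOf (G (j + 1))))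

/-- The symbol map. -/
def grSymb (j : ℕ) : G (j + 1) →ₗ[ℂ] Gr G :=
  DirectSum.lof ℂ ℕ (fun j => G (j + 1) ⧸ (G j).submoduleOf (G (j + 1))) j ∘ₗ Submodule.mkQ _

variable {G}

lemma grSymb_eq_zero {j : ℕ} {x : G (j + 1)} : grSymb G j x = 0 ↔ (x : M) ∈ G j := by
  have h1 : grSymb G j x = 0 ↔ Submodule.mkQ ((G j).submoduleOf (G (j + 1))) x = 0 :=
    map_eq_zero_iff _ (DirectSum.of_injective (β := fun j => G (j + 1) ⧸
      (G j).submoduleOf (G (j + 1))) j)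
  rw [h1, Submodule.mkQ_apply, Submodule.Quotient.mk_eq_zero]
  exact Iff.rfl

lemma gr_induction {P : Gr G → Prop} (hs : ∀ j x, P (grSymb G j x)) (h0 : P 0)
    (ha : ∀ a b, P a → P b → P (a + b)) (m : Gr G) : P m := by
  induction m using DirectSum.induction_on with
  | zero => exact h0
  | of j x =>
    obtain ⟨x, rfl⟩ := Submodule.mkQ_surjective _ x
    exact hs j x
  | add a b h1 h2 => exact ha a b h1 h2

variable (G) in
/-- The projection of the associated graded space to one degree. -/
def grProj (k : ℕ) : Module.End ℂ (Gr G) :=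
  DirectSum.lof ℂ ℕ (fun j => G (j + 1) ⧸ (G j).submoduleOf (G (j + 1))) k ∘ₗ
    DirectSum.component ℂ ℕ (fun j => G (j + 1) ⧸ (G j).submoduleOf (G (j + 1))) k

lemma grProj_symb_self (k : ℕ) (x : G (k + 1)) : grProj G k (grSymb G k x) = grSymb G k x := by
  exact congrArg (DirectSum.lof ℂ ℕ (fun j => G (j + 1) ⧸ (G j).submoduleOf (G (j + 1))) k)
    (DirectSum.component.lof_self ℂ (M := fun j => G (j + 1) ⧸ (G j).submoduleOf (G (j + 1))) k
      (Submodule.mkQ _ x))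

lemma grProj_symb_of_ne {j k : ℕ} (hjk : j ≠ k) (x : G (j + 1)) :
    grProj G k (grSymb G j x) = 0 := by
  refine (congrArg (DirectSum.lof ℂ ℕ (fun j => G (j + 1) ⧸ (G j).submoduleOf (G (j + 1))) k)
    ((DirectSum.component.of ℂ (M := fun j => G (j + 1) ⧸ (G j).submoduleOf (G (j + 1))) k j
      (Submodule.mkQ _ x)).trans (dif_neg hjk))).trans (map_zero _)

variable (L : W →ₗ[ℂ] Module.End ℂ M) (hL : ∀ j w, ∀ m ∈ G j, L w m ∈ G (j + 1))

/-- The operator on the associated graded space defined by an operator of filtration degree one. -/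
def grMap (f : Module.End ℂ M) (hf : ∀ j, ∀ m ∈ G j, f m ∈ G (j + 1)) : Module.End ℂ (Gr G) :=
  DirectSum.toModule ℂ ℕ (Gr G) fun j =>
    Submodule.liftQ _ (grSymb G (j + 1) ∘ₗ f.restrict (hf (j + 1))) fun x hx =>
      LinearMap.mem_ker.2 ((grSymb_eq_zero (G := G) (j := j + 1)
        (x := f.restrict (hf (j + 1)) x)).2 (hf j x hx))

lemma grMap_symb {f : Module.End ℂ M} (hf : ∀ j, ∀ m ∈ G j, f m ∈ G (j + 1)) (j : ℕ)
    (x : G (j + 1)) : grMap f hf (grSymb G j x) = grSymb G (j + 1) ⟨f x, hf _ x x.2⟩ := by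
  exact (DirectSum.toModule_lof ℂ (M := fun j => G (j + 1) ⧸ (G j).submoduleOf (G (j + 1)))
    (N := Gr G) j (Submodule.mkQ _ x)).trans rfl

/-- The action on the associated graded space of operators of filtration degree one. -/
def grAct : W →ₗ[ℂ] Module.End ℂ (Gr G) where
  toFun w := grMap (L w) fun j => hL j w
  map_add' w w' := LinearMap.ext fun m => by
    induction m using gr_induction with
    | hs j x =>
      rw [LinearMap.add_apply, grMap_symb, grMap_symb, grMap_symb, ← map_add]
      exact congrArg _ (Subtype.ext (by simp))
    | h0 => simp only [map_zero]
    | ha a b h1 h2 => exact (map_add _ a b).trans ((congrArg₂ _ h1 h2).trans (map_add _ a b).symm)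
  map_smul' r w := LinearMap.ext fun m => by
    induction m using gr_induction with
    | hs j x =>
      rw [LinearMap.smul_apply, grMap_symb, grMap_symb, ← map_smul]
      exact congrArg _ (Subtype.ext (by simp))
    | h0 => simp only [map_zero]
    | ha a b h1 h2 => simp only [map_add, h1, h2]

variable {L}

lemma grAct_symb (w : W) (j : ℕ) (x : G (j + 1)) :
    grAct L hL w (grSymb G j x) = grSymb G (j + 1) ⟨L w x, hL _ w x x.2⟩ :=
  grMap_symb (fun j => hL j w) j x

lemma exists_grSymb_extend (j : ℕ) : ∃ s : M →ₗ[ℂ] Gr G, ∀ x : G (j + 1), s x = grSymb G j x := by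
  obtain ⟨s, hs⟩ := LinearMap.exists_extend (K := ℂ) (V' := Gr G) (p := G (j + 1)) (grSymb G j)
  exact ⟨s, fun x => LinearMap.congr_fun hs x⟩

variable {ι : Type*} [Fintype ι] (b : Module.Basis ι ℂ W) [FiniteDimensional ℂ W]

/-- For a good filtration of a module over almost commuting operators, the Koszul complexes of the
high degree parts of the associated graded space are exact. -/
theorem exists_kosz_gap (hL : ∀ j w, ∀ m ∈ G j, L w m ∈ G (j + 1)) (hG0 : G 0 = ⊥) (hmono : Monotone G) (hfin : FiniteDimensional ℂ (G 1))
    (hcomm : ∀ j v w, ∀ m ∈ G j, L v (L w m) - L w (L v m) ∈ G j)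
    (hgen : ∀ j, ∀ m ∈ G (j + 2), m ∈ G (j + 1) ⊔ ⨆ i, (G (j + 1)).map (L (b i))) :
    ∃ k₀, ∀ j ≥ k₀, ∀ z ∈ tens (G (j + 2)) (⊤ : Submodule ℂ (ExteriorAlgebra ℂ W)),
      kosz L b z ∈ tens (G (j + 2)) ⊤ → ∃ w ∈ tens (G (j + 1)) ⊤,
        z - kosz L b w ∈ tens (G (j + 1)) ⊤ := by
  classical
  choose s hs using fun j => exists_grSymb_extend (G := G) j
  have hsz : ∀ j, ∀ x ∈ G j, s j x = 0 := fun j x hx =>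
    (hs j ⟨x, hmono (Nat.le_succ j) hx⟩).trans (grSymb_eq_zero.2 hx)
  have hsL : ∀ j, ∀ x ∈ G (j + 1), ∀ w, grAct L hL w (s j x) = s (j + 1) (L w x) :=
    fun j x hx w => by
      rw [hs j ⟨x, hx⟩, grAct_symb]
      exact (hs (j + 1) ⟨L w x, _⟩).symm
  have hkosz : ∀ j, ∀ z ∈ tens (G (j + 1)) (⊤ : Submodule ℂ (ExteriorAlgebra ℂ W)),
      kosz (grAct L hL) b (TensorProduct.map (s j) LinearMap.id z) =
        TensorProduct.map (s (j + 1)) LinearMap.id (kosz L b z) := fun j z hz => by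
    have := mem_of_mem_tens (kosz (grAct L hL) b ∘ₗ TensorProduct.map (s j) LinearMap.id -
      TensorProduct.map (s (j + 1)) LinearMap.id ∘ₗ kosz L b) ⊥ (fun x hx ω _ => by
        rw [Submodule.mem_bot, LinearMap.sub_apply, LinearMap.comp_apply, LinearMap.comp_apply,
          TensorProduct.map_tmul, kosz_tmul, kosz_tmul, map_sum, sub_eq_zero]
        exact Finset.sum_congr rfl fun i _ => by
          rw [hsL j x hx, TensorProduct.map_tmul]
          rfl) hz
    exact sub_eq_zero.1 ((Submodule.mem_bot ℂ).1 this)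
  obtain ⟨F, hF⟩ := Module.finite_def.1 (inferInstance : Module.Finite ℂ (G 1))
  obtain ⟨k₀, hk₀⟩ := exists_kosz_eq (L := grAct L hL) b (fun v w m => by
      induction m using gr_induction with
      | hs j x =>
        rw [grAct_symb, grAct_symb, grAct_symb, grAct_symb, ← sub_eq_zero, ← map_sub]
        exact grSymb_eq_zero.2 (hmono (Nat.le_succ _) (hcomm (j + 1) v w x x.2))
      | h0 => simp only [map_zero]
      | ha a b h1 h2 => simp only [map_add, h1, h2])
    (grProj G) (fun k w m => by
      induction m using gr_induction with
      | hs j x =>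
        by_cases hjk : j = k
        · subst hjk
          rw [grProj_symb_self, grAct_symb, grProj_symb_self]
        · rw [grProj_symb_of_ne hjk, map_zero, grAct_symb, grProj_symb_of_ne (by omega)]
      | h0 => simp only [map_zero]
      | ha a b h1 h2 => simp only [map_add, h1, h2])
    (fun m => by
      induction m using gr_induction with
      | hs j x => exact ⟨j + 1, fun k hk => grProj_symb_of_ne (by omega) x⟩
      | h0 => exact ⟨0, fun k _ => map_zero _⟩
      | ha a b h1 h2 =>
        obtain ⟨K, hK⟩ := h1
        obtain ⟨K', hK'⟩ := h2
        exact ⟨max K K', fun k hk => by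
          rw [map_add, hK k (le_trans (le_max_left _ _) hk),
            hK' k (le_trans (le_max_right _ _) hk), add_zero]⟩)
    (F.image (grSymb G 0)) (fun S hFS hS => by
      have hmem : ∀ j, ∀ x : G (j + 1), grSymb G j x ∈ S := fun j => by
        induction j with
        | zero =>
          have h1 : Submodule.span ℂ (F : Set (G 1)) ≤ S.comap (grSymb G 0) :=
            Submodule.span_le.2 fun x hx => hFS (by
              exact_mod_cast Finset.mem_image_of_mem _ hx)
          rw [hF] at h1
          exact fun x => h1 trivial
        | succ j ih =>
          intro x
          obtain ⟨y, hy, y', hy', hyy⟩ := Submodule.mem_sup.1 (hgen j x x.2)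
          obtain ⟨f, hf, hf'⟩ := (Submodule.mem_iSup_iff_exists_finsupp _ _).1 hy'
          have h1 : s (j + 1) x ∈ S := by
            rw [← hyy, map_add, hsz _ _ hy, zero_add, ← hf', Finsupp.sum, map_sum]
            refine Submodule.sum_mem _ fun i _ => ?_
            obtain ⟨u, hu, hu'⟩ := hf i
            rw [← hu', ← hsL j u hu]
            refine hS _ _ ?_
            rw [hs j ⟨u, hu⟩]
            exact ih _
          rwa [hs (j + 1) x] at h1
      refine top_le_iff.1 fun m _ => ?_
      induction m using gr_induction with
      | hs j x => exact hmem j x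
      | h0 => exact zero_mem _
      | ha a b h1 h2 => exact add_mem (h1 trivial) (h2 trivial))
  refine ⟨k₀, fun j hj z hz hdz => ?_⟩
  have hπs : ∀ k, ∀ x ∈ G (k + 1), grProj G k (s k x) = s k x := fun k x hx => by
    rw [hs k ⟨x, hx⟩, grProj_symb_self]
  obtain ⟨w', hw'⟩ := hk₀ j hj (TensorProduct.map (s (j + 1)) LinearMap.id z) (by
      rw [hkosz (j + 1) z hz]
      have := mem_of_mem_tens (TensorProduct.map (s (j + 2)) LinearMap.id) ⊥ (fun x hx ω _ => by
        rw [TensorProduct.map_tmul, hsz _ _ hx, TensorProduct.zero_tmul]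
        exact zero_mem _) hdz
      exact (Submodule.mem_bot ℂ).1 this) (by
      have := mem_of_mem_tens (TensorProduct.map (grProj G (j + 1)) LinearMap.id ∘ₗ
        TensorProduct.map (s (j + 1)) LinearMap.id - TensorProduct.map (s (j + 1)) LinearMap.id) ⊥
        (fun x hx ω _ => by
          rw [Submodule.mem_bot, LinearMap.sub_apply, LinearMap.comp_apply, TensorProduct.map_tmul,
            TensorProduct.map_tmul, hπs _ x hx, sub_eq_zero]
          rfl) hz
      exact sub_eq_zero.1 ((Submodule.mem_bot ℂ).1 this))
  have hlift : ∃ w ∈ tens (G (j + 1)) (⊤ : Submodule ℂ (ExteriorAlgebra ℂ W)),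
      TensorProduct.map (s j) LinearMap.id w = TensorProduct.map (grProj G j) LinearMap.id w' := by
    clear hw'
    induction w' with
    | zero => exact ⟨0, zero_mem _, by simp only [map_zero]⟩
    | add a b h1 h2 =>
      obtain ⟨u, hu, hu'⟩ := h1
      obtain ⟨v, hv, hv'⟩ := h2
      exact ⟨u + v, add_mem hu hv, by rw [map_add, hu', hv', map_add]⟩
    | tmul m ω =>
      have h1 : ∃ x ∈ G (j + 1), s j x = grProj G j m := by
        induction m using gr_induction with
        | hs i x =>
          by_cases hij : i = j
          · subst hij
            exact ⟨x, x.2, by rw [grProj_symb_self, hs]⟩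
          · exact ⟨0, zero_mem _, by rw [grProj_symb_of_ne hij, map_zero]⟩
        | h0 => exact ⟨0, zero_mem _, by simp only [map_zero]⟩
        | ha a b h1 h2 =>
          obtain ⟨u, hu, hu'⟩ := h1
          obtain ⟨v, hv, hv'⟩ := h2
          exact ⟨u + v, add_mem hu hv, by rw [map_add, hu', hv', map_add]⟩
      obtain ⟨x, hx, hx'⟩ := h1
      exact ⟨x ⊗ₜ ω, tmul_mem_tens hx trivial, by
        rw [TensorProduct.map_tmul, TensorProduct.map_tmul, hx']⟩
  obtain ⟨w, hw, hw''⟩ := hlift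
  refine ⟨w, hw, ?_⟩
  have hδw : kosz L b w ∈ tens (G (j + 2)) ⊤ := mem_of_mem_tens (kosz L b) _ (fun x hx ω _ => by
    rw [kosz_tmul]
    exact Submodule.sum_mem _ fun i _ => tmul_mem_tens (hL _ _ x hx) trivial) hw
  refine tens_mono (fun x hx => ?_) le_rfl (mem_tens_inf_ker (f := s (j + 1)) (sub_mem hz hδw) ?_)
  · have h1 : s (j + 1) x = 0 := hx.2
    rw [hs (j + 1) ⟨x, hx.1⟩, grSymb_eq_zero] at h1
    exact h1
  · rw [map_sub, ← hkosz j w hw, hw'', hw', sub_self]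

end AssociatedGraded

end Cherednik

namespace Cherednik
variable {h : Type u} [AddCommGroup h] [Module ℂ h]

section ExteriorProjection

variable {W : Type*} [AddCommGroup W] [Module ℂ W] {M : Type*} [AddCommGroup M] [Module ℂ M]

/-- The projection of the exterior algebra to one degree. -/
def extProj (W : Type*) [AddCommGroup W] [Module ℂ W] (p : ℕ) : Module.End ℂ (ExteriorAlgebra ℂ W) :=
  (⋀[ℂ]^p W).subtype ∘ₗ DirectSum.component ℂ ℕ (fun p => ⋀[ℂ]^p W) p ∘ₗ
    (DirectSum.decomposeLinearEquiv (fun p : ℕ => ⋀[ℂ]^p W)).toLinearMap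

lemma extProj_mem (p : ℕ) (ω : ExteriorAlgebra ℂ W) : extProj W p ω ∈ ⋀[ℂ]^p W :=
  Subtype.property _

lemma extProj_of_mem {p : ℕ} {ω : ExteriorAlgebra ℂ W} (hω : ω ∈ ⋀[ℂ]^p W) : extProj W p ω = ω :=
  DirectSum.decompose_of_mem_same (fun p : ℕ => ⋀[ℂ]^p W) hω

lemma extProj_of_mem_ne {p q : ℕ} {ω : ExteriorAlgebra ℂ W} (hω : ω ∈ ⋀[ℂ]^p W) (hpq : p ≠ q) :
    extProj W q ω = 0 :=
  DirectSum.decompose_of_mem_ne (fun p : ℕ => ⋀[ℂ]^p W) hω hpq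

lemma ctr_extProj (ξ : Module.Dual ℂ W) (p : ℕ) (ω : ExteriorAlgebra ℂ W) :
    ctr ξ (extProj W (p + 1) ω) = extProj W p (ctr ξ ω) := by
  have hω : ω ∈ ⨆ p : ℕ, ⋀[ℂ]^p W := by
    rw [iSup_exteriorPower]
    trivial
  induction hω using Submodule.iSup_induction' with
  | zero => simp only [map_zero]
  | add a b _ _ h1 h2 => simp only [map_add, h1, h2]
  | mem q ω hω =>
    rcases q with _ | q
    · rw [extProj_of_mem_ne hω (by omega), ctr_exteriorPower_zero ξ hω, map_zero, map_zero]
    · by_cases hq : q = p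
      · subst hq
        rw [extProj_of_mem hω, extProj_of_mem (ctr_mem_exteriorPower ξ hω)]
      · rw [extProj_of_mem_ne hω (by omega), extProj_of_mem_ne (ctr_mem_exteriorPower ξ hω) hq,
          map_zero]

variable {L : W →ₗ[ℂ] Module.End ℂ M} {ι : Type*} [Fintype ι] (b : Module.Basis ι ℂ W)

lemma kosz_extProj (p : ℕ) (z : M ⊗[ℂ] ExteriorAlgebra ℂ W) :
    kosz L b (TensorProduct.map LinearMap.id (extProj W (p + 1)) z) =
      TensorProduct.map LinearMap.id (extProj W p) (kosz L b z) := by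
  induction z with
  | zero => simp only [map_zero]
  | add a b h1 h2 => simp only [map_add, h1, h2]
  | tmul m ω =>
    rw [TensorProduct.map_tmul, kosz_tmul, kosz_tmul, map_sum]
    exact Finset.sum_congr rfl fun j _ => by rw [ctr_extProj, TensorProduct.map_tmul]; rfl

lemma map_extProj_mem {S : Submodule ℂ M} {T : Submodule ℂ (ExteriorAlgebra ℂ W)} (p : ℕ)
    {z : M ⊗[ℂ] ExteriorAlgebra ℂ W} (hz : z ∈ tens S T) :
    TensorProduct.map LinearMap.id (extProj W p) z ∈ tens S (⋀[ℂ]^p W) :=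
  mem_of_mem_tens (TensorProduct.map (LinearMap.id : M →ₗ[ℂ] M) (extProj W p)) _
    (fun _ ha ω _ => tmul_mem_tens ha (extProj_mem p ω)) hz

lemma map_extProj_of_mem {S : Submodule ℂ M} {p : ℕ} {z : M ⊗[ℂ] ExteriorAlgebra ℂ W}
    (hz : z ∈ tens S (⋀[ℂ]^p W)) : TensorProduct.map LinearMap.id (extProj W p) z = z := by
  have := mem_of_mem_tens (TensorProduct.map LinearMap.id (extProj W p) - LinearMap.id) ⊥
    (fun m _ ω hω => by
      rw [Submodule.mem_bot, LinearMap.sub_apply, TensorProduct.map_tmul, extProj_of_mem hω,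
        sub_eq_zero]
      rfl) hz
  exact sub_eq_zero.1 ((Submodule.mem_bot ℂ).1 this)

lemma kosz_mem_tens {S S' : Submodule ℂ M} (hS : ∀ w, ∀ m ∈ S, L w m ∈ S') {p : ℕ}
    {z : M ⊗[ℂ] ExteriorAlgebra ℂ W} (hz : z ∈ tens S (⋀[ℂ]^(p + 1) W)) :
    kosz L b z ∈ tens S' (⋀[ℂ]^p W) :=
  mem_of_mem_tens (kosz L b) _ (fun m hm ω hω => by
    rw [kosz_tmul]
    exact Submodule.sum_mem _ fun j _ =>
      tmul_mem_tens (hS _ m hm) (ctr_mem_exteriorPower _ hω)) hz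

lemma kosz_eq_zero {S : Submodule ℂ M} {z : M ⊗[ℂ] ExteriorAlgebra ℂ W}
    (hz : z ∈ tens S (⋀[ℂ]^0 W)) : kosz L b z = 0 := by
  refine (Submodule.mem_bot ℂ).1 (mem_of_mem_tens (kosz L b) ⊥ (fun m hm ω hω => ?_) hz)
  rw [kosz_tmul, Submodule.mem_bot]
  exact Finset.sum_eq_zero fun j _ => by
    rw [ctr_exteriorPower_zero _ hω, TensorProduct.tmul_zero]

lemma kosz_kosz_mem {S S' : Submodule ℂ M} (hS : ∀ v w, ∀ m ∈ S, L v (L w m) - L w (L v m) ∈ S')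
    {p : ℕ} {z : M ⊗[ℂ] ExteriorAlgebra ℂ W} (hz : z ∈ tens S (⋀[ℂ]^(p + 2) W)) :
    kosz L b (kosz L b z) ∈ tens S' (⋀[ℂ]^p W) := by
  refine mem_of_mem_tens (kosz L b ∘ₗ kosz L b) _ (fun m hm ω hω => ?_) hz
  rw [LinearMap.comp_apply, kosz_tmul, map_sum]
  simp only [kosz_tmul]
  have h1 : ∑ i, ∑ j, L (b j) (L (b i) m) ⊗ₜ[ℂ] ctr (b.coord j) (ctr (b.coord i) ω) =
      (2 : ℂ)⁻¹ • ∑ i, ∑ j, (L (b j) (L (b i) m) - L (b i) (L (b j) m)) ⊗ₜ[ℂ]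
        ctr (b.coord j) (ctr (b.coord i) ω) := by
    have h2 : ∑ i, ∑ j, L (b i) (L (b j) m) ⊗ₜ[ℂ] ctr (b.coord j) (ctr (b.coord i) ω) =
        -∑ i, ∑ j, L (b j) (L (b i) m) ⊗ₜ[ℂ] ctr (b.coord j) (ctr (b.coord i) ω) := by
      rw [Finset.sum_comm, ← Finset.sum_neg_distrib]
      refine Finset.sum_congr rfl fun i _ => ?_
      rw [← Finset.sum_neg_distrib]
      refine Finset.sum_congr rfl fun j _ => ?_
      rw [ctr_comm (b.coord i), TensorProduct.tmul_neg]
    simp only [TensorProduct.sub_tmul, Finset.sum_sub_distrib]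
    rw [h2, sub_neg_eq_add, ← two_smul ℂ, smul_smul, inv_mul_cancel₀ two_ne_zero, one_smul]
  rw [h1]
  exact Submodule.smul_mem _ _ (Submodule.sum_mem _ fun i _ => Submodule.sum_mem _ fun j _ =>
    tmul_mem_tens (hS _ _ m hm) (ctr_mem_exteriorPower _ (ctr_mem_exteriorPower _ hω)))

/-- Equivariance of the Koszul differential. -/
lemma kosz_map_map (φ : W ≃ₗ[ℂ] W) {a : Module.End ℂ M} (ha : ∀ w m, a (L w m) = L (φ w) (a m))
    (z : M ⊗[ℂ] ExteriorAlgebra ℂ W) :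
    kosz L b (TensorProduct.map a (ExteriorAlgebra.map (φ : W →ₗ[ℂ] W)).toLinearMap z) =
      TensorProduct.map a (ExteriorAlgebra.map (φ : W →ₗ[ℂ] W)).toLinearMap (kosz L b z) := by
  induction z with
  | zero => simp only [map_zero]
  | add a b h1 h2 => simp only [map_add, h1, h2]
  | tmul m ω =>
    have h1 := sum_coord_comp_basis b φ (LinearMap.mk₂ ℂ (fun (ξ : Module.Dual ℂ W) (w : W) =>
      L w (a m) ⊗ₜ[ℂ] ctr ξ (ExteriorAlgebra.map (φ : W →ₗ[ℂ] W) ω))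
      (by intros; rw [map_add, LinearMap.add_apply, TensorProduct.tmul_add])
      (by intros; rw [map_smul, LinearMap.smul_apply, TensorProduct.tmul_smul])
      (by intros; rw [map_add, LinearMap.add_apply, TensorProduct.add_tmul])
      (by intros; rw [map_smul, LinearMap.smul_apply, TensorProduct.smul_tmul']))
    simp only [LinearMap.mk₂_apply] at h1
    rw [TensorProduct.map_tmul, kosz_tmul, kosz_tmul, map_sum]
    refine h1.symm.trans (Finset.sum_congr rfl fun j _ => ?_)
    rw [TensorProduct.map_tmul, ha, ctr_map]
    have h2 : (b.coord j ∘ₗ (φ.symm : W →ₗ[ℂ] W)) ∘ₗ (φ : W →ₗ[ℂ] W) = b.coord j :=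
      LinearMap.ext fun w => by simp
    rw [h2]
    rfl

variable [FiniteDimensional ℂ W] {G : ℕ → Submodule ℂ M}

/-- For a good filtration of a module over almost commuting operators, the Koszul complexes of the
high degree parts of the associated graded space are exact. -/
theorem exists_kosz_gap_degree (hL : ∀ j w, ∀ m ∈ G j, L w m ∈ G (j + 1)) (hG0 : G 0 = ⊥)
    (hmono : Monotone G) (hfin : FiniteDimensional ℂ (G 1))
    (hcomm : ∀ j v w, ∀ m ∈ G j, L v (L w m) - L w (L v m) ∈ G j)
    (hgen : ∀ j, ∀ m ∈ G (j + 2), m ∈ G (j + 1) ⊔ ⨆ i, (G (j + 1)).map (L (b i))) :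
    ∃ k₀, ∀ j ≥ k₀, ∀ p, ∀ z ∈ tens (G (j + 2)) (⋀[ℂ]^p W),
      kosz L b z ∈ tens (G (j + 2)) ⊤ → ∃ w ∈ tens (G (j + 1)) (⋀[ℂ]^(p + 1) W),
        z - kosz L b w ∈ tens (G (j + 1)) (⋀[ℂ]^p W) := by
  obtain ⟨k₀, hk₀⟩ := exists_kosz_gap b hL hG0 hmono hfin hcomm hgen
  refine ⟨k₀, fun j hj p z hz hdz => ?_⟩
  obtain ⟨w, hw, hw'⟩ := hk₀ j hj z (tens_mono le_rfl le_top hz) hdz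
  refine ⟨_, map_extProj_mem (p + 1) hw, ?_⟩
  have := map_extProj_mem p hw'
  rwa [map_sub, map_extProj_of_mem hz, ← kosz_extProj] at this

end ExteriorProjection

section GoodFiltration

variable {D : Datum h} {t : ℂ} [FiniteDimensional ℂ h] (X : GrMod.{u, v} D t) (s : Finset ℤ)

/-- The filtration of `X` generated by finitely many of its graded pieces. -/
def goodFil : ℕ → Submodule ℂ X.carrier
  | 0 => ⊥
  | 1 => ⨆ d ∈ s, X.piece d
  | j + 2 => goodFil (j + 1) ⊔ ⨆ i, (goodFil (j + 1)).map (actV X (vBasis h i))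

lemma goodFil_le_succ (j : ℕ) : goodFil X s j ≤ goodFil X s (j + 1) := by
  rcases j with _ | j
  · exact bot_le
  · exact le_sup_left

lemma goodFil_mono : Monotone (goodFil X s) := monotone_nat_of_le_succ (goodFil_le_succ X s)

lemma actV_goodFil (j : ℕ) (v : h × Module.Dual ℂ h) : ∀ x ∈ goodFil X s j,
    actV X v x ∈ goodFil X s (j + 1) := fun x hx => by
  rcases j with _ | j
  · rw [(Submodule.mem_bot ℂ).1 hx, map_zero]
    exact zero_mem _
  · rw [← (vBasis h).sum_repr v, map_sum, LinearMap.sum_apply]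
    refine Submodule.sum_mem _ fun i _ => ?_
    rw [map_smul]
    refine Submodule.smul_mem _ _ (le_sup_right (a := goodFil X s (j + 1))
      (Submodule.mem_iSup_of_mem i ⟨x, hx, rfl⟩))

/-- A semilinear operator preserving the graded pieces preserves the good filtration. -/
lemma map_goodFil {a : Module.End ℂ X.carrier} {φ : (h × Module.Dual ℂ h) → h × Module.Dual ℂ h}
    (ha : ∀ v x, a (actV X v x) = actV X (φ v) (a x)) (hp : ∀ d, ∀ x ∈ X.piece d, a x ∈ X.piece d)
    (j : ℕ) : ∀ x ∈ goodFil X s j, a x ∈ goodFil X s j := by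
  change goodFil X s j ≤ (goodFil X s j).comap a
  induction j with
  | zero => exact bot_le
  | succ j ih =>
    rcases j with _ | j
    · have h1 : ∀ d ∈ s, X.piece d ≤ (⨆ d ∈ s, X.piece d : Submodule ℂ X.carrier).comap a :=
        fun d hd x hx => Submodule.mem_iSup_of_mem d (Submodule.mem_iSup_of_mem hd (hp d x hx))
      exact iSup₂_le h1
    · refine sup_le (ih.trans (Submodule.comap_mono le_sup_left)) (iSup_le fun i => ?_)
      rintro _ ⟨x, hx, rfl⟩
      change a (actV X (vBasis h i) x) ∈ goodFil X s (j + 2)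
      rw [ha]
      exact actV_goodFil X s _ _ _ (ih hx)

omit [FiniteDimensional ℂ h] in
lemma rep_actV (g : D.G) (v : h × Module.Dual ℂ h) (x : X.carrier) :
    X.rep g (actV X v x) = actV X (vEquiv D g v) (X.rep g x) := by
  rw [actV_apply, actV_apply, X.rep_apply, X.rep_apply, smul_smul, smul_smul, gen_g_vMap]
  rfl

omit [FiniteDimensional ℂ h] in
lemma tau_actV (v : h × Module.Dual ℂ h) (x : X.carrier) :
    X.tau (actV X v x) = actV X (scaleV h v) (X.tau x) := by
  rw [actV_apply, actV_apply, X.tau_smul, tauH_vMap]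

lemma rep_goodFil (g : D.G) (j : ℕ) : ∀ x ∈ goodFil X s j, X.rep g x ∈ goodFil X s j :=
  map_goodFil X s (rep_actV X g) (fun d _ hx => X.res.stable d g hx) j

lemma tau_goodFil (j : ℕ) : ∀ x ∈ goodFil X s j, X.tau x ∈ goodFil X s j :=
  map_goodFil X s (tau_actV X) (fun d x hx => by
    rw [X.tau_apply hx]
    exact Submodule.smul_mem _ _ hx) j

lemma goodFil_commutator (j : ℕ) (v w : h × Module.Dual ℂ h) : ∀ x ∈ goodFil X s j,
    actV X v (actV X w x) - actV X w (actV X v x) ∈ goodFil X s j := fun x hx => by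
  rw [actV_apply, actV_apply, actV_apply, actV_apply, smul_smul, smul_smul, ← sub_smul,
    vMap_commutator, sub_smul, Finset.sum_smul]
  refine sub_mem ?_ (Submodule.sum_mem _ fun r _ => ?_)
  · rw [smul_assoc, one_smul]
    exact Submodule.smul_mem _ _ hx
  · rw [smul_assoc]
    exact Submodule.smul_mem _ _ (rep_goodFil X s _ j x hx)

variable {X s}

lemma finite_goodFil (hX : X.FiniteType) (j : ℕ) : FiniteDimensional ℂ (goodFil X s j) := by
  induction j with
  | zero => exact inferInstanceAs (FiniteDimensional ℂ (⊥ : Submodule ℂ X.carrier))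
  | succ j ih =>
    rcases j with _ | j
    · have := fun d : s => hX d
      change FiniteDimensional ℂ (⨆ d ∈ s, X.piece d : Submodule ℂ X.carrier)
      rw [iSup_subtype']
      exact Submodule.finite_iSup _
    · change FiniteDimensional ℂ (goodFil X s (j + 1) ⊔ ⨆ i, (goodFil X s (j + 1)).map
        (actV X (vBasis h i)) : Submodule ℂ X.carrier)
      infer_instance

/-- The filtration is exhaustive if the chosen pieces generate `X`. -/
lemma iSup_goodFil (hs : Submodule.span (H D t) ((⨆ d ∈ s, X.piece d : Submodule ℂ X.carrier) :
    Set X.carrier) = ⊤) : ⨆ j, goodFil X s j = ⊤ := by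
  have hdir : ∀ x, x ∈ ⨆ j, goodFil X s j ↔ ∃ j, x ∈ goodFil X s j := fun x =>
    Submodule.mem_iSup_of_directed _ (goodFil_mono X s).directed_le
  have hH : ∀ (a : H D t), ∀ x ∈ ⨆ j, goodFil X s j, a • x ∈ ⨆ j, goodFil X s j := fun a => by
    have hv : ∀ (v : h × Module.Dual ℂ h), ∀ x ∈ ⨆ j, goodFil X s j,
        vMap D t v • x ∈ ⨆ j, goodFil X s j := fun v x hx => by
      obtain ⟨j, hj⟩ := (hdir x).1 hx
      exact (hdir _).2 ⟨j + 1, actV_goodFil X s j v x hj⟩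
    induction a using H.induction with
    | hs r =>
      intro x hx
      rw [algebraMap_smul]
      exact Submodule.smul_mem _ _ hx
    | hg a =>
      intro x hx
      rcases a with g | y | ξ
      · obtain ⟨j, hj⟩ := (hdir x).1 hx
        exact (hdir _).2 ⟨j, rep_goodFil X s g j x hj⟩
      · have h1 := hv (y, 0) x hx
        have h2 : gen D t (.x (0 : Module.Dual ℂ h)) = 0 := (xMap D t).map_zero
        rwa [vMap_apply, h2, add_zero] at h1
      · have h1 := hv (0, ξ) x hx
        have h2 : gen D t (.y (0 : h)) = 0 := (yMap D t).map_zero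
        rwa [vMap_apply, h2, zero_add] at h1
    | hm a b h1 h2 =>
      intro x hx
      rw [mul_smul]
      exact h1 _ (h2 x hx)
    | ha a b h1 h2 =>
      intro x hx
      rw [add_smul]
      exact add_mem (h1 x hx) (h2 x hx)
  let T : Submodule (H D t) X.carrier :=
    { carrier := (⨆ j, goodFil X s j : Submodule ℂ X.carrier)
      add_mem' := fun h1 h2 => add_mem h1 h2
      zero_mem' := zero_mem _
      smul_mem' := fun a x hx => hH a x hx }
  have hT : T = ⊤ := by
    rw [eq_top_iff, ← hs, Submodule.span_le]
    exact le_iSup (goodFil X s) 1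
  exact top_le_iff.1 fun x _ => (hT ▸ (Submodule.mem_top : x ∈ (⊤ : Submodule (H D t) X.carrier)) :
    x ∈ T)

omit [FiniteDimensional ℂ h] in
/-- A finitely generated graded module is generated by finitely many of its pieces. -/
lemma exists_generating_pieces (X : GrMod.{u, v} D t) [Module.Finite (H D t) X.carrier] :
    ∃ s : Finset ℤ, Submodule.span (H D t) ((⨆ d ∈ s, X.piece d : Submodule ℂ X.carrier) :
      Set X.carrier) = ⊤ := by
  classical
  obtain ⟨F, hF⟩ := Module.finite_def.1 (inferInstance : Module.Finite (H D t) X.carrier)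
  have h1 : ∀ x : X.carrier, ∃ s : Finset ℤ, x ∈ ⨆ d ∈ s, X.piece d := fun x => by
    obtain ⟨s, f, hf, rfl⟩ := exists_sum_of_mem_iSup
      (X.isInternal.submodule_iSup_eq_top ▸ (Submodule.mem_top : x ∈ ⊤))
    exact ⟨s, Submodule.sum_mem _ fun n hn =>
      Submodule.mem_iSup_of_mem n (Submodule.mem_iSup_of_mem hn (hf n))⟩
  choose S hS using h1
  refine ⟨F.biUnion S, ?_⟩
  rw [eq_top_iff, ← hF]
  refine Submodule.span_mono fun x hx => ?_
  have h2 : (⨆ d ∈ S x, X.piece d) ≤ ⨆ d ∈ F.biUnion S, X.piece d :=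
    biSup_mono fun d hd => Finset.mem_biUnion.2 ⟨x, hx, hd⟩
  exact h2 (hS x)

end GoodFiltration

end Cherednik

namespace Cherednik
variable {h : Type u} [AddCommGroup h] [Module ℂ h]

section DegreeProjection

variable {M : Type*} [AddCommGroup M] [Module ℂ M] {τ : Module.End ℂ M} (hτ : IsGrading τ)

lemma IsGrading.proj_mem {p : Submodule ℂ M} (hp : ∀ m ∈ p, τ m ∈ p) (d : ℤ) {m : M} (hm : m ∈ p) :
    internalProj hτ.isInternal d m ∈ p ⊓ deg τ d := by
  refine ⟨?_, internalProj_mem _ d m⟩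
  obtain ⟨s, f, hf, hfp, rfl⟩ := hτ.exists_sum_mem hp hm
  rw [SetLike.mem_coe, map_sum]
  refine Submodule.sum_mem _ fun n _ => ?_
  by_cases hn : n = d
  · subst hn
    rw [internalProj_of_mem _ (hf n)]
    exact hfp n
  · rw [internalProj_of_mem_ne _ hn (hf n)]
    exact zero_mem _

lemma IsGrading.map_proj {f : Module.End ℂ M} (hf : ∀ m, τ (f m) = f (τ m)) (d : ℤ) (m : M) :
    f (internalProj hτ.isInternal d m) = internalProj hτ.isInternal d (f m) := by
  have : f ∘ₗ internalProj hτ.isInternal d = internalProj hτ.isInternal d ∘ₗ f :=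
    hτ.hom_ext fun n m hm => by
      have hfm : f m ∈ deg τ n := by rw [mem_deg, hf, mem_deg.1 hm, map_smul]
      rw [LinearMap.comp_apply, LinearMap.comp_apply]
      by_cases hn : n = d
      · subst hn
        rw [internalProj_of_mem _ hm, internalProj_of_mem _ hfm]
      · rw [internalProj_of_mem_ne _ hn hm, internalProj_of_mem_ne _ hn hfm, map_zero]
  exact LinearMap.congr_fun this m

lemma finite_setOf_inf_deg_ne_bot {p : Submodule ℂ M} [FiniteDimensional ℂ p]
    (hp : ∀ m ∈ p, τ m ∈ p) : {d : ℤ | p ⊓ deg τ d ≠ ⊥}.Finite := by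
  refine (WellFoundedGT.finite_ne_bot_of_iSupIndep (iSupIndep_deg (τ.restrict hp))).subset
    fun d hd h0 => hd (eq_bot_iff.2 fun m hm => ?_)
  have h1 : (⟨m, hm.1⟩ : p) ∈ deg (τ.restrict hp) d := (mem_deg_restrict hp).2 hm.2
  rw [h0] at h1
  exact (Submodule.mem_bot ℂ).2 (congrArg Subtype.val ((Submodule.mem_bot ℂ).1 h1))

end DegreeProjection

section GoodSubcomplex

variable {D : Datum h} {t : ℂ} [FiniteDimensional ℂ h] (X : GrMod.{u, v} D t) (s : Finset ℤ)

/-- The subspaces of `X ⊗ ⋀ V` generating the finite part of the Koszul complex. -/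
def goodPart (k p : ℕ) : Submodule ℂ (extSpace X) :=
  tens (goodFil X s (k - p)) (⋀[ℂ]^p (h × Module.Dual ℂ h))

variable {X s}

lemma extSpaceRep_mem_goodPart (g : D.G) (k p : ℕ) :
    ∀ m ∈ goodPart X s k p, extSpaceRep X g m ∈ goodPart X s k p := fun _ hm =>
  mem_of_mem_tens (extSpaceRep X g) _ (fun x hx ω hω =>
    tmul_mem_tens (rep_goodFil X s g _ x hx) (map_mem_exteriorPower _ hω)) hm

lemma extTau_mem_goodPart (k p : ℕ) :
    ∀ m ∈ goodPart X s k p, extTau X m ∈ goodPart X s k p := fun _ hm =>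
  mem_of_mem_tens (extTau X) _ (fun x hx ω hω =>
    tmul_mem_tens (tau_goodFil X s _ x hx) (tauE_mem_exteriorPower hω)) hm

lemma isHomogeneous_goodPart (k p : ℕ) : IsHomogeneous (goodPart X s k p) :=
  ⟨fun g => extSpaceRep_mem_goodPart g k p, extTau_mem_goodPart k p⟩

lemma goodPart_mono {k l : ℕ} (hkl : k ≤ l) (p : ℕ) : goodPart X s k p ≤ goodPart X s l p :=
  tens_mono (goodFil_mono X s (Nat.sub_le_sub_right hkl p)) le_rfl

lemma goodPart_le_extPart (k p : ℕ) : goodPart X s k p ≤ extPart X p := tens_mono le_top le_rfl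

lemma leftD_mem_goodPart {k p : ℕ} {m : extSpace X} (hm : m ∈ goodPart X s k (p + 1)) :
    leftD X m ∈ goodPart X s k p := by
  refine kosz_mem_tens (L := actV X) (vBasis h) (fun w x hx => ?_) hm
  by_cases hp : p + 1 ≤ k
  · have h1 := actV_goodFil X s _ w x hx
    rwa [show k - (p + 1) + 1 = k - p by omega] at h1
  · rw [show k - (p + 1) = 0 by omega] at hx
    rw [(Submodule.mem_bot ℂ).1 hx, map_zero]
    exact zero_mem _

lemma rightD_mem_tens {S : Submodule ℂ X.carrier} {p : ℕ} {z : koszulSpace X}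
    (hz : z ∈ tens ⊤ (tens S (⋀[ℂ]^(p + 1) (h × Module.Dual ℂ h)))) :
    rightD X z ∈ tens ⊤ (tens S (⋀[ℂ]^p (h × Module.Dual ℂ h))) := by
  refine mem_of_mem_tens₃ (rightD X) _ (fun a _ x hx ω hω => ?_) hz
  rw [rightD_tmul]
  exact Submodule.sum_mem _ fun j _ =>
    tmul_mem_tens trivial (tmul_mem_tens hx (ctr_mem_exteriorPower _ hω))

lemma rightD_mem_tens_top {S : Submodule ℂ X.carrier} {z : koszulSpace X}
    (hz : z ∈ tens ⊤ (tens S ⊤)) : rightD X z ∈ tens ⊤ (tens S ⊤) := by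
  refine mem_of_mem_tens₃ (rightD X) _ (fun a _ x hx ω hω => ?_) hz
  rw [rightD_tmul]
  exact Submodule.sum_mem _ fun j _ => tmul_mem_tens trivial (tmul_mem_tens hx trivial)

lemma koszulD_mem_goodPart {k p : ℕ} {z : koszulSpace X}
    (hz : z ∈ koszulInv X (goodPart X s k (p + 1))) : koszulD X z ∈ koszulInv X (goodPart X s k p) := by
  refine ⟨?_, koszulD_mem_invariants hz.2⟩
  refine sub_mem ?_ (mem_of_mem_tens (TensorProduct.map LinearMap.id (leftD X)) _
    (fun a _ m hm => tmul_mem_tens_top a (leftD_mem_goodPart hm)) hz.1)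
  exact tens_mono le_rfl (tens_mono (goodFil_mono X s (by omega)) le_rfl) (rightD_mem_tens hz.1)

/-- The exactness of the high degree parts of the Koszul complex of the associated graded space. -/
def GoodBound (X : GrMod.{u, v} D t) (s : Finset ℤ) (k₀ : ℕ) : Prop :=
  ∀ j ≥ k₀, ∀ p, ∀ z ∈ tens (goodFil X s (j + 2)) (⋀[ℂ]^p (h × Module.Dual ℂ h)),
    leftD X z ∈ tens (goodFil X s (j + 2)) ⊤ →
      ∃ w ∈ tens (goodFil X s (j + 1)) (⋀[ℂ]^(p + 1) (h × Module.Dual ℂ h)),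
        z - leftD X w ∈ tens (goodFil X s (j + 1)) (⋀[ℂ]^p (h × Module.Dual ℂ h))

lemma exists_goodBound (hX : X.FiniteType) (s : Finset ℤ) : ∃ k₀, GoodBound X s k₀ :=
  exists_kosz_gap_degree (L := actV X) (vBasis h) (fun j w => actV_goodFil X s j w) rfl
    (goodFil_mono X s) (finite_goodFil hX 1) (fun j => goodFil_commutator X s j) fun _ _ hm => hm

variable {k₀ : ℕ} (hk : GoodBound X s k₀)

include hk in
lemma GoodBound.exists_koszulD_add_mem {j q : ℕ} (hj : j ≥ k₀) {u : koszulSpace X}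
    (hu : u ∈ koszulInv X (tens (goodFil X s (j + 2)) (⋀[ℂ]^q (h × Module.Dual ℂ h))))
    (hdu : koszulD X u ∈ tens ⊤ (tens (goodFil X s (j + 2)) ⊤)) :
    ∃ w ∈ (koszulRep X).invariants, u + koszulD X w ∈
      koszulInv X (tens (goodFil X s (j + 1)) (⋀[ℂ]^q (h × Module.Dual ℂ h))) := by
  have h1 : TensorProduct.map LinearMap.id (leftD X) u ∈
      tens (⊤ : Submodule ℂ (H D t)) (tens (goodFil X s (j + 2)) ⊤) := by
    have h2 := sub_mem (rightD_mem_tens_top (tens_mono le_rfl (tens_mono le_rfl le_top) hu.1)) hdu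
    rwa [koszulD, LinearMap.sub_apply, sub_sub_cancel] at h2
  obtain ⟨w, hw, hw'⟩ := exists_tens_of_forall (hk j hj q) hu.1 h1
  have h3 : u + koszulD X w ∈
      tens ⊤ (tens (goodFil X s (j + 1)) (⋀[ℂ]^q (h × Module.Dual ℂ h))) := by
    have h4 := add_mem hw' (rightD_mem_tens hw)
    rw [koszulD, LinearMap.sub_apply]
    convert h4 using 1
    abel
  refine ⟨koszulAv X w, Representation.averageMap_invariant _ w, ?_⟩
  have h5 := koszulAv_mem_koszulInv (fun g _ hm => mem_of_mem_tens (extSpaceRep X g) _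
    (fun x hx ω hω => tmul_mem_tens (rep_goodFil X s g _ x hx) (map_mem_exteriorPower _ hω)) hm) h3
  rwa [map_add, koszulAv_eq_self hu.2, ← koszulD_koszulAv] at h5

include hk in
lemma GoodBound.exists_koszulD_eq_of_mem {j q : ℕ} (hj : j ≥ k₀) (n : ℕ) {u : koszulSpace X}
    (hu : u ∈ koszulInv X (tens (goodFil X s (j + 1 + n)) (⋀[ℂ]^q (h × Module.Dual ℂ h))))
    (hdu : koszulD X u ∈ tens ⊤ (tens (goodFil X s (j + 2)) ⊤)) :
    ∃ w ∈ koszulInv X (tens (goodFil X s (j + 1)) (⋀[ℂ]^q (h × Module.Dual ℂ h))),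
      koszulD X w = koszulD X u := by
  induction n generalizing u with
  | zero => exact ⟨u, hu, rfl⟩
  | succ n ih =>
    rw [show j + 1 + (n + 1) = j + n + 2 by ring] at hu
    obtain ⟨w, hw, hw'⟩ := hk.exists_koszulD_add_mem (j := j + n) (by omega) hu
      (tens_mono le_rfl (tens_mono (goodFil_mono X s (by omega)) le_rfl) hdu)
    have h1 : koszulD X (u + koszulD X w) = koszulD X u := by
      rw [map_add, koszulD_koszulD X hw, add_zero]
    rw [show j + n + 1 = j + 1 + n by ring] at hw'
    obtain ⟨w', hw1, hw2⟩ := ih hw' (by rwa [h1])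
    exact ⟨w', hw1, hw2.trans h1⟩

variable (hs : Submodule.span (H D t) ((⨆ d ∈ s, X.piece d : Submodule ℂ X.carrier) :
  Set X.carrier) = ⊤)

include hs in
lemma exists_mem_goodFil_of_mem {q : ℕ} {z : koszulSpace X} (hz : z ∈ tens ⊤ (extPart X q)) :
    ∃ n, z ∈ tens ⊤ (tens (goodFil X s n) (⋀[ℂ]^q (h × Module.Dual ℂ h))) := by
  rw [extPart, ← iSup_goodFil hs, tens_iSup_left, tens_iSup_right] at hz
  refine (Submodule.mem_iSup_of_directed _ ?_).1 hz
  exact (show Monotone fun n => tens (⊤ : Submodule ℂ (H D t)) (tens (goodFil X s n) _) from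
    fun m n hmn => tens_mono le_rfl (tens_mono (goodFil_mono X s hmn) le_rfl)).directed_le

include hk hs in
lemma GoodBound.exists_koszulD_eq {P : ℕ} (hP : ∀ p > P, extPart X p = ⊥) {k p : ℕ}
    (hkk : k ≥ k₀ + P + 1) {u : koszulSpace X} (hu : u ∈ koszulInv X (extPart X (p + 1)))
    (hdu : koszulD X u ∈ koszulInv X (goodPart X s k p)) :
    ∃ w ∈ koszulInv X (goodPart X s k (p + 1)), koszulD X w = koszulD X u := by
  by_cases hp : p + 1 > P
  · have h1 := hu.1
    rw [hP _ hp, tens_bot_right] at h1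
    replace h1 : u = 0 := h1
    exact ⟨0, zero_mem _, by rw [h1]⟩
  · obtain ⟨n, hn⟩ := exists_mem_goodFil_of_mem hs hu.1
    obtain ⟨j, rfl⟩ : ∃ j, k = j + 2 + p := ⟨k - 2 - p, by omega⟩
    rw [goodPart, show j + 2 + p - (p + 1) = j + 1 by omega]
    refine hk.exists_koszulD_eq_of_mem (by omega) n
      ⟨tens_mono le_rfl (tens_mono (goodFil_mono X s (by omega)) le_rfl) hn, hu.2⟩ ?_
    have h2 := hdu.1
    rw [goodPart, show j + 2 + p - p = j + 2 by omega] at h2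
    exact tens_mono le_rfl (tens_mono le_rfl le_top) h2

include hs in
lemma exists_koszulAug_eq_goodPart {k : ℕ} (hk1 : 1 ≤ k) (x : X.carrier) :
    ∃ z ∈ koszulInv X (goodPart X s k 0), koszulAug X z = x := by
  let T : Submodule (H D t) X.carrier :=
    { carrier := {x | ∃ z ∈ koszulInv X (goodPart X s k 0), koszulAug X z = x}
      add_mem' := by
        rintro _ _ ⟨z, hz, rfl⟩ ⟨z', hz', rfl⟩
        exact ⟨z + z', add_mem hz hz', map_add _ _ _⟩
      zero_mem' := ⟨0, zero_mem _, map_zero _⟩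
      smul_mem' := by
        rintro a _ ⟨z, hz, rfl⟩
        exact ⟨a • z, (koszulModule (goodPart X s k 0)).smul_mem a hz, koszulAug_smul X a z⟩ }
  have hT : T = ⊤ := by
    rw [eq_top_iff, ← hs, Submodule.span_le]
    intro x hx
    exact exists_koszulAug_eq (isHomogeneous_goodPart k 0)
      (tmul_mem_tens (goodFil_mono X s (by omega : 1 ≤ k - 0) hx)
        (mem_exteriorPower_zero.2 ⟨1, map_one _⟩))
  exact (hT ▸ (Submodule.mem_top : x ∈ (⊤ : Submodule (H D t) X.carrier)) : x ∈ T)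

/-- The finite part of the Koszul complex of a finitely generated module. -/
def goodFamily {P : ℕ} (hP : ∀ p > P, extPart X p = ⊥) {k : ℕ} (hkk : k ≥ k₀ + P + 1) :
    KoszulFamily X where
  N := goodPart X s k
  homogeneous := isHomogeneous_goodPart k
  d_mem _ _ hz := koszulD_mem_goodPart hz
  surjective x := exists_koszulAug_eq_goodPart hs (by omega) x
  exact_zero z hz h0 := by
    obtain ⟨u, hu, rfl⟩ := exists_koszulD_eq_of_koszulAug_eq_zero
      (koszulInv_mono (goodPart_le_extPart k 0) hz) h0
    exact hk.exists_koszulD_eq hs hP hkk hu hz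
  exact_succ p z hz h0 := by
    obtain ⟨u, hu, rfl⟩ := Cherednik.exists_koszulD_eq (by omega)
      (koszulInv_mono (goodPart_le_extPart k (p + 1)) hz) h0
    exact hk.exists_koszulD_eq hs hP hkk hu hz

lemma leftD_extTau (m : extSpace X) : extTau X (leftD X m) = leftD X (extTau X m) :=
  (kosz_map_map (L := actV X) (vBasis h) (scaleV h) (tau_actV X) m).symm

lemma leftD_extSpaceRep (g : D.G) (m : extSpace X) :
    leftD X (extSpaceRep X g m) = extSpaceRep X g (leftD X m) :=
  kosz_map_map (L := actV X) (vBasis h) (vEquiv D g) (rep_actV X g) m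

lemma finite_goodPart (hX : X.FiniteType) (k p : ℕ) : FiniteDimensional ℂ (goodPart X s k p) := by
  have := finite_goodFil (s := s) hX (k - p)
  exact finite_tens _ _

omit [FiniteDimensional ℂ h] in
lemma extSpaceRep_mem_deg (g : D.G) (d : ℤ) :
    ∀ m ∈ deg (extTau X) d, extSpaceRep X g m ∈ deg (extTau X) d := fun m hm => by
  rw [mem_deg, extTau_extSpaceRep, mem_deg.1 hm, map_smul]

lemma leftD_mem_deg {d : ℤ} {m : extSpace X} (hm : m ∈ deg (extTau X) d) :
    leftD X m ∈ deg (extTau X) d := by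
  rw [mem_deg, leftD_extTau, mem_deg.1 hm, map_smul]

include hk in
lemma GoodBound.exists_sub_mem_deg {j q : ℕ} (hj : j ≥ k₀) {d : ℤ} {z : extSpace X}
    (hz : z ∈ tens (goodFil X s (j + 2)) (⋀[ℂ]^q (h × Module.Dual ℂ h))) (hzd : z ∈ deg (extTau X) d)
    (hdz : leftD X z ∈ tens (goodFil X s (j + 2)) ⊤) :
    ∃ w ∈ tens (goodFil X s (j + 1)) (⋀[ℂ]^(q + 1) (h × Module.Dual ℂ h)) ⊓ deg (extTau X) d,
      z - leftD X w ∈ tens (goodFil X s (j + 1)) (⋀[ℂ]^q (h × Module.Dual ℂ h)) ⊓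
        deg (extTau X) d := by
  obtain ⟨w, hw, hw'⟩ := hk j hj q z hz hdz
  have hst : ∀ i q, ∀ m ∈ tens (goodFil X s i) (⋀[ℂ]^q (h × Module.Dual ℂ h)), extTau X m ∈
      tens (goodFil X s i) (⋀[ℂ]^q (h × Module.Dual ℂ h)) := fun i q m hm =>
    mem_of_mem_tens (extTau X) _ (fun x hx ω hω =>
      tmul_mem_tens (tau_goodFil X s _ x hx) (tauE_mem_exteriorPower hω)) hm
  refine ⟨_, (isGrading_extTau X).proj_mem (hst _ _) d hw, ?_⟩
  have h1 := (isGrading_extTau X).proj_mem (hst _ _) d hw'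
  rwa [map_sub, internalProj_of_mem _ hzd, ← (isGrading_extTau X).map_proj leftD_extTau] at h1

include hk in
/-- The alternating sum of the traces on the finite parts of the Koszul complex stabilises. -/
lemma GoodBound.sum_trOn_succ (hX : X.FiniteType) {P : ℕ} (hP : ∀ p > P, extPart X p = ⊥) {k : ℕ}
    (hkk : k ≥ k₀ + P + 1) (d : ℤ) (g : D.G) :
    ∑ p ∈ Finset.range (P + 1),
      (-1) ^ p * trOn (extSpaceRep X g) (goodPart X s (k + 1) p ⊓ deg (extTau X) d) =
    ∑ p ∈ Finset.range (P + 1),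
      (-1) ^ p * trOn (extSpaceRep X g) (goodPart X s k p ⊓ deg (extTau X) d) := by
  have hbot : ∀ k, ∀ p > P, goodPart X s k p ⊓ deg (extTau X) d = ⊥ := fun k p hp => by
    rw [eq_bot_iff, ← hP p hp]
    exact inf_le_left.trans (goodPart_le_extPart k p)
  have hfin : ∀ k p, FiniteDimensional ℂ (goodPart X s k p ⊓ deg (extTau X) d :
      Submodule ℂ (extSpace X)) := fun k p => by
    have := finite_goodPart (s := s) hX k p
    infer_instance
  have := hfin
  have hst : ∀ k p, ∀ m ∈ goodPart X s k p ⊓ deg (extTau X) d,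
      extSpaceRep X g m ∈ goodPart X s k p ⊓ deg (extTau X) d := fun k p m hm =>
    ⟨extSpaceRep_mem_goodPart g k p m hm.1, extSpaceRep_mem_deg g d m hm.2⟩
  refine sum_trOn_eq (leftD_extSpaceRep g) (fun p => goodPart X s (k + 1) p ⊓ deg (extTau X) d)
    (fun p => goodPart X s k p ⊓ deg (extTau X) d) (hst _) (hst _)
    (fun m hm => kosz_eq_zero (L := actV X) (vBasis h) hm.1) (fun p => ?_) ?_
    (hbot _ _ (by omega)) (hbot _ _ (by omega))
  · by_cases hp : p + 1 > P
    · rw [hbot _ _ hp, hbot _ (p + 2) (by omega), hbot _ _ hp, bot_inf_eq, Submodule.map_bot,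
        bot_sup_eq]
    · obtain ⟨j, rfl⟩ : ∃ j, k = j + 2 + p := ⟨k - 2 - p, by omega⟩
      refine le_antisymm ?_ (sup_le ?_ fun m hm =>
        ⟨⟨goodPart_mono (by omega) _ hm.1, hm.2⟩, leftD_mem_goodPart hm.1, leftD_mem_deg hm.2⟩)
      · rintro z ⟨⟨hz, hzd⟩, hdz, -⟩
        rw [SetLike.mem_coe, goodPart, show j + 2 + p + 1 - (p + 1) = j + 2 by omega] at hz
        rw [SetLike.mem_coe, goodPart, show j + 2 + p - p = j + 2 by omega] at hdz
        obtain ⟨w, hw, hw'⟩ := hk.exists_sub_mem_deg (by omega) hz hzd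
          (tens_mono le_rfl le_top hdz)
        rw [← add_sub_cancel (leftD X w) z]
        refine add_mem (Submodule.mem_sup_left ⟨w, ?_, rfl⟩) (Submodule.mem_sup_right ?_)
        · rwa [goodPart, show j + 2 + p + 1 - (p + 2) = j + 1 by omega]
        · rwa [goodPart, show j + 2 + p - (p + 1) = j + 1 by omega]
      · rintro _ ⟨w, ⟨hw, hwd⟩, rfl⟩
        refine ⟨⟨leftD_mem_goodPart hw, leftD_mem_deg hwd⟩, ?_, leftD_mem_deg (leftD_mem_deg hwd)⟩
        have h1 := kosz_kosz_mem (L := actV X) (vBasis h)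
          (fun v w => goodFil_commutator X s _ v w) hw
        exact tens_mono (goodFil_mono X s (by omega)) le_rfl h1
  · refine le_antisymm ?_ (sup_le ?_ fun m hm => ⟨goodPart_mono (by omega) _ hm.1, hm.2⟩)
    · rintro z ⟨hz, hzd⟩
      obtain ⟨j, rfl⟩ : ∃ j, k = j + 1 := ⟨k - 1, by omega⟩
      have h0 : leftD X z = 0 := kosz_eq_zero (L := actV X) (vBasis h) hz
      obtain ⟨w, hw, hw'⟩ := hk.exists_sub_mem_deg (j := j) (by omega) hz hzd
        (by rw [h0]; exact zero_mem _)
      rw [← add_sub_cancel (leftD X w) z]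
      exact add_mem (Submodule.mem_sup_left ⟨w, hw, rfl⟩) (Submodule.mem_sup_right hw')
    · rintro _ ⟨w, ⟨hw, hwd⟩, rfl⟩
      exact ⟨leftD_mem_goodPart hw, leftD_mem_deg hwd⟩

include hs in
lemma exists_extPart_inf_le_goodPart (hX : X.FiniteType) (p : ℕ) (d : ℤ) :
    ∃ n, extPart X p ⊓ deg (extTau X) d ≤ goodPart X s n p := by
  have h1 : ⨆ n, goodPart X s n p = extPart X p := by
    refine le_antisymm (iSup_le fun n => goodPart_le_extPart n p) ?_
    rw [extPart, ← iSup_goodFil hs, tens_iSup_left]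
    refine iSup_le fun n => le_iSup_of_le (n + p) ?_
    rw [goodPart, Nat.add_sub_cancel]
  have h2 := finite_extPart_inf_deg hX p d
  have h3 : IsCompactElement (extPart X p ⊓ deg (extTau X) d) :=
    (Submodule.fg_iff_compact _).1 (Module.Finite.iff_fg.1 h2)
  obtain ⟨S, hS⟩ := CompleteLattice.IsCompactElement.exists_finset_of_le_iSup _ h3 (fun n => goodPart X s n p)
    (inf_le_left.trans h1.ge)
  obtain ⟨n, hn⟩ := S.exists_le
  exact ⟨n, hS.trans (iSup₂_le fun i hi => goodPart_mono (hn i hi) p)⟩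

include hk hs in
lemma GoodBound.chr_elliptic (hX : X.FiniteType) {P : ℕ} (hP : ∀ p > P, extPart X p = ⊥)
    (hchr : ∀ d g, X.res.elliptic.chr d g = ∑ p ∈ Finset.range (P + 1),
      (-1) ^ p * trOn (extSpaceRep X g) (extPart X p ⊓ deg (extTau X) d)) {k : ℕ}
    (hkk : k ≥ k₀ + P + 1) (d : ℤ) (g : D.G) :
    X.res.elliptic.chr d g = ∑ p ∈ Finset.range (P + 1),
      (-1) ^ p * trOn (extSpaceRep X g) (goodPart X s k p ⊓ deg (extTau X) d) := by
  choose n hn using fun p => exists_extPart_inf_le_goodPart hs hX p d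
  have h1 : ∀ l, ∑ p ∈ Finset.range (P + 1),
      (-1) ^ p * trOn (extSpaceRep X g) (goodPart X s (k + l) p ⊓ deg (extTau X) d) =
      ∑ p ∈ Finset.range (P + 1),
      (-1) ^ p * trOn (extSpaceRep X g) (goodPart X s k p ⊓ deg (extTau X) d) := fun l => by
    induction l with
    | zero => rfl
    | succ l ih => exact (hk.sum_trOn_succ hX hP (Nat.le_trans hkk (Nat.le_add_right k l)) d g).trans ih
  rw [hchr, ← h1 ((Finset.range (P + 1)).sup n)]
  refine Finset.sum_congr rfl fun p hp => ?_
  congr 2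
  refine le_antisymm (le_inf ((hn p).trans (goodPart_mono ?_ p)) inf_le_right)
    (inf_le_inf_right _ (goodPart_le_extPart _ p))
  exact (Finset.le_sup (f := n) hp).trans (Nat.le_add_left _ _)

/-- The comparison of pairings for finitely generated modules. -/
theorem pairing_eq_of_finite {Y : GrMod.{u, w} D t} (hX : X.FiniteType) (hY : Y.FiniteType)
    [Module.Finite (H D t) X.carrier] (R : GrProjRes X) :
    R.EPgrDefined Y ∧ VEllDefined X.res Y.res ∧ R.EPgr Y = vEll X.res Y.res := by
  obtain ⟨s, hs⟩ := exists_generating_pieces X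
  obtain ⟨k₀, hk⟩ := exists_goodBound hX s
  have hP : ∀ p > Module.finrank ℂ (h × Module.Dual ℂ h), extPart X p = ⊥ :=
    fun p hp => extPart_eq_bot hp
  have hfin : ∀ k p d, Module.Finite ℂ (goodPart X s k p ⊓ deg (extTau X) d :
      Submodule ℂ (extSpace X)) := fun k p d => by
    have := finite_goodPart (s := s) hX k p
    infer_instance
  refine (goodFamily hk hs hP le_rfl).pairing_eq hX hY (fun p hp => ?_) (fun p d => hfin _ p d)
    (fun p n => ?_) (fun d g => hk.chr_elliptic hs hX hP (chr_elliptic hX) le_rfl d g) R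
  · rw [eq_bot_iff, ← hP p hp]
    exact goodPart_le_extPart _ p
  · have := finite_goodPart (s := s) hX (k₀ + Module.finrank ℂ (h × Module.Dual ℂ h) + 1) p
    refine (finite_setOf_inf_deg_ne_bot (τ := extTau X) (extTau_mem_goodPart
      (s := s) (k₀ + Module.finrank ℂ (h × Module.Dual ℂ h) + 1) p)).subset fun d hd h0 => hd ?_
    have h1 := (isHomogeneous_goodPart (s := s) (k₀ + Module.finrank ℂ (h × Module.Dual ℂ h) + 1)
      p).homDim_eq hY (hfin _ p d) (d + n)
    rw [h0] at h1
    simp only [trOn_bot, mul_zero, Finset.sum_const_zero] at h1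
    exact Nat.cast_eq_zero.1 h1

end GoodSubcomplex

end Cherednik

namespace Cherednik
variable {h : Type u} [AddCommGroup h] [Module ℂ h]

section ExteriorTraces

/-- The trace on an exterior power is a sum of principal minors. -/
lemma trOn_exteriorPower {W : Type*} [AddCommGroup W] [Module ℂ W] {I : Type*} [LinearOrder I]
    [Fintype I] (b : Module.Basis I ℂ W) (f : Module.End ℂ W) (n : ℕ) :
    trOn (ExteriorAlgebra.map f).toLinearMap (⋀[ℂ]^n W) =
      ∑ s : Set.powersetCard I n, (Matrix.of fun i j : Fin n =>
        b.coord (Set.powersetCard.ofFinEmbEquiv.symm s j)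
          (f (b (Set.powersetCard.ofFinEmbEquiv.symm s i)))).det := by
  rw [trOn_eq fun _ hm => map_mem_exteriorPower f hm,
    LinearMap.trace_eq_matrix_trace ℂ (b.exteriorPower n), Matrix.trace]
  refine Finset.sum_congr rfl fun s _ => ?_
  rw [Matrix.diag_apply, LinearMap.toMatrix_apply, exteriorPower.basis_repr_apply,
    exteriorPower.basis_apply]
  have h1 : ((ExteriorAlgebra.map f).toLinearMap.restrict fun _ hm => map_mem_exteriorPower f hm)
      (exteriorPower.ιMulti_family ℂ n b s) = exteriorPower.ιMulti ℂ n
        (f ∘ b ∘ Set.powersetCard.ofFinEmbEquiv.symm s) :=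
    Subtype.ext (ExteriorAlgebra.map_apply_ιMulti _ _)
  rw [h1, exteriorPower.ιMultiDual_apply_ιMulti]
  rfl

lemma trOn_exteriorPower_transpose [FiniteDimensional ℂ h] (f : Module.End ℂ h) (n : ℕ) :
    trOn (ExteriorAlgebra.map (Module.Dual.transpose (R := ℂ) f)).toLinearMap
        (⋀[ℂ]^n (Module.Dual ℂ h)) =
      trOn (ExteriorAlgebra.map f).toLinearMap (⋀[ℂ]^n h) := by
  rw [trOn_exteriorPower (Module.finBasis ℂ h),
    trOn_exteriorPower (Module.finBasis ℂ h).dualBasis]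
  refine Finset.sum_congr rfl fun s _ => ?_
  rw [← Matrix.det_transpose]
  congr 1
  ext i j
  simp [Module.Dual.transpose_apply]

variable {D : Datum h}

/-- The character of `⋀^a h*`. -/
def spinChr (g : D.G) (a : ℕ) : ℂ := trOn (extRep D.dualRep g) (⋀[ℂ]^a (Module.Dual ℂ h))

variable (h) in
/-- The multiplication `⋀ h* ⊗ ⋀ h → ⋀ V`. -/
def extMul : ExteriorAlgebra ℂ (Module.Dual ℂ h) ⊗[ℂ] ExteriorAlgebra ℂ h →ₗ[ℂ]
    ExteriorAlgebra ℂ (h × Module.Dual ℂ h) :=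
  LinearMap.mul' ℂ _ ∘ₗ TensorProduct.map
    (ExteriorAlgebra.map (LinearMap.inr ℂ h (Module.Dual ℂ h))).toLinearMap
    (ExteriorAlgebra.map (LinearMap.inl ℂ h (Module.Dual ℂ h))).toLinearMap

lemma extMul_tmul (a : ExteriorAlgebra ℂ (Module.Dual ℂ h)) (b : ExteriorAlgebra ℂ h) :
    extMul h (a ⊗ₜ b) = ExteriorAlgebra.map (LinearMap.inr ℂ h (Module.Dual ℂ h)) a *
      ExteriorAlgebra.map (LinearMap.inl ℂ h (Module.Dual ℂ h)) b := rfl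

lemma extMul_injective : Function.Injective (extMul h) := by
  let Q₁ : QuadraticForm ℂ (Module.Dual ℂ h) := 0
  let Q₂ : QuadraticForm ℂ h := 0
  let E₁ := CliffordAlgebra.evenOdd Q₁
  let E₂ := CliffordAlgebra.evenOdd Q₂
  let σ : (0 : QuadraticForm ℂ (h × Module.Dual ℂ h)) →qᵢ Q₁.prod Q₂ :=
    { toLinearMap := (LinearEquiv.prodComm ℂ h (Module.Dual ℂ h)).toLinearMap
      map_app' := fun m => by simp [Q₁, Q₂] }
  let ψ := (CliffordAlgebra.ofProd Q₁ Q₂).comp (CliffordAlgebra.map σ)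
  have h1 : ψ.comp (ExteriorAlgebra.map (LinearMap.inr ℂ h (Module.Dual ℂ h))) =
      GradedTensorProduct.includeLeft E₁ E₂ := CliffordAlgebra.hom_ext (LinearMap.ext fun x => by
    have e1 : ExteriorAlgebra.map (LinearMap.inr ℂ h (Module.Dual ℂ h))
      (CliffordAlgebra.ι Q₁ x) = CliffordAlgebra.ι 0 (0, x) := ExteriorAlgebra.map_apply_ι _ _
    have e2 : CliffordAlgebra.map σ (CliffordAlgebra.ι 0 ((0 : h), x)) =
      CliffordAlgebra.ι _ (x, 0) := CliffordAlgebra.map_apply_ι _ _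
    change CliffordAlgebra.ofProd Q₁ Q₂ (CliffordAlgebra.map σ
      (ExteriorAlgebra.map _ (CliffordAlgebra.ι Q₁ x))) = _
    rw [e1, e2, CliffordAlgebra.ofProd_ι_mk, map_zero]
    rw [GradedTensorProduct.tmul, GradedTensorProduct.tmul, TensorProduct.tmul_zero]
    exact (congrArg _ (map_zero (GradedTensorProduct.of ℂ E₁ E₂))).trans (add_zero _))
  have h2 : ψ.comp (ExteriorAlgebra.map (LinearMap.inl ℂ h (Module.Dual ℂ h))) =
      GradedTensorProduct.includeRight E₁ E₂ := CliffordAlgebra.hom_ext (LinearMap.ext fun y => by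
    have e1 : ExteriorAlgebra.map (LinearMap.inl ℂ h (Module.Dual ℂ h))
      (CliffordAlgebra.ι Q₂ y) = CliffordAlgebra.ι 0 (y, 0) := ExteriorAlgebra.map_apply_ι _ _
    have e2 : CliffordAlgebra.map σ (CliffordAlgebra.ι 0 (y, (0 : Module.Dual ℂ h))) =
      CliffordAlgebra.ι _ (0, y) := CliffordAlgebra.map_apply_ι _ _
    change CliffordAlgebra.ofProd Q₁ Q₂ (CliffordAlgebra.map σ
      (ExteriorAlgebra.map _ (CliffordAlgebra.ι Q₂ y))) = _
    rw [e1, e2, CliffordAlgebra.ofProd_ι_mk, map_zero, GradedTensorProduct.tmul,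
      GradedTensorProduct.tmul, TensorProduct.zero_tmul]
    exact (congrArg (· + _) (map_zero (GradedTensorProduct.of ℂ E₁ E₂))).trans (zero_add _))
  have h3 : ψ.toLinearMap ∘ₗ extMul h = (GradedTensorProduct.of ℂ E₁ E₂).toLinearMap :=
    TensorProduct.ext' fun a b => by
      have e1 := AlgHom.congr_fun h1 a
      have e2 := AlgHom.congr_fun h2 b
      rw [AlgHom.comp_apply] at e1 e2
      rw [LinearMap.comp_apply, extMul_tmul, AlgHom.toLinearMap_apply]
      refine (map_mul ψ _ _).trans ?_
      rw [e1, e2]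
      exact GradedTensorProduct.tmul_one_mul_one_tmul _ _ _ _
  have h4 : Function.Injective (ψ.toLinearMap ∘ₗ extMul h) := by
    rw [h3]
    exact (GradedTensorProduct.of ℂ E₁ E₂).injective
  exact Function.Injective.of_comp (f := ψ) h4

lemma map_extMul_tens (x : ℕ × ℕ) :
    (tens (⋀[ℂ]^x.1 (Module.Dual ℂ h)) (⋀[ℂ]^x.2 h)).map (extMul h) = extBlock h x := by
  have h1 : extBlock h x = (⋀[ℂ]^x.1 (Module.Dual ℂ h)).map
      (ExteriorAlgebra.map (LinearMap.inr ℂ h (Module.Dual ℂ h))).toLinearMap *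
      (⋀[ℂ]^x.2 h).map (ExteriorAlgebra.map (LinearMap.inl ℂ h (Module.Dual ℂ h))).toLinearMap := by
    rw [extBlock, ExteriorAlgebra.exteriorPower, ExteriorAlgebra.exteriorPower, Submodule.map_pow,
      Submodule.map_pow, extX, extY, ← LinearMap.range_comp, ← LinearMap.range_comp,
      ← LinearMap.range_comp, ← LinearMap.range_comp]
    congr 2 <;> congr 1 <;> ext v <;> simp
  rw [h1]
  refine le_antisymm (Submodule.map_le_iff_le_comap.2 (tens_le.2 fun a ha b hb =>
    Submodule.mul_mem_mul ⟨a, ha, rfl⟩ ⟨b, hb, rfl⟩)) (Submodule.mul_le.2 ?_)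
  rintro _ ⟨a, ha, rfl⟩ _ ⟨b, hb, rfl⟩
  exact ⟨a ⊗ₜ b, tmul_mem_tens ha hb, rfl⟩

/-- The character of `⋀^a h* ⊗ ⋀^b h`, in terms of the characters of the exterior powers
of `h*`. -/
lemma extChr_inv [FiniteDimensional ℂ h] (g : D.G) (x : ℕ × ℕ) :
    extChr g⁻¹ x = spinChr g⁻¹ x.1 * spinChr g x.2 := by
  have h1 : spinChr g x.2 = trOn (extRep D.rep g⁻¹) (⋀[ℂ]^x.2 h) :=
    trOn_exteriorPower_transpose (D.rep g⁻¹) x.2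
  rw [h1, spinChr, ← trOn_tens (f := extRep D.dualRep g⁻¹) (f' := extRep D.rep g⁻¹)
    (fun m hm => map_mem_exteriorPower (D.dualRep g⁻¹) hm)
    (fun m hm => map_mem_exteriorPower (D.rep g⁻¹) hm), extChr, ← map_extMul_tens]
  refine trOn_map (fun m => ?_) extMul_injective fun m hm => mem_of_mem_tens
    (TensorProduct.map (extRep D.dualRep g⁻¹) (extRep D.rep g⁻¹)) _ (fun a ha b hb =>
      tmul_mem_tens (map_mem_exteriorPower _ ha) (map_mem_exteriorPower _ hb)) hm
  induction m with
  | zero => simp only [map_zero]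
  | add a b h1 h2 => simp only [map_add, h1, h2]
  | tmul a b =>
    change _ = ExteriorAlgebra.map (vRep D g⁻¹) (_ * _)
    rw [TensorProduct.map_tmul, extMul_tmul, map_mul]
    have h2 : ∀ (a : ExteriorAlgebra ℂ (Module.Dual ℂ h)),
        ExteriorAlgebra.map (LinearMap.inr ℂ h (Module.Dual ℂ h)) (ExteriorAlgebra.map
          (D.dualRep g⁻¹) a) = ExteriorAlgebra.map (vRep D g⁻¹) (ExteriorAlgebra.map
            (LinearMap.inr ℂ h (Module.Dual ℂ h)) a) := fun a => by
      rw [← AlgHom.comp_apply, ← AlgHom.comp_apply, ExteriorAlgebra.map_comp_map,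
        ExteriorAlgebra.map_comp_map]
      congr 2
      ext v <;> simp
    have h3 : ∀ (b : ExteriorAlgebra ℂ h),
        ExteriorAlgebra.map (LinearMap.inl ℂ h (Module.Dual ℂ h)) (ExteriorAlgebra.map
          (D.rep g⁻¹) b) = ExteriorAlgebra.map (vRep D g⁻¹) (ExteriorAlgebra.map
            (LinearMap.inl ℂ h (Module.Dual ℂ h)) b) := fun b => by
      rw [← AlgHom.comp_apply, ← AlgHom.comp_apply, ExteriorAlgebra.map_comp_map,
        ExteriorAlgebra.map_comp_map]
      congr 2
    exact congrArg₂ _ (h2 a) (h3 b)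

end ExteriorTraces

end Cherednik

namespace Cherednik
variable {h : Type u} [AddCommGroup h] [Module ℂ h]

section SpinTrace

variable {D : Datum h} {t : ℂ} (X : GrMod.{u, v} D t)

/-- The part of `X ⊗ ⋀^a h*` of total degree `n`. -/
def spinBlock (n : ℤ) (a : ℕ) : Submodule ℂ (spinSpace X) :=
  tens (X.piece (n - a)) (⋀[ℂ]^a (Module.Dual ℂ h))

lemma iSupIndep_spinBlock (n : ℤ) : iSupIndep (spinBlock X n) := by
  have h1 := (Module.End.eigenspaces_iSupIndep (TensorProduct.map (LinearMap.id (M := X.carrier))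
    (ExteriorAlgebra.map ((2 : ℂ) • (LinearMap.id (M := Module.Dual ℂ h)))).toLinearMap)).comp
    (two_zpow_injective.comp Nat.cast_injective)
  refine h1.mono fun a => tens_le.2 fun x _ ω hω => ?_
  have h2 := Module.End.mem_eigenspace_iff.1 (pow_le_eigenspace
    (ExteriorAlgebra.map ((2 : ℂ) • (LinearMap.id (M := Module.Dual ℂ h)))) (c := 2) (by
      rintro _ ⟨y, rfl⟩
      rw [Module.End.mem_eigenspace_iff, AlgHom.toLinearMap_apply, ExteriorAlgebra.map_apply_ι,
        ← map_smul]
      rfl) a hω)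
  refine Module.End.mem_eigenspace_iff.2 ?_
  rw [TensorProduct.map_tmul, h2, TensorProduct.tmul_smul, Function.comp_apply, zpow_natCast]
  rfl

variable {X}

lemma rep_mem_spinBlock (g : D.G) (n : ℤ) (a : ℕ) : ∀ m ∈ spinBlock X n a,
    X.rep.tprod (extRep D.dualRep) g m ∈ spinBlock X n a := fun m hm =>
  mem_of_mem_tens (X.rep.tprod (extRep D.dualRep) g) (spinBlock X n a) (fun x hx ω hω =>
    tmul_mem_tens (X.res.stable _ g hx) (map_mem_exteriorPower (D.dualRep g) hω)) hm

variable [FiniteDimensional ℂ h]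

lemma finite_spinBlock (hX : X.FiniteType) (n : ℤ) (a : ℕ) :
    FiniteDimensional ℂ (spinBlock X n a) := by
  have : FiniteDimensional ℂ (X.piece (n - a)) := hX _
  exact finite_tens _ _

lemma trOn_spinBlock (hX : X.FiniteType) (n : ℤ) (a : ℕ) (g : D.G) :
    trOn (X.rep.tprod (extRep D.dualRep) g) (spinBlock X n a) =
      X.res.chr (n - a) g * spinChr g a := by
  have : FiniteDimensional ℂ (X.piece (n - a)) := hX _
  exact trOn_tens (X.res.stable _ g) fun m hm => map_mem_exteriorPower (D.dualRep g) hm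

lemma exteriorPower_dual_eq_bot {a : ℕ} (ha : Module.finrank ℂ h < a) :
    ⋀[ℂ]^a (Module.Dual ℂ h) = ⊥ :=
  exteriorPower_eq_bot (Subspace.dual_finrank_eq.trans_lt ha)

lemma spinBlock_eq_bot (n : ℤ) {a : ℕ} (ha : Module.finrank ℂ h < a) : spinBlock X n a = ⊥ := by
  rw [spinBlock, exteriorPower_dual_eq_bot ha]
  exact tens_bot_right

lemma spinRep_piece (ε : ZMod 2) (n : ℤ) : (spinRep X ε).piece n =
    ⨆ a ∈ (Finset.range (Module.finrank ℂ h + 1)).filter (fun a : ℕ => (a : ZMod 2) = ε),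
      spinBlock X n a := by
  change ⨆ i, tens (X.piece i) (⨆ (a : ℕ) (_ : (a : ℤ) = n - i ∧ (a : ZMod 2) = ε),
    ((⊤ : Submodule ℂ (Module.Dual ℂ h)).map (ExteriorAlgebra.ι ℂ)) ^ a) = _
  simp only [tens_iSup_right, Submodule.map_top]
  refine le_antisymm (iSup_le fun i => iSup₂_le fun a ha => ?_) (iSup₂_le fun a ha => ?_)
  · obtain rfl : i = n - a := by omega
    by_cases hN : a < Module.finrank ℂ h + 1
    · exact le_iSup₂_of_le (f := fun a _ => spinBlock X n a) a
        (Finset.mem_filter.2 ⟨Finset.mem_range.2 hN, ha.2⟩) le_rfl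
    · exact (spinBlock_eq_bot (X := X) n (by omega : Module.finrank ℂ h < a)).le.trans bot_le
  · exact le_iSup_of_le (n - a) (le_iSup₂_of_le a
      ⟨by omega, (Finset.mem_filter.1 ha).2⟩ le_rfl)

lemma finite_spinRep (hX : X.FiniteType) (ε : ZMod 2) (n : ℤ) :
    FiniteDimensional ℂ ((spinRep X ε).piece n) := by
  have : ∀ s : Finset ℕ, FiniteDimensional ℂ (⨆ a ∈ s, spinBlock X n a :
      Submodule ℂ (spinSpace X)) := fun s => Module.Finite.iff_fg.2
    (Submodule.fg_biSup _ _ fun a _ => Module.Finite.iff_fg.1 (finite_spinBlock hX n a))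
  rw [spinRep_piece]
  exact this _

variable (X) in
/-- The supertrace on the part of `X ⊗ S*` of degree `n`. -/
def spinTrace (n : ℤ) (g : D.G) : ℂ := ∑ a ∈ Finset.range (Module.finrank ℂ h + 1),
  (-1) ^ a * (X.res.chr (n - a) g * spinChr g a)

lemma chr_spinRep_sub (hX : X.FiniteType) (n : ℤ) (g : D.G) :
    (spinRep X 0).chr n g - (spinRep X 1).chr n g = spinTrace X n g := by
  have h1 : ∀ ε, (spinRep X ε).chr n g =
      ∑ a ∈ (Finset.range (Module.finrank ℂ h + 1)).filter (fun a : ℕ => (a : ZMod 2) = ε),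
        X.res.chr (n - a) g * spinChr g a := fun ε => by
    have h2 : (spinRep X ε).chr n g =
      trOn (X.rep.tprod (extRep D.dualRep) g) ((spinRep X ε).piece n) := rfl
    rw [h2, spinRep_piece, trOn_biSup (iSupIndep_spinBlock X n) _
      (fun a _ => finite_spinBlock hX n a) fun a _ => rep_mem_spinBlock g n a]
    exact Finset.sum_congr rfl fun a _ => trOn_spinBlock hX n a g
  rw [h1, h1, sum_filter_sub_sum_filter _ (fun a => a)]
  rfl

end SpinTrace

section Vanishing

variable {D : Datum h} {t : ℂ} {X : GrMod.{u, v} D t}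

lemma actX_mem_piece (x : Module.Dual ℂ h) {n : ℤ} {m : X.carrier} (hm : m ∈ X.piece n) :
    actX X x m ∈ X.piece (n + 1) := by
  rw [add_comm]
  exact X.smul_mem 1 n _ (gen_mem_degPart D t (.x x)) m hm

lemma actX_comm (x x' : Module.Dual ℂ h) (m : X.carrier) :
    actX X x (actX X x' m) = actX X x' (actX X x m) := by
  change gen D t (.x x) • gen D t (.x x') • m = gen D t (.x x') • gen D t (.x x) • m
  rw [smul_smul, smul_smul, gen_x_comm]

/-- Generation by a finite set, for modules in category `𝒪`. -/
lemma exists_generating_finset (hO : Module.Finite (polyX D t) X.carrier) :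
    ∃ F : Finset X.carrier, ∀ S : Submodule ℂ X.carrier, (F : Set X.carrier) ⊆ S →
      (∀ x, ∀ m ∈ S, actX X x m ∈ S) → S = ⊤ := by
  obtain ⟨F, hF⟩ := Module.finite_def.1 hO
  refine ⟨F, fun S hFS hS => top_le_iff.1 fun m _ => ?_⟩
  have h1 : ∀ a ∈ polyX D t, ∀ m ∈ S, a • m ∈ S := fun a ha => by
    induction ha using Algebra.adjoin_induction with
    | mem a ha =>
      obtain ⟨x, rfl⟩ := ha
      exact hS x
    | algebraMap r =>
      intro m hm
      rw [algebraMap_smul]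
      exact S.smul_mem r hm
    | add a b _ _ ha hb =>
      intro m hm
      rw [add_smul]
      exact add_mem (ha m hm) (hb m hm)
    | mul a b _ _ ha hb =>
      intro m hm
      rw [mul_smul]
      exact ha _ (hb m hm)
  have h2 : m ∈ Submodule.span (polyX D t) (F : Set X.carrier) := hF ▸ Submodule.mem_top
  induction h2 using Submodule.span_induction with
  | mem m hm => exact hFS hm
  | zero => exact zero_mem _
  | add a b _ _ ha hb => exact add_mem (ha trivial) (hb trivial)
  | smul a m _ hm => exact h1 a a.2 m (hm trivial)

/-- Every vector has components in finitely many degrees only. -/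
lemma exists_internalProj_eq_zero (m : X.carrier) :
    ∃ K : ℕ, ∀ k : ℤ, K ≤ |k| → internalProj X.isInternal k m = 0 := by
  refine internal_induction X.isInternal (P := fun m => ∃ K : ℕ, ∀ k : ℤ, K ≤ |k| →
    internalProj X.isInternal k m = 0) (fun n m hm => ?_) ⟨0, fun k _ => map_zero _⟩ ?_ m
  · refine ⟨n.natAbs + 1, fun k hk => internalProj_of_mem_ne _ ?_ hm⟩
    rintro rfl
    rw [Int.abs_eq_natAbs] at hk
    omega
  · rintro a b ⟨K, hK⟩ ⟨L, hL⟩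
    exact ⟨K + L, fun k hk => by rw [map_add, hK k (by omega), hL k (by omega), add_zero]⟩

/-- Modules in category `𝒪` are bounded below. -/
lemma exists_piece_eq_bot (hO : Module.Finite (polyX D t) X.carrier) :
    ∃ K : ℕ, ∀ n : ℤ, n ≤ -K → X.piece n = ⊥ := by
  obtain ⟨F, hF⟩ := exists_generating_finset hO
  choose K hK using exists_internalProj_eq_zero (X := X)
  obtain ⟨L, hL⟩ := (F.image K).exists_le
  refine ⟨L, fun n hn => eq_bot_iff.2 fun m hm => ?_⟩
  have h1 := hF (⨅ (k : ℤ) (_ : k ≤ -L), LinearMap.ker (internalProj X.isInternal k))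
    (fun f hf => by
      simp only [SetLike.mem_coe, Submodule.mem_iInf, LinearMap.mem_ker]
      intro k hk
      have := hL _ (Finset.mem_image_of_mem K hf)
      refine hK f k ?_
      have h2 := neg_le_abs k
      omega)
    (fun x m hm => by
      simp only [Submodule.mem_iInf, LinearMap.mem_ker] at hm ⊢
      intro k hk
      have h2 := internalProj_smul X (gen_mem_degPart D t (.x x)) (k - 1) m
      rw [show (Gen.x x : Gen D).deg + (k - 1) = k by simp [Gen.deg], hm (k - 1) (by omega),
        smul_zero] at h2
      exact h2)
  have h2 : m ∈ (⨅ (k : ℤ) (_ : k ≤ -L), LinearMap.ker (internalProj X.isInternal k)) :=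
    h1 ▸ Submodule.mem_top
  simp only [Submodule.mem_iInf, LinearMap.mem_ker] at h2
  rw [← internalProj_of_mem X.isInternal hm, h2 n hn]
  exact zero_mem _

variable [FiniteDimensional ℂ h]

variable (h) in
/-- The basis of `h*` dual to the standard basis of `h`. -/
abbrev dualBasis : Module.Basis (Fin (Module.finrank ℂ h)) ℂ (Module.Dual ℂ h) :=
  (Module.finBasis ℂ h).dualBasis

variable (X) in
/-- The Koszul differential for the action of `h*` on `X`. -/
def spinKosz : Module.End ℂ (spinSpace X) := kosz (actX X) (dualBasis h)

/-- The Koszul complex of `X` over `ℂ[h]` is exact in high degrees. -/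
lemma exists_spinKosz_eq (hO : Module.Finite (polyX D t) X.carrier) :
    ∃ K : ℤ, ∀ n ≥ K, ∀ a, ∀ z ∈ spinBlock X n a, spinKosz X z = 0 →
      ∃ w ∈ spinBlock X n (a + 1), spinKosz X w = z := by
  obtain ⟨F, hF⟩ := exists_generating_finset hO
  obtain ⟨k₀, hk₀⟩ := exists_kosz_eq (L := actX X) (dualBasis h) actX_comm
    (fun k => internalProj X.isInternal k) (fun k x m => by
      have := internalProj_smul X (gen_mem_degPart D t (.x x)) k m
      rw [add_comm] at this
      exact this.symm)
    (fun m => by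
      obtain ⟨K, hK⟩ := exists_internalProj_eq_zero m
      exact ⟨K, fun k hk => hK k (by rw [Nat.abs_cast]; exact_mod_cast hk)⟩) F hF
  refine ⟨k₀ + Module.finrank ℂ h + 1, fun n hn a z hz hdz => ?_⟩
  by_cases ha : Module.finrank ℂ h < a
  · rw [spinBlock_eq_bot n ha, Submodule.mem_bot] at hz
    exact ⟨0, zero_mem _, by rw [map_zero, hz]⟩
  obtain ⟨k, hk⟩ : ∃ k : ℕ, n - a = k + 1 := ⟨(n - a - 1).toNat, by omega⟩
  rw [spinBlock, hk] at hz
  obtain ⟨w, hw⟩ := hk₀ k (by omega) z hdz (by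
    have := mem_of_mem_tens (TensorProduct.map (internalProj X.isInternal ((k + 1 : ℕ) : ℤ))
      LinearMap.id - LinearMap.id) ⊥ (fun m hm ω _ => by
        rw [Submodule.mem_bot, LinearMap.sub_apply, TensorProduct.map_tmul,
          internalProj_of_mem _ (by push_cast; exact hm), sub_eq_zero]
        rfl) hz
    exact sub_eq_zero.1 ((Submodule.mem_bot ℂ).1 this))
  have h1 : TensorProduct.map (internalProj X.isInternal (k : ℤ)) LinearMap.id w ∈
      tens (X.piece (n - (a + 1 : ℕ))) ⊤ := by
    rw [show n - (a + 1 : ℕ) = k by push_cast; omega]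
    clear hw
    induction w with
    | zero => rw [map_zero]; exact zero_mem _
    | add a b h1 h2 => rw [map_add]; exact add_mem h1 h2
    | tmul m ω => exact tmul_mem_tens (internalProj_mem _ _ m) trivial
  refine ⟨_, map_extProj_mem (a + 1) h1, ?_⟩
  refine (kosz_extProj (L := actX X) (dualBasis h) a _).trans ?_
  rw [hw, map_extProj_of_mem hz]

lemma spinKosz_rep (g : D.G) (m : spinSpace X) :
    spinKosz X (X.rep.tprod (extRep D.dualRep) g m) =
      X.rep.tprod (extRep D.dualRep) g (spinKosz X m) := by
  have h1 : ∀ g : D.G, D.dualRep g ∘ₗ D.dualRep g⁻¹ = LinearMap.id := fun g => by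
    rw [← Module.End.mul_eq_comp, ← map_mul, mul_inv_cancel, map_one]
    rfl
  exact kosz_map_map (L := actX X) (dualBasis h) (LinearEquiv.ofLinearMap (D.dualRep g) (D.dualRep g⁻¹)
    (h1 g) (by simpa using h1 g⁻¹)) (rep_actX X g) m

/-- The supertraces of a module in category `𝒪` vanish in almost all degrees. -/
lemma exists_spinTrace_eq_zero (hX : X.FiniteType) (hO : Module.Finite (polyX D t) X.carrier) :
    ∃ T : Finset ℤ, ∀ n ∉ T, ∀ g, spinTrace X n g = 0 := by
  obtain ⟨K, hK⟩ := exists_spinKosz_eq hO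
  obtain ⟨L, hL⟩ := exists_piece_eq_bot hO
  refine ⟨Finset.Ioo (-L) K, fun n hn g => ?_⟩
  rw [Finset.mem_Ioo, not_and_or, not_lt, not_lt] at hn
  rcases hn with hn | hn
  · refine Finset.sum_eq_zero fun a _ => ?_
    have h1 : X.res.chr (n - a) g = trOn (X.rep g) (X.piece (n - a)) := rfl
    rw [h1, hL _ (by omega), trOn_bot, zero_mul, mul_zero]
  · have := finite_spinBlock hX n
    have hd : ∀ a, ∀ z ∈ spinBlock X n (a + 1), spinKosz X z ∈ spinBlock X n a := fun a z hz =>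
      kosz_mem_tens (L := actX X) (dualBasis h) (fun x m hm => by
        have := actX_mem_piece x hm
        rwa [show n - (a + 1 : ℕ) + 1 = n - a by push_cast; ring] at this) hz
    have hdd : ∀ a, ∀ z ∈ spinBlock X n (a + 2), spinKosz X (spinKosz X z) = 0 := fun a z hz => by
      have := kosz_kosz_mem (L := actX X) (S' := ⊥) (dualBasis h) (fun x x' m _ => by
        rw [actX_comm, sub_self]
        exact zero_mem _) hz
      rwa [tens_bot_left, Submodule.mem_bot] at this
    have h0 : ∀ z ∈ spinBlock X n 0, spinKosz X z = 0 := fun z hz =>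
      kosz_eq_zero (L := actX X) (dualBasis h) hz
    have h1 := sum_trOn_eq (spinKosz_rep g) (spinBlock X n) (fun _ => ⊥) (rep_mem_spinBlock g n)
      (fun _ m hm => by rw [(Submodule.mem_bot ℂ).1 hm, map_zero]; exact zero_mem _) h0
      (fun p => le_antisymm
        (fun z hz => Submodule.mem_sup_left (hK n hn _ z hz.1 ((Submodule.mem_bot ℂ).1 hz.2)))
        (sup_le (by
          rintro _ ⟨w, hw, rfl⟩
          exact ⟨hd _ w hw, (Submodule.mem_bot ℂ).2 (hdd _ w hw)⟩) bot_le))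
      (le_antisymm (fun z hz => Submodule.mem_sup_left (hK n hn _ z hz (h0 z hz)))
        (sup_le (by
          rintro _ ⟨w, hw, rfl⟩
          exact hd _ w hw) bot_le))
      (spinBlock_eq_bot n (Nat.lt_succ_self (Module.finrank ℂ h))) rfl
    simp only [trOn_bot, mul_zero, Finset.sum_const_zero, trOn_spinBlock hX] at h1
    exact h1

end Vanishing

end Cherednik

namespace Cherednik
variable {h : Type u} [AddCommGroup h] [Module ℂ h]

section EulerElement

variable {D : Datum h} {t : ℂ} [FiniteDimensional ℂ h]

omit [FiniteDimensional ℂ h] in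
lemma sum_apply_smul_coord {ι : Type*} [Fintype ι] (b : Module.Basis ι ℂ h)
    (α : Module.Dual ℂ h) : ∑ j, α (b j) • b.coord j = α :=
  LinearMap.ext fun v => by
    conv_rhs => rw [← b.sum_repr v, map_sum]
    rw [LinearMap.sum_apply]
    exact Finset.sum_congr rfl fun j _ => by
      rw [map_smul, LinearMap.smul_apply, smul_eq_mul, smul_eq_mul, mul_comm]
      rfl

lemma euler_mul_gen_x (ht : t = 0) (x : Module.Dual ℂ h) :
    euler D t * gen D t (.x x) = gen D t (.x x) * euler D t := by
  have h1 : ∀ s : reflections D.G, gen D t (.g (D.refl s)) * gen D t (.x x) =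
      gen D t (.x x) * gen D t (.g (D.refl s)) -
        (dCoef D s * x (D.coroot s)) • (xMap D t (D.root s) * gen D t (.g (D.refl s))) := fun s => by
    rw [gen_g_x, Datum.refl_dual_apply]
    change xMap D t _ * _ = _
    rw [map_sub, map_smul, sub_mul, smul_mul_assoc]
    rfl
  have h2 : ∀ j, xMap D t ((Module.finBasis ℂ h).coord j) * yMap D t (Module.finBasis ℂ h j) *
      gen D t (.x x) = gen D t (.x x) * (xMap D t ((Module.finBasis ℂ h).coord j) *
        yMap D t (Module.finBasis ℂ h j)) - ∑ s, (D.c s * x (D.coroot s)) •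
          (xMap D t (D.root s (Module.finBasis ℂ h j) • (Module.finBasis ℂ h).coord j) *
            gen D t (.g (D.refl s))) := fun j => by
    have h3 := gen_y_x D t (Module.finBasis ℂ h j) x
    rw [ht, zero_mul, map_zero, zero_sub, sub_eq_iff_eq_add] at h3
    subst ht
    change gen D 0 (.x _) * gen D 0 (.y _) * _ = _ * (gen D 0 (.x _) * gen D 0 (.y _)) - _
    rw [mul_assoc, h3, mul_add, ← mul_assoc, gen_x_comm, mul_assoc, mul_neg, Finset.mul_sum,
      add_comm, sub_eq_add_neg]
    congr 2
    refine Finset.sum_congr rfl fun s _ => ?_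
    rw [map_smul, mul_smul_comm, smul_mul_assoc, smul_smul]
    congr 1
    ring
  have h4 : ∀ s : reflections D.G, ∑ j, (D.c s * x (D.coroot s)) •
      (xMap D t (D.root s (Module.finBasis ℂ h j) • (Module.finBasis ℂ h).coord j) *
        gen D t (.g (D.refl s))) = (D.c s * x (D.coroot s)) •
          (xMap D t (D.root s) * gen D t (.g (D.refl s))) := fun s => by
    rw [← Finset.smul_sum, ← Finset.sum_mul, ← map_sum, sum_apply_smul_coord (Module.finBasis ℂ h)]
  have h5 : ∀ s : reflections D.G, ((D.c s / dCoef D s) • gMap D t (D.refl s)) * gen D t (.x x) =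
      gen D t (.x x) * ((D.c s / dCoef D s) • gMap D t (D.refl s)) - (D.c s * x (D.coroot s)) •
          (xMap D t (D.root s) * gen D t (.g (D.refl s))) := fun s => by
    change (_ • gen D t (.g _)) * _ = _ * (_ • gen D t (.g _)) - _
    rw [smul_mul_assoc, h1, smul_sub, mul_smul_comm, smul_smul, ← mul_assoc,
      div_mul_cancel₀ _ (dCoef_ne_zero D s)]
  rw [euler, sub_mul, add_mul, mul_sub, mul_add, Finset.sum_mul, Finset.sum_mul, Finset.mul_sum,
    Finset.mul_sum, Algebra.commutes ((Module.finrank ℂ h : ℂ) / 2) (gen D t (.x x))]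
  simp only [h2, h5, Finset.sum_sub_distrib]
  rw [Finset.sum_comm]
  simp only [h4]
  abel

lemma euler_mul_gen_y (ht : t = 0) (y : h) :
    euler D t * gen D t (.y y) = gen D t (.y y) * euler D t := by
  have h1 : ∀ s : reflections D.G, gen D t (.y y) * gen D t (.g (D.refl s)) =
      gen D t (.g (D.refl s)) * gen D t (.y y) -
        (dCoef D s * D.root s y) • (gen D t (.g (D.refl s)) * yMap D t (D.coroot s)) := fun s => by
    have h2 := gen_g_y D t (D.refl s) (D.rep (D.refl s)⁻¹ y)
    rw [Datum.rep_rep_inv, Datum.refl_inv_apply] at h2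
    rw [← h2]
    change _ * yMap D t _ = _ * yMap D t _ - _
    rw [map_sub, map_smul, mul_sub, mul_smul_comm]
  have h2 : ∀ j, xMap D t ((Module.finBasis ℂ h).coord j) * yMap D t (Module.finBasis ℂ h j) *
      gen D t (.y y) = gen D t (.y y) * (xMap D t ((Module.finBasis ℂ h).coord j) *
        yMap D t (Module.finBasis ℂ h j)) + ∑ s, (D.c s * D.root s y) •
          (gen D t (.g (D.refl s)) * yMap D t ((Module.finBasis ℂ h).coord j (D.coroot s) •
            Module.finBasis ℂ h j)) := fun j => by
    have h3 := gen_y_x D t y ((Module.finBasis ℂ h).coord j)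
    rw [ht, zero_mul, map_zero, zero_sub, sub_eq_iff_eq_add] at h3
    subst ht
    change gen D 0 (.x _) * gen D 0 (.y _) * _ = _ * (gen D 0 (.x _) * gen D 0 (.y _)) + _
    rw [← mul_assoc (gen D 0 (.y y)), h3, mul_assoc, gen_y_comm, ← mul_assoc, add_mul, neg_mul,
      Finset.sum_mul]
    rw [add_right_comm, eq_comm, add_eq_right, neg_add_eq_zero]
    refine Finset.sum_congr rfl fun s _ => ?_
    rw [map_smul, mul_smul_comm, smul_mul_assoc, smul_smul]
    rfl
  have h4 : ∀ s : reflections D.G, ∑ j, (D.c s * D.root s y) •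
      (gen D t (.g (D.refl s)) * yMap D t ((Module.finBasis ℂ h).coord j (D.coroot s) •
        Module.finBasis ℂ h j)) = (D.c s * D.root s y) •
          (gen D t (.g (D.refl s)) * yMap D t (D.coroot s)) := fun s => by
    rw [← Finset.smul_sum, ← Finset.mul_sum, ← map_sum]
    exact congrArg (fun v => (D.c s * D.root s y) • (gen D t (.g (D.refl s)) * yMap D t v))
      ((Module.finBasis ℂ h).sum_repr _)
  have h5 : ∀ s : reflections D.G, gen D t (.y y) * ((D.c s / dCoef D s) • gMap D t (D.refl s)) =
      ((D.c s / dCoef D s) • gMap D t (D.refl s)) * gen D t (.y y) - (D.c s * D.root s y) •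
          (gen D t (.g (D.refl s)) * yMap D t (D.coroot s)) := fun s => by
    change _ * (_ • gen D t (.g _)) = (_ • gen D t (.g _)) * _ - _
    rw [mul_smul_comm, h1, smul_sub, smul_mul_assoc, smul_smul, ← mul_assoc,
      div_mul_cancel₀ _ (dCoef_ne_zero D s)]
  rw [euler, sub_mul, add_mul, mul_sub, mul_add, Finset.sum_mul, Finset.sum_mul, Finset.mul_sum,
    Finset.mul_sum, Algebra.commutes ((Module.finrank ℂ h : ℂ) / 2) (gen D t (.y y))]
  simp only [h2, h5, Finset.sum_sub_distrib, Finset.sum_add_distrib]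
  rw [Finset.sum_comm (f := fun j s => (D.c s * D.root s y) •
    (gen D t (.g (D.refl s)) * yMap D t ((Module.finBasis ℂ h).coord j (D.coroot s) •
      Module.finBasis ℂ h j))), Finset.sum_congr rfl fun s _ => h4 s]
  abel

lemma euler_mul_gen_g (g : D.G) : euler D t * gen D t (.g g) = gen D t (.g g) * euler D t := by
  have h1 : gen D t (.g g) * ∑ i, xMap D t ((Module.finBasis ℂ h).coord i) *
      yMap D t (Module.finBasis ℂ h i) = (∑ i, xMap D t ((Module.finBasis ℂ h).coord i) *
        yMap D t (Module.finBasis ℂ h i)) * gen D t (.g g) := by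
    have h0 : ∑ i, xMap D t (D.dualRep g ((Module.finBasis ℂ h).coord i)) *
        yMap D t (D.rep g (Module.finBasis ℂ h i)) = ∑ i, xMap D t ((Module.finBasis ℂ h).coord i) *
          yMap D t (Module.finBasis ℂ h i) :=
      sum_dual_basis (D := D) ((LinearMap.mul ℂ (H D t)).compl₁₂ (xMap D t) (yMap D t)) g
    rw [Finset.mul_sum]
    refine Eq.trans ?_ (congrArg (· * gen D t (.g g)) h0)
    rw [Finset.sum_mul]
    refine Finset.sum_congr rfl fun i _ => ?_
    change _ * (gen D t (.x _) * gen D t (.y _)) = gen D t (.x _) * gen D t (.y _) * _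
    rw [← mul_assoc, gen_g_x, mul_assoc, gen_g_y, ← mul_assoc]
  have h2 : gen D t (.g g) * ∑ s, (D.c s / dCoef D s) • gMap D t (D.refl s) =
      (∑ s, (D.c s / dCoef D s) • gMap D t (D.refl s)) * gen D t (.g g) := by
    rw [Finset.mul_sum, Finset.sum_mul, ← (D.conjEquiv g).sum_comp
      (fun s => (D.c s / dCoef D s) • gMap D t (D.refl s) * gen D t (.g g))]
    refine Finset.sum_congr rfl fun s _ => ?_
    change _ = (D.c (D.conj g s) / dCoef D (D.conj g s)) • gMap D t (D.refl (D.conj g s)) *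
      gMap D t g
    rw [D.c_conj', dCoef_conj, D.refl_conj, smul_mul_assoc, ← map_mul, inv_mul_cancel_right,
      map_mul, mul_smul_comm]
    rfl
  rw [euler, sub_mul, add_mul, mul_sub, mul_add, h1, h2,
    Algebra.commutes ((Module.finrank ℂ h : ℂ) / 2) (gen D t (.g g))]

/-- The Euler element is central when `t = 0`. -/
lemma euler_mem_center (ht : t = 0) : euler D t ∈ Subalgebra.center ℂ (H D t) := by
  refine Subalgebra.mem_center_iff.2 fun a => ?_
  induction a using H.induction with
  | hs r => exact Algebra.commutes r _
  | hg a =>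
    rcases a with g | y | x
    · exact (euler_mul_gen_g g).symm
    · exact (euler_mul_gen_y ht y).symm
    · exact (euler_mul_gen_x ht x).symm
  | hm a b h1 h2 => rw [mul_assoc, h2, ← mul_assoc, h1, mul_assoc]
  | ha a b h1 h2 => rw [add_mul, mul_add, h1, h2]

/-- The action of the Euler element on a module with an infinitesimal character. -/
lemma exists_euler_smul {X : GrMod.{u, v} D t} (hX : X.HasInfChar) :
    ∃ k : ℂ, ∀ d : ℤ, ∀ m ∈ X.piece d, euler D t • m = (t * d + k) • m := by
  by_cases ht : t = 0
  · subst ht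
    obtain ⟨χ, hχ⟩ := hX.2.2 rfl
    refine ⟨χ ⟨_, euler_mem_center rfl⟩, fun d m _ => ?_⟩
    rw [zero_mul, zero_add]
    exact hχ ⟨_, euler_mem_center rfl⟩ m
  · exact hX.2.1 ht

end EulerElement

section DiracSquare

variable {D : Datum h} {t : ℂ} [FiniteDimensional ℂ h] (X : GrMod.{u, v} D t)

lemma sum_sum_eq_zero {ι M : Type*} [Fintype ι] [AddCommGroup M] [Module ℂ M] {f : ι → ι → M}
    (hf : ∀ i j, f i j = -f j i) : ∑ i, ∑ j, f i j = 0 := by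
  have h1 : ∑ i, ∑ j, f i j = -∑ i, ∑ j, f i j := by
    conv_lhs => rw [Finset.sum_comm]
    simp only [← Finset.sum_neg_distrib]
    exact Finset.sum_congr rfl fun i _ => Finset.sum_congr rfl fun j _ => hf j i
  have h2 : (2 : ℂ) • ∑ i, ∑ j, f i j = 0 := by
    rw [two_smul]
    exact add_eq_zero_iff_eq_neg.2 h1
  exact (smul_eq_zero.1 h2).resolve_left two_ne_zero

/-- The part of the Dirac operator raising the exterior degree. -/
def spinDiff : Module.End ℂ (spinSpace X) := ∑ j, TensorProduct.map (actY X (Module.finBasis ℂ h j))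
  (wedge ((Module.finBasis ℂ h).coord j))

lemma spinDiff_tmul (m : X.carrier) (ω : ExteriorAlgebra ℂ (Module.Dual ℂ h)) :
    spinDiff X (m ⊗ₜ ω) = ∑ k, (actY X (Module.finBasis ℂ h k) m) ⊗ₜ
      wedge ((Module.finBasis ℂ h).coord k) ω := by
  rw [spinDiff, LinearMap.sum_apply]
  rfl

lemma dualBasis_coord {ι W : Type*} [Fintype ι] [DecidableEq ι] [AddCommGroup W] [Module ℂ W]
    (b : Module.Basis ι ℂ W) (j : ι) : b.dualBasis.coord j = Module.Dual.eval ℂ W (b j) :=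
  LinearMap.ext fun ξ => b.dualBasis_repr ξ j

lemma spinKosz_tmul (m : X.carrier) (ω : ExteriorAlgebra ℂ (Module.Dual ℂ h)) :
    spinKosz X (m ⊗ₜ ω) = ∑ j, (actX X ((Module.finBasis ℂ h).coord j) m) ⊗ₜ
      ctr (Module.Dual.eval ℂ h (Module.finBasis ℂ h j)) ω := by
  rw [spinKosz, kosz_tmul]
  refine Finset.sum_congr rfl fun j _ => ?_
  exact congrArg₂ (fun (u : Module.Dual ℂ h) (v : Module.Dual ℂ (Module.Dual ℂ h)) =>
    (actX X u m) ⊗ₜ[ℂ] ctr v ω) (congrFun (Module.Basis.coe_dualBasis _) j) (dualBasis_coord _ j)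

lemma dirac_eq (z : spinSpace X) : dirac X z = (2 : ℂ) • spinDiff X z - spinKosz X z := by
  induction z using TensorProduct.induction_on with
  | zero => simp only [map_zero, smul_zero, sub_zero]
  | add a b h1 h2 => simp only [map_add, h1, h2, smul_add]; abel
  | tmul m ω =>
    rw [spinDiff_tmul, spinKosz_tmul, dirac, LinearMap.add_apply, LinearMap.sum_apply,
      LinearMap.sum_apply, Finset.smul_sum, sub_eq_add_neg, add_comm, ← Finset.sum_neg_distrib]
    refine congrArg₂ _ (Finset.sum_congr rfl fun j _ => ?_) (Finset.sum_congr rfl fun j _ => ?_)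
    · rw [TensorProduct.map_tmul, ← TensorProduct.tmul_smul]
      rfl
    · rw [TensorProduct.map_tmul, ← TensorProduct.tmul_neg]
      rfl

lemma spinKosz_spinKosz (z : spinSpace X) : spinKosz X (spinKosz X z) = 0 := by
  induction z using TensorProduct.induction_on with
  | zero => simp only [map_zero]
  | add a b h1 h2 => simp only [map_add, h1, h2, add_zero]
  | tmul m ω =>
    simp only [spinKosz_tmul, map_sum]
    exact sum_sum_eq_zero fun i j => by rw [actX_comm, ctr_comm, TensorProduct.tmul_neg]

lemma spinDiff_spinDiff (z : spinSpace X) : spinDiff X (spinDiff X z) = 0 := by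
  induction z using TensorProduct.induction_on with
  | zero => simp only [map_zero]
  | add a b h1 h2 => simp only [map_add, h1, h2, add_zero]
  | tmul m ω =>
    simp only [spinDiff_tmul, map_sum]
    refine sum_sum_eq_zero fun i j => ?_
    rw [wedge_comm, TensorProduct.tmul_neg]
    change -((gen D t (.y _) • gen D t (.y _) • m) ⊗ₜ _) = -((gen D t (.y _) • gen D t (.y _) • m) ⊗ₜ _)
    rw [smul_smul, smul_smul, gen_y_comm]

variable {X}

omit [FiniteDimensional ℂ h] in
lemma actY_actX_sub (y : h) (x : Module.Dual ℂ h) (m : X.carrier) :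
    actY X y (actX X x m) - actX X x (actY X y m) = (t * x y) • m -
      ∑ s, (D.c s * D.root s y * x (D.coroot s)) • X.rep (D.refl s) m := by
  change gen D t (.y y) • gen D t (.x x) • m - gen D t (.x x) • gen D t (.y y) • m = _
  rw [smul_smul, smul_smul, ← sub_smul, gen_y_x, sub_smul, algebraMap_smul, Finset.sum_smul]
  refine congrArg _ (Finset.sum_congr rfl fun s _ => ?_)
  rw [smul_assoc]
  rfl

omit [FiniteDimensional ℂ h] in
lemma sum_sum_wedge_ctr {ι : Type*} [Fintype ι] (b : Module.Basis ι ℂ h) (α : Module.Dual ℂ h)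
    (v : h) (ω : ExteriorAlgebra ℂ (Module.Dual ℂ h)) :
    ∑ k, ∑ j, (α (b k) * b.coord j v) • wedge (b.coord k) (ctr (Module.Dual.eval ℂ h (b j)) ω) =
      wedge α (ctr (Module.Dual.eval ℂ h v) ω) := by
  conv_rhs => rw [← sum_apply_smul_coord b α, ← b.sum_repr v]
  simp only [map_sum, map_smul, LinearMap.sum_apply, LinearMap.smul_apply, Finset.smul_sum,
    smul_smul]
  rw [Finset.sum_comm]
  exact Finset.sum_congr rfl fun j _ => Finset.sum_congr rfl fun k _ =>
    congrArg (· • _) (mul_comm _ _)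

omit [FiniteDimensional ℂ h] in
lemma map_refl_eq (s : reflections D.G) (ω : ExteriorAlgebra ℂ (Module.Dual ℂ h)) :
    extRep D.dualRep (D.refl s) ω = ω - dCoef D s •
      wedge (D.root s) (ctr (Module.Dual.eval ℂ h (D.coroot s)) ω) := by
  have h1 := map_sub_smul (dCoef D s • Module.Dual.eval ℂ h (D.coroot s)) (D.root s)
    (D.dualRep (D.refl s)) (fun x => D.refl_dual_apply s x) ω
  rw [map_smul, LinearMap.smul_apply, map_smul] at h1
  exact h1

omit [FiniteDimensional ℂ h] in
lemma sum_sum_smul_wedge_ctr {ι : Type*} [Fintype ι] [DecidableEq ι] (b : Module.Basis ι ℂ h)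
    (m : X.carrier) {a : ℕ} {ω : ExteriorAlgebra ℂ (Module.Dual ℂ h)}
    (hω : ω ∈ ⋀[ℂ]^a (Module.Dual ℂ h)) :
    ∑ k, ∑ j, ((t * b.coord j (b k)) • m) ⊗ₜ[ℂ]
      wedge (b.coord k) (ctr (Module.Dual.eval ℂ h (b j)) ω) = (t * a) • m ⊗ₜ[ℂ] ω := by
  have h4 := sum_wedge_ctr b.dualBasis hω
  simp only [dualBasis_coord, Module.Basis.coe_dualBasis] at h4
  rw [mul_smul, ← TensorProduct.tmul_smul, ← h4, TensorProduct.tmul_sum, Finset.smul_sum]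
  refine Finset.sum_congr rfl fun k _ => ?_
  rw [Finset.sum_eq_single k]
  · simp [TensorProduct.smul_tmul']
  · intro j _ hj
    simp [Finsupp.single_apply, hj.symm]
  · simp

lemma sum_sum_refl {ι : Type*} [Fintype ι] (b : Module.Basis ι ℂ h)
    (m : X.carrier) (ω : ExteriorAlgebra ℂ (Module.Dual ℂ h)) (s : reflections D.G) :
    ∑ k, ∑ j, ((D.c s * D.root s (b k) * b.coord j (D.coroot s)) • X.rep (D.refl s) m) ⊗ₜ[ℂ]
      wedge (b.coord k) (ctr (Module.Dual.eval ℂ h (b j)) ω) = (D.c s / dCoef D s) •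
        (X.rep (D.refl s) m ⊗ₜ[ℂ] ω -
          X.rep.tprod (extRep D.dualRep) (D.refl s) (m ⊗ₜ ω)) := by
  have h5 : X.rep.tprod (extRep D.dualRep) (D.refl s) (m ⊗ₜ[ℂ] ω) =
    X.rep (D.refl s) m ⊗ₜ extRep D.dualRep (D.refl s) ω := rfl
  rw [h5, map_refl_eq, TensorProduct.tmul_sub, sub_sub_cancel, TensorProduct.tmul_smul,
    smul_smul, div_mul_cancel₀ _ (dCoef_ne_zero D s), ← sum_sum_wedge_ctr b, TensorProduct.tmul_sum,
    Finset.smul_sum]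
  refine Finset.sum_congr rfl fun k _ => ?_
  rw [TensorProduct.tmul_sum, Finset.smul_sum]
  refine Finset.sum_congr rfl fun j _ => ?_
  rw [TensorProduct.tmul_smul, smul_smul, ← TensorProduct.smul_tmul', mul_assoc]

lemma sum_ctr_wedge_add_sum_wedge_ctr {ι : Type*} [Fintype ι] [DecidableEq ι]
    (b : Module.Basis ι ℂ h)
    (m : X.carrier) {a : ℕ} {ω : ExteriorAlgebra ℂ (Module.Dual ℂ h)}
    (hω : ω ∈ ⋀[ℂ]^a (Module.Dual ℂ h)) :
    ∑ k, ∑ j, actX X (b.coord j) (actY X (b k) m) ⊗ₜ[ℂ]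
        ctr (Module.Dual.eval ℂ h (b j)) (wedge (b.coord k) ω) +
      ∑ j, ∑ k, actY X (b k) (actX X (b.coord j) m) ⊗ₜ[ℂ]
        wedge (b.coord k) (ctr (Module.Dual.eval ℂ h (b j)) ω) =
      (∑ j, actX X (b.coord j) (actY X (b j) m)) ⊗ₜ[ℂ] ω + (t * a) • m ⊗ₜ[ℂ] ω -
        ∑ s, (D.c s / dCoef D s) • (X.rep (D.refl s) m ⊗ₜ[ℂ] ω -
          X.rep.tprod (extRep D.dualRep) (D.refl s) (m ⊗ₜ ω)) := by
  have h1 : ∀ k j, actX X (b.coord j) (actY X (b k) m) ⊗ₜ[ℂ]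
        ctr (Module.Dual.eval ℂ h (b j)) (wedge (b.coord k) ω) +
      actY X (b k) (actX X (b.coord j) m) ⊗ₜ[ℂ]
        wedge (b.coord k) (ctr (Module.Dual.eval ℂ h (b j)) ω) =
      b.coord k (b j) • (actX X (b.coord j) (actY X (b k) m)) ⊗ₜ[ℂ] ω +
        (((t * b.coord j (b k)) • m) ⊗ₜ[ℂ]
          wedge (b.coord k) (ctr (Module.Dual.eval ℂ h (b j)) ω) -
        ∑ s, ((D.c s * D.root s (b k) * b.coord j (D.coroot s)) • X.rep (D.refl s) m) ⊗ₜ[ℂ]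
          wedge (b.coord k) (ctr (Module.Dual.eval ℂ h (b j)) ω)) := fun k j => by
    rw [← TensorProduct.sum_tmul, ← TensorProduct.sub_tmul, ← actY_actX_sub, ctr_wedge,
      TensorProduct.tmul_sub, TensorProduct.tmul_smul, TensorProduct.sub_tmul,
      Module.Dual.eval_apply]
    abel
  have h2 : ∑ k, ∑ j, b.coord k (b j) • (actX X (b.coord j) (actY X (b k) m)) ⊗ₜ[ℂ] ω =
      (∑ j, actX X (b.coord j) (actY X (b j) m)) ⊗ₜ[ℂ] ω := by
    rw [TensorProduct.sum_tmul]
    refine Finset.sum_congr rfl fun k _ => ?_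
    rw [Finset.sum_eq_single k]
    · simp
    · intro j _ hj
      simp [Finsupp.single_apply, hj]
    · simp
  have h6 : ∑ k, ∑ j, ∑ s, ((D.c s * D.root s (b k) * b.coord j (D.coroot s)) •
      X.rep (D.refl s) m) ⊗ₜ[ℂ] wedge (b.coord k) (ctr (Module.Dual.eval ℂ h (b j)) ω) =
      ∑ s, (D.c s / dCoef D s) • (X.rep (D.refl s) m ⊗ₜ[ℂ] ω -
          X.rep.tprod (extRep D.dualRep) (D.refl s) (m ⊗ₜ ω)) := by
    rw [← Finset.sum_congr rfl fun s _ => sum_sum_refl b m ω s]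
    refine (Finset.sum_congr rfl fun k _ => Finset.sum_comm).trans Finset.sum_comm
  rw [Finset.sum_comm (f := fun j k => actY X (b k) (actX X (b.coord j) m) ⊗ₜ[ℂ]
        wedge (b.coord k) (ctr (Module.Dual.eval ℂ h (b j)) ω)), ← Finset.sum_add_distrib]
  simp only [← Finset.sum_add_distrib, h1]
  simp only [Finset.sum_add_distrib, Finset.sum_sub_distrib]
  rw [h2, h6, sum_sum_smul_wedge_ctr b m hω, add_sub_assoc]

lemma euler_smul (m : X.carrier) : euler D t • m =
    ∑ j, actX X ((Module.finBasis ℂ h).coord j) (actY X (Module.finBasis ℂ h j) m) +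
      ((Module.finrank ℂ h : ℂ) / 2) • m - ∑ s, (D.c s / dCoef D s) • X.rep (D.refl s) m := by
  rw [euler, sub_smul, add_smul, Finset.sum_smul, Finset.sum_smul, algebraMap_smul]
  exact congrArg₂ _ (congrArg₂ _ (Finset.sum_congr rfl fun j _ => mul_smul _ _ _) rfl)
    (Finset.sum_congr rfl fun s _ => smul_assoc _ _ _)

/-- The anticommutator of the two parts of the Dirac operator. -/
lemma spinKosz_spinDiff_add (m : X.carrier) {a : ℕ} {ω : ExteriorAlgebra ℂ (Module.Dual ℂ h)}
    (hω : ω ∈ ⋀[ℂ]^a (Module.Dual ℂ h)) :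
    spinKosz X (spinDiff X (m ⊗ₜ ω)) + spinDiff X (spinKosz X (m ⊗ₜ ω)) =
      (euler D t • m) ⊗ₜ ω + (t * a - (Module.finrank ℂ h : ℂ) / 2) • m ⊗ₜ ω +
        ∑ s, (D.c s / dCoef D s) • X.rep.tprod (extRep D.dualRep) (D.refl s) (m ⊗ₜ ω) := by
  rw [spinDiff_tmul, spinKosz_tmul, map_sum, map_sum]
  refine (congrArg₂ (· + ·) (Finset.sum_congr rfl fun k _ => spinKosz_tmul X _ _)
    (Finset.sum_congr rfl fun j _ => spinDiff_tmul X _ _)).trans ?_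
  refine (sum_ctr_wedge_add_sum_wedge_ctr (Module.finBasis ℂ h) m hω).trans ?_
  rw [euler_smul]
  simp only [smul_sub, Finset.sum_sub_distrib, TensorProduct.sub_tmul, TensorProduct.add_tmul,
    TensorProduct.sum_tmul, TensorProduct.smul_tmul', sub_smul]
  abel

lemma dirac_dirac {k : ℂ} (hk : ∀ d : ℤ, ∀ m ∈ X.piece d, euler D t • m = (t * d + k) • m) {n : ℤ}
    {a : ℕ} {z : spinSpace X} (hz : z ∈ spinBlock X n a) :
    dirac X (dirac X z) = (-2 : ℂ) • ((t * n + k - (Module.finrank ℂ h : ℂ) / 2) • z +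
        ∑ s, (D.c s / dCoef D s) • X.rep.tprod (extRep D.dualRep) (D.refl s) z) := by
  have h1 : dirac X (dirac X z) =
      (-2 : ℂ) • (spinKosz X (spinDiff X z) + spinDiff X (spinKosz X z)) := by
    rw [dirac_eq, dirac_eq]
    simp only [map_sub, map_smul, spinKosz_spinKosz, spinDiff_spinDiff, smul_zero, sub_zero,
      zero_sub]
    rw [smul_add, neg_smul, neg_smul, sub_eq_add_neg, smul_neg, add_comm]
  rw [h1]
  congr 1
  have h2 := mem_of_mem_tens
    (spinKosz X ∘ₗ spinDiff X + spinDiff X ∘ₗ spinKosz X -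
      ((t * n + k - (Module.finrank ℂ h : ℂ) / 2) • LinearMap.id +
        ∑ s, (D.c s / dCoef D s) • X.rep.tprod (extRep D.dualRep) (D.refl s))) ⊥
    (fun m hm ω hω => ?_) hz
  · rw [Submodule.mem_bot, LinearMap.sub_apply, sub_eq_zero] at h2
    refine h2.trans ?_
    rw [LinearMap.add_apply, LinearMap.sum_apply]
    rfl
  · rw [Submodule.mem_bot, LinearMap.sub_apply, sub_eq_zero]
    refine (spinKosz_spinDiff_add m hω).trans ?_
    rw [LinearMap.add_apply, LinearMap.sum_apply, hk _ m hm, ← TensorProduct.smul_tmul', ← add_smul]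
    refine congrArg₂ _ (congrArg (· • m ⊗ₜ[ℂ] ω) ?_) rfl
    push_cast
    ring

end DiracSquare

end Cherednik

namespace Cherednik
variable {h : Type u} [AddCommGroup h] [Module ℂ h]

section Supertrace

variable {M : Type*} [AddCommGroup M] [Module ℂ M]

/-- An element of the group algebra acts semisimply on a stable subspace where it is central. -/
lemma eq_zero_of_apply_apply_eq_zero {G ι : Type*} [Group G] [Finite G] [Fintype ι]
    (ρ : Representation ℂ G M) {A : Module.End ℂ M} {P : Submodule ℂ M}
    (hP : ∀ g, ∀ m ∈ P, ρ g m ∈ P) (hρ : ∀ g m, ρ g (A m) = A (ρ g m)) {r : ℂ} {a : ι → ℂ}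
    {γ : ι → G} (hA : ∀ m ∈ P, A m = r • m + ∑ i, a i • ρ (γ i) m) {m : M} (hm : m ∈ P)
    (h0 : A (A m) = 0) : A m = 0 := by
  have := Fintype.ofFinite G
  set K := P ⊓ LinearMap.ker A with hK
  have hAP : A m ∈ P := by
    rw [hA m hm]
    exact add_mem (P.smul_mem _ hm) (sum_mem fun i _ => P.smul_mem _ (hP _ _ hm))
  have hρK : ∀ g, ∀ m ∈ K, ρ g m ∈ K := fun g m hm => ⟨hP g m hm.1, by
    change A (ρ g m) = 0
    rw [← hρ, LinearMap.mem_ker.1 hm.2, map_zero]⟩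
  obtain ⟨π, hπ⟩ := K.subtype.exists_leftInverse_of_injective K.ker_subtype
  have hπ' : ∀ m ∈ K, (π m : M) = m := fun m hm =>
    congrArg Subtype.val (LinearMap.congr_fun hπ ⟨m, hm⟩)
  let p : Module.End ℂ M := ∑ g, ρ g ∘ₗ K.subtype ∘ₗ π ∘ₗ ρ g⁻¹
  have hp : ∀ m, p m = ∑ g, ρ g (π (ρ g⁻¹ m)) := fun m => by
    rw [LinearMap.sum_apply]
    rfl
  have h1 : ∀ m, p m ∈ K := fun m => by
    rw [hp]
    exact sum_mem fun g _ => hρK g _ (π _).2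
  have h2 : ∀ m ∈ K, p m = (Fintype.card G : ℂ) • m := fun m hm => by
    rw [hp, Finset.sum_congr rfl fun g _ => by
      rw [hπ' _ (hρK _ m hm), Representation.self_inv_apply], Finset.sum_const, Finset.card_univ,
      Nat.cast_smul_eq_nsmul]
  have h3 : ∀ g m, p (ρ g m) = ρ g (p m) := fun g m => by
    rw [hp, hp, map_sum, ← Equiv.sum_comp (Equiv.mulLeft g) fun k => ρ k (π (ρ k⁻¹ (ρ g m)))]
    refine Finset.sum_congr rfl fun k _ => ?_
    rw [Equiv.coe_mulLeft, map_mul, Module.End.mul_apply, ← Module.End.mul_apply (ρ (g * k)⁻¹),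
      ← map_mul, mul_inv_rev, inv_mul_cancel_right]
  have h4 : p (A m) = A (p m) := by
    rw [hA m hm, hA _ (h1 m).1, map_add, map_smul, map_sum]
    simp only [map_smul, h3]
  rw [h2 _ ⟨hAP, h0⟩, LinearMap.mem_ker.1 (h1 m).2] at h4
  exact (smul_eq_zero.1 h4).resolve_left (Nat.cast_ne_zero.2 Fintype.card_ne_zero)

lemma trOn_id (S : Submodule ℂ M) [FiniteDimensional ℂ S] :
    trOn LinearMap.id S = Module.finrank ℂ S := by
  rw [trOn_eq fun _ hm => hm, ← LinearMap.trace_id ℂ S]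
  rfl

variable {f d : Module.End ℂ M} {P Q : Submodule ℂ M} [FiniteDimensional ℂ P]
  [FiniteDimensional ℂ Q]

omit [FiniteDimensional ℂ Q] in
lemma finrank_map_map_le (hPQ : ∀ m ∈ P, d m ∈ Q)
    (hP : ∀ m ∈ P, d (d (d (d m))) = 0 → d (d m) = 0) :
    ((P.map d).map d).map d ≤ (Q.map d).map d ∧ (P.map d).map d ⊓ LinearMap.ker d = ⊥ ∧
      Module.finrank ℂ (((P.map d).map d).map d) = Module.finrank ℂ ((P.map d).map d) := by
  have h1 : (P.map d).map d ⊓ LinearMap.ker d = ⊥ := by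
    rw [eq_bot_iff]
    rintro _ ⟨⟨_, ⟨m, hm, rfl⟩, rfl⟩, h2⟩
    refine hP m hm ?_
    rw [LinearMap.mem_ker.1 h2, map_zero]
  refine ⟨Submodule.map_mono (Submodule.map_mono ?_), h1, ?_⟩
  · rintro _ ⟨m, hm, rfl⟩
    exact hPQ m hm
  · have h2 := trOn_eq_add (f := LinearMap.id) (f' := LinearMap.id) (d := d) (fun _ => rfl)
      (S := (P.map d).map d) fun _ hm => hm
    rw [h1, trOn_bot, zero_add, trOn_id, trOn_id] at h2
    exact_mod_cast h2.symm

/-- The supertrace on the cohomology of an odd operator with semisimple square. -/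
lemma trOn_sub_trOn_eq (hd : ∀ m, d (f m) = f (d m)) (hfP : ∀ m ∈ P, f m ∈ P)
    (hfQ : ∀ m ∈ Q, f m ∈ Q) (hPQ : ∀ m ∈ P, d m ∈ Q) (hQP : ∀ m ∈ Q, d m ∈ P)
    (hP : ∀ m ∈ P, d (d (d (d m))) = 0 → d (d m) = 0)
    (hQ : ∀ m ∈ Q, d (d (d (d m))) = 0 → d (d m) = 0) :
    (trOn f (LinearMap.ker d ⊓ P) - trOn f (LinearMap.ker d ⊓ Q.map d)) -
      (trOn f (LinearMap.ker d ⊓ Q) - trOn f (LinearMap.ker d ⊓ P.map d)) =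
        trOn f P - trOn f Q := by
  have hmap : ∀ S : Submodule ℂ M, (∀ m ∈ S, f m ∈ S) → ∀ m ∈ S.map d, f m ∈ S.map d := by
    rintro S hS _ ⟨m, hm, rfl⟩
    exact ⟨f m, hS m hm, hd m⟩
  obtain ⟨h1, h2, h3⟩ := finrank_map_map_le hPQ hP
  obtain ⟨h4, -, h6⟩ := finrank_map_map_le hQP hQ
  have h7 : ((P.map d).map d).map d = (Q.map d).map d := by
    refine Submodule.eq_of_le_of_finrank_le h1 ?_
    rw [h3, ← h6]
    exact Submodule.finrank_mono h4
  have e1 := trOn_eq_add hd hfP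
  have e2 := trOn_eq_add hd hfQ
  have e3 := trOn_eq_add hd (hmap P hfP)
  have e4 := trOn_eq_add hd (hmap Q hfQ)
  have e5 := trOn_eq_add hd (hmap _ (hmap P hfP))
  rw [h2, trOn_bot, zero_add, h7] at e5
  rw [inf_comm] at e1 e2 e3 e4
  linear_combination -e1 + e2 - e3 + e4 - e5

end Supertrace

section DiracIndex

variable {D : Datum h} {t : ℂ} [FiniteDimensional ℂ h] {X : GrMod.{u, v} D t}

variable (X) in
/-- The part of `X ⊗ S^{*,±}` of degree `n`. -/
def spinPiece (ε : ZMod 2) (n : ℤ) : Submodule ℂ (spinSpace X) := (spinRep X ε).piece n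

omit [FiniteDimensional ℂ h] in
lemma spinPiece_stable (ε : ZMod 2) (n : ℤ) (g : D.G) : ∀ z ∈ spinPiece X ε n,
    X.rep.tprod (extRep D.dualRep) g z ∈ spinPiece X ε n := (spinRep X ε).stable n g

lemma finite_spinPiece (hX : X.FiniteType) (ε : ZMod 2) (n : ℤ) :
    FiniteDimensional ℂ (spinPiece X ε n) := finite_spinRep hX ε n

lemma spinBlock_le_spinPiece (n : ℤ) {a : ℕ} {ε : ZMod 2} (ha : (a : ZMod 2) = ε) :
    spinBlock X n a ≤ spinPiece X ε n := by
  rw [spinPiece, spinRep_piece]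
  by_cases hN : a < Module.finrank ℂ h + 1
  · exact le_iSup₂_of_le (f := fun a _ => spinBlock X n a) a
      (Finset.mem_filter.2 ⟨Finset.mem_range.2 hN, ha⟩) le_rfl
  · exact (spinBlock_eq_bot (X := X) n (by omega : Module.finrank ℂ h < a)).le.trans bot_le

lemma spinPiece_le {n : ℤ} {ε : ZMod 2} {S : Submodule ℂ (spinSpace X)}
    (hS : ∀ a : ℕ, (a : ZMod 2) = ε → spinBlock X n a ≤ S) : spinPiece X ε n ≤ S := by
  rw [spinPiece, spinRep_piece]
  exact iSup₂_le fun a ha => hS a (Finset.mem_filter.1 ha).2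

omit [FiniteDimensional ℂ h] in
lemma actY_mem_piece (y : h) {n : ℤ} {m : X.carrier} (hm : m ∈ X.piece n) :
    actY X y m ∈ X.piece (n - 1) := by
  rw [sub_eq_neg_add]
  exact X.smul_mem (-1) n _ (gen_mem_degPart D t (.y y)) m hm

lemma dirac_mem_spinPiece {ε ε' : ZMod 2} (hε : ε' = ε + 1) {n : ℤ} {z : spinSpace X}
    (hz : z ∈ spinPiece X ε n) : dirac X z ∈ spinPiece X ε' n := by
  have h1 : spinPiece X ε n ≤ (spinPiece X ε' n).comap (dirac X) := by
    refine spinPiece_le fun a ha => tens_le.2 fun m hm ω hω => ?_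
    rw [Submodule.mem_comap, dirac_eq, spinDiff_tmul, spinKosz_tmul]
    refine sub_mem (Submodule.smul_mem _ _ (sum_mem fun j _ => ?_)) (sum_mem fun j _ => ?_)
    · refine spinBlock_le_spinPiece (a := a + 1) n (by rw [hε, ← ha]; push_cast; rfl)
        (tmul_mem_tens ?_ (wedge_mem_exteriorPower _ hω))
      have := actY_mem_piece (Module.finBasis ℂ h j) hm
      rwa [show n - a - 1 = n - (a + 1 : ℕ) by push_cast; ring] at this
    · cases a with
      | zero =>
        rw [ctr_exteriorPower_zero _ hω, TensorProduct.tmul_zero]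
        exact zero_mem _
      | succ a =>
        refine spinBlock_le_spinPiece (a := a) n ?_ (tmul_mem_tens ?_ (ctr_mem_exteriorPower _ hω))
        · rw [hε, ← ha]
          push_cast
          rw [add_assoc, show (1 + 1 : ZMod 2) = 0 from rfl, add_zero]
        · have := actX_mem_piece ((Module.finBasis ℂ h).coord j) hm
          rwa [show n - (a + 1 : ℕ) + 1 = n - a by push_cast; ring] at this
  exact h1 hz

variable (X) in
/-- The grading operator of `X ⊗ S*`. -/
def spinTau : Module.End ℂ (spinSpace X) := TensorProduct.map X.tau
  (ExteriorAlgebra.map ((2 : ℂ) • (LinearMap.id (M := Module.Dual ℂ h)))).toLinearMap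

lemma spinPiece_le_deg (ε : ZMod 2) (n : ℤ) : spinPiece X ε n ≤ deg (spinTau X) n := by
  refine spinPiece_le fun a _ => tens_le.2 fun m hm ω hω => ?_
  have h2 := Module.End.mem_eigenspace_iff.1 (pow_le_eigenspace
    (ExteriorAlgebra.map ((2 : ℂ) • (LinearMap.id (M := Module.Dual ℂ h)))) (c := 2) (by
      rintro _ ⟨y, rfl⟩
      rw [Module.End.mem_eigenspace_iff, AlgHom.toLinearMap_apply, ExteriorAlgebra.map_apply_ι,
        ← map_smul]
      rfl) a hω)
  rw [mem_deg, spinTau, TensorProduct.map_tmul, h2, X.tau_apply hm, TensorProduct.tmul_smul,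
    ← TensorProduct.smul_tmul', smul_smul, ← zpow_natCast, ← zpow_add₀ two_ne_zero,
    add_sub_cancel]

lemma ker_inf_piece_inf {ε ε' : ZMod 2} (hε : ε = ε' + 1) (hε' : ε' = ε + 1) (n : ℤ) :
    LinearMap.ker (dirac X) ⊓ spinPiece X ε n ⊓
      LinearMap.ker (diracKer X ε ⊓ diracIm X ε).mkQ =
        LinearMap.ker (dirac X) ⊓ (spinPiece X ε' n).map (dirac X) := by
  have h1 : ∀ n, (spinPiece X ε' n).map (dirac X) ≤ spinPiece X ε n := by
    rintro n _ ⟨z, hz, rfl⟩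
    exact dirac_mem_spinPiece hε hz
  rw [Submodule.ker_mkQ]
  refine le_antisymm ?_ ?_
  · rintro z ⟨⟨hz, hzn⟩, -, hz'⟩
    refine ⟨hz, mem_of_mem_iSup_of_mem_deg (τ := spinTau X)
      (S := fun n => (spinPiece X ε' n).map (dirac X))
      (fun n => (h1 n).trans (spinPiece_le_deg _ _)) ?_ (spinPiece_le_deg _ _ hzn)⟩
    rw [← Submodule.map_iSup, hε']
    exact hz'
  · rintro z ⟨hz, hzn⟩
    refine ⟨⟨hz, h1 n hzn⟩, ⟨hz, le_iSup (spinPiece X ε) n (h1 n hzn)⟩, ?_⟩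
    rw [diracIm, ← hε']
    exact Submodule.map_mono (le_iSup (spinPiece X ε') n) hzn

lemma ker_dirac_inf_stable (ε : ZMod 2) (n : ℤ) (g : D.G) :
    ∀ z ∈ LinearMap.ker (dirac X) ⊓ spinPiece X ε n,
      X.rep.tprod (extRep D.dualRep) g z ∈ LinearMap.ker (dirac X) ⊓ spinPiece X ε n :=
  fun z hz => ⟨by
    change dirac X (X.rep.tprod (extRep D.dualRep) g z) = 0
    rw [← dirac_equivariant, LinearMap.mem_ker.1 hz.1, map_zero], spinPiece_stable ε n g z hz.2⟩

lemma chr_diracCoh (hX : X.FiniteType) {ε ε' : ZMod 2} (hε : ε = ε' + 1) (hε' : ε' = ε + 1) (n : ℤ)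
    (g : D.G) : (diracCoh X ε).chr n g =
      trOn (X.rep.tprod (extRep D.dualRep) g) (LinearMap.ker (dirac X) ⊓ spinPiece X ε n) -
        trOn (X.rep.tprod (extRep D.dualRep) g)
          (LinearMap.ker (dirac X) ⊓ (spinPiece X ε' n).map (dirac X)) := by
  have := finite_spinPiece hX ε n
  have : FiniteDimensional ℂ (LinearMap.ker (dirac X) ⊓ spinPiece X ε n :
      Submodule ℂ (spinSpace X)) := Submodule.finiteDimensional_inf_right _ _
  rw [eq_sub_iff_add_eq', ← ker_inf_piece_inf hε hε']
  exact (trOn_eq_add (f := X.rep.tprod (extRep D.dualRep) g)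
    (f' := (spinRep X ε).rho.quotient (diracKer X ε ⊓ diracIm X ε) (dirac_stable X ε) g)
    (d := (diracKer X ε ⊓ diracIm X ε).mkQ) (fun _ => rfl) fun z hz =>
      ker_dirac_inf_stable ε n g z hz).symm

lemma finite_diracCoh (hX : X.FiniteType) (ε : ZMod 2) (n : ℤ) :
    Module.Finite ℂ ((diracCoh X ε).piece n) := by
  have := finite_spinPiece hX ε n
  have : FiniteDimensional ℂ (LinearMap.ker (dirac X) ⊓ spinPiece X ε n :
      Submodule ℂ (spinSpace X)) := Submodule.finiteDimensional_inf_right _ _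
  exact Module.Finite.map (LinearMap.ker (dirac X) ⊓ spinPiece X ε n)
    (Submodule.mkQ (diracKer X ε ⊓ diracIm X ε))

lemma finiteType_diracIndex (hX : X.FiniteType) : (diracIndex X).FiniteType :=
  fun n => ⟨finite_diracCoh hX 0 n, finite_diracCoh hX 1 n⟩

/-- The square of the Dirac operator on a homogeneous part. -/
lemma dirac_dirac_spinPiece {k : ℂ}
    (hk : ∀ d : ℤ, ∀ m ∈ X.piece d, euler D t • m = (t * d + k) • m) {n : ℤ} {ε : ZMod 2} :
    ∀ z ∈ spinPiece X ε n, dirac X (dirac X z) =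
      (-2 * (t * n + k - (Module.finrank ℂ h : ℂ) / 2)) • z + ∑ s, (-2 * (D.c s / dCoef D s)) •
        X.rep.tprod (extRep D.dualRep) (D.refl s) z := fun z hz => by
  have h1 : spinPiece X ε n ≤ LinearMap.eqLocus (dirac X ∘ₗ dirac X)
      ((-2 * (t * n + k - (Module.finrank ℂ h : ℂ) / 2)) • LinearMap.id +
        ∑ s, (-2 * (D.c s / dCoef D s)) • X.rep.tprod (extRep D.dualRep) (D.refl s)) :=
    spinPiece_le fun a _ z hz => (dirac_dirac hk hz).trans (by
      rw [LinearMap.add_apply, LinearMap.sum_apply, smul_add, Finset.smul_sum, smul_smul]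
      exact congrArg _ (Finset.sum_congr rfl fun s _ => smul_smul _ _ _))
  refine (h1 hz).trans ?_
  rw [LinearMap.add_apply, LinearMap.sum_apply]
  rfl

lemma dirac_dirac_eq_zero (hc : X.HasInfChar) {ε : ZMod 2} {n : ℤ} : ∀ z ∈ spinPiece X ε n,
    dirac X (dirac X (dirac X (dirac X z))) = 0 → dirac X (dirac X z) = 0 := fun z hz h0 => by
  obtain ⟨k, hk⟩ := exists_euler_smul hc
  exact eq_zero_of_apply_apply_eq_zero (X.rep.tprod (extRep D.dualRep)) (A := dirac X ∘ₗ dirac X)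
    (spinPiece_stable ε n) (fun g z => by
      rw [LinearMap.comp_apply, LinearMap.comp_apply, dirac_equivariant, dirac_equivariant])
    (dirac_dirac_spinPiece hk) hz h0

/-- The character of the local Dirac index. -/
lemma chr_diracIndex (hX : X.FiniteType) (hc : X.HasInfChar) (n : ℤ) (g : D.G) :
    (diracIndex X).chr n g = spinTrace X n g := by
  have h0 := finite_spinPiece hX 0 n
  have h1 := finite_spinPiece hX 1 n
  have e0 : (0 : ZMod 2) = 1 + 1 := rfl
  have e1 : (1 : ZMod 2) = 0 + 1 := (zero_add 1).symm
  have e2 : (diracIndex X).chr n g = (diracCoh X 0).chr n g - (diracCoh X 1).chr n g := rfl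
  have e3 : spinTrace X n g = trOn (X.rep.tprod (extRep D.dualRep) g) (spinPiece X 0 n) -
      trOn (X.rep.tprod (extRep D.dualRep) g) (spinPiece X 1 n) := (chr_spinRep_sub hX n g).symm
  rw [e2, e3, chr_diracCoh hX e0 e1, chr_diracCoh hX e1 e0]
  exact trOn_sub_trOn_eq (fun z => (dirac_equivariant X g z).symm) (spinPiece_stable 0 n g)
    (spinPiece_stable 1 n g) (fun z hz => dirac_mem_spinPiece e1 hz)
    (fun z hz => dirac_mem_spinPiece e0 hz) (dirac_dirac_eq_zero hc) (dirac_dirac_eq_zero hc)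

end DiracIndex

end Cherednik

namespace Cherednik
variable {h : Type u} [AddCommGroup h] [Module ℂ h]

section Pairings

lemma finsum_sum_add_right {F : ℕ → ℤ → ℂ} {T : Finset ℤ} (hF : ∀ b, ∀ d ∉ T, F b d = 0)
    (s : Finset ℕ) : ∑ᶠ d : ℤ, ∑ b ∈ s, F b (d + b) = ∑ᶠ d : ℤ, ∑ b ∈ s, F b d := by
  have h1 : ∀ b, (Function.support (F b)).Finite := fun b => T.finite_toSet.subset fun d hd => by
    by_contra h0
    exact hd (hF b d h0)
  rw [finsum_sum_comm _ _ fun b _ => (h1 b).preimage (add_left_injective (b : ℤ)).injOn,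
    finsum_sum_comm _ _ fun b _ => h1 b]
  exact Finset.sum_congr rfl fun b _ => finsum_comp_equiv (Equiv.addRight (b : ℤ)) (f := F b)

universe v' w'

variable {D : Datum h}

lemma VirtGrRep.cast_pairing {A : VirtGrRep.{u, v, w} D} {B : VirtGrRep.{u, v', w'} D}
    (hAB : A.PairingDefined B) (n : ℤ) :
    (A.pairing B n : ℂ) = ∑ᶠ d : ℤ, (A.homDim B d (d + n) : ℂ) :=
  map_finsum (Int.castAddHom ℂ) (hAB n)

variable {t : ℂ} [FiniteDimensional ℂ h] {X : GrMod.{u, v} D t} {Y : GrMod.{u, w} D t}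

lemma spinChr_eq_zero (g : D.G) {a : ℕ} (ha : Module.finrank ℂ h < a) : spinChr g a = 0 := by
  rw [spinChr, exteriorPower_dual_eq_bot ha, trOn_bot]

/-- The character of the elliptic combination, in terms of the supertraces on `X ⊗ S*`. -/
lemma chr_elliptic_inv (hX : X.FiniteType) (d : ℤ) (g : D.G) :
    X.res.elliptic.chr d g⁻¹ = ∑ b ∈ Finset.range (Module.finrank ℂ h + 1),
      (-1) ^ b * (spinChr g b * spinTrace X (d + b) g⁻¹) := by
  have h1 : ∀ b ∈ Finset.range (Module.finrank ℂ h + 1),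
      (-1) ^ b * (spinChr g b * spinTrace X (d + b) g⁻¹) =
        ∑ a ∈ Finset.range (Module.finrank ℂ h + 1), (-1) ^ (a + b) *
          (X.res.chr (d - a + b) g⁻¹ * extChr g⁻¹ (a, b)) := fun b _ => by
    rw [spinTrace, Finset.mul_sum, Finset.mul_sum]
    refine Finset.sum_congr rfl fun a _ => ?_
    rw [extChr_inv, sub_add_eq_add_sub, pow_add]
    ring
  rw [chr_elliptic_eq_sum_block hX, Finset.sum_congr rfl h1, Finset.sum_comm,
    ← Finset.sum_product']
  refine (Finset.sum_subset (fun x hx => ?_) fun x _ hx => ?_).symm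
  · rw [Finset.mem_product, Finset.mem_range, Finset.mem_range] at hx
    rw [mem_extIndex, Module.finrank_prod, Subspace.dual_finrank_eq]
    omega
  · rw [Finset.mem_product, Finset.mem_range, Finset.mem_range, not_and_or, not_lt, not_lt] at hx
    rw [extChr_inv]
    rcases hx with hx | hx
    · rw [spinChr_eq_zero _ (Nat.lt_of_succ_le hx), zero_mul, mul_zero, mul_zero]
    · rw [spinChr_eq_zero g (Nat.lt_of_succ_le hx), mul_zero, mul_zero, mul_zero]

/-- The pairing of local Dirac indices. -/
theorem vEll_eq_pairing_diracIndex (hX : X.FiniteType) (hY : Y.FiniteType) (hcX : X.HasInfChar)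
    (hcY : Y.HasInfChar) (hell : VEllDefined X.res Y.res) :
    (diracIndex X).PairingDefined (diracIndex Y) ∧
      vEll X.res Y.res = (diracIndex X).pairing (diracIndex Y) := by
  obtain ⟨T, hT⟩ := exists_spinTrace_eq_zero hX hcX.1.1
  have h1 : ∀ n d, ((diracIndex X).homDim (diracIndex Y) d (d + n) : ℂ) =
      (Nat.card D.G : ℂ)⁻¹ * ∑ g, spinTrace Y (d + n) g * spinTrace X d g⁻¹ := fun n d => by
    rw [VirtGrRep.homDim_eq (finiteType_diracIndex hX) (finiteType_diracIndex hY)]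
    refine congrArg _ (Finset.sum_congr rfl fun g _ => ?_)
    rw [chr_diracIndex hX hcX, chr_diracIndex hY hcY]
  have hdef : (diracIndex X).PairingDefined (diracIndex Y) := fun n =>
    T.finite_toSet.subset fun d hd => by
      by_contra h0
      refine hd (Int.cast_injective (α := ℂ) ?_)
      rw [h1, Int.cast_zero, Finset.sum_eq_zero fun g _ => by rw [hT d h0, mul_zero], mul_zero]
  refine ⟨hdef, funext fun n => Int.cast_injective (α := ℂ) ?_⟩
  have h2 : ∀ d, ((X.res.elliptic).homDim Y.res.toVirt d (d + n) : ℂ) =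
      (Nat.card D.G : ℂ)⁻¹ * ∑ g, Y.res.chr (d + n) g * X.res.elliptic.chr d g⁻¹ := fun d => by
    rw [VirtGrRep.homDim_eq (elliptic_finiteType hX) 
      (GrRep.finiteType_toVirt (A := Y.res) hY)]
    refine congrArg _ (Finset.sum_congr rfl fun g _ => ?_)
    rw [GrRep.chr_toVirt]
  let F : ℕ → ℤ → ℂ := fun b d => (Nat.card D.G : ℂ)⁻¹ * ∑ g, (-1) ^ b *
    (Y.res.chr (d + n - b) g * spinChr g b) * spinTrace X d g⁻¹
  have hF : ∀ b, ∀ d ∉ T, F b d = 0 := fun b d hd => by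
    change _ * _ = _
    rw [Finset.sum_eq_zero fun g _ => by rw [hT d hd, mul_zero], mul_zero]
  rw [VirtGrRep.cast_pairing hdef]
  refine (VirtGrRep.cast_pairing hell n).trans ?_
  refine Eq.trans (finsum_congr fun d => ?_) ((finsum_sum_add_right hF
    (Finset.range (Module.finrank ℂ h + 1))).trans (finsum_congr fun d => ?_))
  · rw [h2, ← Finset.mul_sum, Finset.sum_comm]
    refine congrArg _ (Finset.sum_congr rfl fun g _ => ?_)
    rw [chr_elliptic_inv hX, Finset.mul_sum]
    refine Finset.sum_congr rfl fun b _ => ?_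
    rw [add_right_comm, add_sub_cancel_right]
    ring
  · rw [h1, ← Finset.mul_sum, Finset.sum_comm]
    refine congrArg _ (Finset.sum_congr rfl fun g _ => ?_)
    rw [← Finset.sum_mul]
    rfl

omit [FiniteDimensional ℂ h] in
/-- Modules in category `𝒪` are finitely generated. -/
lemma finite_of_inCategoryO (hX : X.InCategoryO) : Module.Finite (H D t) X.carrier := by
  have := hX.1
  exact Module.Finite.of_restrictScalars_finite (polyX D t) (H D t) X.carrier

end Pairings

end Cherednik

theorem theoremt {h : Type u} [AddCommGroup h] [Module ℂ h] [FiniteDimensional ℂ h]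
    (D : Cherednik.Datum h) (t : ℂ)
    (X : Cherednik.GrMod.{u, v} D t) (Y : Cherednik.GrMod.{u, w} D t)
    (hX : X.FiniteType) (hY : Y.FiniteType) :
    Nonempty (Cherednik.GrProjRes X) ∧
    ∀ R : Cherednik.GrProjRes X,
      (Module.Finite (Cherednik.H D t) X.carrier ∨ Cherednik.HomFinite X.res Y.res →
        R.EPgrDefined Y ∧ Cherednik.VEllDefined X.res Y.res ∧
        R.EPgr Y = Cherednik.vEll X.res Y.res) ∧
      (X.HasInfChar → Y.HasInfChar →
        R.EPgrDefined Y ∧ Cherednik.VEllDefined X.res Y.res ∧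
        (Cherednik.diracIndex X).PairingDefined (Cherednik.diracIndex Y) ∧
        R.EPgr Y = Cherednik.vEll X.res Y.res ∧
        Cherednik.vEll X.res Y.res =
          (Cherednik.diracIndex X).pairing (Cherednik.diracIndex Y)) := by
  refine ⟨Cherednik.nonempty_grProjRes X, fun R => ⟨?_, fun hcX hcY => ?_⟩⟩
  · rintro (hfin | hhom)
    · exact Cherednik.pairing_eq_of_finite hX hY R
    · exact Cherednik.pairing_eq_of_homFinite hX hY hhom R
  · have := Cherednik.finite_of_inCategoryO hcX.1
    obtain ⟨h1, h2, h3⟩ := Cherednik.pairing_eq_of_finite hX hY R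
    obtain ⟨h4, h5⟩ := Cherednik.vEll_eq_pairing_diracIndex hX hY hcX hcY h2
    exact ⟨h1, h2, h4, h3, h5⟩
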